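/- **Setting.** Fix $a\in(0,1)$ with $a\neq\tfrac12$ and $m,L>0$. Let $S(\theta)=\dfrac{\sinh\theta-i\sin\pi a}{\sinh\theta+i\sin\pi a}$ be the sinh-Gordon $S$-matrix and $\varphi(\theta)=\frac{d}{d\theta}(-i\log S(\theta))$. *Form factors.* Let $F_n(\theta_1,\dots,\theta_n)$, $n\ge 0$, be the form factors of a local operator $\mathcal O$, i.e. functions with (at generic rapidities) $$F_n(\dots,\theta_j,\theta_{j+1},\dots)=S(\theta_j-\theta_{j+1})F_n(\dots,\theta_{j+1},\theta_j,\dots),$$ $$-i\operatorname*{Res}_{\theta=\theta'}F_{n+2}(\theta+i\pi,\theta',\theta_1,\dots,\theta_n)=\Big(1-\prod_{k=1}^nS(\theta'-\theta_k)\Big)F_n(\theta_1,\dots,\theta_n),$$ whose only singularities in the region $0\le\operatorname{Im}(\theta_i-\theta_j)<2\pi$ ($i<j$) are simple poles at $\theta_i-\theta_j=i\pi$. The connected form factor $F_{2n,c}(\theta_1,\dots,\theta_n)$ is the constant term of the Laurent expansion at $\eta=0$ of $F_{2n}(\theta_1+i\pi+\eta_1,\dots,\theta_n+i\pi+\eta_n,\theta_n,\dots,\theta_1)$,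 extended by continuity to coinciding rapidities. *Excited-state TBA.* For $u\in\mathbb R$ let $\varepsilon_u:\mathbb R\to\mathbb R$ be the continuous solution of $$\varepsilon_u(\theta)=mL\cosh\theta+\log S(\theta-u-\tfrac{i\pi}2)-\int_{\mathbb R}\frac{d\theta'}{2\pi}\,\varphi(\theta-\theta')\log(1+e^{-\varepsilon_u(\theta')}),$$ where $\log S$ is real on the line $\operatorname{Im}=-\pi/2$ and $\log S(0)=i\pi$; at complex $\theta$, $\varepsilon_u(\theta)$ is defined by the right-hand side. Put $\bar Q(u)=-i\,\varepsilon_u(u+\tfrac{i\pi}2)$. Let $\bar\theta\in\mathbb R$, $I\in\mathbb Z$ satisfy the quantization condition $\varepsilon(\bar\theta+\tfrac{i\pi}2)=i(2I+1)\pi$, where $\varepsilon=\varepsilon_{\bar\theta}$, and assume that this zero of $1+e^{\varepsilon}$ is simple: $n_1:=-i\,\varepsilon'(\bar\theta+\tfrac{i\pi}2)\ne0$. Write $\widetilde{d\theta}=\frac{d\theta}{2\pi}\frac1{1+e^{\varepsilon(\theta)}}$. **Assumption (contour-deformed LeClair–Mussardo series).** For all sufficiently small circles, the mean value $\langle\bar\theta|\mathcal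 O|\bar\theta\rangle_L$ is the sum of the absolutely convergent series $$\langle\bar\theta|\mathcal O|\bar\theta\rangle_L=\sum_{n\ge0}\frac1{n!}\int_{\mathcal C}\widetilde{d\theta_1}\cdots\int_{\mathcal C}\widetilde{d\theta_n}\;F_{2n,c}(\theta_1,\dots,\theta_n),$$ where $\mathcal C$ consists of the real line and a small clockwise circle around $\bar\theta+\tfrac{i\pi}2$. **Conclusion.** $\bar Q$ is differentiable at $\bar\theta$, the two series below converge absolutely, and $$\langle\bar\theta|\mathcal O|\bar\theta\rangle_L=\sum_{n\ge0}\frac1{n!}\int_{\mathbb R^n}\widetilde{d\theta_1}\cdots\widetilde{d\theta_n}\,F_{2n,c}(\theta_1,\dots,\theta_n)+\Big(\frac{d\bar Q}{d\bar\theta}\Big)^{-1}\sum_{n\ge0}\frac1{n!}\int_{\mathbb R^n}\widetilde{d\theta_1}\cdots\widetilde{d\theta_n}\,F_{2(n+1),c}(\bar\theta+\tfrac{i\pi}2,\theta_1,\dots,\theta_n)$$ (with the convention $0^{-1}=0$; if $d\bar Q/d\bar\theta=0$, the dressed series vanishes). Moreover $d\bar Q/d\bar\theta$ is the normalization $N_1$.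 For a finite sequence $s=(s_0,\dots,s_k)$ of labels put $[s]_\varphi=\prod_{i<k}\varphi(\theta_{s_i}-\theta_{s_{i+1}})$, where the label $1$ stands for $\theta_1=\bar\theta+\tfrac{i\pi}2$. Then, with an absolutely convergent sum, $$\frac{d\bar Q}{d\bar\theta}=n_1-\sum_{l\ge0}\int\widetilde{d\theta_2}\cdots\widetilde{d\theta_{l+1}}\,[1\,2\,3\cdots(l{+}1)\,1]_\varphi ,$$ and, whenever the double series $$\frac1{N_1}=\sum_{j\ge1}\sum_{l\ge0}\frac{n_1^{-j}}{l!}\int\widetilde{d\theta_2}\cdots\widetilde{d\theta_{l+1}}\sum_s[s]_\varphi$$ converges absolutely (here $s$ runs over the sequences containing $1$ exactly $j$ times and each of $2,\dots,l+1$ once, and starting and ending with $1$), one has $N_1=d\bar Q/d\bar\theta$. -/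

import Mathlib

open MeasureTheory Filter Topology

noncomputable section

namespace SinhGordon

/-! ## Scattering theory of the sinh-Gordon model -/

/-- The sinh-Gordon `S`-matrix with coupling parameter `a ∈ (0,1)`:
`S(θ) = (sinh θ - i sin πa) / (sinh θ + i sin πa)`. -/
def S (a : ℝ) (z : ℂ) : ℂ :=
  (Complex.sinh z - Complex.I * (Real.sin (Real.pi * a) : ℂ)) /
    (Complex.sinh z + Complex.I * (Real.sin (Real.pi * a) : ℂ))

/-- The derivative of the phase shift, `φ(θ) = d/dθ (-i log S(θ))`. -/
def phi (a : ℝ) (z : ℂ) : ℂ := -Complex.I * logDeriv (S a) z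

/-- The branch of `log S` used in the source term of the excited-state equation. It is the real
logarithm of the positive number `S(x - iπ/2)` on the line `Im z = -π/2`, and it is holomorphic
near `z = 0`, where its value is `iπ`. -/
def logS (a : ℝ) (z : ℂ) : ℂ := Real.pi * Complex.I - Complex.log (-(S a z)⁻¹)

theorem exp_logS (a : ℝ) (z : ℂ) (h : S a z ≠ 0) : Complex.exp (logS a z) = S a z := by
  have h2 : -(S a z)⁻¹ ≠ 0 := neg_ne_zero.mpr (inv_ne_zero h)
  rw [logS, Complex.exp_sub, Complex.exp_log h2, Complex.exp_pi_mul_I]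
  field_simp

theorem logS_zero (a : ℝ) (h : Real.sin (Real.pi * a) ≠ 0) :
    logS a 0 = Real.pi * Complex.I := by
  have h2 : (Real.sin (Real.pi * a) : ℂ) ≠ 0 := by exact_mod_cast h
  have h3 : Complex.I * (Real.sin (Real.pi * a) : ℂ) ≠ 0 := mul_ne_zero Complex.I_ne_zero h2
  have hS : S a 0 = -1 := by
    rw [S, Complex.sinh_zero, zero_sub, zero_add, neg_div, div_self h3]
  rw [logS, hS]
  norm_num

/-! ## Form factors of a local operator -/

/-- A configuration of rapidities at which no two differ by a zero of `sinh` or by a zero or a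
pole of `S`. -/
def Generic (a : ℝ) {n : ℕ} (θ : Fin n → ℂ) : Prop :=
  ∀ i j, i ≠ j → Complex.sinh (θ i - θ j) ≠ 0 ∧
    Complex.sinh (θ i - θ j) ^ 2 ≠ -(Real.sin (Real.pi * a) : ℂ) ^ 2

/-- The elementary form factors `F_n` of a local operator: the exchange axiom, the kinematical
pole axiom, and the analyticity property that in the region `0 ≤ Im (θ_i - θ_j) < 2π` (`i < j`)
the only singularities are the simple kinematical poles `θ_i - θ_j = iπ`. The first two are
identities of meromorphic functions, so they are required at generic points; no convention is
made on the value of `F_n` at a pole. -/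
structure IsFormFactorFamily (a : ℝ) (F : ∀ n : ℕ, (Fin n → ℂ) → ℂ) : Prop where
  exchange : ∀ (n : ℕ) (j : Fin n) (θ : Fin (n + 1) → ℂ), Generic a θ →
    F (n + 1) θ = S a (θ j.castSucc - θ j.succ) *
      F (n + 1) (θ ∘ Equiv.swap j.castSucc j.succ)
  kinematical_pole : ∀ (n : ℕ) (θ' : ℂ) (θ : Fin n → ℂ),
    Generic a (Fin.cons θ' θ : Fin (n + 1) → ℂ) →
    Tendsto (fun z : ℂ => -Complex.I * ((z - θ') *
        F (n + 2) (Fin.cons (z + Real.pi * Complex.I) (Fin.cons θ' θ : Fin (n + 1) → ℂ))))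
      (𝓝[≠] θ') (𝓝 ((1 - ∏ k, S a (θ' - θ k)) * F n θ))
  analytic : ∀ (n : ℕ) (θ₀ : Fin n → ℂ),
    (∀ i j, i < j → 0 ≤ (θ₀ i - θ₀ j).im ∧ (θ₀ i - θ₀ j).im < 2 * Real.pi) →
    ∃ G : (Fin n → ℂ) → ℂ, AnalyticAt ℂ G θ₀ ∧ ∀ᶠ θ in 𝓝 θ₀, Generic a θ →
      F n θ = G θ / ∏ i, ∏ j ∈ Finset.Ioi i, Complex.cosh ((θ i - θ j) / 2)

/-- `c` is the constant term of the Laurent expansion around `η = 0` of a function `f` of `n`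
variables with at most simple poles along `η_i = 0`: writing `f = G / (η_1 ⋯ η_n)` with `G`
analytic, it is the coefficient of `η_1 ⋯ η_n` in the Taylor series of `G`. -/
def IsFinitePart {n : ℕ} (f : (Fin n → ℂ) → ℂ) (c : ℂ) : Prop :=
  ∃ G : (Fin n → ℂ) → ℂ, AnalyticAt ℂ G 0 ∧
    (∀ᶠ η in 𝓝 (0 : Fin n → ℂ), (∀ i, η i ≠ 0) → f η * ∏ i, η i = G η) ∧
    c = iteratedFDeriv ℂ n G 0 (fun i => Pi.single i 1)

open Classical in
/-- The finite part at `η = 0` (zero if there is none). -/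
def finitePart {n : ℕ} (f : (Fin n → ℂ) → ℂ) : ℂ :=
  if h : ∃ c, IsFinitePart f c then h.choose else 0

/-- The rapidities `(θ_1 + iπ + η_1, …, θ_n + iπ + η_n, θ_n, …, θ_1)`. -/
def diagConfig {n : ℕ} (θ η : Fin n → ℂ) : Fin (n + n) → ℂ :=
  Fin.append (fun i => θ i + Real.pi * Complex.I + η i) (fun i => θ i.rev)

/-- The connected diagonal form factor `F_{2n,c}(θ_1, …, θ_n)`: the finite part of
`F_{2n}(θ_1 + iπ + η_1, …, θ_n + iπ + η_n, θ_n, …, θ_1)`, extended from generic to coinciding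
rapidities by continuity. -/
def connectedFF (a : ℝ) (F : ∀ n : ℕ, (Fin n → ℂ) → ℂ) (n : ℕ) (θ : Fin n → ℂ) : ℂ :=
  limUnder (𝓝[{θ' : Fin n → ℂ | Generic a θ'}] θ)
    (fun θ' => finitePart fun η => F (n + n) (diagConfig θ' η))

/-! ## The one-particle excited-state thermodynamic Bethe ansatz -/

/-- The point `θ̄ + iπ/2`. -/
def root (u : ℝ) : ℂ := (u : ℂ) + (Real.pi / 2 : ℝ) * Complex.I

/-- The right-hand side of the one-particle excited-state equation with root parameter `u`, as a
function of a complex rapidity `z`, given the pseudoenergy `e` on the real line. It defines the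
pseudoenergy at complex arguments. -/
def pseudoenergy (a m L u : ℝ) (e : ℝ → ℝ) (z : ℂ) : ℂ :=
  m * L * Complex.cosh z + logS a (z - root u) -
    ∫ t : ℝ, phi a (z - t) * (Real.log (1 + Real.exp (-e t)) : ℂ) / (2 * Real.pi)

/-- `e` solves the one-particle excited-state equation with root parameter `u`. -/
def IsTBASolution (a m L u : ℝ) (e : ℝ → ℝ) : Prop :=
  Continuous e ∧ ∀ θ : ℝ, (e θ : ℂ) = pseudoenergy a m L u e θ

/-- The function `Q̄(u) = -i ε(u + iπ/2)`; the pseudoenergy depends on `u` as well. -/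
def Qbar (a m L : ℝ) (ε : ℝ → ℝ → ℝ) (u : ℝ) : ℂ :=
  -Complex.I * pseudoenergy a m L u (ε u) (root u)

/-- `n_1 = -i ∂ε/∂θ` at `θ = u + iπ/2`. -/
def nOne (a m L u : ℝ) (e : ℝ → ℝ) : ℂ :=
  -Complex.I * deriv (pseudoenergy a m L u e) (root u)

/-- The weight function `1 / (1 + e^{ε(z)})`. -/
def weight (a m L u : ℝ) (e : ℝ → ℝ) (z : ℂ) : ℂ :=
  1 / (1 + Complex.exp (pseudoenergy a m L u e z))

/-! ## Multiple integral series -/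

/-- Absolute convergence of the series `∑_n (1/n!) ∫ f_n dμ^n`. -/
def SeriesConverges {X : Type} [MeasurableSpace X] (μ : Measure X)
    (f : ∀ n : ℕ, (Fin n → X) → ℂ) : Prop :=
  (∀ n, Integrable (f n) (Measure.pi fun _ => μ)) ∧
    Summable fun n : ℕ => (1 / (n.factorial : ℝ)) * ∫ t, ‖f n t‖ ∂(Measure.pi fun _ => μ)

/-- The sum of the series `∑_n (1/n!) ∫ f_n dμ^n`. -/
def seriesSum {X : Type} [MeasurableSpace X] (μ : Measure X)
    (f : ∀ n : ℕ, (Fin n → X) → ℂ) : ℂ :=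
  ∑' n : ℕ, (1 / (n.factorial : ℂ)) * ∫ t, f n t ∂(Measure.pi fun _ => μ)

/-- Parametrization of the contour `𝒞`: the real line, and the circle of radius `r` around
`θ̄ + iπ/2`, run through clockwise. -/
def contourPoint (u r : ℝ) : ℝ ⊕ ℝ → ℂ :=
  Sum.elim (fun t => (t : ℂ)) (fun s => root u + r * Complex.exp (-(s * Complex.I)))

/-- The derivative of the parametrization of `𝒞`. -/
def contourSpeed (r : ℝ) : ℝ ⊕ ℝ → ℂ :=
  Sum.elim (fun _ => 1) (fun s => -Complex.I * r * Complex.exp (-(s * Complex.I)))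

/-- The measure on the parameter space of `𝒞`: Lebesgue measure on the real line and on
`(0, 2π]`. -/
def contourMeasure : Measure (ℝ ⊕ ℝ) :=
  (volume : Measure ℝ).map Sum.inl +
    ((volume : Measure ℝ).restrict (Set.Ioc 0 (2 * Real.pi))).map Sum.inr

/-- The integrand of the `n`-th term of the LeClair–Mussardo series on the contour `𝒞`. -/
def contourIntegrand (a m L u : ℝ) (e : ℝ → ℝ) (F : ∀ n : ℕ, (Fin n → ℂ) → ℂ) (r : ℝ)
    (n : ℕ) (t : Fin n → ℝ ⊕ ℝ) : ℂ :=
  (∏ j, contourSpeed r (t j) / (2 * Real.pi) * weight a m L u e (contourPoint u r (t j))) *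
    connectedFF a F n (fun j => contourPoint u r (t j))

/-- The integrand of the `n`-th term of the LeClair–Mussardo series on the real line. -/
def realIntegrand (a m L u : ℝ) (e : ℝ → ℝ) (F : ∀ n : ℕ, (Fin n → ℂ) → ℂ)
    (n : ℕ) (θ : Fin n → ℝ) : ℂ :=
  (∏ j, 1 / (2 * Real.pi) * weight a m L u e (θ j)) *
    connectedFF a F n (fun j => (θ j : ℂ))

/-- The integrand of the `n`-th term of the dressed series: one insertion of `θ̄ + iπ/2`. -/
def dressedIntegrand (a m L u : ℝ) (e : ℝ → ℝ) (F : ∀ n : ℕ, (Fin n → ℂ) → ℂ)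
    (n : ℕ) (θ : Fin n → ℝ) : ℂ :=
  (∏ j, 1 / (2 * Real.pi) * weight a m L u e (θ j)) *
    connectedFF a F (n + 1) (Fin.cons (root u) (fun j => (θ j : ℂ)) : Fin (n + 1) → ℂ)

/-! ## The normalization `N_1` -/

/-- The product `[s]_φ = φ(θ_{s_0} - θ_{s_1}) φ(θ_{s_1} - θ_{s_2}) ⋯` along a sequence `s` of
labels; the label `none` stands for the rapidity `c`, the label `some i` for `θ_i`. -/
def bracket (a : ℝ) (c : ℂ) {l k : ℕ} (θ : Fin l → ℝ) (s : Fin (k + 1) → Option (Fin l)) : ℂ :=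
  ∏ i : Fin k, phi a ((s i.castSucc).elim c (fun p => (θ p : ℂ)) -
    (s i.succ).elim c (fun p => (θ p : ℂ)))

open Classical in
/-- The sequences of length `k + 1` that contain every label `some i` exactly once and that start
and end with the label `none`. -/
def sequences (l k : ℕ) : Finset (Fin (k + 1) → Option (Fin l)) :=
  Finset.univ.filter fun s => s 0 = none ∧ s (Fin.last k) = none ∧
    ∀ i : Fin l, ∃! p, s p = some i

/-- The term of the series for `1/N_1` with `j + 1` insertions of `θ̄ + iπ/2` and `l` integrated
rapidities:
`n_1^{-(j+1)} (1/l!) ∫ dθ̃_1 ⋯ dθ̃_l ∑_s [s]_φ`. For `j = 0` it is `1/n_1` if `l = 0` and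
vanishes otherwise. -/
def invNTerm (a m L u : ℝ) (e : ℝ → ℝ) (q : ℕ × ℕ) : ℂ :=
  (nOne a m L u e)⁻¹ ^ (q.1 + 1) * (1 / (q.2.factorial : ℂ)) *
    ∫ θ : Fin q.2 → ℝ, (∏ i, 1 / (2 * Real.pi) * weight a m L u e (θ i)) *
      ∑ s ∈ sequences q.2 (q.1 + q.2), bracket a (root u) θ s

/-- The connected path `(1, 2, …, l+1, 1)`, integrated over its `l` interior rapidities. -/
def pathTerm (a m L u : ℝ) (e : ℝ → ℝ) (l : ℕ) : ℂ :=
  ∫ θ : Fin l → ℝ, (∏ i, 1 / (2 * Real.pi) * weight a m L u e (θ i)) *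
    bracket a (root u) θ
      (Fin.cons none (Fin.snoc (fun i : Fin l => some i) none : Fin (l + 1) → Option (Fin l)))

end SinhGordon

end

/-!
Divided by suitable exchange factors, the diagonal form factors become antisymmetric functions
(`normFF`), quotients of an analytic function by known hyperbolic ones. They are studied along
lines through the diagonal, where rapidities and shifted rapidities agree. The vanishing order and
the leading form along such lines (`HasLead`) follow by induction on the number of rapidities: the
kinematical residues fix the leading form on a family of hyperplanes, and a form of degree `k` that
vanishes on more than `k` hyperplanes in general position is zero (`PolyOnLines.eq_zero`,
`exists_hasLead`). The connected form factor is the multilinear coefficient of the leading form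
(`HasLead.connectedFF_eq`). Hence it is symmetric and analytic at distinct rapidities, and the
same uniqueness argument at configurations with one repeated rapidity shows that, as two rapidities
merge, it tends to twice a sum over chains of kernels `φ` which starts and ends at the merged
rapidity and carries the connected form factor of the remaining ones (`mergeWt`,
`tendsto_connectedFF_merge`).

The filling fraction `1 / (1 + e^ε)` is bounded by some `q < 1`, and `|φ| / 2π` has integral one.
The linearized integral equation is therefore a contraction: the difference quotients of the
pseudoenergy in the position of the root converge to the Neumann series of iterated kernels
(`chain`), and the quantization function has the derivative `n₁ - P`, where `P` is the sum of the
closed chains through the root (`KernelBound.hasDerivAt_Qbar`). A walk that visits the root `j`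
times splits into `j - 1` closed chains, so the double series for `1 / N₁` is the geometric series
of `P / n₁` divided by `n₁` (`eq_of_hasSum_invNTerm`).

The zero of `1 + e^ε` at the root is simple, hence integration over a small circle is evaluation at
the root, divided by `n₁` (`KernelBound.eventually_isContour`). The terms of the contour series are
sorted by the number `k` of rapidities on the circle (`countInd`). The first of them puts the root
into the connected form factor; each further one meets it there and yields a merging limit, hence a
factor made of closed chains times a term with one circle rapidity less (`mergedTerm_eq`,
`dressedTerm_recursion`). Summed over the real rapidities, the configurations with `k + 1` circle
rapidities contribute `(P / n₁) ^ k / n₁` times the dressed series, and the sum over `k` is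
`(n₁ - P)⁻¹` times the dressed series (`tsum_sectors`). If `n₁ = P`, convergence of the geometric
series forces the dressed series to vanish.
-/


noncomputable section

namespace SinhGordon

/-! ### Leading forms of analytic functions -/

section

section LeadingForms

variable {E : Type*} [NormedAddCommGroup E] [NormedSpace ℂ E]

/-- The restriction of `Q` to every affine line is a polynomial of degree at most `k`. -/
def PolyOnLines (k : ℕ) (Q : E → ℂ) : Prop :=
  ∀ v u, ∃ q : Polynomial ℂ, q.natDegree ≤ k ∧ ∀ t, q.eval t = Q (v + t • u)

theorem PolyOnLines.sub {k : ℕ} {Q R : E → ℂ} (hQ : PolyOnLines k Q) (hR : PolyOnLines k R) :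
    PolyOnLines k (fun v => Q v - R v) := by
  intro v u
  obtain ⟨q, hq, hq'⟩ := hQ v u
  obtain ⟨r, hr, hr'⟩ := hR v u
  exact ⟨q - r, (Polynomial.natDegree_sub_le _ _).trans (max_le hq hr), fun t => by
    rw [Polynomial.eval_sub, hq', hr']⟩

theorem PolyOnLines.neg {k : ℕ} {Q : E → ℂ} (hQ : PolyOnLines k Q) :
    PolyOnLines k (fun v => - Q v) := by
  intro v u
  obtain ⟨q, hq, hq'⟩ := hQ v u
  exact ⟨-q, by rwa [Polynomial.natDegree_neg], fun t => by rw [Polynomial.eval_neg, hq']⟩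

theorem PolyOnLines.mul {k l : ℕ} {Q R : E → ℂ} (hQ : PolyOnLines k Q) (hR : PolyOnLines l R) :
    PolyOnLines (k + l) (fun v => Q v * R v) := by
  intro v u
  obtain ⟨q, hq, hq'⟩ := hQ v u
  obtain ⟨r, hr, hr'⟩ := hR v u
  exact ⟨q * r, Polynomial.natDegree_mul_le.trans (add_le_add hq hr), fun t => by
    rw [Polynomial.eval_mul, hq', hr']⟩

theorem polyOnLines_const (c : ℂ) : PolyOnLines 0 (fun _ : E => c) := fun _ _ =>
  ⟨Polynomial.C c, by simp, fun t => by simp⟩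

theorem PolyOnLines.mono {k l : ℕ} (h : k ≤ l) {Q : E → ℂ} (hQ : PolyOnLines k Q) :
    PolyOnLines l Q := fun v u => by
  obtain ⟨q, hq, hq'⟩ := hQ v u
  exact ⟨q, hq.trans h, hq'⟩

theorem PolyOnLines.add {k : ℕ} {Q R : E → ℂ} (hQ : PolyOnLines k Q) (hR : PolyOnLines k R) :
    PolyOnLines k (fun v => Q v + R v) := by
  simpa using hQ.sub hR.neg

theorem polyOnLines_linear (l : E →ₗ[ℂ] ℂ) : PolyOnLines 1 (fun v => l v) := fun v u =>
  ⟨Polynomial.C (l v) + Polynomial.C (l u) * Polynomial.X, by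
    refine (Polynomial.natDegree_add_le _ _).trans (max_le (by simp) ?_)
    exact (Polynomial.natDegree_C_mul_le _ _).trans (by simp), fun t => by
    simp; ring⟩

theorem PolyOnLines.sum {k : ℕ} {ι : Type*} (s : Finset ι) {Q : ι → E → ℂ}
    (hQ : ∀ i ∈ s, PolyOnLines k (Q i)) : PolyOnLines k (fun v => ∑ i ∈ s, Q i v) := by
  classical
  induction s using Finset.induction_on with
  | empty => simpa using (polyOnLines_const (E := E) 0).mono (Nat.zero_le k)
  | insert a s ha ih =>
    simp only [Finset.sum_insert ha]
    exact (hQ a (Finset.mem_insert_self _ _)).add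
      (ih fun i hi => hQ i (Finset.mem_insert_of_mem hi))

theorem PolyOnLines.prod {ι : Type*} (s : Finset ι) {k : ι → ℕ} {Q : ι → E → ℂ}
    (hQ : ∀ i ∈ s, PolyOnLines (k i) (Q i)) :
    PolyOnLines (∑ i ∈ s, k i) (fun v => ∏ i ∈ s, Q i v) := by
  classical
  induction s using Finset.induction_on with
  | empty => simpa using polyOnLines_const (E := E) 1
  | insert a s ha ih =>
    simp only [Finset.prod_insert ha, Finset.sum_insert ha]
    exact (hQ a (Finset.mem_insert_self _ _)).mul
      (ih fun i hi => hQ i (Finset.mem_insert_of_mem hi))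

/-- A homogeneous polynomial in `n` linear forms is a polynomial on lines. -/
theorem polyOnLines_eval {n k : ℕ} {P : MvPolynomial (Fin n) ℂ} (hP : P.IsHomogeneous k)
    (l : Fin n → E →ₗ[ℂ] ℂ) :
    PolyOnLines k (fun v => MvPolynomial.eval (fun i => l i v) P) := by
  simp only [MvPolynomial.eval_eq']
  refine PolyOnLines.sum _ fun d hd => ?_
  have h1 : PolyOnLines (∑ i, d i) (fun v => ∏ i, l i v ^ d i) := by
    refine PolyOnLines.prod _ fun i _ => ?_
    have := PolyOnLines.prod (E := E) (Finset.range (d i)) (k := fun _ => 1)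
      (Q := fun _ v => l i v) fun _ _ => polyOnLines_linear _
    simpa using this
  have h2 : ∑ i, d i = k := by
    have := hP (MvPolynomial.mem_support_iff.mp hd)
    rw [Finsupp.weight_apply, Finsupp.sum_fintype _ _ (by simp)] at this
    simpa using this
  simpa [h2] using (polyOnLines_const (E := E) (P.coeff d)).mul h1

theorem polyOnLines_multilinear {k : ℕ}
    (f : ContinuousMultilinearMap ℂ (fun _ : Fin k => E) ℂ) :
    PolyOnLines k (fun v => f fun _ => v) := by
  classical
  intro v u
  refine ⟨∑ s : Finset (Fin k), Polynomial.C (f (s.piecewise (fun _ => u) fun _ => v)) *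
    Polynomial.X ^ s.card, ?_, fun t => ?_⟩
  · refine Polynomial.natDegree_sum_le_of_forall_le _ _ fun s _ => ?_
    refine (Polynomial.natDegree_C_mul_X_pow_le _ _).trans ?_
    simpa using s.card_le_univ
  · have h : (fun _ : Fin k => v + t • u) = (fun _ => t • u) + fun _ => v := by
      ext; simp [add_comm]
    show _ = f fun _ => v + t • u
    rw [h, ContinuousMultilinearMap.map_add_univ, Polynomial.eval_finsetSum]
    refine Finset.sum_congr rfl fun s _ => ?_
    have h2 := f.toMultilinearMap.map_piecewise_smul (fun _ => t)
      (s.piecewise (fun _ => u) fun _ => v) s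
    have h3 : s.piecewise (fun i => t • s.piecewise (fun _ => u) (fun _ => v) i)
        (s.piecewise (fun _ => u) fun _ => v) = s.piecewise (fun _ => t • u) fun _ => v := by
      ext i
      by_cases hi : i ∈ s <;> simp [hi]
    rw [h3] at h2
    simp only [Finset.prod_const, smul_eq_mul, ContinuousMultilinearMap.coe_coe] at h2
    rw [Polynomial.eval_mul, Polynomial.eval_C, Polynomial.eval_pow, Polynomial.eval_X, mul_comm]
    exact h2.symm

/-- Finitely many nonzero linear forms have a common non-root. -/
theorem exists_forall_ne_zero {ι : Type*} [Finite ι] (l : ι → E →ₗ[ℂ] ℂ)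
    (h : ∀ i, ∃ u, l i u ≠ 0) : ∃ u, ∀ i, l i u ≠ 0 := by
  by_contra hcon
  push Not at hcon
  have hcov : ⋃ i, (LinearMap.ker (l i) : Set E) = Set.univ := by
    rw [Set.eq_univ_iff_forall]
    intro u
    obtain ⟨i, hi⟩ := hcon u
    exact Set.mem_iUnion.mpr ⟨i, hi⟩
  obtain ⟨i, hi⟩ := Subspace.exists_eq_top_of_iUnion_eq_univ hcov
  obtain ⟨u, hu⟩ := h i
  exact hu (by rw [LinearMap.ker_eq_top.mp hi]; rfl)

/-- A function of degree at most `k` on lines which vanishes on more than `k` hyperplanes of a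
finite arrangement (at the points off all other hyperplanes) is zero: a generic line meets these
hyperplanes in more than `k` points. -/
theorem PolyOnLines.eq_zero {k : ℕ} {Q : E → ℂ} (hQ : PolyOnLines k Q) {ι : Type*} [Finite ι]
    (l : ι → E →ₗ[ℂ] ℂ) (h0 : ∀ i, ∃ u, l i u ≠ 0)
    (hl : ∀ i j, i ≠ j → ∃ u, l i u = 0 ∧ l j u ≠ 0) (J : Finset ι) (hJ : k < J.card)
    (hz : ∀ j ∈ J, ∀ z, l j z = 0 → (∀ i, i ≠ j → l i z ≠ 0) → Q z = 0) (v : E) : Q v = 0 := by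
  classical
  -- points off all hyperplanes; the direction `u` is chosen such that the line through `v` meets
  -- the hyperplanes in pairwise different points
  have key : ∀ v, (∀ i, l i v ≠ 0) → Q v = 0 := by
    intro v hv
    obtain ⟨u, hu⟩ := exists_forall_ne_zero
      (ι := ι ⊕ {p : ι × ι // p.1 ≠ p.2})
      (Sum.elim l fun p => l p.1.1 v • l p.1.2 - l p.1.2 v • l p.1.1) (by
        rintro (i | ⟨⟨i, j⟩, hij⟩)
        · exact h0 i
        · obtain ⟨u, hu, hu'⟩ := hl i j hij
          exact ⟨u, by simpa [hu] using ⟨hv i, hu'⟩⟩)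
    have hu1 : ∀ i, l i u ≠ 0 := fun i => hu (Sum.inl i)
    have hu2 : ∀ i j, i ≠ j → l i v * l j u - l j v * l i u ≠ 0 := fun i j hij => by
      simpa using hu (Sum.inr ⟨(i, j), hij⟩)
    obtain ⟨q, hq, hqv⟩ := hQ v u
    set r : ι → ℂ := fun i => - l i v / l i u with hr
    have hinj : Function.Injective r := by
      intro i j hij
      by_contra hne
      apply hu2 i j hne
      simp only [hr] at hij
      rw [div_eq_div_iff (hu1 i) (hu1 j)] at hij
      linear_combination -hij
    have hroot : ∀ i, l i (v + r i • u) = 0 := by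
      intro i
      simp only [hr, map_add, map_smul, smul_eq_mul]
      field_simp [hu1 i]
      ring
    have hq0 : q = 0 := by
      refine Polynomial.eq_zero_of_natDegree_lt_card_of_eval_eq_zero' q (J.image r) ?_ ?_
      · intro x hx
        obtain ⟨i, hi, rfl⟩ := Finset.mem_image.mp hx
        rw [hqv]
        refine hz i hi _ (hroot i) fun j hj hj0 => hj (hinj ?_)
        have h1 := hj0
        simp only [map_add, map_smul, smul_eq_mul] at h1
        simp only [hr] at h1 ⊢
        rw [div_eq_iff (hu1 j)]
        linear_combination -h1
      · rw [Finset.card_image_of_injective _ hinj]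
        exact lt_of_le_of_lt hq hJ
    have := hqv 0
    simpa [hq0] using this.symm
  -- a generic line through any point leaves the hyperplanes, so `Q` vanishes along it
  obtain ⟨u, hu⟩ := exists_forall_ne_zero l h0
  obtain ⟨q, hq, hqv⟩ := hQ v u
  have hfin : (⋃ i, {t : ℂ | l i (v + t • u) = 0}).Finite := by
    refine Set.finite_iUnion fun i => Set.Subsingleton.finite fun t ht t' ht' => ?_
    simp only [Set.mem_ofPred_eq, map_add, map_smul, smul_eq_mul] at ht ht'
    exact mul_right_cancel₀ (hu i) (by linear_combination ht - ht')
  have hq0 : q = 0 := by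
    refine Polynomial.eq_zero_of_infinite_isRoot q (Set.Infinite.mono ?_ hfin.infinite_compl)
    intro t ht
    simp only [Set.mem_compl_iff, Set.mem_iUnion, Set.mem_ofPred_eq, not_exists] at ht
    show q.eval t = 0
    rw [hqv]
    exact key _ ht
  have := hqv 0
  simpa [hq0] using this.symm

variable {g : E → ℂ} {p : FormalMultilinearSeries ℂ E ℂ}

theorem tendsto_div_pow_of_coeff_eq_zero (hp : HasFPowerSeriesAt g p 0) {N : ℕ} {v : E}
    (h0 : ∀ k < N, p k (fun _ => v) = 0) :
    Tendsto (fun s : ℂ => g (s • v) / s ^ N) (𝓝[≠] 0) (𝓝 (p N fun _ => v)) := by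
  have h1 := hp.isBigO_sub_partialSum_pow (N + 1)
  have h2 : Tendsto (fun s : ℂ => s • v) (𝓝 0) (𝓝 0) := by
    have : Continuous fun s : ℂ => s • v := by fun_prop
    simpa using this.tendsto 0
  have h3 := h1.comp_tendsto h2
  have h4 : ∀ s : ℂ, p.partialSum (N + 1) (s • v) = s ^ N * p N fun _ => v := by
    intro s
    rw [FormalMultilinearSeries.partialSum, Finset.sum_range_succ]
    have h5 : ∀ k, (p k fun _ => s • v) = s ^ k * p k fun _ => v := fun k => by
      have := (p k).map_smul_univ (fun _ => s) (fun _ => v)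
      simpa using this
    rw [Finset.sum_eq_zero, h5, zero_add]
    intro k hk
    rw [h5, h0 k (Finset.mem_range.mp hk), mul_zero]
  have h6 : (fun s : ℂ => g (s • v) / s ^ N - p N fun _ => v) =O[𝓝[≠] 0] fun s : ℂ => s := by
    have h7 := (h3.mono (nhdsWithin_le_nhds (s := {0}ᶜ))).mul
      (Asymptotics.isBigO_refl (fun s : ℂ => (s ^ N)⁻¹) (𝓝[≠] 0)).norm_right
    refine (h7.congr' ?_ Filter.EventuallyEq.rfl).trans ?_
    · filter_upwards [self_mem_nhdsWithin] with s hs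
      have hs' : s ≠ 0 := hs
      simp only [Function.comp_apply, zero_add, h4]
      field_simp
    · refine Asymptotics.IsBigO.of_bound (‖v‖ ^ (N + 1)) ?_
      filter_upwards [self_mem_nhdsWithin] with s hs
      have hs' : ‖s‖ ≠ 0 := norm_ne_zero_iff.mpr hs
      simp only [Function.comp_apply, norm_mul, norm_pow, norm_norm, norm_smul, norm_inv]
      apply le_of_eq
      field_simp
      ring
  have h8 : Tendsto (fun s : ℂ => s) (𝓝[≠] 0) (𝓝 0) := nhdsWithin_le_nhds
  have h9 := (h6.trans_tendsto h8).add_const (p N fun _ => v)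
  simpa using h9

theorem coeff_eq_of_tendsto_div_pow (hp : HasFPowerSeriesAt g p 0) {N : ℕ} {v : E} {c : ℂ}
    (h : Tendsto (fun s : ℂ => g (s • v) / s ^ N) (𝓝[≠] 0) (𝓝 c)) :
    (∀ k < N, p k (fun _ => v) = 0) ∧ (p N fun _ => v) = c := by
  have h0 : ∀ k < N, p k (fun _ => v) = 0 := by
    intro k
    induction k using Nat.strong_induction_on with
    | _ k ih =>
      intro hk
      have h1 := tendsto_div_pow_of_coeff_eq_zero hp (N := k) (v := v)
        fun j hj => ih j hj (hj.trans hk)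
      have h8 : Tendsto (fun s : ℂ => s ^ (N - k)) (𝓝[≠] 0) (𝓝 0) := by
        have : Continuous fun s : ℂ => s ^ (N - k) := by fun_prop
        have h9 := this.tendsto 0
        rw [zero_pow (by omega)] at h9
        exact h9.mono_left nhdsWithin_le_nhds
      have h2 := h8.mul h
      rw [zero_mul] at h2
      refine tendsto_nhds_unique (h1.congr' ?_) h2
      filter_upwards [self_mem_nhdsWithin] with s hs
      have hs' : s ≠ 0 := hs
      have : s ^ N = s ^ (N - k) * s ^ k := by rw [← pow_add]; congr 1; omega
      rw [this]
      field_simp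
  exact ⟨h0, tendsto_nhds_unique (tendsto_div_pow_of_coeff_eq_zero hp h0) h⟩

/-- The diagonal of a multilinear form on `ℂⁿ` as a polynomial. -/
def diagPoly {n k : ℕ} (f : ContinuousMultilinearMap ℂ (fun _ : Fin k => (Fin n → ℂ)) ℂ) :
    MvPolynomial (Fin n) ℂ :=
  ∑ r : Fin k → Fin n, MvPolynomial.C (f fun i => Pi.single (r i) 1) *
    ∏ i, MvPolynomial.X (r i)

theorem eval_diagPoly {n k : ℕ}
    (f : ContinuousMultilinearMap ℂ (fun _ : Fin k => (Fin n → ℂ)) ℂ) (v : Fin n → ℂ) :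
    MvPolynomial.eval v (diagPoly f) = f fun _ => v := by
  have h : (fun _ : Fin k => v) = fun _ => ∑ j : Fin n, v j • (Pi.single j 1 : Fin n → ℂ) := by
    ext _ i
    simp [Finset.sum_apply, Pi.single_apply]
  rw [h]
  have := f.toMultilinearMap.map_sum
    (g := fun (_ : Fin k) (j : Fin n) => v j • (Pi.single j 1 : Fin n → ℂ))
  simp only [ContinuousMultilinearMap.coe_coe] at this
  rw [this, diagPoly, map_sum]
  refine Finset.sum_congr rfl fun r _ => ?_
  have h2 := f.map_smul_univ (fun i => v (r i)) (fun i => (Pi.single (r i) 1 : Fin n → ℂ))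
  rw [h2]
  simp [mul_comm]

theorem isHomogeneous_diagPoly {n k : ℕ}
    (f : ContinuousMultilinearMap ℂ (fun _ : Fin k => (Fin n → ℂ)) ℂ) :
    (diagPoly f).IsHomogeneous k := by
  refine MvPolynomial.IsHomogeneous.sum _ _ _ fun r _ => ?_
  have h1 : (∏ i, MvPolynomial.X (r i) : MvPolynomial (Fin n) ℂ).IsHomogeneous (∑ _i : Fin k, 1) :=
    MvPolynomial.IsHomogeneous.prod _ _ _ fun i _ => MvPolynomial.isHomogeneous_X _ _
  simpa using (MvPolynomial.isHomogeneous_C (Fin n) _).mul h1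

/-- The exponent `(1, …, 1)`. -/
def ones (n : ℕ) : Fin n →₀ ℕ := Finsupp.equivFunOnFinite.symm fun _ => 1

@[simp] theorem ones_apply (n : ℕ) (i : Fin n) : ones n i = 1 := rfl

/-- The multilinear coefficient of the degree-`n` Taylor form in `n` variables is the mixed
derivative. -/
theorem coeff_ones_diagPoly {n : ℕ}
    (f : ContinuousMultilinearMap ℂ (fun _ : Fin n => (Fin n → ℂ)) ℂ) :
    (diagPoly f).coeff (ones n) =
      ∑ σ : Equiv.Perm (Fin n), f fun i => Pi.single (σ i) 1 := by
  classical
  have hX : ∀ r : Fin n → Fin n, (∏ i, MvPolynomial.X (r i) : MvPolynomial (Fin n) ℂ) =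
      MvPolynomial.monomial (∑ i, Finsupp.single (r i) 1) 1 := by
    intro r
    rw [MvPolynomial.monomial_sum_one]
    rfl
  have hones : ∀ r : Fin n → Fin n, (∑ i, Finsupp.single (r i) 1) = ones n ↔
      Function.Bijective r := by
    intro r
    constructor
    · intro h
      rw [← Finite.surjective_iff_bijective]
      intro j
      have h1 := DFunLike.congr_fun h j
      rw [Finsupp.finsetSum_apply, ones_apply] at h1
      by_contra hj
      push Not at hj
      rw [Finset.sum_eq_zero] at h1
      · exact zero_ne_one h1
      · intro i _
        simp [hj i]
    · intro h
      ext j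
      rw [Finsupp.finsetSum_apply, ones_apply]
      have := (Equiv.ofBijective r h).sum_comp (fun i => (Finsupp.single i 1 : Fin n →₀ ℕ) j)
      simp only [Equiv.ofBijective_apply] at this
      rw [this]
      simp [Finsupp.single_apply]
  simp only [diagPoly, MvPolynomial.coeff_sum, hX, MvPolynomial.coeff_C_mul,
    MvPolynomial.coeff_monomial, hones, mul_ite, mul_one, mul_zero]
  rw [← Finset.sum_filter]
  symm
  refine Finset.sum_bij (fun σ _ => (σ : Fin n → Fin n)) ?_ ?_ ?_ ?_
  · intro σ _
    exact Finset.mem_filter.mpr ⟨Finset.mem_univ _, σ.bijective⟩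
  · intro σ _ τ _ h
    exact DFunLike.coe_injective h
  · intro r hr
    exact ⟨Equiv.ofBijective r (Finset.mem_filter.mp hr).2, Finset.mem_univ _, rfl⟩
  · intro σ _
    rfl

theorem iteratedFDeriv_eq_coeff {n : ℕ} {G : (Fin n → ℂ) → ℂ}
    {p : FormalMultilinearSeries ℂ (Fin n → ℂ) ℂ} (hp : HasFPowerSeriesAt G p 0)
    {P : MvPolynomial (Fin n) ℂ}
    (hP : ∀ v : Fin n → ℂ, (∀ i, v i ≠ 0) → (p n fun _ => v) = MvPolynomial.eval v P) :
    iteratedFDeriv ℂ n G 0 (fun i => Pi.single i 1) = P.coeff (ones n) := by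
  obtain ⟨r, hr⟩ := hp
  rw [hr.iteratedFDeriv_eq_sum_of_completeSpace]
  have : P = diagPoly (p n) := by
    refine MvPolynomial.funext_set (fun _ => {0}ᶜ)
      (fun _ => (Set.finite_singleton (0 : ℂ)).infinite_compl) fun x hx => ?_
    rw [eval_diagPoly, hP x fun i => by simpa using hx i (Set.mem_univ i)]
  rw [this, coeff_ones_diagPoly]

end LeadingForms

end

/-! ### The exchange relation and antisymmetry -/

section

/-- The denominator `sinh z + i sin πa` of the `S`-matrix. -/
def sgm (a : ℝ) (z : ℂ) : ℂ := Complex.sinh z + Complex.I * (Real.sin (Real.pi * a) : ℂ)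

/-- The product `sinh² z + sin² πa` of numerator and denominator of the `S`-matrix. -/
def tau (a : ℝ) (z : ℂ) : ℂ := Complex.sinh z ^ 2 + (Real.sin (Real.pi * a) : ℂ) ^ 2

/-- `z` is neither a zero of `sinh` nor a zero or pole of `S`. -/
def IsReg (a : ℝ) (z : ℂ) : Prop := Complex.sinh z ≠ 0 ∧ tau a z ≠ 0

theorem tau_eq (a : ℝ) (z : ℂ) : tau a z = - (sgm a z * sgm a (-z)) := by
  simp only [tau, sgm, Complex.sinh_neg]
  linear_combination ((Real.sin (Real.pi * a) : ℂ) ^ 2) * Complex.I_sq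

theorem S_eq (a : ℝ) (z : ℂ) : S a z = - sgm a (-z) / sgm a z := by
  simp only [S, sgm, Complex.sinh_neg]
  congr 1
  ring

theorem tau_neg (a : ℝ) (z : ℂ) : tau a (-z) = tau a z := by
  simp [tau, Complex.sinh_neg]

theorem IsReg.neg {a : ℝ} {z : ℂ} (h : IsReg a z) : IsReg a (-z) :=
  ⟨by simpa [Complex.sinh_neg] using h.1, by simpa [tau_neg] using h.2⟩

theorem IsReg.sub_comm {a : ℝ} {x y : ℂ} (h : IsReg a (x - y)) : IsReg a (y - x) := by
  simpa using h.neg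

theorem sinh_add_pi (z : ℂ) : Complex.sinh (z + Real.pi * Complex.I) = - Complex.sinh z := by
  rw [Complex.sinh_add, Complex.sinh_mul_I, Complex.cosh_mul_I]
  simp

theorem tau_add_pi (a : ℝ) (z : ℂ) : tau a (z + Real.pi * Complex.I) = tau a z := by
  simp only [tau, sinh_add_pi, neg_sq]

theorem sgm_add_pi (a : ℝ) (z : ℂ) : sgm a (z + Real.pi * Complex.I) = sgm a (-z) := by
  simp only [sgm, sinh_add_pi, Complex.sinh_neg]

theorem isReg_add_pi {a : ℝ} {z : ℂ} : IsReg a (z + Real.pi * Complex.I) ↔ IsReg a z := by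
  simp only [IsReg, sinh_add_pi, tau_add_pi, ne_eq, neg_eq_zero]

theorem sgm_ne_zero {a : ℝ} {z : ℂ} (h : tau a z ≠ 0) : sgm a z ≠ 0 := by
  intro h0
  exact h (by rw [tau_eq, h0]; ring)

theorem S_ne_zero {a : ℝ} {z : ℂ} (h : tau a z ≠ 0) : S a z ≠ 0 := by
  rw [S_eq]
  exact div_ne_zero (neg_ne_zero.mpr (sgm_ne_zero (by rwa [tau_neg]))) (sgm_ne_zero h)

theorem S_neg (a : ℝ) (z : ℂ) : S a (-z) = (S a z)⁻¹ := by
  rw [S_eq, S_eq, neg_neg, inv_div, neg_div, div_neg]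

theorem S_add_pi (a : ℝ) (z : ℂ) : S a (z + Real.pi * Complex.I) = S a (-z) := by
  have h1 : -(z + Real.pi * Complex.I) = -(z + 2 * Real.pi * Complex.I) + Real.pi * Complex.I := by
    ring
  have h2 : Complex.sinh (z + 2 * Real.pi * Complex.I) = Complex.sinh z := by
    rw [show z + 2 * Real.pi * Complex.I = z + Real.pi * Complex.I + Real.pi * Complex.I by ring,
      sinh_add_pi, sinh_add_pi, neg_neg]
  rw [S_eq, S_eq, sgm_add_pi, h1, sgm_add_pi, neg_neg, neg_neg]
  simp only [sgm, h2]

theorem continuous_sgm (a : ℝ) : Continuous (sgm a) := by unfold sgm; fun_prop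

theorem continuous_tau (a : ℝ) : Continuous (tau a) := by unfold tau; fun_prop

theorem isOpen_isReg (a : ℝ) : IsOpen {z | IsReg a z} :=
  (isOpen_ne_fun Complex.continuous_sinh continuous_const).inter
    (isOpen_ne_fun (continuous_tau a) continuous_const)

theorem IsReg.eventually {a : ℝ} {X : Type*} [TopologicalSpace X] {f : X → ℂ} {x : X}
    (h : IsReg a (f x)) (hf : ContinuousAt f x) : ∀ᶠ y in 𝓝 x, IsReg a (f y) :=
  hf.eventually ((isOpen_isReg a).mem_nhds h)

theorem generic_iff {a : ℝ} {n : ℕ} {θ : Fin n → ℂ} :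
    Generic a θ ↔ ∀ i j, i ≠ j → IsReg a (θ i - θ j) := by
  simp only [Generic, IsReg, tau, ne_eq, ← eq_neg_iff_add_eq_zero]

theorem Generic.comp {a : ℝ} {n m : ℕ} {θ : Fin n → ℂ} (h : Generic a θ) {f : Fin m → Fin n}
    (hf : Function.Injective f) : Generic a (θ ∘ f) :=
  fun _ _ hij => h _ _ (hf.ne hij)

theorem generic_cons {a : ℝ} {n : ℕ} {x : ℂ} {θ : Fin n → ℂ} :
    Generic a (Fin.cons x θ : Fin (n + 1) → ℂ) ↔
      (∀ k, IsReg a (x - θ k)) ∧ Generic a θ := by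
  simp only [generic_iff]
  constructor
  · intro h
    exact ⟨fun k => by simpa using h 0 k.succ (Fin.succ_ne_zero k).symm,
      fun i j hij => by simpa using h i.succ j.succ (by simpa using hij)⟩
  · rintro ⟨h1, h2⟩ i j hij
    induction i using Fin.cases with
    | zero =>
      induction j using Fin.cases with
      | zero => exact absurd rfl hij
      | succ j => simpa using h1 j
    | succ i =>
      induction j using Fin.cases with
      | zero => simpa using (h1 i).sub_comm
      | succ j => simpa using h2 i j (by simpa using hij)

theorem generic_append {a : ℝ} {n m : ℕ} {x : Fin n → ℂ} {y : Fin m → ℂ} :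
    Generic a (Fin.append x y) ↔
      Generic a x ∧ Generic a y ∧ ∀ i j, IsReg a (x i - y j) := by
  simp only [generic_iff]
  constructor
  · intro h
    refine ⟨fun i j hij => ?_, fun i j hij => ?_, fun i j => ?_⟩
    · simpa using h (Fin.castAdd m i) (Fin.castAdd m j) (by simpa using hij)
    · simpa using h (Fin.natAdd n i) (Fin.natAdd n j) (by simpa using hij)
    · simpa using h (Fin.castAdd m i) (Fin.natAdd n j) (by
        intro h; have := congrArg Fin.val h; simp at this; omega)
  · rintro ⟨h1, h2, h3⟩ i j hij
    induction i using Fin.addCases with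
    | left i =>
      induction j using Fin.addCases with
      | left j => simpa using h1 i j (by simpa using hij)
      | right j => simpa using h3 i j
    | right i =>
      induction j using Fin.addCases with
      | left j => simpa using (h3 j i).sub_comm
      | right j => simpa using h2 i j (by simpa using hij)

/-- The product of `sinh (θ_i - θ_j) + i sin πa` over the pairs `i < j`. -/
def pairProd (a : ℝ) {n : ℕ} (θ : Fin n → ℂ) : ℂ :=
  ∏ i, ∏ j, if i < j then sgm a (θ i - θ j) else 1

theorem pairProd_eq_prod_filter (a : ℝ) {n : ℕ} (θ : Fin n → ℂ) :
    pairProd a θ = ∏ p ∈ Finset.univ.filter (fun p : Fin n × Fin n => p.1 < p.2),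
      sgm a (θ p.1 - θ p.2) := by
  rw [pairProd, Finset.prod_filter, ← Finset.univ_product_univ, Finset.prod_product]

theorem pairProd_cons (a : ℝ) {n : ℕ} (x : ℂ) (θ : Fin n → ℂ) :
    pairProd a (Fin.cons x θ : Fin (n + 1) → ℂ) = (∏ k, sgm a (x - θ k)) * pairProd a θ := by
  simp [pairProd, Fin.prod_univ_succ]

theorem swap_lt_swap {n : ℕ} (j : Fin n) {x y : Fin (n + 1)} (hxy : x < y)
    (hne : ¬ (x = j.castSucc ∧ y = j.succ)) :
    Equiv.swap j.castSucc j.succ x < Equiv.swap j.castSucc j.succ y := by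
  simp only [Equiv.swap_apply_def, Fin.ext_iff, Fin.lt_def, Fin.val_castSucc,
    Fin.val_succ] at *
  split_ifs <;> simp_all <;> omega

theorem pairProd_swap (a : ℝ) {n : ℕ} (j : Fin n) (θ : Fin (n + 1) → ℂ) :
    pairProd a (θ ∘ Equiv.swap j.castSucc j.succ) * sgm a (θ j.castSucc - θ j.succ) =
      pairProd a θ * sgm a (θ j.succ - θ j.castSucc) := by
  classical
  set σ := Equiv.swap j.castSucc j.succ with hσ
  set A := Finset.univ.filter (fun p : Fin (n + 1) × Fin (n + 1) => p.1 < p.2) with hA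
  have hmem : (j.castSucc, j.succ) ∈ A := by simp [hA]
  have hσσ : ∀ x, σ (σ x) = x := fun x => by simp [hσ]
  have hmaps : ∀ p ∈ A.erase (j.castSucc, j.succ),
      (σ p.1, σ p.2) ∈ A.erase (j.castSucc, j.succ) := by
    rintro ⟨x, y⟩ hp
    simp only [hA, Finset.mem_erase, Finset.mem_filter, Finset.mem_univ, true_and, ne_eq,
      Prod.mk.injEq] at hp ⊢
    refine ⟨?_, swap_lt_swap j hp.2 hp.1⟩
    rintro ⟨h1, h2⟩
    have h3 : x = j.succ := by rw [← hσσ x, h1]; simp [hσ]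
    have h4 : y = j.castSucc := by rw [← hσσ y, h2]; simp [hσ]
    have := hp.2
    rw [h3, h4] at this
    exact absurd this (by simp [Fin.lt_def])
  rw [pairProd_eq_prod_filter, pairProd_eq_prod_filter, ← Finset.mul_prod_erase A _ hmem,
    ← Finset.mul_prod_erase A _ hmem]
  have h1 : ∏ p ∈ A.erase (j.castSucc, j.succ), sgm a ((θ ∘ σ) p.1 - (θ ∘ σ) p.2) =
      ∏ p ∈ A.erase (j.castSucc, j.succ), sgm a (θ p.1 - θ p.2) := by
    refine Finset.prod_nbij' (fun p => (σ p.1, σ p.2)) (fun p => (σ p.1, σ p.2)) hmaps hmaps ?_ ?_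
      ?_
    · intro p _; simp [hσσ]
    · intro p _; simp [hσσ]
    · intro p _; simp
  rw [h1]
  simp only [Function.comp_apply, hσ, Equiv.swap_apply_left, Equiv.swap_apply_right]
  ring

/-- The form factor multiplied by `∏_{i<j} (sinh (θ_i - θ_j) + i sin πa)`. The exchange relation
says that it is antisymmetric. -/
def antiFF (a : ℝ) (F : ∀ n : ℕ, (Fin n → ℂ) → ℂ) (n : ℕ) (θ : Fin n → ℂ) : ℂ :=
  F n θ * pairProd a θ

variable {a : ℝ} {F : ∀ n : ℕ, (Fin n → ℂ) → ℂ}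

theorem antiFF_swap (hF : IsFormFactorFamily a F) {n : ℕ} (j : Fin n) {θ : Fin (n + 1) → ℂ}
    (hθ : Generic a θ) :
    antiFF a F (n + 1) (θ ∘ Equiv.swap j.castSucc j.succ) = - antiFF a F (n + 1) θ := by
  have hj : j.castSucc ≠ j.succ := (Fin.castSucc_lt_succ (i := j)).ne
  have h0 := sgm_ne_zero ((generic_iff.mp hθ) _ _ hj).2
  have h1 := pairProd_swap a j θ
  have h2 := hF.exchange n j θ hθ
  rw [antiFF, antiFF, h2, S_eq]
  rw [neg_sub]
  field_simp
  linear_combination (F (n + 1) (θ ∘ Equiv.swap j.castSucc j.succ)) * h1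

theorem antiFF_comp_perm (hF : IsFormFactorFamily a F) {n : ℕ} (τ : Equiv.Perm (Fin n))
    {θ : Fin n → ℂ} (hθ : Generic a θ) :
    antiFF a F n (θ ∘ τ) = (Equiv.Perm.sign τ : ℤ) * antiFF a F n θ := by
  cases n with
  | zero => simp [Subsingleton.elim τ 1]
  | succ n =>
    have hτ : τ ∈ Submonoid.closure
        (Set.range fun i : Fin n => Equiv.swap i.castSucc i.succ) := by
      rw [Equiv.Perm.mclosure_swap_castSucc_succ]; trivial
    induction hτ using Submonoid.closure_induction generalizing θ with
    | mem x hx =>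
      obtain ⟨j, rfl⟩ := hx
      rw [antiFF_swap hF j hθ, Equiv.Perm.sign_swap (Fin.castSucc_lt_succ (i := j)).ne]
      simp
    | one => simp
    | mul x y _ _ hx hy =>
      have h1 : θ ∘ ⇑(x * y) = (θ ∘ x) ∘ y := rfl
      rw [h1, hy (hθ.comp x.injective), hx hθ]
      push_cast [Equiv.Perm.sign_mul]
      ring

/-- Configurations `(ξ, θ)` of outgoing and incoming rapidities at which no exchange factor and no
form factor is singular. -/
def DG (a : ℝ) {n : ℕ} (ξ θ : Fin n → ℂ) : Prop :=
  Generic a ξ ∧ Generic a θ ∧ ∀ i j, IsReg a (ξ i - θ j)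

/-- The configuration `(ξ_1 + iπ, …, ξ_n + iπ, θ_n, …, θ_1)`. -/
def crossed {n : ℕ} (ξ θ : Fin n → ℂ) : Fin (n + n) → ℂ :=
  Fin.append (fun i => ξ i + Real.pi * Complex.I) (fun i => θ i.rev)

theorem crossed_castAdd {n : ℕ} (ξ θ : Fin n → ℂ) (i : Fin n) :
    crossed ξ θ (Fin.castAdd n i) = ξ i + Real.pi * Complex.I :=
  Fin.append_left _ _ i

theorem crossed_natAdd {n : ℕ} (ξ θ : Fin n → ℂ) (i : Fin n) :
    crossed ξ θ (Fin.natAdd n i) = θ i.rev :=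
  Fin.append_right _ _ i

theorem generic_crossed {n : ℕ} {ξ θ : Fin n → ℂ} : Generic a (crossed ξ θ) ↔ DG a ξ θ := by
  rw [crossed, generic_append, DG]
  refine and_congr ?_ (and_congr ?_ ?_)
  · simp [generic_iff]
  · constructor
    · intro h
      have := h.comp (f := Fin.rev) Fin.rev_injective
      simpa [Function.comp_def] using this
    · intro h
      exact h.comp (f := Fin.rev) Fin.rev_injective
  · have : ∀ i j, ξ i + Real.pi * Complex.I - θ j = ξ i - θ j + Real.pi * Complex.I :=
      fun i j => by ring
    simp only [this, isReg_add_pi]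
    exact ⟨fun h i j => by simpa using h i j.rev, fun h i j => h i j.rev⟩

theorem DG.comp {n m : ℕ} {ξ θ : Fin n → ℂ} (h : DG a ξ θ) {f g : Fin m → Fin n}
    (hf : Function.Injective f) (hg : Function.Injective g) : DG a (ξ ∘ f) (θ ∘ g) :=
  ⟨h.1.comp hf, h.2.1.comp hg, fun _ _ => h.2.2 _ _⟩

/-- The normalized diagonal form factor: `F_{2n}(ξ + iπ, θ)` divided by exchange factors in such a
way that it is antisymmetric in `ξ` and in `θ` and agrees with `F_{2n}` to leading order as
`ξ → θ`. -/
def normFF (a : ℝ) (F : ∀ n : ℕ, (Fin n → ℂ) → ℂ) (n : ℕ) (ξ θ : Fin n → ℂ) : ℂ :=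
  (-Complex.I * (Real.sin (Real.pi * a) : ℂ)) ^ n * antiFF a F (n + n) (crossed ξ θ) /
    ∏ i, ∏ j, tau a (ξ i - θ j)

theorem antiFF_crossed_comp (hF : IsFormFactorFamily a F) {n : ℕ} {ξ θ : Fin n → ℂ}
    (h : DG a ξ θ) (σ τ : Equiv.Perm (Fin n)) :
    antiFF a F (n + n) (crossed (ξ ∘ σ) (θ ∘ τ)) =
      (Equiv.Perm.sign σ : ℤ) * (Equiv.Perm.sign τ : ℤ) * antiFF a F (n + n) (crossed ξ θ) := by
  set e : Equiv.Perm (Fin (n + n)) :=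
    finSumFinEquiv.permCongr (Equiv.Perm.sumCongr σ (Fin.revPerm.permCongr τ)) with he
  have h1 : crossed (ξ ∘ σ) (θ ∘ τ) = crossed ξ θ ∘ e := by
    ext i
    induction i using Fin.addCases with
    | left i =>
      have : e (Fin.castAdd n i) = Fin.castAdd n (σ i) := by simp [he, Equiv.permCongr_apply]
      rw [Function.comp_apply, this, crossed_castAdd, crossed_castAdd, Function.comp_apply]
    | right i =>
      have : e (Fin.natAdd n i) = Fin.natAdd n (τ i.rev).rev := by
        rw [he, Equiv.permCongr_apply, finSumFinEquiv_symm_apply_natAdd]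
        simp [-Fin.natAdd_eq_addNat]
      rw [Function.comp_apply, this, crossed_natAdd, crossed_natAdd, Function.comp_apply,
        Fin.rev_rev]
  rw [h1, antiFF_comp_perm hF e (generic_crossed.mpr h), he, Equiv.Perm.sign_permCongr,
    Equiv.Perm.sign_sumCongr, Equiv.Perm.sign_permCongr]
  push_cast
  ring

theorem normFF_comp (hF : IsFormFactorFamily a F) {n : ℕ} {ξ θ : Fin n → ℂ}
    (h : DG a ξ θ) (σ τ : Equiv.Perm (Fin n)) :
    normFF a F n (ξ ∘ σ) (θ ∘ τ) =
      (Equiv.Perm.sign σ : ℤ) * (Equiv.Perm.sign τ : ℤ) * normFF a F n ξ θ := by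
  rw [normFF, normFF, antiFF_crossed_comp hF h]
  have h1 : ∏ i, ∏ j, tau a ((ξ ∘ σ) i - (θ ∘ τ) j) = ∏ i, ∏ j, tau a (ξ i - θ j) := by
    rw [← Equiv.prod_comp σ (fun i => ∏ j, tau a (ξ i - θ j))]
    refine Finset.prod_congr rfl fun i _ => ?_
    exact Equiv.prod_comp τ (fun j => tau a (ξ (σ i) - θ j))
  rw [h1]
  ring

theorem normFF_comp_same (hF : IsFormFactorFamily a F) {n : ℕ} {ξ θ : Fin n → ℂ}
    (h : DG a ξ θ) (σ : Equiv.Perm (Fin n)) :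
    normFF a F n (ξ ∘ σ) (θ ∘ σ) = normFF a F n ξ θ := by
  rw [normFF_comp hF h]
  rcases Int.units_eq_one_or (Equiv.Perm.sign σ) with h | h <;> simp [h]

theorem antiFF_cast {n m : ℕ} (h : n = m) (θ : Fin m → ℂ) :
    antiFF a F n (θ ∘ Fin.cast h) = antiFF a F m θ := by
  subst h; rfl

/-- The last rapidity may be moved past an even number of rapidities. -/
theorem antiFF_crossed_succ (hF : IsFormFactorFamily a F) {n : ℕ} {x : ℂ} {ξ : Fin n → ℂ}
    {θ : Fin (n + 1) → ℂ}
    (h : DG a (Fin.cons x ξ : Fin (n + 1) → ℂ) θ) :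
    antiFF a F (n + 1 + (n + 1)) (crossed (Fin.cons x ξ : Fin (n + 1) → ℂ) θ) =
      antiFF a F (n + n + 2) (Fin.cons (x + Real.pi * Complex.I)
        (Fin.cons (θ 0) (crossed ξ (Fin.tail θ)) : Fin (n + n + 1) → ℂ)) := by
  set R := crossed ξ (Fin.tail θ) with hR
  set e : Equiv.Perm (Fin (n + n + 2)) := Equiv.Perm.decomposeFin.symm (0, finRotate _) with he
  set T : Fin (n + n + 2) → ℂ := Fin.cons (x + Real.pi * Complex.I)
        (Fin.cons (θ 0) R : Fin (n + n + 1) → ℂ) with hT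
  have hcast : n + 1 + (n + 1) = n + n + 2 := by ring
  have h2 : crossed (Fin.cons x ξ : Fin (n + 1) → ℂ) θ = (T ∘ e) ∘ Fin.cast hcast := by
    have h3 : (fun i : Fin (n + 1) => (Fin.cons x ξ : Fin (n + 1) → ℂ) i + Real.pi * Complex.I) =
        Fin.cons (x + Real.pi * Complex.I) (fun i => ξ i + Real.pi * Complex.I) := by
      ext i
      induction i using Fin.cases <;> simp
    have h4 : (fun i : Fin (n + 1) => θ i.rev) =
        Fin.snoc (fun i : Fin n => Fin.tail θ i.rev) (θ 0) := by
      ext i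
      induction i using Fin.lastCases with
      | last => simp
      | cast i => simp [Fin.tail, Fin.rev_castSucc]
    rw [crossed, h3, h4, Fin.append_cons, Fin.append_snoc]
    have h5 : (Fin.cons (x + Real.pi * Complex.I) (Fin.snoc R (θ 0) : Fin (n + n + 1) → ℂ) :
        Fin (n + n + 2) → ℂ) = T ∘ e := by
      ext i
      induction i using Fin.cases with
      | zero => simp [he, hT]
      | succ i => simp [he, hT, Fin.snoc_eq_cons_rotate]
    rw [← h5]
    rfl
  have hg : Generic a T := by
    have h6 := generic_crossed.mpr h
    rw [h2] at h6
    have h7 := h6.comp (f := Fin.cast hcast.symm ∘ e.symm)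
      ((Fin.cast_injective _).comp e.symm.injective)
    convert h7 using 1
    ext i
    simp
  rw [h2, antiFF_cast, antiFF_comp_perm hF e hg, he, Equiv.Perm.decomposeFin.symm_sign,
    sign_finRotate]
  simp [← two_mul]

/-- The residue factor `i (1 - ∏_{k ≠ i} S(θ_i - θ_k) / S(θ_i - ξ_k))`. -/
def resFactor (a : ℝ) {n : ℕ} (i : Fin (n + 1)) (ξ θ : Fin (n + 1) → ℂ) : ℂ :=
  Complex.I * (1 - ∏ k : Fin n, S a (θ i - θ (i.succAbove k)) / S a (θ i - ξ (i.succAbove k)))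

theorem eventually_isReg_sub (ha : Real.sin (Real.pi * a) ≠ 0) (x : ℂ) :
    ∀ᶠ z in 𝓝[≠] x, IsReg a (z - x) := by
  have hs : (Real.sin (Real.pi * a) : ℂ) ≠ 0 := by exact_mod_cast ha
  have h1 : ∀ᶠ z in 𝓝 x, tau a (z - x) ≠ 0 := by
    have hc : ContinuousAt (fun z => tau a (z - x)) x := by
      have := continuous_tau a
      fun_prop
    exact hc.eventually_ne (by simpa [tau, -Complex.ofReal_sin] using hs)
  have h2 : ∀ᶠ z in 𝓝[≠] x, Complex.sinh (z - x) ≠ 0 := by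
    have hd : HasDerivAt (fun z => Complex.sinh (z - x)) 1 x := by
      have := ((hasDerivAt_id x).sub_const x).csinh
      simpa using this
    exact hd.eventually_ne (c := 0) one_ne_zero
  filter_upwards [nhdsWithin_le_nhds h1, h2] with z h1 h2 using ⟨h2, h1⟩

theorem eventually_dg_cons (ha : Real.sin (Real.pi * a) ≠ 0)
    {n : ℕ} {ξ : Fin n → ℂ} {θ : Fin (n + 1) → ℂ} (h : DG a ξ (Fin.tail θ))
    (hθ : ∀ k : Fin n, IsReg a (θ 0 - θ k.succ)) (hξ : ∀ k, IsReg a (θ 0 - ξ k)) :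
    ∀ᶠ z in 𝓝[≠] (θ 0), DG a (Fin.cons z ξ : Fin (n + 1) → ℂ) θ := by
  have e1 : ∀ᶠ z in 𝓝[≠] (θ 0), ∀ k, IsReg a (z - ξ k) :=
    nhdsWithin_le_nhds (eventually_all.mpr fun k =>
      (hξ k).eventually (f := fun z => z - ξ k) (by fun_prop))
  have e2 : ∀ᶠ z in 𝓝[≠] (θ 0), ∀ k : Fin n, IsReg a (z - θ k.succ) :=
    nhdsWithin_le_nhds (eventually_all.mpr fun k =>
      (hθ k).eventually (f := fun z => z - θ k.succ) (by fun_prop))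
  have e3 := eventually_isReg_sub ha (θ 0)
  filter_upwards [e1, e2, e3] with z h1 h2 h3
  refine ⟨generic_cons.mpr ⟨h1, h.1⟩, ?_, ?_⟩
  · have : θ = Fin.cons (θ 0) (Fin.tail θ) := (Fin.cons_self_tail θ).symm
    rw [this]
    exact generic_cons.mpr ⟨hθ, h.2.1⟩
  · intro i j
    induction i using Fin.cases with
    | zero => induction j using Fin.cases with
      | zero => simpa using h3
      | succ j => simpa using h2 j
    | succ i => induction j using Fin.cases with
      | zero => simpa using (hξ i).sub_comm
      | succ j => simpa [Fin.tail] using h.2.2 i j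

theorem eventually_dg_update (ha : Real.sin (Real.pi * a) ≠ 0)
    {n : ℕ} (i : Fin (n + 1)) {ξ θ : Fin (n + 1) → ℂ}
    (h : DG a (ξ ∘ i.succAbove) (θ ∘ i.succAbove))
    (hθ : ∀ k : Fin n, IsReg a (θ i - θ (i.succAbove k)))
    (hξ : ∀ k : Fin n, IsReg a (θ i - ξ (i.succAbove k))) :
    ∀ᶠ z in 𝓝[≠] (θ i), DG a (Function.update ξ i z) θ := by
  set c := i.cycleRange.symm with hc
  have hc0 : c 0 = i := Fin.cycleRange_symm_zero i
  have hcs : ∀ j : Fin n, c j.succ = i.succAbove j := Fin.cycleRange_symm_succ i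
  have htail : Fin.tail (θ ∘ c) = θ ∘ i.succAbove := by
    ext j; simp [Fin.tail, hcs]
  have hupd : ∀ z, Function.update ξ i z = Fin.cons z (ξ ∘ i.succAbove) ∘ c.symm := by
    intro z
    ext j
    obtain ⟨j, rfl⟩ := c.surjective j
    induction j using Fin.cases with
    | zero => rw [Function.comp_apply, Equiv.symm_apply_apply, Fin.cons_zero, hc0,
        Function.update_self]
    | succ j => rw [Function.comp_apply, Equiv.symm_apply_apply, Fin.cons_succ, hcs,
        Function.update_of_ne (Fin.succAbove_ne i j) z ξ, Function.comp_apply]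
  have key := eventually_dg_cons ha (ξ := ξ ∘ i.succAbove) (θ := θ ∘ c) (by rwa [htail])
    (by simpa [hc0, hcs] using hθ) (by simpa [hc0] using hξ)
  simp only [Function.comp_apply, hc0] at key
  filter_upwards [key] with z hz
  have h1 := hz.comp c.symm.injective c.symm.injective
  rw [hupd]
  convert h1 using 1
  ext j
  simp

/-- The kinematical residue at `ξ_0 = θ_0` for the normalized form factors. The normalizing factors
cancel against each other by crossing, `S (z + iπ) = S (-z)`. -/
theorem tendsto_residue_zero (hF : IsFormFactorFamily a F) (ha : Real.sin (Real.pi * a) ≠ 0)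
    {n : ℕ} {ξ : Fin n → ℂ}
    {θ : Fin (n + 1) → ℂ} (h : DG a ξ (Fin.tail θ))
    (hθ : ∀ k : Fin n, IsReg a (θ 0 - θ k.succ)) (hξ : ∀ k, IsReg a (θ 0 - ξ k)) :
    Tendsto (fun z => (z - θ 0) * normFF a F (n + 1) (Fin.cons z ξ : Fin (n + 1) → ℂ) θ)
      (𝓝[≠] (θ 0))
      (𝓝 (Complex.I * (1 - ∏ k : Fin n, S a (θ 0 - θ k.succ) / S a (θ 0 - ξ k)) *
        normFF a F n ξ (Fin.tail θ))) := by
  have hs : (Real.sin (Real.pi * a) : ℂ) ≠ 0 := by exact_mod_cast ha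
  set s : ℂ := (Real.sin (Real.pi * a) : ℂ) with hsdef
  set R := crossed ξ (Fin.tail θ) with hR
  have hRg : Generic a R := generic_crossed.mpr h
  -- products over the remaining rapidities split into the two groups
  have hRprod : ∀ f : ℂ → ℂ, ∏ k, f (R k) =
      (∏ k, f (ξ k + Real.pi * Complex.I)) * ∏ k : Fin n, f (θ k.succ) := by
    intro f
    rw [Fin.prod_univ_add]
    congr 1
    · simp only [hR, crossed_castAdd]
    · rw [← Equiv.prod_comp Fin.revPerm]
      simp only [hR, crossed_natAdd, Fin.revPerm_apply, Fin.rev_rev, Fin.tail]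
  have hRreg : ∀ k, IsReg a (θ 0 - R k) := by
    intro k
    induction k using Fin.addCases with
    | left k =>
      have : θ 0 - R (Fin.castAdd n k) = - (ξ k - θ 0 + Real.pi * Complex.I) := by
        rw [hR, crossed_castAdd]; ring
      rw [this]
      exact (isReg_add_pi.mpr (hξ k).sub_comm).neg
    | right k => rw [hR, crossed_natAdd]; exact hθ k.rev
  have hg : Generic a (Fin.cons (θ 0) R : Fin (n + n + 1) → ℂ) := generic_cons.mpr ⟨hRreg, hRg⟩
  have hkin := hF.kinematical_pole (n + n) (θ 0) R hg
  have hkin2 := hkin.const_mul Complex.I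
  have hprod : Tendsto (fun z : ℂ => (sgm a (z + Real.pi * Complex.I - θ 0) *
      ∏ k, sgm a (z + Real.pi * Complex.I - R k)) * ((∏ k, sgm a (θ 0 - R k)) * pairProd a R))
      (𝓝[≠] (θ 0)) (𝓝 ((sgm a (θ 0 + Real.pi * Complex.I - θ 0) *
      ∏ k, sgm a (θ 0 + Real.pi * Complex.I - R k)) *
        ((∏ k, sgm a (θ 0 - R k)) * pairProd a R))) := by
    refine Tendsto.mono_left ?_ nhdsWithin_le_nhds
    refine Continuous.tendsto (f := fun z : ℂ => (sgm a (z + Real.pi * Complex.I - θ 0) *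
      ∏ k, sgm a (z + Real.pi * Complex.I - R k)) * ((∏ k, sgm a (θ 0 - R k)) * pairProd a R)) ?_ _
    have := continuous_sgm a
    fun_prop
  have hden : Tendsto (fun z : ℂ => ∏ i, ∏ j, tau a ((Fin.cons z ξ : Fin (n + 1) → ℂ) i - θ j))
      (𝓝[≠] (θ 0)) (𝓝 (∏ i, ∏ j, tau a ((Fin.cons (θ 0) ξ : Fin (n + 1) → ℂ) i - θ j))) := by
    refine Tendsto.mono_left ?_ nhdsWithin_le_nhds
    simp only [Fin.prod_univ_succ, Fin.cons_zero, Fin.cons_succ]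
    refine Continuous.tendsto (f := fun z : ℂ => ((tau a (z - θ 0) * ∏ j : Fin n,
      tau a (z - θ j.succ)) * ∏ i, (tau a (ξ i - θ 0) * ∏ j : Fin n, tau a (ξ i - θ j.succ)))) ?_ _
    have := continuous_tau a
    fun_prop
  have ht0 : tau a 0 = s ^ 2 := by simp [tau, hsdef]
  have hden0 : ∏ i, ∏ j, tau a ((Fin.cons (θ 0) ξ : Fin (n + 1) → ℂ) i - θ j) =
      s ^ 2 * (∏ k : Fin n, tau a (θ 0 - θ k.succ)) * (∏ k, tau a (θ 0 - ξ k)) *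
        ∏ i, ∏ j, tau a (ξ i - Fin.tail θ j) := by
    simp only [Fin.prod_univ_succ, Fin.cons_zero, Fin.cons_succ, sub_self, ht0,
      Finset.prod_mul_distrib, Fin.tail]
    have : ∀ k, tau a (ξ k - θ 0) = tau a (θ 0 - ξ k) := fun k => by
      rw [← tau_neg, neg_sub]
    simp only [this]
    ring
  have hT1 : ∏ k : Fin n, tau a (θ 0 - θ k.succ) ≠ 0 :=
    Finset.prod_ne_zero_iff.mpr fun k _ => (hθ k).2
  have hT2 : ∏ k : Fin n, tau a (θ 0 - ξ k) ≠ 0 :=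
    Finset.prod_ne_zero_iff.mpr fun k _ => (hξ k).2
  have hT3 : ∏ i, ∏ j, tau a (ξ i - Fin.tail θ j) ≠ 0 :=
    Finset.prod_ne_zero_iff.mpr fun i _ => Finset.prod_ne_zero_iff.mpr fun j _ => (h.2.2 i j).2
  have hlim := ((hkin2.mul hprod).const_mul
    ((-Complex.I * s) ^ (n + 1))).div hden (by
      rw [hden0]
      exact mul_ne_zero (mul_ne_zero (mul_ne_zero (pow_ne_zero 2 hs) hT1) hT2) hT3)
  have hDG := eventually_dg_cons ha h hθ hξ
  refine Tendsto.congr' ?_ (hlim.trans (le_of_eq ?_))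
  · filter_upwards [hDG] with z hz
    rw [normFF, antiFF_crossed_succ hF hz, antiFF, pairProd_cons, pairProd_cons,
      Fin.prod_univ_succ]
    simp only [Fin.cons_zero, Fin.cons_succ]
    have hII : Complex.I * (-Complex.I) = 1 := by simp
    rw [← hsdef]
    rw [Pi.div_apply, mul_div_assoc', mul_left_comm]
    congr 1
    rw [← mul_assoc Complex.I, hII]
    ring
  · congr 1
    rw [hden0]
    have hr1 : ∏ k, S a (θ 0 - R k) = ∏ k : Fin n, S a (θ 0 - θ k.succ) / S a (θ 0 - ξ k) := by
      rw [hRprod (fun y => S a (θ 0 - y)), mul_comm, ← Finset.prod_mul_distrib]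
      refine Finset.prod_congr rfl fun k _ => ?_
      have : θ 0 - (ξ k + Real.pi * Complex.I) = -(ξ k - θ 0 + Real.pi * Complex.I) := by ring
      rw [this, S_neg, S_add_pi, neg_sub, div_eq_mul_inv]
    have hr2 : (∏ k, sgm a (θ 0 + Real.pi * Complex.I - R k)) * ∏ k, sgm a (θ 0 - R k) =
        (∏ k : Fin n, tau a (θ 0 - θ k.succ)) * ∏ k, tau a (θ 0 - ξ k) := by
      rw [← Finset.prod_mul_distrib]
      have : ∀ k, sgm a (θ 0 + Real.pi * Complex.I - R k) * sgm a (θ 0 - R k) =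
          - tau a (θ 0 - R k) := by
        intro k
        rw [show θ 0 + Real.pi * Complex.I - R k = θ 0 - R k + Real.pi * Complex.I by ring,
          sgm_add_pi, tau_eq]
        ring
      simp only [this]
      rw [hRprod (fun y => - tau a (θ 0 - y)), mul_comm, ← Finset.prod_mul_distrib,
        ← Finset.prod_mul_distrib]
      refine Finset.prod_congr rfl fun k _ => ?_
      have : θ 0 - (ξ k + Real.pi * Complex.I) = -(ξ k - θ 0 + Real.pi * Complex.I) := by ring
      rw [this, tau_neg, tau_add_pi, ← tau_neg a (ξ k - θ 0), neg_sub]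
      ring
    have hr3 : sgm a (θ 0 + Real.pi * Complex.I - θ 0) = Complex.I * s := by
      rw [show θ 0 + Real.pi * Complex.I - θ 0 = 0 + Real.pi * Complex.I by ring, sgm_add_pi]
      simp [sgm, hsdef]
    rw [hr1, hr3, normFF, antiFF, ← hR, ← hsdef]
    set p := ∏ k : Fin n, S a (θ 0 - θ k.succ) / S a (θ 0 - ξ k)
    set T1 := ∏ k : Fin n, tau a (θ 0 - θ k.succ)
    set T2 := ∏ k : Fin n, tau a (θ 0 - ξ k)
    set T3 := ∏ i, ∏ j, tau a (ξ i - Fin.tail θ j)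
    have hr4 : (Complex.I * s * ∏ k, sgm a (θ 0 + Real.pi * Complex.I - R k)) *
        ((∏ k, sgm a (θ 0 - R k)) * pairProd a R) = Complex.I * s * (T1 * T2) * pairProd a R := by
      rw [← hr2]; ring
    rw [hr4, pow_succ]
    field_simp
    linear_combination (-((1 - p) * F (n + n) R * pairProd a R)) * Complex.I_sq

theorem tendsto_residue (hF : IsFormFactorFamily a F) (ha : Real.sin (Real.pi * a) ≠ 0)
    {n : ℕ} (i : Fin (n + 1)) {ξ θ : Fin (n + 1) → ℂ}
    (h : DG a (ξ ∘ i.succAbove) (θ ∘ i.succAbove))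
    (hθ : ∀ k : Fin n, IsReg a (θ i - θ (i.succAbove k)))
    (hξ : ∀ k : Fin n, IsReg a (θ i - ξ (i.succAbove k))) :
    Tendsto (fun z => (z - θ i) * normFF a F (n + 1) (Function.update ξ i z) θ) (𝓝[≠] (θ i))
      (𝓝 (resFactor a i ξ θ * normFF a F n (ξ ∘ i.succAbove) (θ ∘ i.succAbove))) := by
  set c := i.cycleRange.symm with hc
  have hc0 : c 0 = i := Fin.cycleRange_symm_zero i
  have hcs : ∀ j : Fin n, c j.succ = i.succAbove j := Fin.cycleRange_symm_succ i
  have htail : Fin.tail (θ ∘ c) = θ ∘ i.succAbove := by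
    ext j; simp [Fin.tail, hcs]
  have hupd : ∀ z, Function.update ξ i z ∘ c = Fin.cons z (ξ ∘ i.succAbove) := by
    intro z
    ext j
    induction j using Fin.cases with
    | zero => simp [hc0]
    | succ j => simp [hcs]
  have key := tendsto_residue_zero hF ha (ξ := ξ ∘ i.succAbove) (θ := θ ∘ c) (by rwa [htail])
    (by simpa [hc0, hcs] using hθ) (by simpa [hc0] using hξ)
  rw [htail] at key
  simp only [Function.comp_apply, hc0, hcs] at key
  refine key.congr' ?_
  have hDG := eventually_dg_update (ξ := ξ) ha i h hθ hξ
  filter_upwards [hDG] with z hz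
  rw [← hupd, normFF_comp_same hF hz]

end

/-! ### Analyticity of the normalized form factors -/

section

/-- A set of rapidities between any two of which the imaginary parts differ by less than `π` and
the `S`-matrix has neither a zero nor a pole. -/
structure Admissible (a : ℝ) (V : Set ℂ) : Prop where
  im_lt : ∀ x ∈ V, ∀ y ∈ V, |(x - y).im| < Real.pi
  tau_ne : ∀ x ∈ V, ∀ y ∈ V, tau a (x - y) ≠ 0

theorem sinh_ne_zero_of_im {z : ℂ} (h : |z.im| < Real.pi) (hz : z ≠ 0) : Complex.sinh z ≠ 0 := by
  intro h0
  have h1 : Complex.sin (z * Complex.I) = 0 := by rw [Complex.sin_mul_I, h0, zero_mul]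
  obtain ⟨k, hk⟩ := Complex.sin_eq_zero_iff.mp h1
  have hre := congrArg Complex.re hk
  have him := congrArg Complex.im hk
  simp at hre him
  have hk0 : k = 0 := by
    rw [abs_lt] at h
    have h2 : (-1 : ℝ) < k := by
      by_contra hc
      nlinarith [Real.pi_pos, not_lt.mp hc]
    have h3 : (k : ℝ) < 1 := by
      by_contra hc
      nlinarith [Real.pi_pos, not_lt.mp hc]
    have h4 : -1 < k := by exact_mod_cast h2
    have h5 : k < 1 := by exact_mod_cast h3
    omega
  apply hz
  apply Complex.ext
  · simpa using him
  · simp only [hk0] at hre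
    simpa using hre

theorem cosh_half_ne_zero_of_im {z : ℂ} (h : |z.im| < Real.pi) : Complex.cosh (z / 2) ≠ 0 := by
  intro h0
  by_cases hz : z = 0
  · simp [hz] at h0
  · refine sinh_ne_zero_of_im h hz ?_
    rw [show z = 2 * (z / 2) by ring, Complex.sinh_two_mul, h0, mul_zero]

theorem sinh_half_ne_zero {z : ℂ} (h : Complex.sinh z ≠ 0) : Complex.sinh (z / 2) ≠ 0 := by
  intro h0
  apply h
  rw [show z = 2 * (z / 2) by ring, Complex.sinh_two_mul, h0]
  ring

theorem Admissible.isReg {a : ℝ} {V : Set ℂ} (hV : Admissible a V) {x y : ℂ} (hx : x ∈ V)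
    (hy : y ∈ V) (hxy : x ≠ y) : IsReg a (x - y) :=
  ⟨sinh_ne_zero_of_im (hV.im_lt x hx y hy) (sub_ne_zero.mpr hxy), hV.tau_ne x hx y hy⟩

theorem Admissible.sin_ne_zero {a : ℝ} {V : Set ℂ} (hV : Admissible a V) {x : ℂ} (hx : x ∈ V) :
    Real.sin (Real.pi * a) ≠ 0 := by
  intro h0
  apply hV.tau_ne x hx x hx
  simp [tau, -Complex.ofReal_sin, h0]

theorem AnalyticAt.entire_comp {E : Type*} [NormedAddCommGroup E] [NormedSpace ℂ E] {f : ℂ → ℂ}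
    (hf : Differentiable ℂ f) {g : E → ℂ} {x : E} (hg : AnalyticAt ℂ g x) :
    AnalyticAt ℂ (fun y => f (g y)) x :=
  (hf.analyticAt (g x)).comp hg

theorem differentiable_sgm (a : ℝ) : Differentiable ℂ (sgm a) := by
  unfold sgm
  exact Complex.differentiable_sinh.add_const _

theorem differentiable_tau (a : ℝ) : Differentiable ℂ (tau a) := by
  unfold tau
  exact (Complex.differentiable_sinh.pow 2).add_const _

section Blocks

variable {M : Type*} [CommMonoid M]

theorem prod_Ioi_eq {n : ℕ} (f : Fin n → Fin n → M) :
    ∏ i, ∏ j ∈ Finset.Ioi i, f i j = ∏ i, ∏ j, if i < j then f i j else 1 := by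
  refine Finset.prod_congr rfl fun i _ => ?_
  have := Finset.prod_ite_mem Finset.univ (Finset.Ioi i) (f i)
  simpa [Finset.mem_Ioi] using this.symm

/-- A product over pairs of an appended tuple splits into three blocks. -/
theorem prod_pairs_append {n : ℕ} {α : Type*} (h : α → α → M) (x y : Fin n → α) :
    (∏ i, ∏ j, if i < j then h (Fin.append x y i) (Fin.append x y j) else 1) =
      (∏ i, ∏ j, if i < j then h (x i) (x j) else 1) *
        (∏ i, ∏ j, if i < j then h (y i) (y j) else 1) * ∏ i, ∏ j, h (x i) (y j) := by
  have h1 : ∀ i j : Fin n, Fin.castAdd n i < Fin.natAdd n j := fun i j => by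
    simp only [Fin.lt_def, Fin.val_castAdd, Fin.val_natAdd]; omega
  have h2 : ∀ i j : Fin n, ¬ Fin.natAdd n i < Fin.castAdd n j := fun i j => (h1 j i).not_gt
  have h3 : ∀ i j : Fin n, Fin.castAdd n i < Fin.castAdd n j ↔ i < j := fun i j => by
    simp only [Fin.lt_def, Fin.val_castAdd]
  have h4 : ∀ i j : Fin n, Fin.natAdd n i < Fin.natAdd n j ↔ i < j := fun i j => by
    simp only [Fin.lt_def, Fin.val_natAdd]; omega
  simp only [Fin.prod_univ_add, Fin.append_left, Fin.append_right, h1, h2, h3, h4, if_true,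
    if_false, Finset.prod_mul_distrib, Finset.prod_const_one, mul_one]
  ac_rfl

theorem prod_prod_eq_diag_mul {n : ℕ} (h : Fin n → Fin n → M) :
    ∏ i, ∏ j, h i j = (∏ i, h i i) * ∏ i, ∏ j, if i < j then h i j * h j i else 1 := by
  have h1 : ∀ i j, h i j = (if i = j then h i j else 1) *
      ((if i < j then h i j else 1) * if j < i then h i j else 1) := by
    intro i j
    rcases lt_trichotomy i j with hij | hij | hij
    · simp [hij, hij.ne, hij.not_gt]
    · simp [hij]
    · simp [hij, hij.ne', hij.not_gt]
  have h2 : ∀ i j, (if i < j then h i j * h j i else 1) =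
      (if i < j then h i j else 1) * if i < j then h j i else 1 := by
    intro i j; split_ifs <;> simp
  simp_rw [h2, Finset.prod_mul_distrib]
  rw [Finset.prod_comm (f := fun i j => if i < j then h j i else 1)]
  calc ∏ i, ∏ j, h i j = ∏ i, ∏ j, ((if i = j then h i j else 1) *
      ((if i < j then h i j else 1) * if j < i then h i j else 1)) :=
        Finset.prod_congr rfl fun i _ => Finset.prod_congr rfl fun j _ => h1 i j
    _ = _ := by
      simp only [Finset.prod_mul_distrib, Finset.prod_ite_eq, Finset.mem_univ, if_true]

end Blocks

variable {a : ℝ} {F : ∀ n : ℕ, (Fin n → ℂ) → ℂ} {V : Set ℂ}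

theorem analyticAt_fst_apply {n : ℕ} (i : Fin n) (x : (Fin n → ℂ) × (Fin n → ℂ)) :
    AnalyticAt ℂ (fun p : (Fin n → ℂ) × (Fin n → ℂ) => p.1 i) x :=
  ((ContinuousLinearMap.proj (R := ℂ) (φ := fun _ : Fin n => ℂ) i).comp
    (ContinuousLinearMap.fst ℂ (Fin n → ℂ) (Fin n → ℂ))).analyticAt x

theorem analyticAt_snd_apply {n : ℕ} (i : Fin n) (x : (Fin n → ℂ) × (Fin n → ℂ)) :
    AnalyticAt ℂ (fun p : (Fin n → ℂ) × (Fin n → ℂ) => p.2 i) x :=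
  ((ContinuousLinearMap.proj (R := ℂ) (φ := fun _ : Fin n => ℂ) i).comp
    (ContinuousLinearMap.snd ℂ (Fin n → ℂ) (Fin n → ℂ))).analyticAt x

theorem analyticAt_crossed {n : ℕ} (x : (Fin n → ℂ) × (Fin n → ℂ)) :
    AnalyticAt ℂ (fun p : (Fin n → ℂ) × (Fin n → ℂ) => crossed p.1 p.2) x := by
  rw [analyticAt_pi_iff]
  intro i
  induction i using Fin.addCases with
  | left i =>
    simp only [crossed_castAdd]
    exact (analyticAt_fst_apply i x).add analyticAt_const
  | right i =>
    simp only [crossed_natAdd]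
    exact analyticAt_snd_apply i.rev x

theorem AnalyticAt.prod_prod {E : Type*} [NormedAddCommGroup E] [NormedSpace ℂ E] {n : ℕ}
    {f : Fin n → Fin n → E → ℂ} {x : E} (h : ∀ i j, AnalyticAt ℂ (f i j) x) :
    AnalyticAt ℂ (fun y => ∏ i, ∏ j, f i j y) x :=
  Finset.analyticAt_fun_prod _ fun i _ => Finset.analyticAt_fun_prod _ fun j _ => h i j

theorem analyticAt_pairProd {E : Type*} [NormedAddCommGroup E] [NormedSpace ℂ E] {n : ℕ}
    {f : E → Fin n → ℂ} {x : E} (h : ∀ i, AnalyticAt ℂ (fun y => f y i) x) :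
    AnalyticAt ℂ (fun y => pairProd a (f y)) x := by
  refine AnalyticAt.prod_prod fun i j => ?_
  by_cases hij : i < j
  · simp only [hij, if_true]
    exact AnalyticAt.entire_comp (differentiable_sgm a) ((h i).sub (h j))
  · simp only [hij, if_false]
    exact analyticAt_const

/-- The form factor axiom of analyticity for the normalized form factors: near a diagonal
configuration, which may have coinciding rapidities, they are quotients of an analytic function by
the product of the `sinh ((ξ_i - θ_j) / 2)`. -/
theorem exists_analytic_prod_sinh (hF : IsFormFactorFamily a F) (hV : Admissible a V) {n : ℕ}
    {θ₀ : Fin n → ℂ} (hθ₀ : ∀ i, θ₀ i ∈ V) :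
    ∃ N : (Fin n → ℂ) × (Fin n → ℂ) → ℂ, AnalyticAt ℂ N (θ₀, θ₀) ∧
      ∀ᶠ p in 𝓝 (θ₀, θ₀), DG a p.1 p.2 →
        normFF a F n p.1 p.2 * ∏ i, ∏ j, Complex.sinh ((p.1 i - p.2 j) / 2) = N p := by
  -- order the rapidities by decreasing imaginary part
  set τ : Equiv.Perm (Fin n) := Tuple.sort (fun i => -(θ₀ i).im) with hτ
  have hmono : Monotone ((fun i => -(θ₀ i).im) ∘ τ) := Tuple.monotone_sort _
  set τ' : Equiv.Perm (Fin n) := Fin.revPerm.trans τ with hτ'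
  set c : (Fin n → ℂ) × (Fin n → ℂ) → Fin (n + n) → ℂ :=
    fun p => crossed (p.1 ∘ τ) (p.2 ∘ τ') with hc
  have hcapp : ∀ p, c p = Fin.append (fun i => p.1 (τ i) + Real.pi * Complex.I)
      (fun i => p.2 (τ i)) := by
    intro p
    simp only [hc, crossed, hτ']
    congr 1
    ext i
    simp
  have hcan : ∀ i, AnalyticAt ℂ (fun p => c p i) (θ₀, θ₀) := by
    intro i
    simp only [hcapp]
    induction i using Fin.addCases with
    | left i =>
      simp only [Fin.append_left]
      exact (analyticAt_fst_apply _ _).add analyticAt_const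
    | right i =>
      simp only [Fin.append_right]
      exact analyticAt_snd_apply _ _
  have himlt : ∀ i j : Fin n, |(θ₀ i).im - (θ₀ j).im| < Real.pi := fun i j => by
    simpa using hV.im_lt _ (hθ₀ i) _ (hθ₀ j)
  have himle : ∀ i j : Fin n, i < j → 0 ≤ (θ₀ (τ i)).im - (θ₀ (τ j)).im := fun i j hij => by
    have := hmono hij.le
    simp only [Function.comp_apply, neg_le_neg_iff] at this
    linarith
  -- in this order the configuration lies in the region of the analyticity axiom
  obtain ⟨G, hG, hGF⟩ := hF.analytic (n + n) (c (θ₀, θ₀)) (by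
    intro i j hij
    rw [hcapp]
    induction i using Fin.addCases with
    | left i =>
      induction j using Fin.addCases with
      | left j =>
        have h1 := himle i j (by
          simpa only [Fin.lt_def, Fin.val_castAdd] using hij)
        have h2 := (abs_lt.mp (himlt (τ i) (τ j))).2
        simp only [Fin.append_left, Complex.sub_im, Complex.add_im]
        constructor <;> linarith [Real.pi_pos]
      | right j =>
        have h2 := abs_lt.mp (himlt (τ i) (τ j))
        simp only [Fin.append_left, Fin.append_right, Complex.sub_im, Complex.add_im,
          Complex.mul_im, Complex.ofReal_re, Complex.I_im, Complex.ofReal_im, Complex.I_re]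
        constructor <;> linarith [Real.pi_pos]
    | right i =>
      induction j using Fin.addCases with
      | left j =>
        simp only [Fin.lt_def, Fin.val_castAdd, Fin.val_natAdd] at hij
        omega
      | right j =>
        have h1 := himle i j (by
          simp only [Fin.lt_def, Fin.val_natAdd] at hij ⊢; omega)
        have h2 := (abs_lt.mp (himlt (τ i) (τ j))).2
        simp only [Fin.append_right, Complex.sub_im]
        constructor <;> linarith [Real.pi_pos])
  have hcc : AnalyticAt ℂ c (θ₀, θ₀) := by rw [analyticAt_pi_iff]; exact hcan
  -- of the factors `cosh` in the axiom, those within a group do not vanish at `θ₀`, while those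
  -- between the groups are `cosh ((ξ_i + iπ - θ_j) / 2) = i sinh ((ξ_i - θ_j) / 2)`
  set C₁ : (Fin n → ℂ) → ℂ := fun x => ∏ i, ∏ j,
    if i < j then Complex.cosh ((x (τ i) - x (τ j)) / 2) else 1 with hC₁
  have hC₁0 : C₁ θ₀ ≠ 0 := by
    refine Finset.prod_ne_zero_iff.mpr fun i _ => Finset.prod_ne_zero_iff.mpr fun j _ => ?_
    split_ifs
    · exact cosh_half_ne_zero_of_im (by simpa using himlt (τ i) (τ j))
    · exact one_ne_zero
  have hCan : AnalyticAt ℂ (fun p : (Fin n → ℂ) × (Fin n → ℂ) => C₁ p.1 * C₁ p.2) (θ₀, θ₀) := by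
    refine AnalyticAt.mul (AnalyticAt.prod_prod fun i j => ?_) (AnalyticAt.prod_prod fun i j => ?_)
    · by_cases hij : i < j
      · simp only [hij, if_true]
        exact AnalyticAt.entire_comp Complex.differentiable_cosh
          (((analyticAt_fst_apply _ _).sub (analyticAt_fst_apply _ _)).div_const)
      · simp only [hij, if_false]
        exact analyticAt_const
    · by_cases hij : i < j
      · simp only [hij, if_true]
        exact AnalyticAt.entire_comp Complex.differentiable_cosh
          (((analyticAt_snd_apply _ _).sub (analyticAt_snd_apply _ _)).div_const)
      · simp only [hij, if_false]
        exact analyticAt_const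
  set T : (Fin n → ℂ) × (Fin n → ℂ) → ℂ := fun p => ∏ i, ∏ j, tau a (p.1 i - p.2 j) with hT
  have hTan : AnalyticAt ℂ T (θ₀, θ₀) := AnalyticAt.prod_prod fun i j =>
    AnalyticAt.entire_comp (differentiable_tau a)
      ((analyticAt_fst_apply _ _).sub (analyticAt_snd_apply _ _))
  have hT0 : T (θ₀, θ₀) ≠ 0 :=
    Finset.prod_ne_zero_iff.mpr fun i _ => Finset.prod_ne_zero_iff.mpr fun j _ =>
      hV.tau_ne _ (hθ₀ i) _ (hθ₀ j)
  set s : ℂ := (Real.sin (Real.pi * a) : ℂ)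
  set sg : ℂ := ((Equiv.Perm.sign τ : ℤ) : ℂ) * ((Equiv.Perm.sign τ' : ℤ) : ℂ) with hsg
  refine ⟨fun p => sg * ((-Complex.I * s) ^ n * (G (c p) * pairProd a (c p)) /
    (T p * (C₁ p.1 * C₁ p.2 * (Complex.I ^ n) ^ n))), ?_, ?_⟩
  · refine analyticAt_const.mul (AnalyticAt.div (analyticAt_const.mul
      (AnalyticAt.mul (hG.comp hcc) (analyticAt_pairProd hcan)))
      (hTan.mul (hCan.mul analyticAt_const)) ?_)
    exact mul_ne_zero hT0 (mul_ne_zero (mul_ne_zero hC₁0 hC₁0)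
      (pow_ne_zero _ (pow_ne_zero _ Complex.I_ne_zero)))
  · have h1 := hcc.continuousAt.eventually hGF
    filter_upwards [h1] with p hp hDG
    have hDG' : DG a (p.1 ∘ τ) (p.2 ∘ τ') := hDG.comp τ.injective τ'.injective
    have h2 := hp (generic_crossed.mpr hDG')
    have hsg2 : sg * sg = 1 := by
      rcases Int.units_eq_one_or (Equiv.Perm.sign τ) with h | h <;>
        rcases Int.units_eq_one_or (Equiv.Perm.sign τ') with h' | h' <;> simp [hsg, h, h']
    have h3 : normFF a F n p.1 p.2 = sg * normFF a F n (p.1 ∘ τ) (p.2 ∘ τ') := by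
      rw [normFF_comp hF hDG, ← hsg, ← mul_assoc, hsg2, one_mul]
    have hTτ : ∏ i, ∏ j, tau a ((p.1 ∘ τ) i - (p.2 ∘ τ') j) = T p := by
      change _ = ∏ i, ∏ j, tau a (p.1 i - p.2 j)
      rw [← Equiv.prod_comp τ (fun i => ∏ j, tau a (p.1 i - p.2 j))]
      refine Finset.prod_congr rfl fun i _ => ?_
      exact Equiv.prod_comp τ' (fun j => tau a (p.1 (τ i) - p.2 j))
    set Sh := ∏ i, ∏ j, Complex.sinh ((p.1 i - p.2 j) / 2) with hSh
    have hSh0 : Sh ≠ 0 :=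
      Finset.prod_ne_zero_iff.mpr fun i _ => Finset.prod_ne_zero_iff.mpr fun j _ =>
        sinh_half_ne_zero (hDG.2.2 i j).1
    have hcosh : ∏ i, ∏ j ∈ Finset.Ioi i, Complex.cosh ((c p i - c p j) / 2) =
        C₁ p.1 * C₁ p.2 * (Complex.I ^ n) ^ n * Sh := by
      rw [prod_Ioi_eq, hcapp, prod_pairs_append (fun x y => Complex.cosh ((x - y) / 2))]
      have h4 : ∏ i : Fin n, ∏ j : Fin n,
          Complex.cosh ((p.1 (τ i) + Real.pi * Complex.I - p.2 (τ j)) / 2) =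
          (Complex.I ^ n) ^ n * Sh := by
        have h5 : ∀ i j : Fin n,
            Complex.cosh ((p.1 (τ i) + Real.pi * Complex.I - p.2 (τ j)) / 2) =
            Complex.I * Complex.sinh ((p.1 (τ i) - p.2 (τ j)) / 2) := by
          intro i j
          rw [show (p.1 (τ i) + Real.pi * Complex.I - p.2 (τ j)) / 2 =
            (p.1 (τ i) - p.2 (τ j)) / 2 + (Real.pi / 2 : ℂ) * Complex.I by ring,
            Complex.cosh_add, Complex.cosh_mul_I, Complex.sinh_mul_I]
          simp [mul_comm]
        simp only [h5, Finset.prod_mul_distrib, Finset.prod_const, Finset.card_univ,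
          Fintype.card_fin]
        congr 1
        rw [hSh, ← Equiv.prod_comp τ (fun i => ∏ j, Complex.sinh ((p.1 i - p.2 j) / 2))]
        refine Finset.prod_congr rfl fun i _ => ?_
        exact Equiv.prod_comp τ (fun j => Complex.sinh ((p.1 (τ i) - p.2 j) / 2))
      rw [h4]
      have h6 : ∀ i j : Fin n, p.1 (τ i) + Real.pi * Complex.I - (p.1 (τ j) + Real.pi * Complex.I)
          = p.1 (τ i) - p.1 (τ j) := fun i j => by ring
      simp only [h6, hC₁]
      ring
    have hcancel : ∀ k g x q t : ℂ, sg * (k * (g / (x * Sh) * q) / t) * Sh =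
        sg * (k * (g * q) / (t * x)) := by
      intro k g x q t
      simp only [div_eq_mul_inv, mul_inv]
      linear_combination (sg * k * g * x⁻¹ * q * t⁻¹) * mul_inv_cancel₀ hSh0
    rw [h3, normFF, hTτ, antiFF]
    rw [hcosh] at h2
    rw [show crossed (p.1 ∘ τ) (p.2 ∘ τ') = c p from rfl, h2]
    exact hcancel _ _ _ _ _

/-- Only the factors `sinh ((ξ_i - θ_j) / 2)` of coinciding rapidities are needed. -/
theorem exists_analytic_mul_sinh (hF : IsFormFactorFamily a F) (hV : Admissible a V) {n : ℕ}
    {θ₀ : Fin n → ℂ} (hθ₀ : ∀ i, θ₀ i ∈ V) (D : Finset (Fin n × Fin n))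
    (hD : ∀ i j, θ₀ i = θ₀ j → (i, j) ∈ D) :
    ∃ M : (Fin n → ℂ) × (Fin n → ℂ) → ℂ, AnalyticAt ℂ M (θ₀, θ₀) ∧
      ∀ᶠ p in 𝓝 (θ₀, θ₀), DG a p.1 p.2 →
        normFF a F n p.1 p.2 * ∏ q ∈ D, (2 * Complex.sinh ((p.1 q.1 - p.2 q.2) / 2)) = M p := by
  classical
  obtain ⟨N, hN, hNF⟩ := exists_analytic_prod_sinh hF hV hθ₀
  set Q : (Fin n → ℂ) × (Fin n → ℂ) → ℂ :=
    fun p => ∏ q ∈ Dᶜ, Complex.sinh ((p.1 q.1 - p.2 q.2) / 2) with hQ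
  have hQan : AnalyticAt ℂ Q (θ₀, θ₀) := Finset.analyticAt_fun_prod _ fun q _ =>
    AnalyticAt.entire_comp Complex.differentiable_sinh
      (((analyticAt_fst_apply _ _).sub (analyticAt_snd_apply _ _)).div_const)
  have hQ0 : Q (θ₀, θ₀) ≠ 0 := Finset.prod_ne_zero_iff.mpr fun q hq =>
    sinh_half_ne_zero (hV.isReg (hθ₀ _) (hθ₀ _) fun h =>
      Finset.mem_compl.mp hq (hD q.1 q.2 h)).1
  refine ⟨fun p => 2 ^ D.card * N p / Q p, (analyticAt_const.mul hN).div hQan hQ0, ?_⟩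
  filter_upwards [hNF, hQan.continuousAt.eventually_ne hQ0] with p hp hq hDG
  rw [← hp hDG, ← Fintype.prod_prod_type' (f := fun i j => Complex.sinh ((p.1 i - p.2 j) / 2)),
    ← Finset.prod_mul_prod_compl D, Finset.prod_mul_distrib, Finset.prod_const, eq_div_iff hq]
  simp only [hQ]
  ring

/-- The ratio of the normalized form factor to the form factor. -/
def normRatio (a : ℝ) {n : ℕ} (ξ θ : Fin n → ℂ) : ℂ :=
  (-Complex.I * (Real.sin (Real.pi * a) : ℂ)) ^ n * pairProd a (crossed ξ θ) /
    ∏ i, ∏ j, tau a (ξ i - θ j)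

theorem normFF_eq {n : ℕ} (ξ θ : Fin n → ℂ) :
    normFF a F n ξ θ = F (n + n) (crossed ξ θ) * normRatio a ξ θ := by
  rw [normFF, normRatio, antiFF]
  ring

theorem prod_tau_ne_zero (hV : Admissible a V) {n : ℕ} {θ₀ : Fin n → ℂ} (hθ₀ : ∀ i, θ₀ i ∈ V) :
    ∏ i, ∏ j, tau a (θ₀ i - θ₀ j) ≠ 0 :=
  Finset.prod_ne_zero_iff.mpr fun i _ => Finset.prod_ne_zero_iff.mpr fun j _ =>
    hV.tau_ne _ (hθ₀ i) _ (hθ₀ j)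

theorem analyticAt_normRatio (hV : Admissible a V) {n : ℕ} {θ₀ : Fin n → ℂ}
    (hθ₀ : ∀ i, θ₀ i ∈ V) :
    AnalyticAt ℂ (fun p : (Fin n → ℂ) × (Fin n → ℂ) => normRatio a p.1 p.2) (θ₀, θ₀) := by
  refine AnalyticAt.div (analyticAt_const.mul (analyticAt_pairProd fun i => ?_))
    (AnalyticAt.prod_prod fun i j => AnalyticAt.entire_comp (differentiable_tau a)
      ((analyticAt_fst_apply _ _).sub (analyticAt_snd_apply _ _))) (prod_tau_ne_zero hV hθ₀)
  exact (analyticAt_pi_iff.mp (analyticAt_crossed (θ₀, θ₀))) i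

/-- On the diagonal `ξ = θ` the exchange factors cancel. -/
theorem normRatio_self {n : ℕ} {θ : Fin n → ℂ}
    (hθ : ∏ i, ∏ j, tau a (θ i - θ j) ≠ 0) : normRatio a θ θ = 1 := by
  set s : ℂ := (Real.sin (Real.pi * a) : ℂ) with hs
  set B : ℂ := ∏ i : Fin n, ∏ j : Fin n, if i < j then tau a (θ i - θ j) else 1 with hB
  have h1 : ∏ i, ∏ j, tau a (θ i - θ j) = (s ^ 2) ^ n * (B * B) := by
    rw [prod_prod_eq_diag_mul]
    have h2 : ∀ i j : Fin n, (if i < j then tau a (θ i - θ j) * tau a (θ j - θ i) else 1) =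
        (if i < j then tau a (θ i - θ j) else 1) * if i < j then tau a (θ i - θ j) else 1 := by
      intro i j
      rw [← tau_neg a (θ j - θ i), neg_sub]
      split_ifs <;> simp
    simp only [h2, Finset.prod_mul_distrib, sub_self]
    congr 1
    simp [tau, hs, -Complex.ofReal_sin]
  set A : ℂ := ∏ i : Fin n, ∏ j : Fin n,
    if i < j then sgm a (θ i - θ j) * sgm a (θ j - θ i) else 1 with hA
  have hAB : A * A = B * B := by
    rw [hA, hB]
    simp only [← Finset.prod_mul_distrib]
    refine Finset.prod_congr rfl fun i _ => Finset.prod_congr rfl fun j _ => ?_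
    rw [tau_eq, neg_sub]
    split_ifs <;> simp
  have h3 : pairProd a (crossed θ θ) = (Complex.I * s) ^ n * (B * B) := by
    rw [pairProd, crossed, prod_pairs_append (fun x y => sgm a (x - y))]
    have e1 : ∏ i : Fin n, ∏ j : Fin n, sgm a (θ i + Real.pi * Complex.I - θ j.rev) =
        (Complex.I * s) ^ n * A := by
      have e2 : ∀ i j : Fin n, sgm a (θ i + Real.pi * Complex.I - θ j) = sgm a (θ j - θ i) := by
        intro i j
        rw [show θ i + Real.pi * Complex.I - θ j = θ i - θ j + Real.pi * Complex.I by ring,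
          sgm_add_pi, neg_sub]
      have e3 : ∀ i : Fin n, ∏ j : Fin n, sgm a (θ i + Real.pi * Complex.I - θ j.rev) =
          ∏ j : Fin n, sgm a (θ j - θ i) := by
        intro i
        rw [← Equiv.prod_comp Fin.revPerm]
        simp [e2]
      simp only [e3]
      rw [prod_prod_eq_diag_mul]
      congr 1
      · simp [sgm, hs, -Complex.ofReal_sin]
      · refine Finset.prod_congr rfl fun i _ => Finset.prod_congr rfl fun j _ => ?_
        rw [mul_comm]
    have e4 : (∏ i : Fin n, ∏ j : Fin n, if i < j then sgm a (θ i.rev - θ j.rev) else 1) =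
        ∏ i : Fin n, ∏ j : Fin n, if i < j then sgm a (θ j - θ i) else 1 := by
      rw [← Equiv.prod_comp Fin.revPerm, Finset.prod_comm]
      have e5 : ∀ y : Fin n, ∏ x : Fin n, (if (Fin.revPerm x : Fin n) < y then
          sgm a (θ (Fin.revPerm x).rev - θ y.rev) else 1) =
          ∏ x : Fin n, (if Fin.rev x < y then sgm a (θ x - θ y.rev) else 1) := by
        intro y; simp
      simp only [e5]
      rw [← Equiv.prod_comp Fin.revPerm]
      refine Finset.prod_congr rfl fun i _ => Finset.prod_congr rfl fun j _ => ?_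
      simp [Fin.rev_lt_rev]
    rw [e1, e4, ← hAB]
    have e6 : ∀ i j : Fin n, θ i + Real.pi * Complex.I - (θ j + Real.pi * Complex.I) =
        θ i - θ j := fun i j => by ring
    simp only [e6]
    have e7 : (∏ i : Fin n, ∏ j : Fin n, if i < j then sgm a (θ i - θ j) else 1) *
        (∏ i : Fin n, ∏ j : Fin n, if i < j then sgm a (θ j - θ i) else 1) = A := by
      rw [hA]
      simp only [← Finset.prod_mul_distrib]
      refine Finset.prod_congr rfl fun i _ => Finset.prod_congr rfl fun j _ => ?_
      split_ifs <;> simp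
    rw [e7]
    ring
  rw [normRatio, h3, ← hs]
  rw [h1] at hθ ⊢
  rw [div_eq_one_iff_eq hθ, ← mul_assoc, ← mul_pow]
  congr 2
  linear_combination (-s ^ 2) * Complex.I_sq

end

/-! ### Leading behaviour along lines through a diagonal configuration -/

section

variable {a : ℝ} {F : ∀ n : ℕ, (Fin n → ℂ) → ℂ} {V : Set ℂ}

/-- The pairs of positions at which a tuple takes the same value. -/
def coinc {n : ℕ} (θ : Fin n → ℂ) : Finset (Fin n × Fin n) := by
  classical exact Finset.univ.filter fun q => θ q.1 = θ q.2

theorem mem_coinc {n : ℕ} {θ : Fin n → ℂ} {q : Fin n × Fin n} : q ∈ coinc θ ↔ θ q.1 = θ q.2 := by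
  simp [coinc]

/-- The line `s ↦ (θ + s (v + w), θ + s w)` consists of generic diagonal configurations for small
`s ≠ 0`. -/
def LineGeneric {n : ℕ} (θ v w : Fin n → ℂ) : Prop :=
  (∀ i j, i ≠ j → θ i = θ j → w i ≠ w j ∧ v i + w i ≠ v j + w j) ∧
    ∀ i j, θ i = θ j → v i + w i ≠ w j

theorem lineGeneric_of_injective {n : ℕ} {θ v w : Fin n → ℂ} (hθ : Function.Injective θ)
    (hv : ∀ i, v i ≠ 0) : LineGeneric θ v w :=
  ⟨fun _ _ hij h => absurd (hθ h) hij, fun i j h => by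
    rw [hθ h, ne_eq, add_eq_right]; exact hv j⟩

theorem eventually_isReg_line (hV : Admissible a V) {x y α β : ℂ} (hx : x ∈ V) (hy : y ∈ V)
    (h : x = y → α ≠ β) : ∀ᶠ s : ℂ in 𝓝[≠] 0, IsReg a (x + s * α - (y + s * β)) := by
  by_cases hxy : x = y
  · have h1 := eventually_isReg_sub (hV.sin_ne_zero hx) 0
    have h2 : Tendsto (fun s : ℂ => s * (α - β)) (𝓝[≠] 0) (𝓝[≠] 0) := by
      refine tendsto_nhdsWithin_iff.mpr ⟨?_, ?_⟩
      · have : Continuous fun s : ℂ => s * (α - β) := by fun_prop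
        simpa using (this.tendsto 0).mono_left nhdsWithin_le_nhds
      · filter_upwards [self_mem_nhdsWithin] with s hs
        exact mul_ne_zero hs (sub_ne_zero.mpr (h hxy))
    filter_upwards [h2.eventually h1] with s hs
    rw [hxy, show y + s * α - (y + s * β) = s * (α - β) - 0 by ring]
    exact hs
  · refine nhdsWithin_le_nhds (IsReg.eventually (f := fun s => x + s * α - (y + s * β)) ?_ ?_)
    · simpa using hV.isReg hx hy hxy
    · fun_prop

theorem LineGeneric.eventually_dg (hV : Admissible a V) {n : ℕ} {θ v w : Fin n → ℂ}
    (hθ : ∀ i, θ i ∈ V) (h : LineGeneric θ v w) :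
    ∀ᶠ s : ℂ in 𝓝[≠] 0, DG a (θ + s • (v + w)) (θ + s • w) := by
  have h1 : ∀ᶠ s : ℂ in 𝓝[≠] 0, ∀ i j, i ≠ j →
      IsReg a (θ i + s * (v i + w i) - (θ j + s * (v j + w j))) :=
    eventually_all.mpr fun i => eventually_all.mpr fun j => by
      by_cases hij : i = j
      · simp [hij]
      · simpa [hij] using eventually_isReg_line hV (hθ i) (hθ j) fun he => (h.1 i j hij he).2
  have h2 : ∀ᶠ s : ℂ in 𝓝[≠] 0, ∀ i j, i ≠ j →
      IsReg a (θ i + s * w i - (θ j + s * w j)) :=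
    eventually_all.mpr fun i => eventually_all.mpr fun j => by
      by_cases hij : i = j
      · simp [hij]
      · simpa [hij] using eventually_isReg_line hV (hθ i) (hθ j) fun he => (h.1 i j hij he).1
  have h3 : ∀ᶠ s : ℂ in 𝓝[≠] 0, ∀ i j,
      IsReg a (θ i + s * (v i + w i) - (θ j + s * w j)) :=
    eventually_all.mpr fun i => eventually_all.mpr fun j =>
      eventually_isReg_line hV (hθ i) (hθ j) (h.2 i j)
  filter_upwards [h1, h2, h3] with s e1 e2 e3
  exact ⟨generic_iff.mpr e1, generic_iff.mpr e2, e3⟩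

theorem tendsto_two_sinh_half_div {x : ℂ} :
    Tendsto (fun s : ℂ => 2 * Complex.sinh (s * x / 2) / s) (𝓝[≠] 0) (𝓝 x) := by
  have h1 : HasDerivAt (fun s : ℂ => 2 * Complex.sinh (s * x / 2))
      (2 * (Complex.cosh (0 * x / 2) * (1 * x / 2))) 0 :=
    ((((hasDerivAt_id (0 : ℂ)).mul_const x).div_const 2).csinh).const_mul 2
  have h2 := hasDerivAt_iff_tendsto_slope.mp h1
  simp only [zero_mul, zero_div, Complex.cosh_zero, one_mul, mul_div_cancel₀ _ (two_ne_zero' ℂ)]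
    at h2
  refine h2.congr fun s => ?_
  simp [slope_def_field]

/-- The product over the coinciding pairs has the product of the linear forms as leading term. -/
theorem tendsto_prod_sinh_line {n : ℕ} {θ v w : Fin n → ℂ} {D : Finset (Fin n × Fin n)}
    (hD : D ⊆ coinc θ) :
    Tendsto (fun s : ℂ => (∏ q ∈ D, 2 * Complex.sinh (((θ + s • (v + w)) q.1 - (θ + s • w) q.2) / 2))
      / s ^ D.card) (𝓝[≠] 0) (𝓝 (∏ q ∈ D, (v q.1 + w q.1 - w q.2))) := by
  have h1 : Tendsto (fun s : ℂ => ∏ q ∈ D, (2 * Complex.sinh (s * (v q.1 + w q.1 - w q.2) / 2) / s))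
      (𝓝[≠] 0) (𝓝 (∏ q ∈ D, (v q.1 + w q.1 - w q.2))) :=
    tendsto_finsetProd _ fun q _ => tendsto_two_sinh_half_div
  refine h1.congr fun s => ?_
  rw [Finset.prod_div_distrib, Finset.prod_const]
  congr 1
  refine Finset.prod_congr rfl fun q hq => ?_
  have := mem_coinc.mp (hD hq)
  simp only [Pi.add_apply, Pi.smul_apply, smul_eq_mul, this]
  congr 3
  ring

theorem tendsto_line {n : ℕ} (θ v w : Fin n → ℂ) :
    Tendsto (fun s : ℂ => (θ + s • (v + w), θ + s • w)) (𝓝[≠] 0) (𝓝 (θ, θ)) := by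
  have : Continuous fun s : ℂ => (θ + s • (v + w), θ + s • w) := by fun_prop
  simpa using (this.tendsto 0).mono_left nhdsWithin_le_nhds

theorem differentiableAt_S {z : ℂ} (h : tau a z ≠ 0) : DifferentiableAt ℂ (S a) z := by
  unfold S
  exact (Complex.differentiable_sinh.sub_const _ z).div (Complex.differentiable_sinh.add_const _ z)
    (sgm_ne_zero h)

/-- To first order, the residue factor is the sum of the kernels `φ`. -/
theorem tendsto_resFactor_line (hV : Admissible a V) {n : ℕ} (i : Fin (n + 1))
    {θ v w : Fin (n + 1) → ℂ} (hθ : ∀ i, θ i ∈ V) :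
    Tendsto (fun s : ℂ => resFactor a i (θ + s • (v + w)) (θ + s • w) / s) (𝓝[≠] 0)
      (𝓝 (∑ k : Fin n, phi a (θ i - θ (i.succAbove k)) * v (i.succAbove k))) := by
  -- the residue factor along the line is `i (1 - ∏ g_k)` with `g_k 0 = 1`, so that its derivative is
  -- a sum of logarithmic derivatives of `S`
  set g : Fin n → ℂ → ℂ := fun k s =>
    S a (θ i - θ (i.succAbove k) + s * (w i - w (i.succAbove k))) /
      S a (θ i - θ (i.succAbove k) + s * (w i - w (i.succAbove k) - v (i.succAbove k))) with hg
  have h0 : ∀ k, tau a (θ i - θ (i.succAbove k)) ≠ 0 := fun k => hV.tau_ne _ (hθ _) _ (hθ _)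
  have hg0 : ∀ k, g k 0 = 1 := fun k => by simp [hg, S_ne_zero (h0 k)]
  have hlin : ∀ (x : ℂ) (k : Fin n),
      HasDerivAt (fun s : ℂ => S a (θ i - θ (i.succAbove k) + s * x))
        (deriv (S a) (θ i - θ (i.succAbove k)) * x) 0 := by
    intro x k
    have h1 : HasDerivAt (fun s : ℂ => θ i - θ (i.succAbove k) + s * x) x 0 := by
      simpa using ((hasDerivAt_id (0 : ℂ)).mul_const x).const_add (θ i - θ (i.succAbove k))
    have h2 : HasDerivAt (S a) (deriv (S a) (θ i - θ (i.succAbove k)))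
        (θ i - θ (i.succAbove k) + 0 * x) := by
      simpa using (differentiableAt_S (h0 k)).hasDerivAt
    exact h2.comp 0 h1
  have hgd : ∀ k, HasDerivAt (g k) (logDeriv (S a) (θ i - θ (i.succAbove k)) *
      v (i.succAbove k)) 0 := by
    intro k
    have hS := S_ne_zero (h0 k)
    have h1 := (hlin (w i - w (i.succAbove k)) k).fun_div
      (hlin (w i - w (i.succAbove k) - v (i.succAbove k)) k) (by simpa using hS)
    refine HasDerivAt.congr_deriv (f := g k) h1 ?_
    simp only [zero_mul, add_zero, logDeriv_apply]
    field_simp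
    ring
  have hd : HasDerivAt (fun s => Complex.I * (1 - ∏ k, g k s))
      (∑ k : Fin n, phi a (θ i - θ (i.succAbove k)) * v (i.succAbove k)) 0 := by
    have h1 := ((HasDerivAt.fun_finsetProd (u := Finset.univ) fun k _ => hgd k).const_sub 1).const_mul
      Complex.I
    refine h1.congr_deriv ?_
    simp only [hg0, Finset.prod_const_one, phi, smul_eq_mul]
    rw [mul_neg, Finset.mul_sum, ← Finset.sum_neg_distrib]
    refine Finset.sum_congr rfl fun k _ => ?_
    ring
  refine (hasDerivAt_iff_tendsto_slope.mp hd).congr fun s => ?_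
  simp only [slope_def_field, hg0, Finset.prod_const_one, sub_self, mul_zero, sub_zero, resFactor]
  congr 3
  refine Finset.prod_congr rfl fun k _ => ?_
  simp only [hg, Pi.add_apply, Pi.smul_apply, smul_eq_mul]
  congr 2 <;> ring

/-- An analytic numerator of the normalized form factor near `(θ, θ)`. -/
structure IsNumerator (a : ℝ) (F : ∀ n : ℕ, (Fin n → ℂ) → ℂ) {n : ℕ} (θ : Fin n → ℂ)
    (M : (Fin n → ℂ) × (Fin n → ℂ) → ℂ) : Prop where
  analyticAt : AnalyticAt ℂ M (θ, θ)
  eventually_eq : ∀ᶠ p in 𝓝 (θ, θ), DG a p.1 p.2 → normFF a F n p.1 p.2 *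
    ∏ q ∈ coinc θ, (2 * Complex.sinh ((p.1 q.1 - p.2 q.2) / 2)) = M p

theorem exists_isNumerator (hF : IsFormFactorFamily a F) (hV : Admissible a V) {n : ℕ}
    {θ : Fin n → ℂ} (hθ : ∀ i, θ i ∈ V) : ∃ M, IsNumerator a F θ M := by
  obtain ⟨M, h1, h2⟩ := exists_analytic_mul_sinh hF hV hθ (coinc θ)
    fun i j h => mem_coinc.mpr h
  exact ⟨M, h1, h2⟩

/-- On the hyperplane `ξ_i = θ_i` the numerator is given by the kinematical residue. -/
theorem IsNumerator.eventually_residue (hF : IsFormFactorFamily a F)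
    (ha : Real.sin (Real.pi * a) ≠ 0) {n : ℕ} {θ : Fin (n + 1) → ℂ}
    {M : (Fin (n + 1) → ℂ) × (Fin (n + 1) → ℂ) → ℂ} (hM : IsNumerator a F θ M) (i : Fin (n + 1)) :
    ∀ᶠ p in 𝓝 (θ, θ), p.1 i = p.2 i → DG a (p.1 ∘ i.succAbove) (p.2 ∘ i.succAbove) →
      (∀ k : Fin n, IsReg a (p.2 i - p.2 (i.succAbove k))) →
      (∀ k : Fin n, IsReg a (p.2 i - p.1 (i.succAbove k))) →
      M p = resFactor a i p.1 p.2 * normFF a F n (p.1 ∘ i.succAbove) (p.2 ∘ i.succAbove) *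
        ∏ q ∈ (coinc θ).erase (i, i), (2 * Complex.sinh ((p.1 q.1 - p.2 q.2) / 2)) := by
  filter_upwards [eventually_eventually_nhds.mpr hM.eventually_eq,
    hM.analyticAt.eventually_analyticAt] with p hp hMp hpi hDG hθ hξ
  have hupd : Tendsto (fun z : ℂ => (Function.update p.1 i z, p.2)) (𝓝[≠] (p.2 i)) (𝓝 p) := by
    have h1 : Continuous fun z : ℂ => (Function.update p.1 i z, p.2) := by fun_prop
    have h2 := (h1.tendsto (p.2 i)).mono_left (nhdsWithin_le_nhds (s := {p.2 i}ᶜ))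
    rwa [← hpi, Function.update_eq_self, hpi] at h2
  have hL : Tendsto (fun z : ℂ => M (Function.update p.1 i z, p.2)) (𝓝[≠] (p.2 i)) (𝓝 (M p)) :=
    hMp.continuousAt.tendsto.comp hupd
  have hres := tendsto_residue hF ha i hDG hθ hξ
  have hsin : Tendsto (fun z : ℂ => 2 * Complex.sinh ((z - p.2 i) / 2) / (z - p.2 i))
      (𝓝[≠] (p.2 i)) (𝓝 1) := by
    have h1 := tendsto_two_sinh_half_div (x := 1)
    have h2 : Tendsto (fun z : ℂ => z - p.2 i) (𝓝[≠] (p.2 i)) (𝓝[≠] 0) := by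
      refine tendsto_nhdsWithin_iff.mpr ⟨?_, ?_⟩
      · have : Continuous fun z : ℂ => z - p.2 i := by fun_prop
        simpa using (this.tendsto (p.2 i)).mono_left nhdsWithin_le_nhds
      · filter_upwards [self_mem_nhdsWithin] with z hz
        exact sub_ne_zero.mpr hz
    simpa [Function.comp_def] using h1.comp h2
  have hprod : Tendsto (fun z : ℂ => ∏ q ∈ (coinc θ).erase (i, i),
      (2 * Complex.sinh ((Function.update p.1 i z q.1 - p.2 q.2) / 2))) (𝓝[≠] (p.2 i))
      (𝓝 (∏ q ∈ (coinc θ).erase (i, i), (2 * Complex.sinh ((p.1 q.1 - p.2 q.2) / 2)))) := by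
    refine tendsto_finsetProd _ fun q _ => ?_
    have h1 : Continuous fun x : (Fin (n + 1) → ℂ) × (Fin (n + 1) → ℂ) =>
        2 * Complex.sinh ((x.1 q.1 - x.2 q.2) / 2) := by fun_prop
    have h2 := (h1.tendsto p).comp hupd
    simp only [Function.comp_def] at h2
    exact h2
  have hall := (hres.mul hsin).mul hprod
  rw [mul_one] at hall
  refine tendsto_nhds_unique (hL.congr' ?_) hall
  filter_upwards [hupd.eventually hp, eventually_dg_update ha i hDG hθ hξ, self_mem_nhdsWithin]
    with z hz hdg hne
  have hne' : z - p.2 i ≠ 0 := sub_ne_zero.mpr hne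
  rw [← hz hdg, ← Finset.mul_prod_erase (coinc θ) _ (mem_coinc.mpr rfl : (i, i) ∈ coinc θ)]
  simp only [Function.update_self]
  field_simp

/-- Leading term of the numerator along lines inside the hyperplane `ξ_i = θ_i`. -/
theorem IsNumerator.tendsto_hyperplane (hF : IsFormFactorFamily a F) (hV : Admissible a V) {n : ℕ}
    {θ v w : Fin (n + 1) → ℂ} (hθ : ∀ i, θ i ∈ V)
    {M : (Fin (n + 1) → ℂ) × (Fin (n + 1) → ℂ) → ℂ} (hM : IsNumerator a F θ M) (i : Fin (n + 1))
    (hvi : v i = 0) (hrest : LineGeneric (θ ∘ i.succAbove) (v ∘ i.succAbove) (w ∘ i.succAbove))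
    (hw : ∀ k : Fin n, θ i = θ (i.succAbove k) → w i ≠ w (i.succAbove k) ∧
      w i ≠ v (i.succAbove k) + w (i.succAbove k)) {r : ℂ}
    (hr : Tendsto (fun s : ℂ => normFF a F n
      (θ ∘ i.succAbove + s • (v ∘ i.succAbove + w ∘ i.succAbove))
      (θ ∘ i.succAbove + s • (w ∘ i.succAbove))) (𝓝[≠] 0) (𝓝 r)) :
    Tendsto (fun s : ℂ => M (θ + s • (v + w), θ + s • w) / s ^ (coinc θ).card) (𝓝[≠] 0)
      (𝓝 ((∑ k : Fin n, phi a (θ i - θ (i.succAbove k)) * v (i.succAbove k)) * r *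
        ∏ q ∈ (coinc θ).erase (i, i), (v q.1 + w q.1 - w q.2))) := by
  have h1 := ((tendsto_resFactor_line hV i (v := v) (w := w) hθ).mul hr).mul
    (tendsto_prod_sinh_line (v := v) (w := w) ((coinc θ).erase_subset (i, i)))
  refine h1.congr' ?_
  have hdg := hrest.eventually_dg hV (fun k => hθ _)
  have e1 : ∀ᶠ s : ℂ in 𝓝[≠] 0, ∀ k : Fin n,
      IsReg a (θ i + s * w i - (θ (i.succAbove k) + s * w (i.succAbove k))) :=
    eventually_all.mpr fun k => eventually_isReg_line hV (hθ _) (hθ _) fun he => (hw k he).1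
  have e2 : ∀ᶠ s : ℂ in 𝓝[≠] 0, ∀ k : Fin n, IsReg a (θ i + s * w i -
      (θ (i.succAbove k) + s * (v (i.succAbove k) + w (i.succAbove k)))) :=
    eventually_all.mpr fun k => eventually_isReg_line hV (hθ _) (hθ _) fun he => (hw k he).2
  have e3 := (tendsto_line θ v w).eventually
    (hM.eventually_residue hF (hV.sin_ne_zero (hθ i)) i)
  filter_upwards [hdg, e1, e2, e3, self_mem_nhdsWithin] with s f1 f2 f3 f4 hs
  rw [f4 (by simp [hvi]) f1 f2 f3]
  have hcard : (coinc θ).card = ((coinc θ).erase (i, i)).card + 1 :=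
    (Finset.card_erase_add_one (mem_coinc.mpr rfl)).symm
  have hs' : s ≠ 0 := hs
  rw [hcard, pow_succ]
  have e4 : (θ + s • (v + w)) ∘ i.succAbove =
    θ ∘ i.succAbove + s • (v ∘ i.succAbove + w ∘ i.succAbove) := rfl
  have e5 : (θ + s • w) ∘ i.succAbove = θ ∘ i.succAbove + s • (w ∘ i.succAbove) := rfl
  rw [e4, e5]
  field_simp

/-- The limit of the normalized form factor along a generic line, from the leading term of the
numerator. -/
theorem IsNumerator.tendsto_mul_prod (hV : Admissible a V) {n : ℕ}
    {θ v w : Fin n → ℂ} (hθ : ∀ i, θ i ∈ V)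
    {M : (Fin n → ℂ) × (Fin n → ℂ) → ℂ} (hM : IsNumerator a F θ M) (h : LineGeneric θ v w) {r : ℂ} :
    Tendsto (fun s : ℂ => M (θ + s • (v + w), θ + s • w) / s ^ (coinc θ).card) (𝓝[≠] 0) (𝓝 r) ↔
    Tendsto (fun s : ℂ => normFF a F n (θ + s • (v + w)) (θ + s • w)) (𝓝[≠] 0)
      (𝓝 (r / ∏ q ∈ coinc θ, (v q.1 + w q.1 - w q.2))) := by
  have hP := tendsto_prod_sinh_line (v := v) (w := w) (subset_refl (coinc θ))
  have hP0 : ∏ q ∈ coinc θ, (v q.1 + w q.1 - w q.2) ≠ 0 :=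
    Finset.prod_ne_zero_iff.mpr fun q hq => sub_ne_zero.mpr (h.2 _ _ (mem_coinc.mp hq))
  have hev : ∀ᶠ s : ℂ in 𝓝[≠] 0, M (θ + s • (v + w), θ + s • w) / s ^ (coinc θ).card =
      normFF a F n (θ + s • (v + w)) (θ + s • w) *
      ((∏ q ∈ coinc θ, 2 * Complex.sinh (((θ + s • (v + w)) q.1 - (θ + s • w) q.2) / 2))
        / s ^ (coinc θ).card) := by
    filter_upwards [(tendsto_line θ v w).eventually hM.eventually_eq, h.eventually_dg hV hθ]
      with s h1 h2
    rw [← h1 h2, mul_div_assoc]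
  constructor
  · intro hr
    refine (hr.div hP hP0).congr' ?_
    filter_upwards [hev, hP.eventually_ne hP0] with s h1 h2
    rw [Pi.div_apply, h1, mul_div_cancel_right₀ _ h2]
  · intro hr
    have := hr.mul hP
    rw [div_mul_cancel₀ _ hP0] at this
    exact this.congr' (hev.mono fun s hs => hs.symm)

end

/-! ### Pairwise distinct rapidities -/

section

variable {a : ℝ} {F : ∀ n : ℕ, (Fin n → ℂ) → ℂ} {V : Set ℂ}

theorem PolyOnLines.comp_linear {E E' : Type*} [NormedAddCommGroup E] [NormedSpace ℂ E]
    [NormedAddCommGroup E'] [NormedSpace ℂ E'] {k : ℕ} {Q : E → ℂ} (hQ : PolyOnLines k Q) (L : E' →ₗ[ℂ] E) :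
    PolyOnLines k (fun v => Q (L v)) := by
  intro v u
  obtain ⟨q, hq, hq'⟩ := hQ (L v) (L u)
  exact ⟨q, hq, fun t => by simp [hq' t]⟩

/-- A tuple of pairwise distinct rapidities in `V`. -/
def Distinct (V : Set ℂ) {n : ℕ} (θ : Fin n → ℂ) : Prop :=
  (∀ i, θ i ∈ V) ∧ Function.Injective θ

theorem Distinct.comp {n m : ℕ} {θ : Fin n → ℂ} (h : Distinct V θ) {f : Fin m → Fin n}
    (hf : Function.Injective f) : Distinct V (θ ∘ f) :=
  ⟨fun _ => h.1 _, h.2.comp hf⟩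

theorem prod_coinc {n : ℕ} {θ : Fin n → ℂ} (f : Fin n × Fin n → ℂ) :
    ∏ q ∈ coinc θ, f q = ∏ i, ∏ j, if θ i = θ j then f (i, j) else 1 := by
  rw [coinc, Finset.prod_filter, ← Finset.univ_product_univ, Finset.prod_product]

/-- Splitting off position `i` in a product over coinciding pairs. -/
theorem prod_coinc_erase {n : ℕ} {θ : Fin (n + 1) → ℂ} (i : Fin (n + 1))
    (f : Fin (n + 1) × Fin (n + 1) → ℂ) :
    ∏ q ∈ (coinc θ).erase (i, i), f q =
      (∏ k : Fin n, if θ i = θ (i.succAbove k) then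
        f (i, i.succAbove k) * f (i.succAbove k, i) else 1) *
      ∏ q ∈ coinc (θ ∘ i.succAbove), f (i.succAbove q.1, i.succAbove q.2) := by
  have h1 : ∏ q ∈ (coinc θ).erase (i, i), f q = ∏ q ∈ coinc θ, Function.update f (i, i) 1 q := by
    rw [← Finset.mul_prod_erase (coinc θ) _ (mem_coinc.mpr rfl : (i, i) ∈ coinc θ),
      Function.update_self, one_mul]
    refine Finset.prod_congr rfl fun q hq => ?_
    rw [Function.update_of_ne (Finset.ne_of_mem_erase hq)]
  rw [h1, prod_coinc, prod_coinc, Fin.prod_univ_succAbove _ i]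
  simp_rw [Fin.prod_univ_succAbove _ i]
  simp only [Function.update_self, if_true, one_mul, Finset.prod_mul_distrib, Function.comp_apply]
  rw [← mul_assoc, ← Finset.prod_mul_distrib]
  congr 1
  · refine Finset.prod_congr rfl fun k _ => ?_
    have h2 : ((i, i.succAbove k) : Fin (n + 1) × Fin (n + 1)) ≠ (i, i) := by
      simp [Fin.succAbove_ne]
    have h3 : ((i.succAbove k, i) : Fin (n + 1) × Fin (n + 1)) ≠ (i, i) := by
      simp [Fin.succAbove_ne]
    rw [Function.update_of_ne h2, Function.update_of_ne h3]
    by_cases h : θ i = θ (i.succAbove k)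
    · simp [h]
    · simp [h, Ne.symm h]
  · refine Finset.prod_congr rfl fun k _ => Finset.prod_congr rfl fun l _ => ?_
    rw [Function.update_of_ne (by simp [Fin.succAbove_ne])]

theorem prod_coinc_of_injective {n : ℕ} {θ : Fin n → ℂ} (hθ : Function.Injective θ)
    (f : Fin n × Fin n → ℂ) : ∏ q ∈ coinc θ, f q = ∏ i, f (i, i) := by
  simp [prod_coinc, hθ.eq_iff]

theorem card_coinc_of_injective {n : ℕ} {θ : Fin n → ℂ} (hθ : Function.Injective θ) :
    (coinc θ).card = n := by
  have : coinc θ = Finset.univ.map ⟨fun i => (i, i), fun i j h => (Prod.ext_iff.mp h).1⟩ := by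
    ext ⟨i, j⟩
    rw [Finset.mem_map, mem_coinc]
    constructor
    · exact fun h => ⟨i, Finset.mem_univ _, Prod.ext rfl (hθ h)⟩
    · rintro ⟨k, -, hk⟩
      obtain ⟨rfl, rfl⟩ := Prod.ext_iff.mp hk
      rfl
  rw [this, Finset.card_map, Finset.card_univ, Fintype.card_fin]

theorem prod_coinc_erase_of_injective {n : ℕ} {θ : Fin (n + 1) → ℂ} (hθ : Function.Injective θ)
    (i : Fin (n + 1)) (f : Fin (n + 1) × Fin (n + 1) → ℂ) :
    ∏ q ∈ (coinc θ).erase (i, i), f q = ∏ k, f (i.succAbove k, i.succAbove k) := by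
  rw [prod_coinc_erase, prod_coinc_of_injective (hθ.comp Fin.succAbove_right_injective),
    Finset.prod_eq_one, one_mul]
  intro k _
  rw [if_neg]
  exact fun h => Fin.succAbove_ne i k (hθ h).symm

/-- `P` is the leading form of the diagonal form factor at `θ`: up to terms that vanish as
`η → 0`, the form factor at `(θ + η + iπ, θ)` is `P η / ∏ η_i`. -/
structure HasLead (a : ℝ) (F : ∀ n : ℕ, (Fin n → ℂ) → ℂ) {n : ℕ} (θ : Fin n → ℂ)
    (P : MvPolynomial (Fin n) ℂ) : Prop where
  homogeneous : P.IsHomogeneous n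
  tendsto : ∀ v w : Fin n → ℂ, (∀ i, v i ≠ 0) →
    Tendsto (fun s : ℂ => normFF a F n (θ + s • (v + w)) (θ + s • w)) (𝓝[≠] 0)
      (𝓝 (MvPolynomial.eval v P / ∏ i, v i))

/-- The function of direction vectors whose Taylor forms give the leading terms of a numerator. -/
def lineFun {n : ℕ} (θ : Fin n → ℂ) (M : (Fin n → ℂ) × (Fin n → ℂ) → ℂ)
    (z : (Fin n → ℂ) × (Fin n → ℂ)) : ℂ := M (θ + (z.1 + z.2), θ + z.2)

theorem lineFun_smul {n : ℕ} (θ : Fin n → ℂ) (M : (Fin n → ℂ) × (Fin n → ℂ) → ℂ) (s : ℂ)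
    (v w : Fin n → ℂ) : lineFun θ M (s • (v, w)) = M (θ + s • (v + w), θ + s • w) := by
  simp [lineFun, smul_add]

theorem IsNumerator.analyticAt_lineFun {n : ℕ} {θ : Fin n → ℂ}
    {M : (Fin n → ℂ) × (Fin n → ℂ) → ℂ} (hM : IsNumerator a F θ M) :
    AnalyticAt ℂ (lineFun θ M) 0 := by
  have h1 : AnalyticAt ℂ (fun z : (Fin n → ℂ) × (Fin n → ℂ) => (θ + (z.1 + z.2), θ + z.2)) 0 :=
    (analyticAt_const.add (analyticAt_fst.add analyticAt_snd)).prod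
      (analyticAt_const.add analyticAt_snd)
  exact AnalyticAt.comp (f := fun z : (Fin n → ℂ) × (Fin n → ℂ) => (θ + (z.1 + z.2), θ + z.2))
    (by simpa using hM.analyticAt) h1

/-- The value of the leading term on the hyperplane `v i = 0`. -/
theorem IsNumerator.coeff_hyperplane (hF : IsFormFactorFamily a F) (hV : Admissible a V) {n : ℕ}
    {θ : Fin (n + 1) → ℂ} (hθ : Distinct V θ)
    {M : (Fin (n + 1) → ℂ) × (Fin (n + 1) → ℂ) → ℂ} (hM : IsNumerator a F θ M)
    {p : FormalMultilinearSeries ℂ ((Fin (n + 1) → ℂ) × (Fin (n + 1) → ℂ)) ℂ}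
    (hp : HasFPowerSeriesAt (lineFun θ M) p 0) {i : Fin (n + 1)} {P' : MvPolynomial (Fin n) ℂ}
    (hP' : HasLead a F (θ ∘ i.succAbove) P') {v w : Fin (n + 1) → ℂ} (hvi : v i = 0)
    (hv : ∀ k, v (i.succAbove k) ≠ 0) :
    (∀ k < n + 1, p k (fun _ => (v, w)) = 0) ∧ (p (n + 1) fun _ => (v, w)) =
      (∑ k : Fin n, phi a (θ i - θ (i.succAbove k)) * v (i.succAbove k)) *
        MvPolynomial.eval (v ∘ i.succAbove) P' := by
  have h1 := hM.tendsto_hyperplane hF hV (v := v) (w := w) hθ.1 i hvi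
    (lineGeneric_of_injective (hθ.2.comp Fin.succAbove_right_injective) hv)
    (fun k hk => absurd (hθ.2 hk).symm (Fin.succAbove_ne i k)) (hP'.tendsto _ _ hv)
  rw [card_coinc_of_injective hθ.2, prod_coinc_erase_of_injective hθ.2] at h1
  refine coeff_eq_of_tendsto_div_pow hp (h1.congr (fun s => ?_) |>.trans_eq ?_)
  · rw [lineFun_smul]
  · have h2 : ∏ k, v (i.succAbove k) ≠ 0 := Finset.prod_ne_zero_iff.mpr fun k _ => hv k
    simp only [add_sub_cancel_right, Function.comp_apply]
    rw [mul_assoc, div_mul_cancel₀ _ h2]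

/-- Existence of the leading form: by the kinematical residues all lower Taylor forms of the
numerator vanish, and the leading one depends only on the differences of the rapidities. -/
theorem exists_hasLead (hF : IsFormFactorFamily a F) (hV : Admissible a V) :
    ∀ {n : ℕ} {θ : Fin n → ℂ}, Distinct V θ → ∃ P, HasLead a F θ P := by
  intro n
  induction n with
  | zero =>
    intro θ _
    refine ⟨MvPolynomial.C (normFF a F 0 θ θ), MvPolynomial.isHomogeneous_C _ _, ?_⟩
    intro v w _
    have h1 : ∀ s : ℂ, normFF a F 0 (θ + s • (v + w)) (θ + s • w) = normFF a F 0 θ θ := fun s => by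
      congr 1 <;> exact Subsingleton.elim _ _
    simp only [h1, MvPolynomial.eval_C, Finset.univ_eq_empty, Finset.prod_empty, div_one]
    exact tendsto_const_nhds
  | succ n ih =>
    intro θ hθ
    obtain ⟨M, hM⟩ := exists_isNumerator hF hV hθ.1
    obtain ⟨p, hp⟩ := hM.analyticAt_lineFun
    choose P' hP' using fun i : Fin (n + 1) =>
      ih (hθ.comp (f := i.succAbove) Fin.succAbove_right_injective)
    have hyp := fun i v w (hvi : v i = 0) hv =>
      hM.coeff_hyperplane hF hV hθ hp (hP' i) (v := v) (w := w) hvi hv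
    -- the forms of degree at most `n` vanish on `n + 1` hyperplanes
    have hlow : ∀ k < n + 1, ∀ z, p k (fun _ => z) = 0 := by
      intro k hk z
      refine (polyOnLines_multilinear (p k)).eq_zero (ι := Fin (n + 1))
        (fun i => (LinearMap.proj i).comp (LinearMap.fst ℂ (Fin (n + 1) → ℂ) (Fin (n + 1) → ℂ)))
        (fun i => ⟨(Pi.single i 1, 0), by simp⟩)
        (fun i j hij => ⟨(Pi.single j 1, 0), by simp [hij], by simp⟩) Finset.univ (by simpa using Nat.lt_succ_iff.mp hk) ?_ z
      rintro j - ⟨v, w⟩ hj hne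
      exact (hyp j v w hj fun k => hne _ (Fin.succAbove_ne j k)).1 _ hk
    -- the difference of the leading form at `(v, w)` and `(v, 0)` vanishes on `n + 2` hyperplanes
    have hindep : ∀ v w, (p (n + 1) fun _ => (v, w)) = p (n + 1) fun _ => (v, 0) := by
      intro v w
      set L₁ : (Fin (n + 1) → ℂ) × ℂ →ₗ[ℂ] (Fin (n + 1) → ℂ) × (Fin (n + 1) → ℂ) :=
        LinearMap.prodMap LinearMap.id (LinearMap.toSpanSingleton ℂ _ w) with hL₁
      set L₂ : (Fin (n + 1) → ℂ) × ℂ →ₗ[ℂ] (Fin (n + 1) → ℂ) × (Fin (n + 1) → ℂ) :=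
        LinearMap.prodMap LinearMap.id 0 with hL₂
      have hQ := ((polyOnLines_multilinear (p (n + 1))).comp_linear L₁).sub
        ((polyOnLines_multilinear (p (n + 1))).comp_linear L₂)
      have := hQ.eq_zero (ι := Option (Fin (n + 1)))
        (fun o => o.elim (LinearMap.snd ℂ (Fin (n + 1) → ℂ) ℂ)
          fun i => (LinearMap.proj i).comp (LinearMap.fst ℂ (Fin (n + 1) → ℂ) ℂ))
        (by
          rintro (_ | i)
          · exact ⟨(0, 1), by simp⟩
          · exact ⟨(Pi.single i 1, 0), by simp⟩)
        (by
          rintro (_ | i) (_ | j) hij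
          · exact absurd rfl hij
          · exact ⟨(Pi.single j 1, 0), by simp, by simp⟩
          · exact ⟨(0, 1), by simp, by simp⟩
          · have : i ≠ j := fun h => hij (by rw [h])
            exact ⟨(Pi.single j 1, 0), by simp [this], by simp⟩) Finset.univ (by simp)
        (by
          rintro (_ | j) - ⟨v', t⟩ hj hne
          · have ht : t = 0 := by simpa using hj
            simp [hL₁, hL₂, ht]
          · have h1 : v' j = 0 := by simpa using hj
            have h2 : ∀ k, v' (j.succAbove k) ≠ 0 := fun k => by
              simpa using hne (some (j.succAbove k)) (by simp [Fin.succAbove_ne])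
            simp only [hL₁, hL₂, LinearMap.prodMap_apply, LinearMap.id_apply]
            rw [(hyp j v' _ h1 h2).2, (hyp j v' _ h1 h2).2, sub_self]) (v, 1)
      simpa [hL₁, hL₂, sub_eq_zero] using this
    refine ⟨diagPoly ((p (n + 1)).compContinuousLinearMap fun _ =>
      ContinuousLinearMap.inl ℂ (Fin (n + 1) → ℂ) (Fin (n + 1) → ℂ)),
      isHomogeneous_diagPoly _, fun v w hv => ?_⟩
    have h1 := tendsto_div_pow_of_coeff_eq_zero hp (N := n + 1) (v := (v, w))
      fun k hk => hlow k hk _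
    have h2 := (hM.tendsto_mul_prod hV hθ.1 (lineGeneric_of_injective hθ.2 hv)
      (r := p (n + 1) fun _ => (v, w)) (w := w)).mp (by
        rw [card_coinc_of_injective hθ.2]
        simpa only [lineFun_smul] using h1)
    rw [prod_coinc_of_injective hθ.2] at h2
    simp only [add_sub_cancel_right] at h2
    rw [eval_diagPoly]
    simpa [hindep v w] using h2

theorem dense_forall_ne_zero (n : ℕ) : Dense {v : Fin n → ℂ | ∀ i, v i ≠ 0} := by
  have h := dense_pi (Set.univ : Set (Fin n)) (fun i _ => dense_compl_singleton (0 : ℂ))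
  convert h using 1
  ext v
  simp [Set.mem_pi]

/-- The kinematical residue axiom for the leading forms. -/
theorem HasLead.eval_eq (hF : IsFormFactorFamily a F) (hV : Admissible a V) {n : ℕ}
    {θ : Fin (n + 1) → ℂ} (hθ : Distinct V θ) {P : MvPolynomial (Fin (n + 1)) ℂ}
    (hP : HasLead a F θ P) {i : Fin (n + 1)} {P' : MvPolynomial (Fin n) ℂ}
    (hP' : HasLead a F (θ ∘ i.succAbove) P') {v : Fin (n + 1) → ℂ} (hvi : v i = 0) :
    MvPolynomial.eval v P =
      (∑ k : Fin n, phi a (θ i - θ (i.succAbove k)) * v (i.succAbove k)) *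
        MvPolynomial.eval (v ∘ i.succAbove) P' := by
  obtain ⟨M, hM⟩ := exists_isNumerator hF hV hθ.1
  obtain ⟨p, hp⟩ := hM.analyticAt_lineFun
  have hcont : Continuous fun v : Fin (n + 1) → ℂ => p (n + 1) fun _ => (v, 0) :=
    (p (n + 1)).cont.comp (by fun_prop)
  have h1 : ∀ v : Fin (n + 1) → ℂ, (p (n + 1) fun _ => (v, 0)) = MvPolynomial.eval v P := by
    refine fun v => congrFun (Continuous.ext_on (dense_forall_ne_zero (n + 1)) hcont
      (MvPolynomial.continuous_eval P) fun v hv => ?_) v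
    have h2 := (hM.tendsto_mul_prod hV hθ.1 (lineGeneric_of_injective hθ.2 hv)
      (r := MvPolynomial.eval v P) (w := 0)).mpr (by
        rw [prod_coinc_of_injective hθ.2]
        simpa using hP.tendsto v 0 hv)
    rw [card_coinc_of_injective hθ.2] at h2
    exact (coeff_eq_of_tendsto_div_pow hp (by simpa only [lineFun_smul] using h2)).2
  -- both sides are continuous in the remaining variables
  have h2 : (fun u : Fin n → ℂ => p (n + 1) fun _ => (i.insertNth 0 u, 0)) = fun u =>
      (∑ k : Fin n, phi a (θ i - θ (i.succAbove k)) * u k) * MvPolynomial.eval u P' := by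
    refine Continuous.ext_on (dense_forall_ne_zero n) ?_ ?_ fun u hu => ?_
    · exact hcont.comp (by fun_prop)
    · exact Continuous.mul (by fun_prop) (MvPolynomial.continuous_eval P')
    · have := (hM.coeff_hyperplane hF hV hθ hp hP' (v := i.insertNth 0 u) (w := 0) (by simp)
        (by simpa using hu)).2
      simpa [Function.comp_def] using this
  have h3 := congrFun h2 (v ∘ i.succAbove)
  have h4 : (i.insertNth 0 (v ∘ i.succAbove) : Fin (n + 1) → ℂ) = v := by
    rw [← hvi]
    exact Fin.insertNth_self_removeNth i v
  simp only [h4, h1] at h3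
  exact h3

theorem HasLead.comp_perm (hF : IsFormFactorFamily a F) (hV : Admissible a V) {n : ℕ}
    {θ : Fin n → ℂ} (hθ : Distinct V θ) {P : MvPolynomial (Fin n) ℂ}
    (hP : HasLead a F θ P) (σ : Equiv.Perm (Fin n)) :
    HasLead a F (θ ∘ σ) (MvPolynomial.rename σ.symm P) := by
  refine ⟨hP.homogeneous.rename_isHomogeneous, fun v w hv => ?_⟩
  have h1 := hP.tendsto (v ∘ σ.symm) (w ∘ σ.symm) fun i => hv _
  rw [MvPolynomial.eval_rename]
  have h2 : ∏ i, (v ∘ σ.symm) i = ∏ i, v i := Equiv.prod_comp σ.symm v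
  rw [h2] at h1
  refine h1.congr' ?_
  have hlg : LineGeneric θ (v ∘ σ.symm) (w ∘ σ.symm) := lineGeneric_of_injective hθ.2 fun i => hv _
  filter_upwards [hlg.eventually_dg hV hθ.1] with s hs
  rw [← normFF_comp_same hF hs σ]
  congr 1 <;> ext i <;> simp

end

/-! ### The connected form factor as a coefficient of the leading form -/

section

variable {a : ℝ} {F : ∀ n : ℕ, (Fin n → ℂ) → ℂ} {V : Set ℂ}

/-- The finite part does not depend on the choice of the numerator: two of them agree off the
coordinate hyperplanes, hence everywhere near `0`. -/
theorem IsFinitePart.unique {n : ℕ} {f : (Fin n → ℂ) → ℂ} {c c' : ℂ} (h : IsFinitePart f c)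
    (h' : IsFinitePart f c') : c = c' := by
  obtain ⟨G, hG, hfG, rfl⟩ := h
  obtain ⟨G', hG', hfG', rfl⟩ := h'
  have h1 : ∀ᶠ η in 𝓝 (0 : Fin n → ℂ), (∀ i, η i ≠ 0) → G η = G' η := by
    filter_upwards [hfG, hfG'] with η h1 h2 h
    rw [← h1 h, ← h2 h]
  have h2 : G =ᶠ[𝓝 0] G' := by
    filter_upwards [hG.eventually_analyticAt, hG'.eventually_analyticAt,
      eventually_eventually_nhds.mpr h1] with η e1 e2 e3
    have hne : (𝓝[{v : Fin n → ℂ | ∀ i, v i ≠ 0}] η).NeBot :=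
      mem_closure_iff_nhdsWithin_neBot.mp (dense_forall_ne_zero n η)
    have e4 := e1.continuousAt.tendsto.mono_left
      (nhdsWithin_le_nhds (s := {v : Fin n → ℂ | ∀ i, v i ≠ 0}))
    have e5 := e2.continuousAt.tendsto.mono_left
      (nhdsWithin_le_nhds (s := {v : Fin n → ℂ | ∀ i, v i ≠ 0}))
    refine tendsto_nhds_unique (e4.congr' ?_) e5
    filter_upwards [nhdsWithin_le_nhds e3, self_mem_nhdsWithin] with v h1 h2
    exact h1 h2
  rw [(h2.iteratedFDeriv ℂ n).eq_of_nhds]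

theorem IsFinitePart.finitePart_eq {n : ℕ} {f : (Fin n → ℂ) → ℂ} {c : ℂ} (h : IsFinitePart f c) :
    finitePart f = c := by
  have h1 : ∃ c, IsFinitePart f c := ⟨c, h⟩
  rw [finitePart, dif_pos h1]
  exact h1.choose_spec.unique h

/-- The mixed derivative in the first block of variables. -/
theorem iteratedFDeriv_fst_eq {E E' : Type*} [NormedAddCommGroup E] [NormedSpace ℂ E]
    [NormedAddCommGroup E'] [NormedSpace ℂ E'] {G : E × E' → ℂ} {y : E'}
    (hG : AnalyticAt ℂ G (0, y)) (n : ℕ) (e : Fin n → E) :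
    iteratedFDeriv ℂ n (fun x => G (x, y)) 0 e =
      iteratedFDeriv ℂ n G (0, y) (fun i => (e i, 0)) := by
  obtain ⟨p, r, hp⟩ := hG
  have h1 : HasFPowerSeriesOnBall (fun z => G (z - (0, -y))) p 0 r := by
    have h0 := hp.comp_sub (0, -y)
    rwa [show ((0 : E), y) + (0, -y) = 0 by simp] at h0
  have h2 := h1.compContinuousLinearMap (u := ContinuousLinearMap.inl ℂ E E') (x := 0)
  have h3 : ((fun z => G (z - (0, -y))) ∘ ContinuousLinearMap.inl ℂ E E') = fun x => G (x, y) := by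
    ext x
    simp
  rw [h3] at h2
  rw [h2.iteratedFDeriv_eq_sum_of_completeSpace, hp.iteratedFDeriv_eq_sum_of_completeSpace]
  rfl

/-- The factors `2 sinh (x / 2)` in the numerators may be traded for `x`. -/
theorem two_sinh_half_eq_mul : ∃ h : ℂ → ℂ, AnalyticAt ℂ h 0 ∧ h 0 ≠ 0 ∧
    ∀ᶠ x in 𝓝 (0 : ℂ), 2 * Complex.sinh (x / 2) = x * h x := by
  have h1 : AnalyticAt ℂ (fun x : ℂ => 2 * Complex.sinh (x / 2)) 0 := by
    have : Differentiable ℂ (fun x : ℂ => 2 * Complex.sinh (x / 2)) := by fun_prop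
    exact this.analyticAt 0
  obtain ⟨p, hp⟩ := h1
  refine ⟨dslope (fun x : ℂ => 2 * Complex.sinh (x / 2)) 0, ⟨_, hp.has_fpower_series_dslope_fslope⟩,
    ?_, Eventually.of_forall fun x => ?_⟩
  · have h2 : HasDerivAt (fun x : ℂ => 2 * Complex.sinh (x / 2))
        (2 * (Complex.cosh (0 / 2) * (1 / 2))) 0 :=
      (((hasDerivAt_id (0 : ℂ)).div_const 2).csinh).const_mul 2
    rw [dslope_same, h2.deriv]
    simp
  · have := sub_smul_dslope (fun x : ℂ => 2 * Complex.sinh (x / 2)) 0 x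
    simpa using this.symm

/-- Near pairwise distinct rapidities the form factor has a numerator that is jointly analytic in
the regulators and the rapidities. -/
theorem exists_joint_numerator (hF : IsFormFactorFamily a F) (hV : Admissible a V) {n : ℕ}
    {θ : Fin n → ℂ} (hθ : Distinct V θ) :
    ∃ G : (Fin n → ℂ) × (Fin n → ℂ) → ℂ, AnalyticAt ℂ G (0, θ) ∧
      ∀ᶠ q in 𝓝 ((0 : Fin n → ℂ), θ), (∀ i, q.1 i ≠ 0) →
        F (n + n) (diagConfig q.2 q.1) * ∏ i, q.1 i = G q := by
  obtain ⟨M, hM⟩ := exists_isNumerator hF hV hθ.1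
  obtain ⟨h, hh, hh0, hsh⟩ := two_sinh_half_eq_mul
  set c : (Fin n → ℂ) × (Fin n → ℂ) → (Fin n → ℂ) × (Fin n → ℂ) :=
    fun q => (q.2 + q.1, q.2) with hc
  have hcc : AnalyticAt ℂ c (0, θ) := (analyticAt_snd.add analyticAt_fst).prod analyticAt_snd
  have hc0 : c (0, θ) = (θ, θ) := by simp [hc]
  have hR : AnalyticAt ℂ (fun q => normRatio a (c q).1 (c q).2) (0, θ) := by
    have := analyticAt_normRatio hV hθ.1
    rw [← hc0] at this
    exact this.comp hcc
  have hR0 : normRatio a (c (0, θ)).1 (c (0, θ)).2 ≠ 0 := by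
    rw [hc0, normRatio_self (prod_tau_ne_zero hV hθ.1)]
    exact one_ne_zero
  have hP : AnalyticAt ℂ (fun q : (Fin n → ℂ) × (Fin n → ℂ) => ∏ i, h (q.1 i)) (0, θ) :=
    Finset.analyticAt_fun_prod _ fun i _ =>
      AnalyticAt.comp (f := fun q : (Fin n → ℂ) × (Fin n → ℂ) => q.1 i) hh
        (analyticAt_fst_apply i _)
  have hP0 : ∏ i, h ((0 : Fin n → ℂ) i) ≠ 0 := Finset.prod_ne_zero_iff.mpr fun i _ => hh0
  have hMc : AnalyticAt ℂ (fun q => M (c q)) (0, θ) := by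
    have := hM.analyticAt
    rw [← hc0] at this
    exact this.comp hcc
  refine ⟨fun q => M (c q) / ((∏ i, h (q.1 i)) * normRatio a (c q).1 (c q).2),
    hMc.div (hP.mul hR) (mul_ne_zero hP0 hR0), ?_⟩
  have hcont := hcc.continuousAt
  rw [ContinuousAt, hc0] at hcont
  have e1 : ∀ᶠ q in 𝓝 ((0 : Fin n → ℂ), θ), (∀ i, q.1 i ≠ 0) → DG a (c q).1 (c q).2 := by
    have f1 : ∀ᶠ q in 𝓝 ((0 : Fin n → ℂ), θ), ∀ i j, i ≠ j →
        IsReg a ((c q).1 i - (c q).1 j) ∧ IsReg a ((c q).2 i - (c q).2 j) ∧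
        IsReg a ((c q).1 i - (c q).2 j) := by
      refine eventually_all.mpr fun i => eventually_all.mpr fun j => ?_
      by_cases hij : i = j
      · simp [hij]
      · have hreg := hV.isReg (hθ.1 i) (hθ.1 j) fun h => hij (hθ.2 h)
        have g1 := IsReg.eventually (a := a) (x := ((0 : Fin n → ℂ), θ))
          (f := fun q => (c q).1 i - (c q).1 j) (by simpa [hc] using hreg) (by fun_prop)
        have g2 := IsReg.eventually (a := a) (x := ((0 : Fin n → ℂ), θ))
          (f := fun q => (c q).2 i - (c q).2 j) (by simpa [hc] using hreg) (by fun_prop)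
        have g3 := IsReg.eventually (a := a) (x := ((0 : Fin n → ℂ), θ))
          (f := fun q => (c q).1 i - (c q).2 j) (by simpa [hc] using hreg) (by fun_prop)
        filter_upwards [g1, g2, g3] with q h1 h2 h3 _
        exact ⟨h1, h2, h3⟩
    have f2 : ∀ᶠ q in 𝓝 ((0 : Fin n → ℂ), θ), ∀ i, q.1 i ≠ 0 → IsReg a (q.1 i) := by
      refine eventually_all.mpr fun i => ?_
      have g1 := eventually_nhdsWithin_iff.mp
        (eventually_isReg_sub (hV.sin_ne_zero (hθ.1 i)) 0)
      have g2 : Tendsto (fun q : (Fin n → ℂ) × (Fin n → ℂ) => q.1 i) (𝓝 (0, θ)) (𝓝 0) := by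
        have : Continuous fun q : (Fin n → ℂ) × (Fin n → ℂ) => q.1 i := by fun_prop
        simpa using this.tendsto (0, θ)
      filter_upwards [g2.eventually g1] with q hq hi
      simpa using hq hi
    filter_upwards [f1, f2] with q h1 h2 hq
    refine ⟨generic_iff.mpr fun i j hij => (h1 i j hij).1,
      generic_iff.mpr fun i j hij => (h1 i j hij).2.1, fun i j => ?_⟩
    by_cases hij : i = j
    · subst hij
      simpa [hc] using h2 i (hq i)
    · exact (h1 i j hij).2.2
  have e2 : ∀ᶠ q in 𝓝 ((0 : Fin n → ℂ), θ), ∀ i,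
      2 * Complex.sinh (q.1 i / 2) = q.1 i * h (q.1 i) := by
    refine eventually_all.mpr fun i => ?_
    have g2 : Tendsto (fun q : (Fin n → ℂ) × (Fin n → ℂ) => q.1 i) (𝓝 (0, θ)) (𝓝 0) := by
      have : Continuous fun q : (Fin n → ℂ) × (Fin n → ℂ) => q.1 i := by fun_prop
      simpa using this.tendsto (0, θ)
    exact g2.eventually hsh
  filter_upwards [hcont.eventually hM.eventually_eq, e1, e2, hR.continuousAt.eventually_ne hR0,
    hP.continuousAt.eventually_ne hP0] with q h1 h2 h3 h4 h5 hq
  rw [← h1 (h2 hq), prod_coinc_of_injective hθ.2, normFF_eq, eq_div_iff (mul_ne_zero h5 h4)]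
  have h6 : crossed (c q).1 (c q).2 = diagConfig q.2 q.1 := by
    simp only [crossed, diagConfig, hc]
    congr 1
    ext i
    simp only [Pi.add_apply]
    ring
  have h7 : ∏ i, 2 * Complex.sinh (((c q).1 i - (c q).2 i) / 2) =
      (∏ i, q.1 i) * ∏ i, h (q.1 i) := by
    rw [← Finset.prod_mul_distrib]
    refine Finset.prod_congr rfl fun i _ => ?_
    rw [← h3 i]
    simp [hc]
  rw [h6, h7]
  ring

/-- The finite part is a derivative at `η = 0` of the joint numerator, hence analytic in the
rapidities. -/
theorem analyticAt_finitePart (hF : IsFormFactorFamily a F) (hV : Admissible a V) {n : ℕ}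
    {θ : Fin n → ℂ} (hθ : Distinct V θ) :
    AnalyticAt ℂ (fun θ' => finitePart fun η => F (n + n) (diagConfig θ' η)) θ ∧
      ∃ c, IsFinitePart (fun η => F (n + n) (diagConfig θ η)) c := by
  obtain ⟨G, hG, hFG⟩ := exists_joint_numerator hF hV hθ
  set A : (Fin n → ℂ) → ℂ := fun θ' =>
    iteratedFDeriv ℂ n G (0, θ') fun i => (Pi.single i 1, 0) with hA
  have hcont : Tendsto (fun θ' : Fin n → ℂ => ((0 : Fin n → ℂ), θ')) (𝓝 θ) (𝓝 (0, θ)) := by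
    have : Continuous fun θ' : Fin n → ℂ => ((0 : Fin n → ℂ), θ') := by fun_prop
    exact this.tendsto θ
  have hfin : ∀ᶠ θ' in 𝓝 θ, IsFinitePart (fun η => F (n + n) (diagConfig θ' η)) (A θ') := by
    filter_upwards [hcont.eventually hG.eventually_analyticAt,
      hcont.eventually (eventually_eventually_nhds.mpr hFG)] with θ' h1 h2
    refine ⟨fun η => G (η, θ'), ?_, ?_, ?_⟩
    · exact AnalyticAt.comp (f := fun η : Fin n → ℂ => (η, θ')) h1
        (analyticAt_id.prod analyticAt_const)
    · have h3 : Tendsto (fun η : Fin n → ℂ => (η, θ')) (𝓝 0) (𝓝 (0, θ')) := by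
        have : Continuous fun η : Fin n → ℂ => (η, θ') := by fun_prop
        exact this.tendsto 0
      exact h3.eventually h2
    · rw [iteratedFDeriv_fst_eq h1]
  refine ⟨?_, _, hfin.self_of_nhds⟩
  have hAan : AnalyticAt ℂ A θ := by
    have h1 : AnalyticAt ℂ (iteratedFDeriv ℂ n G) (0, θ) :=
      AnalyticOnNhd.iteratedFDeriv (s := {x | AnalyticAt ℂ G x}) (fun x hx => hx) n _ hG
    have h2 : AnalyticAt ℂ (fun θ' : Fin n → ℂ => iteratedFDeriv ℂ n G (0, θ')) θ :=
      AnalyticAt.comp (f := fun θ' : Fin n → ℂ => ((0 : Fin n → ℂ), θ')) h1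
        (analyticAt_const.prod analyticAt_id)
    exact ((ContinuousMultilinearMap.apply ℂ (fun _ : Fin n => (Fin n → ℂ) × (Fin n → ℂ)) ℂ
      fun i => (Pi.single i 1, 0)).analyticAt _).comp h2
  refine hAan.congr ?_
  filter_upwards [hfin] with θ' h
  exact h.finitePart_eq.symm

theorem Distinct.generic (hV : Admissible a V) {n : ℕ} {θ : Fin n → ℂ} (hθ : Distinct V θ) :
    Generic a θ :=
  generic_iff.mpr fun _ _ hij => hV.isReg (hθ.1 _) (hθ.1 _) fun h => hij (hθ.2 h)

theorem Generic.eventually {n : ℕ} {θ : Fin n → ℂ} (h : Generic a θ) :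
    ∀ᶠ θ' in 𝓝 θ, Generic a θ' := by
  simp only [generic_iff] at h ⊢
  refine eventually_all.mpr fun i => eventually_all.mpr fun j => ?_
  by_cases hij : i = j
  · simp [hij]
  · filter_upwards [(h i j hij).eventually (f := fun θ' : Fin n → ℂ => θ' i - θ' j)
      (by fun_prop)] with θ' h1 _
    exact h1

/-- At pairwise distinct rapidities the extension by continuity in the definition of the connected
form factor is not needed. -/
theorem connectedFF_eventuallyEq (hF : IsFormFactorFamily a F) (hV : Admissible a V) {n : ℕ}
    {θ : Fin n → ℂ} (hθ : Distinct V θ) :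
    connectedFF a F n =ᶠ[𝓝 θ] fun θ' => finitePart fun η => F (n + n) (diagConfig θ' η) := by
  filter_upwards [(analyticAt_finitePart hF hV hθ).1.eventually_analyticAt,
    (hθ.generic hV).eventually] with θ' h1 h2
  have hne : (𝓝[{θ'' : Fin n → ℂ | Generic a θ''}] θ').NeBot :=
    mem_closure_iff_nhdsWithin_neBot.mp (subset_closure h2)
  exact Tendsto.limUnder_eq (h1.continuousAt.tendsto.mono_left nhdsWithin_le_nhds)

theorem analyticAt_connectedFF (hF : IsFormFactorFamily a F) (hV : Admissible a V) {n : ℕ}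
    {θ : Fin n → ℂ} (hθ : Distinct V θ) : AnalyticAt ℂ (connectedFF a F n) θ :=
  (analyticAt_finitePart hF hV hθ).1.congr (connectedFF_eventuallyEq hF hV hθ).symm

/-- The connected form factor is the multilinear coefficient of the leading form. -/
theorem HasLead.connectedFF_eq (hF : IsFormFactorFamily a F) (hV : Admissible a V) {n : ℕ}
    {θ : Fin n → ℂ} (hθ : Distinct V θ) {P : MvPolynomial (Fin n) ℂ} (hP : HasLead a F θ P) :
    connectedFF a F n θ = P.coeff (ones n) := by
  obtain ⟨c, hc⟩ := (analyticAt_finitePart hF hV hθ).2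
  rw [(connectedFF_eventuallyEq hF hV hθ).self_of_nhds]
  refine hc.finitePart_eq.trans ?_
  obtain ⟨G, ⟨p, hp⟩, hFG, rfl⟩ := hc
  refine iteratedFDeriv_eq_coeff hp fun v hv => ?_
  refine (coeff_eq_of_tendsto_div_pow hp ?_).2
  have h0 : ∏ i, v i ≠ 0 := Finset.prod_ne_zero_iff.mpr fun i _ => hv i
  have h1 := (hP.tendsto v 0 hv).mul_const (∏ i, v i)
  rw [div_mul_cancel₀ _ h0] at h1
  have hline := tendsto_line θ v 0
  have h2 : Tendsto (fun s : ℂ => normRatio a (θ + s • (v + 0)) (θ + s • (0 : Fin n → ℂ))) (𝓝[≠] 0)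
      (𝓝 1) := by
    have := (analyticAt_normRatio hV hθ.1).continuousAt.tendsto.comp hline
    simp only [normRatio_self (prod_tau_ne_zero hV hθ.1)] at this
    exact this
  have h3 := h1.div h2 one_ne_zero
  rw [div_one] at h3
  refine h3.congr' ?_
  have h4 : Tendsto (fun s : ℂ => s • v) (𝓝[≠] 0) (𝓝 0) := by
    have : Continuous fun s : ℂ => s • v := by fun_prop
    simpa using (this.tendsto 0).mono_left nhdsWithin_le_nhds
  filter_upwards [h4.eventually hFG, h2.eventually_ne one_ne_zero, self_mem_nhdsWithin]
    with s e1 e2 hs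
  have hs' : s ≠ 0 := hs
  have e3 : crossed (θ + s • (v + 0)) (θ + s • (0 : Fin n → ℂ)) = diagConfig θ (s • v) := by
    simp only [crossed, diagConfig, smul_zero, add_zero]
    congr 1
    ext i
    simp only [Pi.add_apply]
    ring
  rw [← e1 fun i => by simpa using ⟨hs', hv i⟩, Pi.div_apply, normFF_eq, e3]
  simp only [Pi.smul_apply, smul_eq_mul, Finset.prod_mul_distrib, Finset.prod_const,
    Finset.card_univ, Fintype.card_fin]
  field_simp

theorem connectedFF_comp_perm (hF : IsFormFactorFamily a F) (hV : Admissible a V) {n : ℕ}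
    {θ : Fin n → ℂ} (hθ : Distinct V θ) (σ : Equiv.Perm (Fin n)) :
    connectedFF a F n (θ ∘ σ) = connectedFF a F n θ := by
  obtain ⟨P, hP⟩ := exists_hasLead hF hV hθ
  rw [hP.connectedFF_eq hF hV hθ,
    (hP.comp_perm hF hV hθ σ).connectedFF_eq hF hV (hθ.comp σ.injective),
    ← MvPolynomial.coeff_rename_mapDomain σ.symm σ.symm.injective P (ones n)]
  congr 1
  ext i
  simp [Finsupp.mapDomain_equiv_apply]

end

/-! ### Two coinciding rapidities -/

section

variable {a : ℝ} {F : ∀ n : ℕ, (Fin n → ℂ) → ℂ} {V : Set ℂ}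

/-- The tuple `(c, c, B)`. -/
def dbl {n : ℕ} (c : ℂ) (B : Fin n → ℂ) : Fin (n + 2) → ℂ :=
  Fin.cons c (Fin.cons c B : Fin (n + 1) → ℂ)

section
variable {n : ℕ} {c : ℂ} {B : Fin n → ℂ}

@[simp] theorem dbl_zero : dbl c B 0 = c := rfl
@[simp] theorem dbl_one : dbl c B 1 = c := rfl
@[simp] theorem dbl_succ_succ (j : Fin n) : dbl c B j.succ.succ = B j := rfl

theorem dbl_succAbove_zero : dbl c B ∘ (0 : Fin (n + 2)).succAbove = Fin.cons c B := by
  ext k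
  simp [dbl]

theorem dbl_succAbove_one : dbl c B ∘ (1 : Fin (n + 2)).succAbove = Fin.cons c B := by
  ext k
  refine Fin.cases ?_ (fun k => ?_) k
  · simp
  · simp [dbl]

theorem cons_comp_succAbove {α : Type*} {m : ℕ} (x : α) (f : Fin (m + 1) → α) (j : Fin (m + 1)) :
    (Fin.cons x f : Fin (m + 2) → α) ∘ j.succ.succAbove =
      (Fin.cons x (f ∘ j.succAbove) : Fin (m + 1) → α) := by
  ext k
  refine Fin.cases ?_ (fun k => ?_) k
  · simp
  · simp

theorem dbl_succAbove {m : ℕ} {B : Fin (m + 1) → ℂ} (j : Fin (m + 1)) :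
    dbl c B ∘ j.succ.succ.succAbove = dbl c (B ∘ j.succAbove) := by
  rw [dbl, cons_comp_succAbove, cons_comp_succAbove, dbl]

theorem dbl_mem (h : Distinct V (Fin.cons c B : Fin (n + 1) → ℂ)) (i : Fin (n + 2)) :
    dbl c B i ∈ V := by
  refine Fin.cases ?_ (fun i => ?_) i
  · exact h.1 0
  · exact h.1 i

theorem Distinct.ne_head (h : Distinct V (Fin.cons c B : Fin (n + 1) → ℂ)) (j : Fin n) :
    c ≠ B j := fun h' => by
  have := @h.2 0 j.succ (by simpa using h')
  exact absurd this (Fin.succ_ne_zero j).symm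

theorem Distinct.tail (h : Distinct V (Fin.cons c B : Fin (n + 1) → ℂ)) : Distinct V B := by
  have := h.comp (f := Fin.succ) (Fin.succ_injective n)
  simpa [Function.comp_def] using this

theorem prod_coinc_dbl_erase_zero (h : Distinct V (Fin.cons c B : Fin (n + 1) → ℂ))
    (f : Fin (n + 2) × Fin (n + 2) → ℂ) :
    ∏ q ∈ (coinc (dbl c B)).erase (0, 0), f q =
      f (0, 1) * f (1, 0) * (f (1, 1) * ∏ j : Fin n, f (j.succ.succ, j.succ.succ)) := by
  rw [prod_coinc_erase, dbl_succAbove_zero, prod_coinc_of_injective h.2, Fin.prod_univ_succ,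
    Fin.prod_univ_succ]
  simp [h.ne_head]

theorem prod_coinc_dbl_erase_one (h : Distinct V (Fin.cons c B : Fin (n + 1) → ℂ))
    (f : Fin (n + 2) × Fin (n + 2) → ℂ) :
    ∏ q ∈ (coinc (dbl c B)).erase (1, 1), f q =
      f (1, 0) * f (0, 1) * (f (0, 0) * ∏ j : Fin n, f (j.succ.succ, j.succ.succ)) := by
  rw [prod_coinc_erase, dbl_succAbove_one, prod_coinc_of_injective h.2, Fin.prod_univ_succ,
    Fin.prod_univ_succ]
  simp [h.ne_head]

theorem prod_coinc_dbl (h : Distinct V (Fin.cons c B : Fin (n + 1) → ℂ))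
    (f : Fin (n + 2) × Fin (n + 2) → ℂ) :
    ∏ q ∈ coinc (dbl c B), f q =
      f (0, 0) * f (1, 1) * f (0, 1) * f (1, 0) * ∏ j : Fin n, f (j.succ.succ, j.succ.succ) := by
  rw [← Finset.mul_prod_erase _ _ (mem_coinc.mpr rfl : ((0 : Fin (n + 2)), (0 : Fin (n + 2))) ∈ _),
    prod_coinc_dbl_erase_zero h]
  ring

theorem card_coinc_dbl (h : Distinct V (Fin.cons c B : Fin (n + 1) → ℂ)) :
    (coinc (dbl c B)).card = n + 4 := by
  have h1 := prod_coinc_dbl h fun _ => 2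
  simp only [Finset.prod_const, Finset.card_univ, Fintype.card_fin] at h1
  have h2 : (2 : ℂ) ^ (coinc (dbl c B)).card = 2 ^ (n + 4) := by rw [h1]; ring
  exact Nat.pow_right_injective le_rfl (by exact_mod_cast h2)

theorem lineGeneric_dbl (h : Distinct V (Fin.cons c B : Fin (n + 1) → ℂ)) {v w : Fin (n + 2) → ℂ}
    (hv : ∀ i, v i ≠ 0) (h1 : v 0 + w 0 ≠ v 1 + w 1) (h2 : w 0 ≠ w 1) (h3 : v 0 + w 0 ≠ w 1)
    (h4 : v 1 + w 1 ≠ w 0) : LineGeneric (dbl c B) v w := by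
  have hB := h.tail.2
  have key : ∀ i j : Fin (n + 2), i ≠ j → dbl c B i = dbl c B j →
      (i = 0 ∧ j = 1) ∨ (i = 1 ∧ j = 0) := by
    intro i j
    refine Fin.cases ?_ (fun i => Fin.cases ?_ (fun i => ?_) i) i <;>
    refine Fin.cases ?_ (fun j => Fin.cases ?_ (fun j => ?_) j) j
    · simp
    · simp
    · intro _ he; exact absurd he (h.ne_head j)
    · simp
    · simp
    · intro _ he; exact absurd he (h.ne_head j)
    · intro _ he; exact absurd he.symm (h.ne_head i)
    · intro _ he; exact absurd he.symm (h.ne_head i)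
    · intro hne he
      exact absurd (congrArg Fin.succ (congrArg Fin.succ (hB he))) hne
  refine ⟨fun i j hij he => ?_, fun i j he => ?_⟩
  · rcases key i j hij he with ⟨rfl, rfl⟩ | ⟨rfl, rfl⟩
    · exact ⟨h2, h1⟩
    · exact ⟨h2.symm, h1.symm⟩
  · by_cases hij : i = j
    · rw [hij, ne_eq, add_eq_right]
      exact hv j
    · rcases key i j hij he with ⟨rfl, rfl⟩ | ⟨rfl, rfl⟩
      · exact h3
      · exact h4

end

/-- The polynomial in `η = (η_0, η_1, η')` that governs the merging of two rapidities at `c`. -/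
def mergeForm (a : ℝ) {n : ℕ} (c : ℂ) (B : Fin n → ℂ) (P : MvPolynomial (Fin (n + 1)) ℂ)
    (v : Fin (n + 2) → ℂ) : ℂ :=
  (phi a 0 * (v 0 + v 1) + ∑ k, phi a (c - B k) * v k.succ.succ) *
    MvPolynomial.eval (Fin.cons (v 0 + v 1) fun k => v k.succ.succ : Fin (n + 1) → ℂ) P

/-- The leading form of the numerator at `(c, c, B)`. -/
def dblForm (a : ℝ) {n : ℕ} (c : ℂ) (B : Fin n → ℂ) (P : MvPolynomial (Fin (n + 1)) ℂ)
    (z : (Fin (n + 2) → ℂ) × (Fin (n + 2) → ℂ)) : ℂ :=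
  -(mergeForm a c B P z.1 * (z.1 0 + z.2 0 - (z.1 1 + z.2 1)) * (z.2 0 - z.2 1))

section forms
variable (n : ℕ)

/-- The coordinate `v i` of a pair of direction vectors. -/
def lv (i : Fin (n + 2)) : (Fin (n + 2) → ℂ) × (Fin (n + 2) → ℂ) →ₗ[ℂ] ℂ :=
  (LinearMap.proj i).comp (LinearMap.fst ℂ _ _)

/-- The coordinate `w i` of a pair of direction vectors. -/
def lw (i : Fin (n + 2)) : (Fin (n + 2) → ℂ) × (Fin (n + 2) → ℂ) →ₗ[ℂ] ℂ :=
  (LinearMap.proj i).comp (LinearMap.snd ℂ _ _)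

/-- The linear forms whose zeros are the exceptional lines through `(c, c, B)`. -/
def dblForms : Fin (n + 2) ⊕ Fin 4 → ((Fin (n + 2) → ℂ) × (Fin (n + 2) → ℂ) →ₗ[ℂ] ℂ) :=
  Sum.elim (lv n) ![lv n 0 + lw n 0 - (lv n 1 + lw n 1), lw n 0 - lw n 1,
    lv n 0 + lw n 0 - lw n 1, lv n 1 + lw n 1 - lw n 0]

variable {n}

@[simp] theorem lv_apply (i : Fin (n + 2)) (z) : lv n i z = z.1 i := rfl
@[simp] theorem lw_apply (i : Fin (n + 2)) (z) : lw n i z = z.2 i := rfl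
@[simp] theorem dblForms_inl (i : Fin (n + 2)) (z) : dblForms n (Sum.inl i) z = z.1 i := rfl
theorem dblForms_inr_zero (z) : dblForms n (Sum.inr 0) z = z.1 0 + z.2 0 - (z.1 1 + z.2 1) := rfl
theorem dblForms_inr_one (z) : dblForms n (Sum.inr 1) z = z.2 0 - z.2 1 := rfl
theorem dblForms_inr_two (z) : dblForms n (Sum.inr 2) z = z.1 0 + z.2 0 - z.2 1 := rfl
theorem dblForms_inr_three (z) : dblForms n (Sum.inr 3) z = z.1 1 + z.2 1 - z.2 0 := rfl

theorem dblForms_independent (i j : Fin (n + 2) ⊕ Fin 4) (hij : i ≠ j) :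
    ∃ u, dblForms n i u = 0 ∧ dblForms n j u ≠ 0 := by
  rcases i with i | i <;> rcases j with j | j
  · have : i ≠ j := fun h => hij (by rw [h])
    exact ⟨(Pi.single j 1, 0), by simp [this], by simp⟩
  · refine ⟨(0, Pi.single 0 1), by simp, ?_⟩
    fin_cases j <;> simp [dblForms]
  · refine Fin.cases ?_ (fun j => Fin.cases ?_ (fun j => ?_) j) j
    · refine ⟨(Pi.single 0 1, if i = 0 ∨ i = 2 then Pi.single 1 1 else 0), ?_, by simp⟩
      fin_cases i <;> simp [dblForms]
    · refine ⟨(Pi.single 1 1, if i = 0 ∨ i = 3 then Pi.single 0 1 else 0), ?_, by simp⟩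
      fin_cases i <;> simp [dblForms]
    · refine ⟨(Pi.single j.succ.succ 1, 0), ?_, by simp⟩
      have h1 : (1 : Fin (n + 2)) ≠ j.succ.succ := by
        simp [Fin.ext_iff]
      fin_cases i <;> simp [dblForms, h1, (Fin.succ_ne_zero j.succ).symm]
  · have hk : i ≠ j := fun h => hij (by rw [h])
    -- a configuration with prescribed values of `ξ_0, ξ_1, θ_0, θ_1`
    have key : ∀ p q x y : ℂ, ![p - q, x - y, p - y, q - x] i = 0 →
        ![p - q, x - y, p - y, q - x] j ≠ 0 →
        ∃ u, dblForms n (Sum.inr i) u = 0 ∧ dblForms n (Sum.inr j) u ≠ 0 := by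
      intro p q x y h1 h2
      have h3 : ∀ k, dblForms n (Sum.inr k) (Pi.single 0 (p - x) + Pi.single 1 (q - y),
          Pi.single 0 x + Pi.single 1 y) = ![p - q, x - y, p - y, q - x] k := by
        intro k
        fin_cases k <;> simp [dblForms]
      exact ⟨_, (h3 i).trans h1, by rw [h3 j]; exact h2⟩
    fin_cases i <;> fin_cases j <;> first
      | exact absurd rfl hk
      | (refine key 0 0 1 0 ?_ ?_ <;> solve | simp)
      | (refine key 1 1 0 0 ?_ ?_ <;> solve | simp)
      | (refine key 1 0 0 0 ?_ ?_ <;> solve | simp)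
      | (refine key 0 1 0 0 ?_ ?_ <;> solve | simp)
      | (refine key 0 0 0 1 ?_ ?_ <;> solve | simp)

theorem dblForms_ne_zero (i : Fin (n + 2) ⊕ Fin 4) : ∃ u, dblForms n i u ≠ 0 := by
  rcases i with i | i
  · exact ⟨(Pi.single i 1, 0), by simp⟩
  · refine ⟨(0, Pi.single 0 1), ?_⟩
    fin_cases i <;> simp [dblForms]

end forms

theorem PolyOnLines.eq_zero_of_generic {E : Type*} [NormedAddCommGroup E] [NormedSpace ℂ E] {k : ℕ}
    {Q : E → ℂ} (hQ : PolyOnLines k Q) {ι : Type*} [Finite ι] (l : ι → E →ₗ[ℂ] ℂ)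
    (h0 : ∀ i, ∃ u, l i u ≠ 0) (hz : ∀ z, (∀ i, l i z ≠ 0) → Q z = 0) (v : E) : Q v = 0 := by
  obtain ⟨u, hu⟩ := exists_forall_ne_zero l h0
  obtain ⟨q, -, hq⟩ := hQ v u
  have hfin : Set.Finite (⋃ i, {t : ℂ | l i (v + t • u) = 0}) := by
    refine Set.finite_iUnion fun i => (Set.finite_singleton (-(l i v) / l i u)).subset ?_
    intro t ht
    have h1 : l i v + t * l i u = 0 := by simpa using ht
    rw [Set.mem_singleton_iff, eq_div_iff (hu i)]
    linear_combination h1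
  have hq0 : q = 0 := by
    refine Polynomial.eq_zero_of_infinite_isRoot q (hfin.infinite_compl.mono fun t ht => ?_)
    rw [Set.mem_compl_iff, Set.mem_iUnion, not_exists] at ht
    change q.eval t = 0
    rw [hq]
    exact hz _ ht
  have := hq 0
  rw [hq0] at this
  simpa using this.symm

/-- If a function changes sign under a linear involution along generic lines, then so do its
Taylor forms. -/
theorem coeff_add_comp_eq_zero {E : Type*} [NormedAddCommGroup E] [NormedSpace ℂ E] {g : E → ℂ}
    {p : FormalMultilinearSeries ℂ E ℂ} (hp : HasFPowerSeriesAt g p 0) (σ : E →L[ℂ] E)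
    {ι : Type*} [Finite ι] (l : ι → E →ₗ[ℂ] ℂ) (h0 : ∀ i, ∃ u, l i u ≠ 0)
    (hz : ∀ z, (∀ i, l i z ≠ 0) → ∀ᶠ s : ℂ in 𝓝[≠] 0, g (s • z) + g (s • σ z) = 0)
    (k : ℕ) (z : E) : (p k fun _ => z) + p k (fun _ => σ z) = 0 := by
  have hp' : HasFPowerSeriesAt g p (σ 0) := by simpa using hp
  have h1 : HasFPowerSeriesAt (g + g ∘ σ) (p + p.compContinuousLinearMap σ) 0 := by
    obtain ⟨r, hr⟩ := hp'
    exact hp.add ⟨_, hr.compContinuousLinearMap⟩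
  refine (((polyOnLines_multilinear (p k)).add
    ((polyOnLines_multilinear (p k)).comp_linear σ.toLinearMap))).eq_zero_of_generic l h0
    (fun z hgen => ?_) z
  have h2 : Tendsto (fun s : ℂ => (g + g ∘ σ) (s • z) / s ^ k) (𝓝[≠] 0) (𝓝 0) := by
    refine tendsto_const_nhds.congr' ?_
    filter_upwards [hz z hgen] with s hs
    rw [Pi.add_apply, Function.comp_apply, map_smul, hs, zero_div]
  exact (coeff_eq_of_tendsto_div_pow h1 h2).2

/-- The exchange of the first two entries. -/
abbrev swp (n : ℕ) : Equiv.Perm (Fin (n + 2)) := Equiv.swap 0 1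

theorem dbl_comp_swp {n : ℕ} {c : ℂ} {B : Fin n → ℂ} : dbl c B ∘ swp n = dbl c B := by
  ext k
  refine Fin.cases ?_ (fun k => Fin.cases ?_ (fun k => ?_) k) k
  · simp
  · simp
  · have h1 : k.succ.succ ≠ (1 : Fin (n + 2)) := by simp [Fin.ext_iff]
    simp [Equiv.swap_apply_of_ne_of_ne (Fin.succ_ne_zero _) h1]

theorem swp_succ_succ {n : ℕ} (k : Fin n) : swp n k.succ.succ = k.succ.succ :=
  Equiv.swap_apply_of_ne_of_ne (Fin.succ_ne_zero _) (by simp [Fin.ext_iff])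

end

section

variable {a : ℝ} {F : ∀ n : ℕ, (Fin n → ℂ) → ℂ} {V : Set ℂ}

/-- Exchange of `ξ_0` and `ξ_1`, as a map of direction vectors. -/
def swapXi (n : ℕ) : (Fin (n + 2) → ℂ) × (Fin (n + 2) → ℂ) →L[ℂ]
    (Fin (n + 2) → ℂ) × (Fin (n + 2) → ℂ) :=
  LinearMap.toContinuousLinearMap
    (((LinearMap.funLeft ℂ ℂ (swp n)).comp (LinearMap.fst ℂ _ _ + LinearMap.snd ℂ _ _) -
      LinearMap.snd ℂ _ _).prod (LinearMap.snd ℂ _ _))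

theorem swapXi_apply {n : ℕ} (v w : Fin (n + 2) → ℂ) :
    swapXi n (v, w) = ((v + w) ∘ swp n - w, w) := rfl

/-- Exchange of `θ_0` and `θ_1`, as a map of direction vectors. -/
def swapTheta (n : ℕ) : (Fin (n + 2) → ℂ) × (Fin (n + 2) → ℂ) →L[ℂ]
    (Fin (n + 2) → ℂ) × (Fin (n + 2) → ℂ) :=
  LinearMap.toContinuousLinearMap
    ((LinearMap.fst ℂ _ _ + LinearMap.snd ℂ _ _ -
      (LinearMap.funLeft ℂ ℂ (swp n)).comp (LinearMap.snd ℂ _ _)).prod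
      ((LinearMap.funLeft ℂ ℂ (swp n)).comp (LinearMap.snd ℂ _ _)))

theorem swapTheta_apply {n : ℕ} (v w : Fin (n + 2) → ℂ) :
    swapTheta n (v, w) = (v + w - w ∘ swp n, w ∘ swp n) := rfl

variable {n : ℕ} {c : ℂ} {B : Fin n → ℂ}

theorem lineGeneric_dbl_of_forms (h : Distinct V (Fin.cons c B : Fin (n + 1) → ℂ))
    {v w : Fin (n + 2) → ℂ} (hz : ∀ i, dblForms n i (v, w) ≠ 0) : LineGeneric (dbl c B) v w := by
  have h0 := hz (Sum.inr 0)
  have h1 := hz (Sum.inr 1)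
  have h2 := hz (Sum.inr 2)
  have h3 := hz (Sum.inr 3)
  rw [dblForms_inr_zero] at h0
  rw [dblForms_inr_one] at h1
  rw [dblForms_inr_two] at h2
  rw [dblForms_inr_three] at h3
  exact lineGeneric_dbl h (fun i => hz (Sum.inl i)) (sub_ne_zero.mp h0) (sub_ne_zero.mp h1)
    (sub_ne_zero.mp h2) (sub_ne_zero.mp h3)

theorem dbl_add_comp_swp (s : ℂ) (v : Fin (n + 2) → ℂ) :
    (dbl c B + s • v) ∘ swp n = dbl c B + s • (v ∘ swp n) := by
  conv_rhs => rw [← dbl_comp_swp]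
  rfl

theorem sign_swp : ((Equiv.Perm.sign (swp n) : ℤ) : ℂ) = -1 := by
  rw [Equiv.Perm.sign_swap (by simp)]
  simp

/-- The numerator at `(c, c, B)` is antisymmetric in `ξ_0` and `ξ_1`, since the product of the
factors `sinh` is symmetric. -/
theorem IsNumerator.add_swapXi (hF : IsFormFactorFamily a F) (hV : Admissible a V)
    (h : Distinct V (Fin.cons c B : Fin (n + 1) → ℂ))
    {M : (Fin (n + 2) → ℂ) × (Fin (n + 2) → ℂ) → ℂ} (hM : IsNumerator a F (dbl c B) M)
    {v w : Fin (n + 2) → ℂ} (hz : ∀ i, dblForms n i (v, w) ≠ 0) :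
    ∀ᶠ s : ℂ in 𝓝[≠] 0, lineFun (dbl c B) M (s • (v, w)) +
      lineFun (dbl c B) M (s • swapXi n (v, w)) = 0 := by
  have e2 := (tendsto_line (dbl c B) ((v + w) ∘ swp n - w) w).eventually hM.eventually_eq
  filter_upwards [(lineGeneric_dbl_of_forms h hz).eventually_dg hV (dbl_mem h),
    (tendsto_line (dbl c B) v w).eventually hM.eventually_eq, e2] with s f1 f2 f3
  rw [swapXi_apply, lineFun_smul, lineFun_smul]
  have hξ : dbl c B + s • ((v + w) ∘ swp n - w + w) = (dbl c B + s • (v + w)) ∘ swp n := by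
    rw [dbl_add_comp_swp, sub_add_cancel]
  simp only [hξ] at f3 ⊢
  have hdg : DG a ((dbl c B + s • (v + w)) ∘ swp n) (dbl c B + s • w) :=
    f1.comp (swp n).injective Function.injective_id
  have hn := normFF_comp hF f1 (swp n) 1
  simp only [Equiv.Perm.sign_one, sign_swp, Equiv.Perm.coe_one, Function.comp_id] at hn
  rw [← f2 f1, ← f3 hdg, hn, prod_coinc_dbl h, prod_coinc_dbl h]
  simp only [Function.comp_apply, swp_succ_succ, Equiv.swap_apply_left, Equiv.swap_apply_right]
  push_cast
  ring

theorem IsNumerator.add_swapTheta (hF : IsFormFactorFamily a F) (hV : Admissible a V)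
    (h : Distinct V (Fin.cons c B : Fin (n + 1) → ℂ))
    {M : (Fin (n + 2) → ℂ) × (Fin (n + 2) → ℂ) → ℂ} (hM : IsNumerator a F (dbl c B) M)
    {v w : Fin (n + 2) → ℂ} (hz : ∀ i, dblForms n i (v, w) ≠ 0) :
    ∀ᶠ s : ℂ in 𝓝[≠] 0, lineFun (dbl c B) M (s • (v, w)) +
      lineFun (dbl c B) M (s • swapTheta n (v, w)) = 0 := by
  have e2 := (tendsto_line (dbl c B) (v + w - w ∘ swp n) (w ∘ swp n)).eventually hM.eventually_eq
  filter_upwards [(lineGeneric_dbl_of_forms h hz).eventually_dg hV (dbl_mem h),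
    (tendsto_line (dbl c B) v w).eventually hM.eventually_eq, e2] with s f1 f2 f3
  rw [swapTheta_apply, lineFun_smul, lineFun_smul]
  have hθ : dbl c B + s • (w ∘ swp n) = (dbl c B + s • w) ∘ swp n := by
    rw [dbl_add_comp_swp]
  simp only [hθ, sub_add_cancel] at f3 ⊢
  have hdg : DG a (dbl c B + s • (v + w)) ((dbl c B + s • w) ∘ swp n) :=
    f1.comp Function.injective_id (swp n).injective
  have hn := normFF_comp hF f1 1 (swp n)
  simp only [Equiv.Perm.sign_one, sign_swp, Equiv.Perm.coe_one, Function.comp_id] at hn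
  rw [← f2 f1, ← f3 hdg, hn, prod_coinc_dbl h, prod_coinc_dbl h]
  simp only [Function.comp_apply, swp_succ_succ, Equiv.swap_apply_left, Equiv.swap_apply_right]
  push_cast
  ring

theorem polyOnLines_dblForm {P : MvPolynomial (Fin (n + 1)) ℂ} (hP : P.IsHomogeneous (n + 1)) :
    PolyOnLines (n + 4) (dblForm a c B P) := by
  have h1 : PolyOnLines 1 fun z : (Fin (n + 2) → ℂ) × (Fin (n + 2) → ℂ) =>
      phi a 0 * (z.1 0 + z.1 1) + ∑ k : Fin n, phi a (c - B k) * z.1 k.succ.succ := by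
    have := polyOnLines_linear (phi a 0 • (lv n 0 + lv n 1) +
      ∑ k : Fin n, phi a (c - B k) • lv n k.succ.succ)
    simpa [mul_add] using this
  have h2 := polyOnLines_eval hP
    (Fin.cons (lv n 0 + lv n 1) fun k => lv n k.succ.succ : Fin (n + 1) → _)
  have h3 := polyOnLines_linear (dblForms n (Sum.inr 0))
  have h4 := polyOnLines_linear (dblForms n (Sum.inr 1))
  have h5 := (((h1.mul h2).mul h3).mul h4).neg
  refine PolyOnLines.mono (k := 1 + (n + 1) + 1 + 1) (by omega) ?_
  convert h5 using 1
  ext z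
  simp only [dblForm, mergeForm, dblForms_inr_zero, dblForms_inr_one]
  congr 4
  refine congrArg (fun f => MvPolynomial.eval f P) (funext fun k => ?_)
  refine Fin.cases ?_ (fun k => ?_) k <;> simp

theorem mergeForm_congr {P : MvPolynomial (Fin (n + 1)) ℂ} {v v' : Fin (n + 2) → ℂ}
    (h : v 0 + v 1 = v' 0 + v' 1) (h' : ∀ k : Fin n, v k.succ.succ = v' k.succ.succ) :
    mergeForm a c B P v = mergeForm a c B P v' := by
  simp only [mergeForm, h, h']

theorem dblForm_swapTheta {P : MvPolynomial (Fin (n + 1)) ℂ} (v w : Fin (n + 2) → ℂ) :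
    dblForm a c B P (swapTheta n (v, w)) = - dblForm a c B P (v, w) := by
  have h1 : mergeForm a c B P (v + w - w ∘ swp n) = mergeForm a c B P v := by
    refine mergeForm_congr ?_ fun k => ?_
    · simp only [Pi.sub_apply, Pi.add_apply, Function.comp_apply, Equiv.swap_apply_left,
        Equiv.swap_apply_right]
      ring
    · simp only [Pi.sub_apply, Pi.add_apply, Function.comp_apply, swp_succ_succ]
      ring
  simp only [dblForm, swapTheta_apply, h1, Pi.sub_apply, Pi.add_apply, Function.comp_apply,
    Equiv.swap_apply_left, Equiv.swap_apply_right]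
  ring

/-- The Taylor forms of the numerator at `(c, c, B)` on the hyperplanes `ξ_0 = θ_0` and
`ξ_1 = θ_1`. -/
theorem IsNumerator.coeff_dbl_head (hF : IsFormFactorFamily a F) (hV : Admissible a V)
    (h : Distinct V (Fin.cons c B : Fin (n + 1) → ℂ))
    {M : (Fin (n + 2) → ℂ) × (Fin (n + 2) → ℂ) → ℂ} (hM : IsNumerator a F (dbl c B) M)
    {p : FormalMultilinearSeries ℂ ((Fin (n + 2) → ℂ) × (Fin (n + 2) → ℂ)) ℂ}
    (hp : HasFPowerSeriesAt (lineFun (dbl c B) M) p 0) {P : MvPolynomial (Fin (n + 1)) ℂ}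
    (hP : HasLead a F (Fin.cons c B : Fin (n + 1) → ℂ) P) {v w : Fin (n + 2) → ℂ}
    (i : Fin (n + 2)) (hi : i = 0 ∨ i = 1) (hvi : v i = 0)
    (hz : ∀ j, j ≠ Sum.inl i → dblForms n j (v, w) ≠ 0) :
    (∀ k < n + 4, p k (fun _ => (v, w)) = 0) ∧ (p (n + 4) fun _ => (v, w)) =
      dblForm a c B P (v, w) := by
  have hv : ∀ k, v (i.succAbove k) ≠ 0 := fun k =>
    hz (Sum.inl (i.succAbove k)) (by simp [Fin.succAbove_ne])
  have h1 := sub_ne_zero.mp (hz (Sum.inr 1) (by simp))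
  have h2 := sub_ne_zero.mp (hz (Sum.inr 2) (by simp))
  have h3 := sub_ne_zero.mp (hz (Sum.inr 3) (by simp))
  simp only [LinearMap.add_apply, lv_apply, lw_apply] at h1 h2 h3
  refine coeff_eq_of_tendsto_div_pow hp ?_
  simp only [lineFun_smul, ← card_coinc_dbl h]
  have hP0 : ∏ k, v (i.succAbove k) ≠ 0 := Finset.prod_ne_zero_iff.mpr fun k _ => hv k
  rcases hi with rfl | rfl
  · have hr := hP.tendsto (v ∘ (0 : Fin (n + 2)).succAbove) (w ∘ (0 : Fin (n + 2)).succAbove) hv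
    rw [← dbl_succAbove_zero] at hr
    have hw : ∀ k : Fin (n + 1), dbl c B 0 = dbl c B ((0 : Fin (n + 2)).succAbove k) →
        w 0 ≠ w ((0 : Fin (n + 2)).succAbove k) ∧
        w 0 ≠ v ((0 : Fin (n + 2)).succAbove k) + w ((0 : Fin (n + 2)).succAbove k) := by
      refine Fin.cases (fun _ => ?_) (fun k hk => absurd hk (h.ne_head k))
      simp only [Fin.succAbove_zero, Fin.succ_zero_eq_one]
      exact ⟨h1, h3.symm⟩
    have hlim := hM.tendsto_hyperplane hF hV (dbl_mem h) 0 hvi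
      (lineGeneric_of_injective (by rw [dbl_succAbove_zero]; exact h.2) hv) hw hr
    · refine hlim.trans_eq ?_
      rw [prod_coinc_dbl_erase_zero h]
      congr 1
      simp only [Fin.prod_univ_succ, Fin.sum_univ_succ, Function.comp_apply, Fin.succAbove_zero,
        Fin.succ_zero_eq_one, dbl_zero, dbl_one, dbl_succ_succ, sub_self, add_sub_cancel_right]
        at hP0 ⊢
      have hev : MvPolynomial.eval (v ∘ Fin.succ) P = MvPolynomial.eval
          (Fin.cons (v 0 + v 1) fun k => v k.succ.succ : Fin (n + 1) → ℂ) P := by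
        refine congrArg (fun f => MvPolynomial.eval f P) (funext fun k => ?_)
        refine Fin.cases ?_ (fun k => ?_) k <;> simp [hvi]
      rw [hev, dblForm, mergeForm]
      simp only [hvi, zero_add]
      linear_combination ((phi a 0 * v 1 + ∑ k, phi a (c - B k) * v k.succ.succ) *
        ((w 0 - w 1) * (v 1 + w 1 - w 0))) * div_mul_cancel₀ (MvPolynomial.eval
          (Fin.cons (v 1) fun k => v k.succ.succ : Fin (n + 1) → ℂ) P) hP0
  · have hr := hP.tendsto (v ∘ (1 : Fin (n + 2)).succAbove) (w ∘ (1 : Fin (n + 2)).succAbove) hv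
    rw [← dbl_succAbove_one] at hr
    have hw : ∀ k : Fin (n + 1), dbl c B 1 = dbl c B ((1 : Fin (n + 2)).succAbove k) →
        w 1 ≠ w ((1 : Fin (n + 2)).succAbove k) ∧
        w 1 ≠ v ((1 : Fin (n + 2)).succAbove k) + w ((1 : Fin (n + 2)).succAbove k) := by
      refine Fin.cases (fun _ => ?_) (fun k hk => absurd (by simpa using hk) (h.ne_head k))
      simp only [Fin.one_succAbove_zero]
      exact ⟨h1.symm, h2.symm⟩
    have hlim := hM.tendsto_hyperplane hF hV (dbl_mem h) 1 hvi
      (lineGeneric_of_injective (by rw [dbl_succAbove_one]; exact h.2) hv) hw hr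
    · refine hlim.trans_eq ?_
      rw [prod_coinc_dbl_erase_one h]
      congr 1
      simp only [Fin.prod_univ_succ, Fin.sum_univ_succ, Function.comp_apply, Fin.one_succAbove_zero,
        Fin.one_succAbove_succ,
        dbl_zero, dbl_one, dbl_succ_succ, sub_self, add_sub_cancel_right] at hP0 ⊢
      have hev : MvPolynomial.eval (v ∘ (1 : Fin (n + 2)).succAbove) P = MvPolynomial.eval
          (Fin.cons (v 0 + v 1) fun k => v k.succ.succ : Fin (n + 1) → ℂ) P := by
        refine congrArg (fun f => MvPolynomial.eval f P) (funext fun k => ?_)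
        refine Fin.cases ?_ (fun k => ?_) k <;> simp [hvi]
      rw [hev, dblForm, mergeForm]
      simp only [hvi, add_zero, zero_add]
      linear_combination ((phi a 0 * v 0 + ∑ k, phi a (c - B k) * v k.succ.succ) *
        ((w 1 - w 0) * (v 0 + w 0 - w 1))) * div_mul_cancel₀ (MvPolynomial.eval
          (Fin.cons (v 0) fun k => v k.succ.succ : Fin (n + 1) → ℂ) P) hP0

/-- The kinematical residue axiom for `mergeForm`, at one of the simple rapidities. -/
theorem mergeForm_eq (hF : IsFormFactorFamily a F) (hV : Admissible a V) {m : ℕ}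
    {B : Fin (m + 1) → ℂ}
    (h : Distinct V (Fin.cons c B : Fin (m + 2) → ℂ)) {P : MvPolynomial (Fin (m + 2)) ℂ}
    (hP : HasLead a F (Fin.cons c B : Fin (m + 2) → ℂ) P) {v : Fin (m + 3) → ℂ} (j : Fin (m + 1))
    (hvj : v j.succ.succ = 0) {P' : MvPolynomial (Fin (m + 1)) ℂ}
    (hP' : HasLead a F (Fin.cons c (B ∘ j.succAbove) : Fin (m + 1) → ℂ) P') :
    mergeForm a c B P v = (∑ k : Fin (m + 2), phi a (dbl c B j.succ.succ -
      dbl c B (j.succ.succ.succAbove k)) * v (j.succ.succ.succAbove k)) *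
      mergeForm a c (B ∘ j.succAbove) P' (v ∘ j.succ.succ.succAbove) := by
  have hP'' : HasLead a F ((Fin.cons c B : Fin (m + 2) → ℂ) ∘ j.succ.succAbove) P' := by
    rw [cons_comp_succAbove]; exact hP'
  rw [mergeForm, hP.eval_eq hF hV h hP'' (by simpa using hvj), mergeForm, Fin.sum_univ_succAbove _ j,
    hvj, cons_comp_succAbove]
  simp only [Fin.sum_univ_succ, Function.comp_apply, Fin.succ_succAbove_zero, Fin.cons_zero,
    Fin.cons_succ, Fin.succ_succAbove_succ, dbl_zero, dbl_succ_succ]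
  have e0 : j.succ.succ.succAbove (0 : Fin (m + 2)) = 0 := by simp
  have e1 : j.succ.succ.succAbove (1 : Fin (m + 2)) = 1 := by
    rw [← Fin.succ_zero_eq_one, Fin.succ_succAbove_succ]; simp
  have e2 : (Fin.succ 0 : Fin (m + 3)) = 1 := rfl
  simp only [e1, e2, dbl_one, Function.comp_def, mul_zero, zero_add]
  ring

/-- The Taylor forms of the numerator at `(c, c, B)`, given their values on the hyperplanes
`ξ_j = θ_j` of the simple rapidities. On all but one of the `n + 6` hyperplanes of `dblForms` the
forms of degree below `n + 4` vanish and that of degree `n + 4` is `dblForm`, and both sides are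
polynomials of degree at most `n + 4` on lines. -/
theorem IsNumerator.coeff_dbl_aux (hF : IsFormFactorFamily a F) (hV : Admissible a V)
    (h : Distinct V (Fin.cons c B : Fin (n + 1) → ℂ))
    {M : (Fin (n + 2) → ℂ) × (Fin (n + 2) → ℂ) → ℂ} (hM : IsNumerator a F (dbl c B) M)
    {p : FormalMultilinearSeries ℂ ((Fin (n + 2) → ℂ) × (Fin (n + 2) → ℂ)) ℂ}
    (hp : HasFPowerSeriesAt (lineFun (dbl c B) M) p 0) {P : MvPolynomial (Fin (n + 1)) ℂ}
    (hP : HasLead a F (Fin.cons c B : Fin (n + 1) → ℂ) P)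
    (hrest : ∀ (j : Fin n) (v w : Fin (n + 2) → ℂ), v j.succ.succ = 0 →
      (∀ i, i ≠ Sum.inl j.succ.succ → dblForms n i (v, w) ≠ 0) →
      (∀ k < n + 4, p k (fun _ => (v, w)) = 0) ∧ (p (n + 4) fun _ => (v, w)) =
        dblForm a c B P (v, w)) :
    (∀ k < n + 4, ∀ z, p k (fun _ => z) = 0) ∧ ∀ z, (p (n + 4) fun _ => z) =
      dblForm a c B P z := by
  classical
  have hXi := fun k z => coeff_add_comp_eq_zero hp (swapXi n) (dblForms n) dblForms_ne_zero
    (fun z hz => hM.add_swapXi hF hV h hz) k z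
  have hTh := fun k z => coeff_add_comp_eq_zero hp (swapTheta n) (dblForms n) dblForms_ne_zero
    (fun z hz => hM.add_swapTheta hF hV h hz) k z
  -- the values on all hyperplanes except `ξ_1 = θ_0`
  have key : ∀ i ∈ Finset.univ.erase (Sum.inr 3 : Fin (n + 2) ⊕ Fin 4), ∀ z, dblForms n i z = 0 →
      (∀ j, j ≠ i → dblForms n j z ≠ 0) →
      (∀ k < n + 4, p k (fun _ => z) = 0) ∧ (p (n + 4) fun _ => z) = dblForm a c B P z := by
    rintro (i | i) hi ⟨v, w⟩ hi0 hz
    · rw [dblForms_inl] at hi0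
      revert hi0 hz hi
      refine Fin.cases ?_ (fun i => Fin.cases ?_ (fun i => ?_) i) i
      · intro _ hi0 hz
        exact hM.coeff_dbl_head hF hV h hp hP 0 (Or.inl rfl) hi0 hz
      · intro _ hi0 hz
        exact hM.coeff_dbl_head hF hV h hp hP 1 (Or.inr rfl) hi0 hz
      · intro _ hi0 hz
        exact hrest i v w hi0 hz
    · have hfix : ∀ {σ : (Fin (n + 2) → ℂ) × (Fin (n + 2) → ℂ)}, σ = (v, w) → ∀ k,
          (p k fun _ => (v, w)) + p k (fun _ => σ) = 0 → (p k fun _ => (v, w)) = 0 := by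
        intro σ hσ k hk
        rw [hσ, ← two_mul] at hk
        exact (mul_eq_zero.mp hk).resolve_left two_ne_zero
      fin_cases i
      · -- the numerator is antisymmetric in `ξ_0, ξ_1`
        have h0 : v 0 + w 0 = v 1 + w 1 := sub_eq_zero.mp hi0
        have hσ : swapXi n (v, w) = (v, w) := by
          rw [swapXi_apply]
          congr 1
          ext k
          refine Fin.cases ?_ (fun k => Fin.cases ?_ (fun k => ?_) k) k
          · simp only [Pi.sub_apply, Function.comp_apply, Equiv.swap_apply_left, Pi.add_apply]
            linear_combination -h0
          · simp only [Pi.sub_apply, Function.comp_apply, Fin.succ_zero_eq_one,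
              Equiv.swap_apply_right, Pi.add_apply]
            linear_combination h0
          · simp [swp_succ_succ]
        refine ⟨fun k _ => hfix hσ k (hXi k _), ?_⟩
        rw [hfix hσ _ (hXi _ _), dblForm]
        simp only [h0]
        ring
      · -- the numerator is antisymmetric in `θ_0, θ_1`
        have h0 : w 0 = w 1 := sub_eq_zero.mp hi0
        have hw : w ∘ swp n = w := by
          ext k
          refine Fin.cases ?_ (fun k => Fin.cases ?_ (fun k => ?_) k) k
          · simp [h0]
          · simp [h0]
          · simp [swp_succ_succ]
        have hσ : swapTheta n (v, w) = (v, w) := by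
          rw [swapTheta_apply, hw, add_sub_cancel_right]
        refine ⟨fun k _ => hfix hσ k (hTh k _), ?_⟩
        rw [hfix hσ _ (hTh _ _), dblForm]
        simp only [h0]
        ring
      · -- the hyperplane `ξ_0 = θ_1` is the image of `ξ_0 = θ_0`
        have h0 : v 0 + w 0 - w 1 = 0 := hi0
        have g0 : v 0 + w 0 - (v 1 + w 1) ≠ 0 := hz (Sum.inr 0) (by simp)
        have g1 : w 0 - w 1 ≠ 0 := hz (Sum.inr 1) (by simp)
        have g3 : v 1 + w 1 - w 0 ≠ 0 := hz (Sum.inr 3) (by simp)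
        have g4 : v 0 ≠ 0 := hz (Sum.inl 0) (by simp)
        have g5 : v 1 ≠ 0 := hz (Sum.inl 1) (by simp)
        have h1 := hM.coeff_dbl_head hF hV h hp hP (v := v + w - w ∘ swp n) (w := w ∘ swp n)
          0 (Or.inl rfl) (by simpa using h0) (by
            rintro (j | j) hj
            · rw [dblForms_inl]
              revert hj
              refine Fin.cases ?_ (fun j => Fin.cases ?_ (fun j => ?_) j) j
              · intro hj; exact absurd rfl hj
              · intro _
                simpa using g3
              · intro _
                have := hz (Sum.inl j.succ.succ) (by simp)
                simpa [swp_succ_succ] using this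
            · fin_cases j
              · simpa [dblForms] using g0
              · simpa [dblForms, sub_eq_zero] using (sub_ne_zero.mp g1).symm
              · simpa [dblForms] using g4
              · simpa [dblForms] using g5)
        rw [← swapTheta_apply] at h1
        refine ⟨fun k hk => ?_, ?_⟩
        · have := hTh k (v, w)
          rwa [h1.1 k hk, add_zero] at this
        · have := hTh (n + 4) (v, w)
          rw [h1.2, dblForm_swapTheta] at this
          linear_combination this
      · simp at hi
  have hcard : n + 4 < (Finset.univ.erase (Sum.inr 3 : Fin (n + 2) ⊕ Fin 4)).card := by
    rw [Finset.card_erase_of_mem (Finset.mem_univ _), Finset.card_univ]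
    simp
  constructor
  · intro k hk z
    exact (polyOnLines_multilinear (p k)).eq_zero (dblForms n) dblForms_ne_zero
      dblForms_independent _ (hk.trans hcard) (fun i hi z h1 h2 => (key i hi z h1 h2).1 k hk) z
  · intro z
    have := ((polyOnLines_multilinear (p (n + 4))).sub
      (polyOnLines_dblForm (a := a) (c := c) (B := B) hP.homogeneous)).eq_zero (dblForms n)
      dblForms_ne_zero dblForms_independent _ hcard
      (fun i hi z h1 h2 => sub_eq_zero.mpr (key i hi z h1 h2).2) z
    exact sub_eq_zero.mp this

/-- The Taylor forms of the numerator at a configuration `(c, c, B)` with two equal rapidities. -/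
theorem IsNumerator.coeff_dbl (hF : IsFormFactorFamily a F) (hV : Admissible a V) :
    ∀ {n : ℕ} {B : Fin n → ℂ} (_ : Distinct V (Fin.cons c B : Fin (n + 1) → ℂ))
    {M : (Fin (n + 2) → ℂ) × (Fin (n + 2) → ℂ) → ℂ} (_ : IsNumerator a F (dbl c B) M)
    {p : FormalMultilinearSeries ℂ ((Fin (n + 2) → ℂ) × (Fin (n + 2) → ℂ)) ℂ}
    (_ : HasFPowerSeriesAt (lineFun (dbl c B) M) p 0) {P : MvPolynomial (Fin (n + 1)) ℂ}
    (_ : HasLead a F (Fin.cons c B : Fin (n + 1) → ℂ) P),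
    (∀ k < n + 4, ∀ z, p k (fun _ => z) = 0) ∧ ∀ z, (p (n + 4) fun _ => z) =
      dblForm a c B P z := by
  intro n
  induction n with
  | zero =>
    intro B h M hM p hp P hP
    exact hM.coeff_dbl_aux hF hV h hp hP fun j => j.elim0
  | succ n ih =>
    intro B h M hM p hp P hP
    refine hM.coeff_dbl_aux hF hV h hp hP fun j v w hvj hz => ?_
    have h' : Distinct V (Fin.cons c (B ∘ j.succAbove) : Fin (n + 1) → ℂ) := by
      rw [← cons_comp_succAbove]
      exact h.comp Fin.succAbove_right_injective
    obtain ⟨M', hM'⟩ := exists_isNumerator hF hV (dbl_mem h')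
    obtain ⟨p', hp'⟩ := hM'.analyticAt_lineFun
    obtain ⟨P', hP'⟩ := exists_hasLead hF hV h'
    obtain ⟨ih1, ih2⟩ := ih h' hM' hp' hP'
    set i := j.succ.succ with hi
    have e0 : i.succAbove (0 : Fin (n + 2)) = 0 := by simp [hi]
    have e1 : i.succAbove (1 : Fin (n + 2)) = 1 := by
      rw [hi, ← Fin.succ_zero_eq_one, Fin.succ_succAbove_succ]; simp
    have g0 := sub_ne_zero.mp (hz (Sum.inr 0) (by simp))
    have g1 := sub_ne_zero.mp (hz (Sum.inr 1) (by simp))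
    have g2 := sub_ne_zero.mp (hz (Sum.inr 2) (by simp))
    have g3 := sub_ne_zero.mp (hz (Sum.inr 3) (by simp))
    simp only [LinearMap.add_apply, lv_apply, lw_apply] at g0 g1 g2 g3
    have hlg : LineGeneric (dbl c (B ∘ j.succAbove)) (v ∘ i.succAbove) (w ∘ i.succAbove) := by
      refine lineGeneric_dbl h' (fun k => hz (Sum.inl (i.succAbove k))
        (by simp [Fin.succAbove_ne])) ?_ ?_ ?_ ?_ <;>
      simp only [Function.comp_apply, e0, e1] <;> assumption
    have hr := (hM'.tendsto_mul_prod hV (dbl_mem h') hlg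
      (r := dblForm a c (B ∘ j.succAbove) P' (v ∘ i.succAbove, w ∘ i.succAbove))).mp (by
        rw [card_coinc_dbl h', ← ih2]
        simpa only [lineFun_smul] using tendsto_div_pow_of_coeff_eq_zero hp' (N := n + 4)
          (v := (v ∘ i.succAbove, w ∘ i.succAbove)) fun k hk => ih1 k hk _)
    have hne : ∀ k : Fin (n + 2), dbl c B i ≠ dbl c B (i.succAbove k) := by
      intro k
      refine Fin.cases ?_ (fun k => Fin.cases ?_ (fun k => ?_) k) k
      · rw [e0]; exact (h.ne_head j).symm
      · rw [Fin.succ_zero_eq_one, e1]; exact (h.ne_head j).symm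
      · rw [hi, Fin.succ_succAbove_succ, Fin.succ_succAbove_succ]
        exact fun he => Fin.succAbove_ne j k (h.tail.2 he).symm
    rw [← dbl_succAbove] at hr hlg
    have hlim := hM.tendsto_hyperplane hF hV (dbl_mem h) i hvj hlg
      (fun k hk => absurd hk (hne k)) hr
    refine coeff_eq_of_tendsto_div_pow hp ?_
    rw [← card_coinc_dbl h]
    simp only [lineFun_smul]
    refine hlim.trans_eq ?_
    rw [prod_coinc_erase, Finset.prod_eq_one (fun k _ => if_neg (hne k)), one_mul]
    have hP0 : ∏ q ∈ coinc (dbl c B ∘ i.succAbove),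
        (v (i.succAbove q.1) + w (i.succAbove q.1) - w (i.succAbove q.2)) ≠ 0 :=
      Finset.prod_ne_zero_iff.mpr fun q hq => sub_ne_zero.mpr (hlg.2 _ _ (mem_coinc.mp hq))
    simp only [Function.comp_apply] at hP0 ⊢
    rw [mul_assoc, div_mul_cancel₀ _ hP0, dblForm, dblForm, mergeForm_eq hF hV h hP j hvj hP']
    simp only [Function.comp_apply, e0, e1]
    congr 1
    ring

end

/-! ### Extraction of coefficients by averaging over signs -/

section

/-- The component of `f` that is odd in every variable, evaluated at `(1, …, 1)`. -/
def oddPart : (n : ℕ) → ((Fin n → ℂ) → ℂ) → ℂ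
  | 0, f => f Fin.elim0
  | n + 1, f => (oddPart n (fun v => f (Fin.cons 1 v)) - oddPart n (fun v => f (Fin.cons (-1) v))) / 2

theorem oddPart_sum {ι : Type*} (s : Finset ι) : ∀ (n : ℕ) (f : ι → (Fin n → ℂ) → ℂ),
    oddPart n (fun v => ∑ i ∈ s, f i v) = ∑ i ∈ s, oddPart n (f i)
  | 0, f => rfl
  | n + 1, f => by
    simp only [oddPart]
    rw [oddPart_sum s n fun i v => f i (Fin.cons 1 v),
      oddPart_sum s n fun i v => f i (Fin.cons (-1) v), ← Finset.sum_sub_distrib, Finset.sum_div]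

theorem oddPart_const_mul (c : ℂ) : ∀ (n : ℕ) (f : (Fin n → ℂ) → ℂ),
    oddPart n (fun v => c * f v) = c * oddPart n f
  | 0, f => rfl
  | n + 1, f => by
    simp only [oddPart]
    rw [oddPart_const_mul c n fun v => f (Fin.cons 1 v),
      oddPart_const_mul c n fun v => f (Fin.cons (-1) v)]
    ring

theorem oddPart_prod_pow : ∀ (n : ℕ) (d : Fin n → ℕ),
    oddPart n (fun v => ∏ i, v i ^ d i) = ∏ i, (1 - (-1) ^ d i) / 2
  | 0, d => by simp [oddPart]
  | n + 1, d => by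
    simp only [oddPart, Fin.prod_univ_succ, Fin.cons_zero, Fin.cons_succ]
    rw [oddPart_const_mul _ n fun v => ∏ i, v i ^ d i.succ,
      oddPart_const_mul _ n fun v => ∏ i, v i ^ d i.succ, oddPart_prod_pow n fun i => d i.succ]
    ring

theorem tendsto_oddPart {X : Type*} {l : Filter X} : ∀ (n : ℕ) (f : X → (Fin n → ℂ) → ℂ)
    (g : (Fin n → ℂ) → ℂ) (_ : ∀ v, (∀ i, v i ≠ 0) → Tendsto (fun x => f x v) l (𝓝 (g v))),
    Tendsto (fun x => oddPart n (f x)) l (𝓝 (oddPart n g))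
  | 0, f, g, h => h _ fun i => i.elim0
  | n + 1, f, g, h => by
    simp only [oddPart]
    refine Tendsto.div_const (Tendsto.sub
      (tendsto_oddPart n _ _ fun v hv => h _ ?_) (tendsto_oddPart n _ _ fun v hv => h _ ?_)) 2
    · exact Fin.cases (by simp) (by simpa using hv)
    · exact Fin.cases (by simp) (by simpa using hv)

theorem prod_odd_ne_zero {n : ℕ} {d : Fin n → ℕ} (h : ∏ i, ((1 - (-1 : ℂ) ^ d i) / 2) ≠ 0)
    (i : Fin n) : Odd (d i) := by
  rw [Finset.prod_ne_zero_iff] at h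
  by_contra hc
  rw [Nat.not_odd_iff_even] at hc
  exact h i (Finset.mem_univ i) (by simp [hc.neg_one_pow])

theorem prod_odd_eq_one {n : ℕ} {d : Fin n → ℕ} (h : ∀ i, Odd (d i)) :
    ∏ i, ((1 - (-1 : ℂ) ^ d i) / 2) = 1 :=
  Finset.prod_eq_one fun i _ => by rw [(h i).neg_one_pow]; norm_num

theorem eq_one_of_odd_of_sum {n : ℕ} {d : Fin n → ℕ} (h : ∀ i, Odd (d i)) (hs : ∑ i, d i ≤ n)
    (i : Fin n) : d i = 1 := by
  have h1 : ∀ i ∈ Finset.univ, 1 ≤ d i := fun i _ => (h i).pos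
  have h2 : ∑ _i : Fin n, 1 = ∑ i, d i :=
    le_antisymm (Finset.sum_le_sum h1) (by simpa using hs)
  exact ((Finset.sum_eq_sum_iff_of_le h1).mp h2 i (Finset.mem_univ i)).symm

theorem sum_eq_of_mem_support {n k : ℕ} {P : MvPolynomial (Fin n) ℂ} (hP : P.IsHomogeneous k)
    {d : Fin n →₀ ℕ} (hd : d ∈ P.support) : ∑ i, d i = k := by
  rw [hP.degree_eq_sum_deg_support hd]
  exact (Finset.sum_subset (Finset.subset_univ _) fun i _ hi => by simpa using hi).symm

theorem oddPart_eval {n : ℕ} {P : MvPolynomial (Fin n) ℂ} (hP : P.IsHomogeneous n) :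
    oddPart n (fun v => MvPolynomial.eval v P) = P.coeff (ones n) := by
  simp only [MvPolynomial.eval_eq']
  rw [oddPart_sum]
  simp only [oddPart_const_mul, oddPart_prod_pow]
  rw [Finset.sum_eq_single (ones n)]
  · rw [prod_odd_eq_one (by simp), mul_one]
  · intro d hd hne
    by_contra hc
    have h1 := prod_odd_ne_zero (right_ne_zero_of_mul hc)
    exact hne (Finsupp.ext fun i => eq_one_of_odd_of_sum h1 (sum_eq_of_mem_support hP hd).le i)
  · intro h
    rw [MvPolynomial.notMem_support_iff.mp h, zero_mul]

/-- The exponent `(2, 1, …, 1)`. -/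
def twoOnes (n : ℕ) : Fin (n + 1) →₀ ℕ := Finsupp.equivFunOnFinite.symm (Fin.cons 2 fun _ => 1)

@[simp] theorem twoOnes_zero (n : ℕ) : twoOnes n 0 = 2 := rfl
@[simp] theorem twoOnes_succ (n : ℕ) (i : Fin n) : twoOnes n i.succ = 1 := rfl

theorem oddPart_eval_cons_add {n : ℕ} {K : MvPolynomial (Fin (n + 1)) ℂ}
    (hK : K.IsHomogeneous (n + 2)) :
    oddPart (n + 2) (fun v => MvPolynomial.eval
      (Fin.cons (v 0 + v 1) fun k => v k.succ.succ : Fin (n + 1) → ℂ) K) =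
      2 * K.coeff (twoOnes n) := by
  have h1 : ∀ d : Fin (n + 1) →₀ ℕ, oddPart (n + 2)
      (fun v => (v 0 + v 1) ^ d 0 * ∏ k : Fin n, v k.succ.succ ^ d k.succ) =
      (2 ^ d 0 + (-2) ^ d 0 - 2 * 0 ^ d 0) / 4 * ∏ k : Fin n, ((1 - (-1) ^ d k.succ) / 2) := by
    intro d
    simp only [oddPart, Fin.cons_zero, Fin.cons_succ, Fin.cons_one, oddPart_const_mul,
      oddPart_prod_pow]
    norm_num
    ring
  simp only [MvPolynomial.eval_eq']
  rw [oddPart_sum]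
  simp only [oddPart_const_mul, Fin.prod_univ_succ, Fin.cons_zero, Fin.cons_succ, h1]
  rw [Finset.sum_eq_single (twoOnes n)]
  · rw [prod_odd_eq_one (by simp)]
    simp only [twoOnes_zero]
    ring
  · intro d hd hne
    by_contra hc
    have h2 := prod_odd_ne_zero (right_ne_zero_of_mul (right_ne_zero_of_mul hc))
    have h3 := sum_eq_of_mem_support hK hd
    rw [Fin.sum_univ_succ] at h3
    have h4 : n ≤ ∑ i : Fin n, d i.succ := by
      simpa using Finset.sum_le_sum (s := Finset.univ) (f := fun _ : Fin n => 1)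
        (g := fun i => d i.succ) fun i _ => (h2 i).pos
    have h5 : d 0 = 0 ∨ d 0 = 1 ∨ d 0 = 2 := by omega
    rcases h5 with h5 | h5 | h5
    · exact hc (by rw [h5]; norm_num)
    · exact hc (by rw [h5]; norm_num)
    · refine hne (Finsupp.ext (Fin.cases h5 fun i => ?_))
      exact eq_one_of_odd_of_sum h2 (by omega) i
  · intro h
    rw [MvPolynomial.notMem_support_iff.mp h, zero_mul]

/-- Coefficients of a polynomial restricted to a coordinate hyperplane. -/
theorem coeff_eq_of_eval_insertNth {n : ℕ} (i : Fin (n + 1)) {P : MvPolynomial (Fin (n + 1)) ℂ}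
    {Q : MvPolynomial (Fin n) ℂ}
    (h : ∀ v : Fin n → ℂ, MvPolynomial.eval (i.insertNth 0 v : Fin (n + 1) → ℂ) P =
      MvPolynomial.eval v Q) {d : Fin (n + 1) →₀ ℕ} {d' : Fin n →₀ ℕ} (hd : d i = 0)
    (hd' : ∀ k, d (i.succAbove k) = d' k) : P.coeff d = Q.coeff d' := by
  set r : MvPolynomial (Fin (n + 1)) ℂ →ₐ[ℂ] MvPolynomial (Fin n) ℂ :=
    MvPolynomial.aeval (i.insertNth 0 MvPolynomial.X) with hr
  have h1 : ∀ R v, MvPolynomial.eval v (r R) =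
      MvPolynomial.eval (i.insertNth 0 v : Fin (n + 1) → ℂ) R := by
    intro R v
    induction R using MvPolynomial.induction_on with
    | C c => simp [hr]
    | add p q hp hq => simp [hp, hq]
    | mul_X p j hp =>
      rw [map_mul, map_mul, map_mul, hp]
      congr 1
      simp only [hr, MvPolynomial.aeval_X, MvPolynomial.eval_X]
      refine Fin.succAboveCases i ?_ (fun k => ?_) j <;> simp
  have h2 : r P = Q := MvPolynomial.funext fun v => by rw [h1, h]
  rw [← h2]
  clear h h2
  induction P using MvPolynomial.induction_on' with
  | monomial u c =>
    have h3 : r (MvPolynomial.monomial u c) = if u i = 0 then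
        MvPolynomial.monomial (Finsupp.equivFunOnFinite.symm fun k => u (i.succAbove k)) c else 0 := by
      refine MvPolynomial.funext fun v => ?_
      rw [h1, MvPolynomial.eval_monomial, Finsupp.prod_fintype _ _ (by simp),
        Fin.prod_univ_succAbove _ i]
      split_ifs with h0
      · rw [MvPolynomial.eval_monomial, Finsupp.prod_fintype _ _ (by simp)]
        simp [h0]
      · simp [h0]
    rw [h3, MvPolynomial.coeff_monomial]
    split_ifs with e1 e2 e2
    · rw [MvPolynomial.coeff_monomial, if_pos]
      ext k
      simp [e1, hd']
    · exact absurd (by rw [e1]; exact hd) e2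
    · rw [MvPolynomial.coeff_monomial, if_neg]
      intro h4
      refine e1 (Finsupp.ext ((Fin.forall_iff_succAbove i).mpr ⟨by rw [e2, hd], fun k => ?_⟩))
      rw [hd', ← h4]
      rfl
    · simp
  | add p q hp hq => simp [hp, hq]

/-! ### The merging limit -/

/-- Cauchy's estimate for the leading coefficient. -/
theorem norm_mul_pow_le_of_tendsto {d : ℂ → ℂ} {R B : ℝ} (hR : 0 < R)
    (hd : DifferentiableOn ℂ d (Metric.closedBall 0 R))
    (hB : ∀ s, ‖s‖ = R → ‖d s‖ ≤ B) {N : ℕ} {L : ℂ}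
    (hL : Tendsto (fun s : ℂ => d s / s ^ N) (𝓝[≠] 0) (𝓝 L)) : ‖L‖ * R ^ N ≤ B := by
  set R' : NNReal := ⟨R, hR.le⟩ with hR'
  have hp : HasFPowerSeriesOnBall d (cauchyPowerSeries d 0 R) 0 R' :=
    DifferentiableOn.hasFPowerSeriesOnBall (R := R') hd hR
  have h1 := (coeff_eq_of_tendsto_div_pow hp.hasFPowerSeriesAt (v := (1 : ℂ)) (N := N) (c := L)
    (by simpa using hL)).2
  have h2 : ‖L‖ ≤ ‖cauchyPowerSeries d 0 R N‖ := by
    rw [← h1]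
    exact (ContinuousMultilinearMap.le_opNorm _ _).trans (by simp)
  have h3 : ∫ θ : ℝ in 0..2 * Real.pi, ‖d (circleMap 0 R θ)‖ ≤ 2 * Real.pi * B := by
    have h4 : ∀ θ : ℝ, ‖circleMap 0 R θ‖ = R := fun θ => by simp [abs_of_pos hR]
    have h5 := intervalIntegral.norm_integral_le_of_norm_le_const (a := 0) (b := 2 * Real.pi)
      (f := fun θ : ℝ => ‖d (circleMap 0 R θ)‖) (C := B)
      (fun θ _ => by rw [norm_norm]; exact hB _ (h4 θ))
    have h6 := (le_abs_self _).trans h5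
    rw [sub_zero, abs_of_pos Real.two_pi_pos] at h6
    linarith
  have h7 := h2.trans (norm_cauchyPowerSeries_le d 0 R N)
  rw [abs_of_pos hR, inv_pow] at h7
  have h8 := Real.two_pi_pos
  calc ‖L‖ * R ^ N ≤ (2 * Real.pi)⁻¹ * (2 * Real.pi * B) * (R ^ N)⁻¹ * R ^ N := by
        gcongr
        exact h7.trans (by gcongr)
    _ = B := by field_simp

theorem eval_smul_of_isHomogeneous {n k : ℕ} {P : MvPolynomial (Fin n) ℂ} (hP : P.IsHomogeneous k)
    (s : ℂ) (v : Fin n → ℂ) :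
    MvPolynomial.eval (s • v) P = s ^ k * MvPolynomial.eval v P := by
  rw [MvPolynomial.eval_eq', MvPolynomial.eval_eq', Finset.mul_sum]
  refine Finset.sum_congr rfl fun d hd => ?_
  simp only [Pi.smul_apply, smul_eq_mul, mul_pow, Finset.prod_mul_distrib]
  rw [Finset.prod_pow_eq_pow_sum, sum_eq_of_mem_support hP hd]
  ring

variable {a : ℝ} {F : ∀ n : ℕ, (Fin n → ℂ) → ℂ} {V : Set ℂ} {n : ℕ} {c : ℂ} {B : Fin n → ℂ}

theorem mergeForm_smul {P : MvPolynomial (Fin (n + 1)) ℂ} (hP : P.IsHomogeneous (n + 1)) (s : ℂ)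
    (v : Fin (n + 2) → ℂ) : mergeForm a c B P (s • v) = s ^ (n + 2) * mergeForm a c B P v := by
  have h1 : (Fin.cons ((s • v) 0 + (s • v) 1) fun k => (s • v) k.succ.succ : Fin (n + 1) → ℂ) =
      s • (Fin.cons (v 0 + v 1) fun k => v k.succ.succ : Fin (n + 1) → ℂ) := by
    ext k
    refine Fin.cases ?_ (fun k => ?_) k
    · simp [mul_add]
    · simp
  rw [mergeForm, mergeForm, h1, eval_smul_of_isHomogeneous hP]
  have h2 : ∑ k, phi a (c - B k) * (s • v) k.succ.succ =
      s * ∑ k, phi a (c - B k) * v k.succ.succ := by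
    rw [Finset.mul_sum]
    exact Finset.sum_congr rfl fun k _ => by simp only [Pi.smul_apply, smul_eq_mul]; ring
  rw [h2]
  simp only [Pi.smul_apply, smul_eq_mul]
  ring

end

section

variable {a : ℝ} {F : ∀ n : ℕ, (Fin n → ℂ) → ℂ} {V : Set ℂ} {n : ℕ} {c : ℂ} {B : Fin n → ℂ}

theorem dbl_add_single (y : ℂ) : dbl c B + (y - c) • Pi.single 1 1 =
    (Fin.cons c (Fin.cons y B : Fin (n + 1) → ℂ) : Fin (n + 2) → ℂ) := by
  ext k
  refine Fin.cases ?_ (fun k => Fin.cases ?_ (fun k => ?_) k) k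
  · simp
  · simp
  · have h1 : k.succ.succ ≠ (1 : Fin (n + 2)) := by simp [Fin.ext_iff]
    simp [h1]

/-- Limit of the leading form when two rapidities merge. The numerator at `(c, y, B)` is compared
on the circle `|s| = |y - c|` with the leading form of the numerator at `(c, c, B)`. -/
theorem tendsto_eval_merge (hF : IsFormFactorFamily a F) (hV : Admissible a V)
    (h : Distinct V (Fin.cons c B : Fin (n + 1) → ℂ)) {P : MvPolynomial (Fin (n + 1)) ℂ}
    (hP : HasLead a F (Fin.cons c B : Fin (n + 1) → ℂ) P)
    {Py : ℂ → MvPolynomial (Fin (n + 2)) ℂ} {l : Filter ℂ} (hl : l ≤ 𝓝[≠] c)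
    (hPy : ∀ᶠ y in l, Distinct V (Fin.cons c (Fin.cons y B : Fin (n + 1) → ℂ) : Fin (n + 2) → ℂ) ∧
      HasLead a F (Fin.cons c (Fin.cons y B : Fin (n + 1) → ℂ)) (Py y)) {v : Fin (n + 2) → ℂ}
    (hv : ∀ i, v i ≠ 0) :
    Tendsto (fun y => MvPolynomial.eval v (Py y)) l (𝓝 (mergeForm a c B P v)) := by
  obtain ⟨M, hM⟩ := exists_isNumerator hF hV (dbl_mem h)
  obtain ⟨p, hp⟩ := hM.analyticAt_lineFun
  obtain ⟨hlow, htop⟩ := hM.coeff_dbl hF hV h hp hP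
  set g := lineFun (dbl c B) M with hg
  set e : Fin (n + 2) → ℂ := Pi.single 1 1 with he
  set m := mergeForm a c B P v with hm
  have hpart : ∀ z, p.partialSum (n + 5) z = dblForm a c B P z := by
    intro z
    rw [FormalMultilinearSeries.partialSum, Finset.sum_range_succ,
      Finset.sum_eq_zero (fun k hk => hlow k (Finset.mem_range.mp hk) z), zero_add, htop]
  obtain ⟨C, hC, hb⟩ := (hp.isBigO_sub_partialSum_pow (n + 5)).exists_pos
  obtain ⟨ρ, hρ, hball⟩ := Metric.eventually_nhds_iff_ball.mp
    (hb.bound.and hM.analyticAt_lineFun.eventually_analyticAt)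
  set K : ℝ := max ‖v‖ 1 with hK
  have hK1 : 1 ≤ K := le_max_right _ _
  have hform : ∀ s δ : ℂ, dblForm a c B P (s • v, δ • e) =
      s ^ (n + 2) * (m * (s * (v 0 - v 1) - δ) * δ) := by
    intro s δ
    simp only [dblForm, mergeForm_smul hP.homogeneous]
    simp [he]
    ring
  have hlc : l ≤ 𝓝 c := hl.trans nhdsWithin_le_nhds
  have hsmall : ∀ᶠ y in l, ‖y - c‖ * K < ρ := by
    have h1 : Continuous fun y : ℂ => ‖y - c‖ * K := by fun_prop
    have h2 := h1.tendsto c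
    simp only [sub_self, norm_zero, zero_mul] at h2
    exact hlc (h2.eventually (gt_mem_nhds hρ))
  have hnear : ∀ᶠ y in l, ∀ᶠ q in 𝓝 (dbl c B + (y - c) • e, dbl c B + (y - c) • e),
      DG a q.1 q.2 → normFF a F (n + 2) q.1 q.2 *
        ∏ q' ∈ coinc (dbl c B), (2 * Complex.sinh ((q.1 q'.1 - q.2 q'.2) / 2)) = M q := by
    have h1 : Continuous fun y : ℂ => (dbl c B + (y - c) • e, dbl c B + (y - c) • e) := by fun_prop
    have h2 := h1.tendsto c
    simp only [sub_self, zero_smul, add_zero] at h2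
    exact hlc (h2.eventually (eventually_eventually_nhds.mpr hM.eventually_eq))
  set q : ℂ → ℂ := fun y => 2 * Complex.sinh ((y - c) / 2) with hq
  -- the value of the form at `(c, y, B)` up to an error of third order
  have hmain : ∀ᶠ y in l, ‖m * (y - c) ^ 2 - MvPolynomial.eval v (Py y) * q y ^ 2‖ ≤
      C * K ^ (n + 5) * ‖y - c‖ ^ 3 := by
    filter_upwards [hPy, hsmall, hnear, hl self_mem_nhdsWithin] with y hy hys hyn hyc
    set δ := y - c with hδ
    have hδ0 : δ ≠ 0 := sub_ne_zero.mpr hyc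
    have hδp : 0 < ‖δ‖ := norm_pos_iff.mpr hδ0
    set d : ℂ → ℂ := fun s => g (s • v, δ • e) - dblForm a c B P (s • v, δ • e) with hd
    have hmem : ∀ s : ℂ, ‖s‖ ≤ ‖δ‖ → ‖(s • v, δ • e)‖ ≤ ‖δ‖ * K := by
      intro s hs
      rw [Prod.norm_def, max_le_iff, norm_smul, norm_smul]
      refine ⟨mul_le_mul hs (le_max_left _ _) (norm_nonneg _) hδp.le, ?_⟩
      refine mul_le_mul_of_nonneg_left ?_ hδp.le
      rw [he, Pi.norm_single, norm_one]
      exact hK1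
    have hbound : ∀ s, ‖s‖ = ‖δ‖ → ‖d s‖ ≤ C * (‖δ‖ * K) ^ (n + 5) := by
      intro s hs
      have h1 := hmem s hs.le
      have h2 := (hball (s • v, δ • e) (by
        rw [mem_ball_zero_iff]; exact h1.trans_lt hys)).1
      rw [zero_add, hpart, norm_pow, norm_norm] at h2
      exact h2.trans (by gcongr)
    have hdiff : DifferentiableOn ℂ d (Metric.closedBall 0 ‖δ‖) := by
      intro s hs
      have h1 := hmem s (by simpa using hs)
      have h2 := (hball (s • v, δ • e) (by
        rw [mem_ball_zero_iff]; exact h1.trans_lt hys)).2.differentiableAt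
      have h3 : DifferentiableAt ℂ (fun s : ℂ => (s • v, δ • e)) s := by fun_prop
      have h4 : DifferentiableAt ℂ (fun s => dblForm a c B P (s • v, δ • e)) s := by
        simp only [hform]
        fun_prop
      exact ((DifferentiableAt.comp s h2 h3).sub h4).differentiableWithinAt
    -- the behaviour of `d` at `s = 0` is that of the numerator at the configuration `(c, y, B)`, since
    -- the two factors `sinh` which join `c` and `y` do not vanish there
    have hlim : Tendsto (fun s : ℂ => d s / s ^ (n + 2)) (𝓝[≠] 0)
        (𝓝 (m * δ ^ 2 - MvPolynomial.eval v (Py y) * q y ^ 2)) := by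
      have hθ : dbl c B + δ • e =
        (Fin.cons c (Fin.cons y B : Fin (n + 1) → ℂ) : Fin (n + 2) → ℂ) := dbl_add_single y
      rw [← hθ] at hy
      obtain ⟨hyd, hyP⟩ := hy
      have h1 := hyP.tendsto v 0 hv
      have h2 := tendsto_prod_sinh_line (v := v) (w := 0) (subset_refl (coinc (dbl c B + δ • e)))
      simp only [Pi.zero_apply, add_zero, sub_zero] at h2
      rw [prod_coinc_of_injective hyd.2, card_coinc_of_injective hyd.2] at h2
      have h3 : Tendsto (fun s : ℂ => 2 * Complex.sinh ((c + s * v 0 - y) / 2) *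
          (2 * Complex.sinh ((y + s * v 1 - c) / 2))) (𝓝[≠] 0) (𝓝 (-q y * q y)) := by
        have h4 : Continuous fun s : ℂ => 2 * Complex.sinh ((c + s * v 0 - y) / 2) *
          (2 * Complex.sinh ((y + s * v 1 - c) / 2)) := by fun_prop
        have h5 := (h4.tendsto 0).mono_left (nhdsWithin_le_nhds (s := {0}ᶜ))
        refine h5.trans_eq ?_
        rw [hq]
        simp only [zero_mul, add_zero]
        rw [show (c - y) / 2 = -((y - c) / 2) by ring, Complex.sinh_neg]
        congr 1
        ring
      have h6 : Tendsto (fun s : ℂ => m * (s * (v 0 - v 1) - δ) * δ) (𝓝[≠] 0)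
          (𝓝 (m * (0 * (v 0 - v 1) - δ) * δ)) := by
        have h7 : Continuous fun s : ℂ => m * (s * (v 0 - v 1) - δ) * δ := by fun_prop
        exact (h7.tendsto 0).mono_left nhdsWithin_le_nhds
      have h8 := ((h1.mul h2).mul h3).sub h6
      have hv0 : ∏ i, v i ≠ 0 := Finset.prod_ne_zero_iff.mpr fun i _ => hv i
      rw [div_mul_cancel₀ _ hv0] at h8
      have h9 : MvPolynomial.eval v (Py y) * (-q y * q y) - m * (0 * (v 0 - v 1) - δ) * δ =
        m * δ ^ 2 - MvPolynomial.eval v (Py y) * q y ^ 2 := by ring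
      rw [h9] at h8
      refine h8.congr' ?_
      have hdg := (lineGeneric_of_injective (w := 0) hyd.2 hv).eventually_dg hV hyd.1
      filter_upwards [hdg, (tendsto_line (dbl c B + δ • e) v 0).eventually hyn, self_mem_nhdsWithin]
        with s f1 f2 hs
      have hs' : s ≠ 0 := hs
      have f3 := f2 f1
      have f4 : g (s • v, δ • e) =
          M (dbl c B + δ • e + s • (v + 0), dbl c B + δ • e + s • (0 : Fin (n + 2) → ℂ)) := by
        simp only [hg, lineFun]
        congr 2
        · rw [add_zero]; abel
        · simp
      simp only [hd, hform, f4]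
      rw [← f3, prod_coinc_dbl h, prod_coinc_of_injective hyd.2, Fin.prod_univ_succ,
        Fin.prod_univ_succ, hθ]
      simp only [Pi.add_apply, Pi.smul_apply, smul_eq_mul, Pi.zero_apply, mul_zero, add_zero,
        Fin.cons_zero, Fin.cons_one, Fin.cons_succ, Fin.succ_zero_eq_one]
      field_simp
    have h1 := norm_mul_pow_le_of_tendsto hδp hdiff hbound hlim
    have h2 : (0 : ℝ) < ‖δ‖ ^ (n + 2) := pow_pos hδp _
    refine le_of_mul_le_mul_right (h1.trans_eq ?_) h2
    rw [mul_pow]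
    ring
  have hq1 : Tendsto (fun y => q y / (y - c)) l (𝓝 1) := by
    have h1 := tendsto_two_sinh_half_div (x := 1)
    have h2 : Tendsto (fun y : ℂ => y - c) (𝓝[≠] c) (𝓝[≠] 0) := by
      refine tendsto_nhdsWithin_iff.mpr ⟨?_, ?_⟩
      · have : Continuous fun y : ℂ => y - c := by fun_prop
        simpa using (this.tendsto c).mono_left nhdsWithin_le_nhds
      · filter_upwards [self_mem_nhdsWithin] with z hz
        exact sub_ne_zero.mpr hz
    have h3 := (h1.comp h2).mono_left hl
    simpa [Function.comp_def] using h3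
  have hEq : Tendsto (fun y => MvPolynomial.eval v (Py y) * (q y / (y - c)) ^ 2) l (𝓝 m) := by
    rw [tendsto_iff_norm_sub_tendsto_zero]
    have h1 : Tendsto (fun y : ℂ => C * K ^ (n + 5) * ‖y - c‖) l (𝓝 0) := by
      have h2 : Continuous fun y : ℂ => C * K ^ (n + 5) * ‖y - c‖ := by fun_prop
      have h3 := h2.tendsto c
      simp only [sub_self, norm_zero, mul_zero] at h3
      exact h3.mono_left hlc
    refine squeeze_zero' (Eventually.of_forall fun y => norm_nonneg _) ?_ h1
    filter_upwards [hmain, hl self_mem_nhdsWithin] with y hy hyc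
    have hδ0 : y - c ≠ 0 := sub_ne_zero.mpr hyc
    have hδp : 0 < ‖y - c‖ := norm_pos_iff.mpr hδ0
    have h4 : MvPolynomial.eval v (Py y) * (q y / (y - c)) ^ 2 - m =
        -(m * (y - c) ^ 2 - MvPolynomial.eval v (Py y) * q y ^ 2) / (y - c) ^ 2 := by
      field_simp
      ring
    rw [h4, norm_div, norm_neg, norm_pow, div_le_iff₀ (by positivity)]
    exact hy.trans_eq (by ring)
  have h1 := hEq.div (hq1.pow 2) (by norm_num)
  rw [one_pow, div_one] at h1
  refine h1.congr' ?_
  filter_upwards [hq1.eventually_ne one_ne_zero] with y hy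
  rw [Pi.div_apply, mul_div_cancel_right₀ _ (pow_ne_zero 2 hy)]

/-- Half the limit of the connected form factor as a further rapidity merges with `c`, with the
outermost kernel evaluated at `x` instead of `c`: a sum over chains of kernels from `x` to `c`. -/
def mergeWt (a : ℝ) (F : ∀ n : ℕ, (Fin n → ℂ) → ℂ) (c : ℂ) : (n : ℕ) → ℂ → (Fin n → ℂ) → ℂ
  | 0, x, B => phi a (x - c) * connectedFF a F 1 (Fin.cons c B)
  | n + 1, x, B => phi a (x - c) * connectedFF a F (n + 2) (Fin.cons c B) +
      ∑ k, phi a (x - B k) * mergeWt a F c n (B k) (B ∘ k.succAbove)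

/-- The polynomial `(φ(x - c) u + ∑ φ(x - B_k) v_k) P(u, v)`. -/
def chainPoly (a : ℝ) (c x : ℂ) (B : Fin n → ℂ) (P : MvPolynomial (Fin (n + 1)) ℂ) :
    MvPolynomial (Fin (n + 1)) ℂ :=
  (MvPolynomial.C (phi a (x - c)) * MvPolynomial.X 0 +
    ∑ k, MvPolynomial.C (phi a (x - B k)) * MvPolynomial.X k.succ) * P

theorem isHomogeneous_chainPoly {P : MvPolynomial (Fin (n + 1)) ℂ} (hP : P.IsHomogeneous (n + 1))
    (x : ℂ) : (chainPoly a c x B P).IsHomogeneous (n + 2) := by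
  rw [show n + 2 = 1 + (n + 1) by ring]
  exact ((MvPolynomial.isHomogeneous_C_mul_X _ _).add (MvPolynomial.IsHomogeneous.sum _ _ _
    fun k _ => MvPolynomial.isHomogeneous_C_mul_X _ _)).mul hP

theorem eval_chainPoly {P : MvPolynomial (Fin (n + 1)) ℂ} (x : ℂ) (v : Fin (n + 1) → ℂ) :
    MvPolynomial.eval v (chainPoly a c x B P) =
      (phi a (x - c) * v 0 + ∑ k, phi a (x - B k) * v k.succ) * MvPolynomial.eval v P := by
  simp [chainPoly]

theorem coeff_chainPoly {P : MvPolynomial (Fin (n + 1)) ℂ} (x : ℂ) :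
    (chainPoly a c x B P).coeff (twoOnes n) = phi a (x - c) * P.coeff (ones (n + 1)) +
      ∑ k, phi a (x - B k) * P.coeff (twoOnes n - Finsupp.single k.succ 1) := by
  simp only [chainPoly, add_mul, Finset.sum_mul, MvPolynomial.coeff_add, MvPolynomial.coeff_sum,
    mul_assoc, MvPolynomial.coeff_C_mul, MvPolynomial.coeff_X_mul']
  congr 1
  · rw [if_pos (by simp)]
    congr 2
    ext i
    refine Fin.cases ?_ (fun i => ?_) i
    · simp
    · simp [Fin.succ_ne_zero]
  · refine Finset.sum_congr rfl fun k _ => ?_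
    rw [if_pos (by simp)]

/-- The recursion for the leading forms, applied to the rapidity `B_k` reached first, is the recursion
that defines `mergeWt`. -/
theorem coeff_chainPoly_eq_mergeWt (hF : IsFormFactorFamily a F) (hV : Admissible a V) :
    ∀ {n : ℕ} {B : Fin n → ℂ} (_ : Distinct V (Fin.cons c B : Fin (n + 1) → ℂ))
    {P : MvPolynomial (Fin (n + 1)) ℂ} (_ : HasLead a F (Fin.cons c B : Fin (n + 1) → ℂ) P) (x : ℂ),
    (chainPoly a c x B P).coeff (twoOnes n) = mergeWt a F c n x B := by
  intro n
  induction n with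
  | zero =>
    intro B h P hP x
    rw [coeff_chainPoly, mergeWt, hP.connectedFF_eq hF hV h]
    simp
  | succ n ih =>
    intro B h P hP x
    rw [coeff_chainPoly, mergeWt, hP.connectedFF_eq hF hV h]
    congr 1
    refine Finset.sum_congr rfl fun k _ => ?_
    congr 1
    have h' : Distinct V (Fin.cons c (B ∘ k.succAbove) : Fin (n + 1) → ℂ) := by
      rw [← cons_comp_succAbove]
      exact h.comp Fin.succAbove_right_injective
    obtain ⟨P', hP'⟩ := exists_hasLead hF hV h'
    rw [← ih h' hP' (B k)]
    have hP'' : HasLead a F ((Fin.cons c B : Fin (n + 2) → ℂ) ∘ k.succ.succAbove) P' := by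
      rw [cons_comp_succAbove]; exact hP'
    refine coeff_eq_of_eval_insertNth k.succ (fun v => ?_) ?_ fun j => ?_
    · rw [hP.eval_eq hF hV h hP'' (i := k.succ) (by simp), eval_chainPoly]
      congr 1
      · simp [Fin.sum_univ_succ]
      · refine congrArg (fun f => MvPolynomial.eval f P') (funext fun R => ?_)
        simp
    · simp
    · refine Fin.cases ?_ (fun j => ?_) j
      · simp [(Fin.succ_ne_zero k).symm]
      · rw [Fin.succ_succAbove_succ]
        simp

/-- The merging limit of the connected form factors. -/
theorem tendsto_connectedFF_merge (hF : IsFormFactorFamily a F) (hV : Admissible a V)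
    (h : Distinct V (Fin.cons c B : Fin (n + 1) → ℂ)) {l : Filter ℂ} (hl : l ≤ 𝓝[≠] c)
    (hlV : ∀ᶠ y in l, y ∈ V) :
    Tendsto (fun y => connectedFF a F (n + 2) (Fin.cons c (Fin.cons y B : Fin (n + 1) → ℂ))) l
      (𝓝 (2 * mergeWt a F c n c B)) := by
  obtain ⟨P, hP⟩ := exists_hasLead hF hV h
  have hne : ∀ᶠ y in l, ∀ k, y ≠ B k :=
    eventually_all.mpr fun k => (hl.trans nhdsWithin_le_nhds)
      (isOpen_ne.mem_nhds (h.ne_head k))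
  have hdist : ∀ᶠ y in l,
      Distinct V (Fin.cons c (Fin.cons y B : Fin (n + 1) → ℂ) : Fin (n + 2) → ℂ) := by
    filter_upwards [hne, hlV, hl self_mem_nhdsWithin] with y h1 h2 h3
    refine ⟨Fin.cases (h.1 0) (Fin.cases h2 fun k => h.1 k.succ), ?_⟩
    rw [Fin.cons_injective_iff, Fin.cons_injective_iff]
    refine ⟨?_, ?_, h.tail.2⟩
    · rintro ⟨k, hk⟩
      revert hk
      refine Fin.cases (fun hk => h3 hk) (fun k hk => h.ne_head k hk.symm) k
    · rintro ⟨k, hk⟩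
      exact h1 k hk.symm
  have hex : ∀ y, ∃ Q, Distinct V (Fin.cons c (Fin.cons y B : Fin (n + 1) → ℂ) : Fin (n + 2) → ℂ) →
      HasLead a F (Fin.cons c (Fin.cons y B : Fin (n + 1) → ℂ)) Q := by
    intro y
    by_cases hy : Distinct V (Fin.cons c (Fin.cons y B : Fin (n + 1) → ℂ) : Fin (n + 2) → ℂ)
    · obtain ⟨Q, hQ⟩ := exists_hasLead hF hV hy
      exact ⟨Q, fun _ => hQ⟩
    · exact ⟨0, fun h => absurd h hy⟩
  choose Py hPy using hex
  -- the multilinear coefficient is an average of values at points without vanishing coordinates,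
  -- where the limit of the leading forms is known
  have h1 := tendsto_oddPart (n + 2) (fun y v => MvPolynomial.eval v (Py y))
    (mergeForm a c B P) fun v hv => tendsto_eval_merge hF hV h hP hl
      (hdist.mono fun y hy => ⟨hy, hPy y hy⟩) hv
  have h2 : oddPart (n + 2) (mergeForm a c B P) = 2 * mergeWt a F c n c B := by
    rw [← coeff_chainPoly_eq_mergeWt hF hV h hP c,
      ← oddPart_eval_cons_add (isHomogeneous_chainPoly hP.homogeneous c)]
    congr 1
    ext v
    rw [eval_chainPoly, mergeForm]
    simp
  rw [h2] at h1
  refine h1.congr' (hdist.mono fun y hy => ?_)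
  rw [oddPart_eval (hPy y hy).homogeneous, ← (hPy y hy).connectedFF_eq hF hV hy]

end

/-! ### The kernel `φ` -/

section

theorem phi_eq (a : ℝ) (z : ℂ) :
    phi a z = 2 * (Real.sin (Real.pi * a) : ℂ) * Complex.cosh z / tau a z := by
  set s : ℂ := (Real.sin (Real.pi * a) : ℂ) with hs
  by_cases h : tau a z = 0
  · rw [h, div_zero, phi, logDeriv_apply]
    rcases mul_eq_zero.mp (neg_eq_zero.mp ((tau_eq a z).symm.trans h)) with h1 | h1 <;>
      simp [S_eq, h1]
  · have h1 : sgm a z ≠ 0 := sgm_ne_zero h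
    have h2 : sgm a (-z) ≠ 0 := sgm_ne_zero (by rwa [tau_neg])
    have hd : HasDerivAt (S a) ((Complex.cosh z * (Complex.sinh z + Complex.I * s) -
        (Complex.sinh z - Complex.I * s) * Complex.cosh z) / (Complex.sinh z + Complex.I * s) ^ 2)
        z := ((Complex.hasDerivAt_sinh z).sub_const _).fun_div
          ((Complex.hasDerivAt_sinh z).add_const _) h1
    have h1' : Complex.sinh z + Complex.I * s ≠ 0 := h1
    have h2' : Complex.sinh z - Complex.I * s ≠ 0 := by
      intro h0
      apply h2
      simp only [sgm, Complex.sinh_neg]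
      linear_combination -h0
    have h3 : tau a z = (Complex.sinh z + Complex.I * s) * (Complex.sinh z - Complex.I * s) := by
      rw [tau, ← hs]
      linear_combination s ^ 2 * Complex.I_sq
    rw [phi, logDeriv_apply, hd.deriv, h3, S, ← hs,
      show ∀ C p q : ℂ, C * p - q * C = C * (p - q) by intros; ring,
      show Complex.sinh z + Complex.I * s - (Complex.sinh z - Complex.I * s) =
        2 * Complex.I * s by ring]
    generalize Complex.sinh z + Complex.I * s = p at *
    generalize Complex.sinh z - Complex.I * s = q at *
    field_simp
    linear_combination (-Complex.cosh z * s) * Complex.I_sq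

theorem measurable_phi (a : ℝ) : Measurable (phi a) := by
  rw [show phi a = fun z => _ from funext (phi_eq a)]
  exact ((Complex.continuous_cosh.measurable.const_mul _)).div (continuous_tau a).measurable

theorem differentiableAt_phi {a : ℝ} {z : ℂ} (h : tau a z ≠ 0) : DifferentiableAt ℂ (phi a) z := by
  rw [show phi a = fun z => _ from funext (phi_eq a)]
  exact ((Complex.differentiable_cosh z).const_mul _).fun_div (differentiable_tau a z) h

/-- The horizontal strips of half-width `δ` around `Im z = 0` and `Im z = ±π/2`. -/
def strips (δ : ℝ) : Set ℂ :=
  {z | |z.im| ≤ δ ∨ |z.im - Real.pi / 2| ≤ δ ∨ |z.im + Real.pi / 2| ≤ δ}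

theorem normSq_sinh (z : ℂ) :
    ‖Complex.sinh z‖ ^ 2 = Real.sinh z.re ^ 2 + Real.sin z.im ^ 2 := by
  have h : Complex.sinh z = (Real.sinh z.re * Real.cos z.im : ℝ) +
      (Real.cosh z.re * Real.sin z.im : ℝ) * Complex.I := by
    conv_lhs => rw [← Complex.re_add_im z]
    rw [Complex.sinh_add, Complex.sinh_mul_I, Complex.cosh_mul_I]
    push_cast
    ring
  rw [h, Complex.sq_norm, Complex.normSq_add_mul_I]
  have h1 := Real.cosh_sq z.re
  have h2 := Real.sin_sq_add_cos_sq z.im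
  rw [mul_pow, mul_pow, h1]
  linear_combination Real.sinh z.re ^ 2 * h2

theorem norm_cosh_le (z : ℂ) : ‖Complex.cosh z‖ ≤ Real.cosh z.re := by
  rw [Complex.cosh, Real.cosh_eq, norm_div]
  have h := norm_add_le (Complex.exp z) (Complex.exp (-z))
  rw [Complex.norm_exp, Complex.norm_exp] at h
  simpa using (div_le_div_of_nonneg_right h (by norm_num : (0 : ℝ) ≤ 2))

theorem mul_cosh_le_norm_sinh {κ : ℝ} (h0 : 0 ≤ κ) {z : ℂ} (h : κ ≤ |Real.sin z.im|) :
    κ * Real.cosh z.re ≤ ‖Complex.sinh z‖ := by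
  have h1 : κ ^ 2 ≤ Real.sin z.im ^ 2 := by
    rw [← sq_abs (Real.sin z.im)]
    exact pow_le_pow_left₀ h0 h 2
  refine le_of_sq_le_sq ?_ (norm_nonneg _)
  rw [normSq_sinh, mul_pow, Real.cosh_sq]
  nlinarith [sq_nonneg (Real.sinh z.re), Real.sin_sq_le_one z.im]

theorem tau_eq_sinh_mul_sinh (a : ℝ) (z : ℂ) : tau a z =
    Complex.sinh (z + (Real.pi * a : ℝ) * Complex.I) *
      Complex.sinh (z - (Real.pi * a : ℝ) * Complex.I) := by
  rw [Complex.sinh_add, Complex.sinh_sub, Complex.sinh_mul_I, Complex.cosh_mul_I, tau,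
    Complex.ofReal_sin]
  have h1 := Complex.cosh_sq z
  have h2 := Complex.sin_sq_add_cos_sq ((Real.pi * a : ℝ) : ℂ)
  linear_combination (-Complex.sinh z ^ 2 ) * h2 + Complex.cosh z ^ 2 *
    Complex.sin ((Real.pi * a : ℝ) : ℂ) ^ 2 * Complex.I_sq -
    Complex.sin ((Real.pi * a : ℝ) : ℂ) ^ 2 * h1

theorem sq_mul_cosh_sq_le_norm_tau {a κ : ℝ} (h0 : 0 ≤ κ) {z : ℂ}
    (h1 : κ ≤ |Real.sin (z.im + Real.pi * a)|) (h2 : κ ≤ |Real.sin (z.im - Real.pi * a)|) :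
    κ ^ 2 * Real.cosh z.re ^ 2 ≤ ‖tau a z‖ := by
  rw [tau_eq_sinh_mul_sinh, norm_mul]
  have e1 : κ * Real.cosh z.re ≤ ‖Complex.sinh (z + (Real.pi * a : ℝ) * Complex.I)‖ := by
    simpa using mul_cosh_le_norm_sinh h0 (z := z + (Real.pi * a : ℝ) * Complex.I)
      (by simpa using h1)
  have e2 : κ * Real.cosh z.re ≤ ‖Complex.sinh (z - (Real.pi * a : ℝ) * Complex.I)‖ := by
    simpa using mul_cosh_le_norm_sinh h0 (z := z - (Real.pi * a : ℝ) * Complex.I)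
      (by simpa using h2)
  calc κ ^ 2 * Real.cosh z.re ^ 2 = (κ * Real.cosh z.re) * (κ * Real.cosh z.re) := by ring
    _ ≤ _ := mul_le_mul e1 e2 (mul_nonneg h0 (Real.cosh_pos _).le) (norm_nonneg _)

theorem sin_pi_mul_pos {a : ℝ} (ha₀ : 0 < a) (ha₁ : a < 1) : 0 < Real.sin (Real.pi * a) :=
  Real.sin_pos_of_pos_of_lt_pi (by positivity) (by nlinarith [Real.pi_pos])

theorem cos_pi_mul_ne_zero {a : ℝ} (ha₀ : 0 < a) (ha₁ : a < 1) (ha : a ≠ 1 / 2) :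
    Real.cos (Real.pi * a) ≠ 0 := by
  intro h
  apply ha
  have h1 : Real.pi * a = Real.pi / 2 := by
    refine Real.injOn_cos ⟨by positivity, by nlinarith [Real.pi_pos]⟩
      ⟨by positivity, by linarith [Real.pi_pos]⟩ ?_
    rw [h, Real.cos_pi_div_two]
  have h2 : Real.pi * (a - 1 / 2) = 0 := by linear_combination h1
  rcases mul_eq_zero.mp h2 with h3 | h3
  · exact absurd h3 Real.pi_ne_zero
  · linarith

theorem sin_pi_mul_lt_one {a : ℝ} (ha₀ : 0 < a) (ha₁ : a < 1) (ha : a ≠ 1 / 2) :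
    Real.sin (Real.pi * a) < 1 := by
  have h1 := cos_pi_mul_ne_zero ha₀ ha₁ ha
  have h2 := Real.sin_sq_add_cos_sq (Real.pi * a)
  have h3 : 0 < Real.cos (Real.pi * a) ^ 2 := by positivity
  nlinarith [Real.sin_le_one (Real.pi * a)]

/-- Around the three lines on which rapidity differences lie, the kernel has no poles and decays
like `1 / cosh`. For `Im z = ±π/2` this is where `a ≠ 1/2` enters. -/
theorem exists_strips_bound {a : ℝ} (ha₀ : 0 < a) (ha₁ : a < 1) (ha : a ≠ 1 / 2) :
    ∃ δ > 0, δ < 1 / 2 ∧ ∃ C > 0, ∀ z ∈ strips δ, tau a z ≠ 0 ∧ ‖phi a z‖ ≤ C / Real.cosh z.re := by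
  have hs := sin_pi_mul_pos ha₀ ha₁
  have hc := cos_pi_mul_ne_zero ha₀ ha₁ ha
  -- at `Im z = y` the denominator of the kernel vanishes only if `sin (y ± πa) = 0`
  have key : ∀ y₀ : ℝ, Real.sin (y₀ + Real.pi * a) ≠ 0 → Real.sin (y₀ - Real.pi * a) ≠ 0 →
      ∃ κ > 0, ∀ᶠ δ in 𝓝[>] (0 : ℝ), ∀ y, |y - y₀| ≤ δ →
        κ ≤ |Real.sin (y + Real.pi * a)| ∧ κ ≤ |Real.sin (y - Real.pi * a)| := by
    intro y₀ h1 h2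
    have h1' := abs_pos.mpr h1
    have h2' := abs_pos.mpr h2
    refine ⟨min |Real.sin (y₀ + Real.pi * a)| |Real.sin (y₀ - Real.pi * a)| / 2, by positivity, ?_⟩
    have h3 : ∀ᶠ y in 𝓝 y₀, min |Real.sin (y₀ + Real.pi * a)| |Real.sin (y₀ - Real.pi * a)| / 2 <
        min |Real.sin (y + Real.pi * a)| |Real.sin (y - Real.pi * a)| := by
      have hcont : Continuous fun y => min |Real.sin (y + Real.pi * a)| |Real.sin (y - Real.pi * a)| := by
        fun_prop
      exact hcont.continuousAt.eventually_const_lt (half_lt_self (by positivity))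
    obtain ⟨ρ, hρ, h4⟩ := Metric.eventually_nhds_iff.mp h3
    filter_upwards [Ioo_mem_nhdsGT hρ] with δ hδ y hy
    have h5 := h4 (y := y) (lt_of_le_of_lt (by simpa [Real.dist_eq] using hy) hδ.2)
    exact ⟨h5.le.trans (min_le_left _ _), h5.le.trans (min_le_right _ _)⟩
  obtain ⟨κ₀, hκ₀, h0⟩ := key 0 (by simpa using hs.ne') (by simpa using hs.ne')
  obtain ⟨κ₁, hκ₁, h1⟩ := key (Real.pi / 2)
    (by rw [add_comm, Real.sin_add_pi_div_two]; exact hc)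
    (by rw [Real.sin_pi_div_two_sub]; exact hc)
  obtain ⟨κ₂, hκ₂, h2⟩ := key (-(Real.pi / 2))
    (by rw [neg_add_eq_sub, ← neg_sub, Real.sin_neg, Real.sin_pi_div_two_sub]
        exact neg_ne_zero.mpr hc)
    (by rw [← neg_add', Real.sin_neg, add_comm, Real.sin_add_pi_div_two]
        exact neg_ne_zero.mpr hc)
  obtain ⟨δ, hδ⟩ := (h0.and (h1.and (h2.and (Ioo_mem_nhdsGT (by norm_num : (0 : ℝ) < 1 / 2))))).exists
  obtain ⟨g0, g1, g2, g3⟩ := hδ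
  set κ := min κ₀ (min κ₁ κ₂) with hκ
  have hκpos : 0 < κ := by positivity
  refine ⟨δ, g3.1, g3.2, 2 / κ ^ 2, by positivity, fun z hz => ?_⟩
  have h3 : κ ≤ |Real.sin (z.im + Real.pi * a)| ∧ κ ≤ |Real.sin (z.im - Real.pi * a)| := by
    rcases hz with hz | hz | hz
    · have := g0 z.im (by simpa using hz)
      exact ⟨(min_le_left _ _).trans this.1, (min_le_left _ _).trans this.2⟩
    · have := g1 z.im hz
      exact ⟨((min_le_right _ _).trans (min_le_left _ _)).trans this.1,
        ((min_le_right _ _).trans (min_le_left _ _)).trans this.2⟩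
    · have := g2 z.im (by simpa using hz)
      exact ⟨((min_le_right _ _).trans (min_le_right _ _)).trans this.1,
        ((min_le_right _ _).trans (min_le_right _ _)).trans this.2⟩
  have h4 := sq_mul_cosh_sq_le_norm_tau hκpos.le h3.1 h3.2
  have hch := Real.cosh_pos z.re
  have h5 : 0 < ‖tau a z‖ := lt_of_lt_of_le (by positivity) h4
  refine ⟨norm_pos_iff.mp h5, ?_⟩
  rw [phi_eq, norm_div, norm_mul, norm_mul, div_le_iff₀ h5, Complex.norm_real, Real.norm_eq_abs,
    abs_of_pos hs, Complex.norm_ofNat]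
  calc 2 * Real.sin (Real.pi * a) * ‖Complex.cosh z‖ ≤ 2 * 1 * Real.cosh z.re := by
        gcongr
        · exact Real.sin_le_one _
        · exact norm_cosh_le z
    _ = 2 / κ ^ 2 / Real.cosh z.re * (κ ^ 2 * Real.cosh z.re ^ 2) := by field_simp
    _ ≤ _ := by gcongr

/-- The kernel of the integral equation on the real line, normalized to total mass one. -/
def ker (a x : ℝ) : ℝ :=
  2 * Real.sin (Real.pi * a) * Real.cosh x /
    (Real.sinh x ^ 2 + Real.sin (Real.pi * a) ^ 2) / (2 * Real.pi)

theorem phi_ofReal (a x : ℝ) : phi a (x : ℂ) = ((2 * Real.pi * ker a x : ℝ) : ℂ) := by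
  have : (Real.pi : ℂ) ≠ 0 := by exact_mod_cast Real.pi_ne_zero
  rw [phi_eq, ker, tau]
  push_cast
  field_simp

theorem ker_neg (a x : ℝ) : ker a (-x) = ker a x := by simp [ker]

section
variable {a : ℝ} (hs : 0 < Real.sin (Real.pi * a))
include hs

theorem ker_pos (x : ℝ) : 0 < ker a x := by
  have := Real.cosh_pos x
  unfold ker
  positivity

theorem continuous_ker : Continuous (ker a) := by
  unfold ker
  refine ((continuous_const.mul Real.continuous_cosh).div₀ (by fun_prop) fun x => ?_).div_const _
  positivity

theorem ker_le (x : ℝ) : ker a x ≤ 1 / (Real.pi * Real.sin (Real.pi * a)) / Real.cosh x := by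
  have h1 := Real.cosh_pos x
  have h2 := Real.cosh_sq x
  have h3 : Real.sin (Real.pi * a) ^ 2 * Real.cosh x ^ 2 ≤
      Real.sinh x ^ 2 + Real.sin (Real.pi * a) ^ 2 := by
    nlinarith [sq_nonneg (Real.sinh x), Real.sin_sq_le_one (Real.pi * a)]
  have hpi := Real.pi_pos
  rw [ker, div_div, div_le_iff₀ (by positivity)]
  calc _ = 1 / (Real.pi * Real.sin (Real.pi * a)) / Real.cosh x *
        ((Real.sin (Real.pi * a) ^ 2 * Real.cosh x ^ 2) * (2 * Real.pi)) := by field_simp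
    _ ≤ _ := by gcongr

theorem le_ker (x : ℝ) : Real.sin (Real.pi * a) / Real.pi / Real.cosh x ≤ ker a x := by
  have h1 := Real.cosh_pos x
  have h2 := Real.cosh_sq x
  have h3 : Real.sinh x ^ 2 + Real.sin (Real.pi * a) ^ 2 ≤ Real.cosh x ^ 2 := by
    nlinarith [Real.sin_sq_le_one (Real.pi * a)]
  have hpi := Real.pi_pos
  rw [ker, div_div _ _ (2 * Real.pi), le_div_iff₀ (by positivity)]
  calc _ ≤ Real.sin (Real.pi * a) / Real.pi / Real.cosh x * (Real.cosh x ^ 2 * (2 * Real.pi)) := by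
        gcongr
    _ = _ := by field_simp

theorem hasDerivAt_arctan_sinh_div (x : ℝ) :
    HasDerivAt (fun x => Real.arctan (Real.sinh x / Real.sin (Real.pi * a)) / Real.pi) (ker a x) x := by
  have h1 := (((Real.hasDerivAt_sinh x).div_const (Real.sin (Real.pi * a))).arctan).div_const Real.pi
  refine h1.congr_deriv ?_
  rw [ker]
  have hpi := Real.pi_pos
  have h4 : 0 < Real.sin (Real.pi * a) ^ 2 + Real.sinh x ^ 2 := by positivity
  field_simp
  ring

theorem integrable_ker_and_integral : Integrable (ker a) ∧ ∫ x, ker a x = 1 := by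
  have hpi := Real.pi_pos
  have hsinh : Tendsto Real.sinh atTop atTop := by
    refine tendsto_atTop_mono' atTop ?_ tendsto_id
    filter_upwards [eventually_ge_atTop 0] with x hx using Real.self_le_sinh_iff.mpr hx
  have hsinh' : Tendsto Real.sinh atBot atBot := by
    have := tendsto_neg_atTop_atBot.comp (hsinh.comp tendsto_neg_atBot_atTop)
    refine this.congr fun x => by simp
  have hT : Tendsto (fun x => Real.arctan (Real.sinh x / Real.sin (Real.pi * a)) / Real.pi) atTop
      (𝓝 (1 / 2)) := by
    have h := ((Real.tendsto_arctan_atTop.mono_right nhdsWithin_le_nhds).comp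
      (hsinh.atTop_div_const hs)).div_const Real.pi
    refine h.trans_eq ?_
    congr 1
    field_simp
  have hB : Tendsto (fun x => Real.arctan (Real.sinh x / Real.sin (Real.pi * a)) / Real.pi) atBot
      (𝓝 (-(1 / 2))) := by
    have h := ((Real.tendsto_arctan_atBot.mono_right nhdsWithin_le_nhds).comp
      (hsinh'.atBot_div_const hs)).div_const Real.pi
    refine h.trans_eq ?_
    congr 1
    field_simp
  have hd := hasDerivAt_arctan_sinh_div hs
  have h1 : IntegrableOn (ker a) (Set.Ioi 0) :=
    integrableOn_Ioi_deriv_of_nonneg' (fun x _ => hd x) (fun x _ => (ker_pos hs x).le) hT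
  have h2 : IntegrableOn (ker a) (Set.Iic 0) := by
    rw [integrableOn_Iic_iff_integrableOn_Iio]
    simpa [ker_neg] using h1.comp_neg
  have h3 : Integrable (ker a) := by
    rw [← integrableOn_univ, ← Set.Iic_union_Ioi (a := (0 : ℝ))]
    exact h2.union h1
  refine ⟨h3, ?_⟩
  rw [integral_of_hasDerivAt_of_tendsto hd h3 hB hT]
  norm_num

theorem integrable_ker : Integrable (ker a) := (integrable_ker_and_integral hs).1

theorem integral_ker : ∫ x, ker a x = 1 := (integrable_ker_and_integral hs).2

theorem integral_ker_sub (θ : ℝ) : ∫ t, ker a (θ - t) = 1 := by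
  rw [integral_sub_left_eq_self (ker a) volume θ, integral_ker hs]

theorem integrable_ker_sub (θ : ℝ) : Integrable fun t => ker a (θ - t) :=
  (integrable_ker hs).comp_sub_left θ

theorem integrable_one_div_cosh : Integrable fun x : ℝ => 1 / Real.cosh x := by
  have hpi := Real.pi_pos
  refine ((integrable_ker hs).const_mul (Real.pi / Real.sin (Real.pi * a))).mono' ?_ ?_
  · exact (continuous_const.div₀ Real.continuous_cosh
      fun x => (Real.cosh_pos x).ne').aestronglyMeasurable
  · refine Eventually.of_forall fun x => ?_
    have h1 := Real.cosh_pos x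
    have h2 := mul_le_mul_of_nonneg_left (le_ker hs x)
      (by positivity : 0 ≤ Real.pi / Real.sin (Real.pi * a))
    rw [Real.norm_eq_abs, abs_of_pos (by positivity)]
    refine le_trans (le_of_eq ?_) h2
    field_simp

end

theorem cosh_add_le (x y : ℝ) : Real.cosh (x + y) ≤ 2 * Real.cosh x * Real.cosh y := by
  have h1 : 0 ≤ Real.cosh (x - y) := (Real.cosh_pos _).le
  rw [Real.cosh_sub] at h1
  rw [Real.cosh_add]
  linarith

end

/-! ### The real integral equation -/

section

/-- The source term `log S(x - iπ/2)`. -/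
def ell (a x : ℝ) : ℝ :=
  Real.log (Real.cosh x + Real.sin (Real.pi * a)) - Real.log (Real.cosh x - Real.sin (Real.pi * a))

/-- The function `log (1 + e^{-x})`. -/
def Lam (x : ℝ) : ℝ := Real.log (1 + Real.exp (-x))

/-- The filling fraction `1 / (1 + e^x)`. -/
def filling (x : ℝ) : ℝ := 1 / (1 + Real.exp x)

theorem S_sub_pi_div_two (a x : ℝ) : S a (x - (Real.pi / 2 : ℝ) * Complex.I) =
    (((Real.cosh x + Real.sin (Real.pi * a)) / (Real.cosh x - Real.sin (Real.pi * a)) : ℝ) : ℂ) := by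
  have h1 : Complex.sinh ((x : ℂ) - (Real.pi / 2 : ℝ) * Complex.I) =
      -Complex.I * (Real.cosh x : ℂ) := by
    rw [Complex.sinh_sub, Complex.sinh_mul_I, Complex.cosh_mul_I, ← Complex.ofReal_sin,
      ← Complex.ofReal_cos, Real.sin_pi_div_two, Real.cos_pi_div_two]
    push_cast
    ring
  rw [S, h1, show -Complex.I * (Real.cosh x : ℂ) - Complex.I * (Real.sin (Real.pi * a) : ℂ) =
      (-Complex.I) * ((Real.cosh x : ℂ) + (Real.sin (Real.pi * a) : ℂ)) by ring,
    show -Complex.I * (Real.cosh x : ℂ) + Complex.I * (Real.sin (Real.pi * a) : ℂ) =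
      (-Complex.I) * ((Real.cosh x : ℂ) - (Real.sin (Real.pi * a) : ℂ)) by ring,
    mul_div_mul_left _ _ (neg_ne_zero.mpr Complex.I_ne_zero)]
  push_cast
  rfl

theorem logS_sub_pi_div_two {a : ℝ} (hs : 0 < Real.sin (Real.pi * a))
    (hs1 : Real.sin (Real.pi * a) < 1) (x : ℝ) :
    logS a (x - (Real.pi / 2 : ℝ) * Complex.I) = (ell a x : ℂ) := by
  have h1 := Real.one_le_cosh x
  have hp : 0 < Real.cosh x + Real.sin (Real.pi * a) := by linarith
  have hm : 0 < Real.cosh x - Real.sin (Real.pi * a) := by linarith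
  rw [logS, S_sub_pi_div_two, ← Complex.ofReal_inv, ← Complex.ofReal_neg, Complex.log,
    Complex.arg_ofReal_of_neg (neg_lt_zero.mpr (by positivity)), Complex.norm_real, norm_neg,
    Real.norm_eq_abs, abs_of_pos (by positivity), inv_div, Real.log_div hm.ne' hp.ne', ell]
  push_cast
  ring

theorem sub_root (θ u : ℝ) :
    (θ : ℂ) - root u = ((θ - u : ℝ) : ℂ) - (Real.pi / 2 : ℝ) * Complex.I := by
  rw [root]
  push_cast
  ring

theorem isTBASolution_iff {a : ℝ} (hs : 0 < Real.sin (Real.pi * a))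
    (hs1 : Real.sin (Real.pi * a) < 1) {m L u : ℝ} {e : ℝ → ℝ} :
    IsTBASolution a m L u e ↔ Continuous e ∧ ∀ θ : ℝ, e θ = m * L * Real.cosh θ + ell a (θ - u) -
      ∫ t, ker a (θ - t) * Lam (e t) := by
  have h : ∀ θ : ℝ, pseudoenergy a m L u e θ = ((m * L * Real.cosh θ + ell a (θ - u) -
      ∫ t, ker a (θ - t) * Lam (e t) : ℝ) : ℂ) := by
    intro θ
    rw [pseudoenergy, sub_root, logS_sub_pi_div_two hs hs1]
    push_cast
    rw [← integral_complex_ofReal]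
    congr 1
    refine integral_congr_ae (Eventually.of_forall fun t => ?_)
    have hpi : (Real.pi : ℂ) ≠ 0 := by exact_mod_cast Real.pi_ne_zero
    simp only [← Complex.ofReal_sub, phi_ofReal, Lam]
    push_cast
    field_simp
  simp only [IsTBASolution, h, Complex.ofReal_inj]

section Bounds

theorem Lam_pos (x : ℝ) : 0 < Lam x := Real.log_pos (by linarith [Real.exp_pos (-x)])

theorem Lam_le_exp (x : ℝ) : Lam x ≤ Real.exp (-x) := by
  have := Real.log_le_sub_one_of_pos (x := 1 + Real.exp (-x)) (by positivity)
  unfold Lam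
  linarith

theorem hasDerivAt_Lam (x : ℝ) : HasDerivAt Lam (-filling x) x := by
  have h : HasDerivAt Lam (-Real.exp (-x) / (1 + Real.exp (-x))) x := by
    have h1 : HasDerivAt (fun x => 1 + Real.exp (-x)) (-Real.exp (-x)) x := by
      simpa using ((hasDerivAt_neg x).exp).const_add 1
    exact h1.log (by positivity)
  refine h.congr_deriv ?_
  rw [filling, Real.exp_neg]
  have := Real.exp_pos x
  field_simp
  ring

theorem continuous_Lam : Continuous Lam :=
  continuous_iff_continuousAt.mpr fun x => (hasDerivAt_Lam x).continuousAt

theorem antitone_Lam : Antitone Lam := fun x y h => by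
  unfold Lam
  gcongr

theorem filling_pos (x : ℝ) : 0 < filling x := by unfold filling; positivity

theorem continuous_filling : Continuous filling := by
  unfold filling
  exact continuous_const.div₀ (by fun_prop) fun x => by positivity

theorem antitone_filling : Antitone filling := fun x y h => by
  unfold filling
  gcongr

theorem filling_lt_one (x : ℝ) : filling x < 1 := by
  rw [filling, div_lt_one (by positivity)]
  linarith [Real.exp_pos x]

theorem filling_le_exp (x : ℝ) : filling x ≤ Real.exp (-x) := by
  rw [filling, Real.exp_neg, ← one_div]
  gcongr
  linarith

/-- Convexity of `log (1 + e^{-x})`, as a tangent inequality. -/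
theorem Lam_add_ge (x h : ℝ) : Lam x - filling x * h ≤ Lam (x + h) := by
  have h2 : ConvexOn ℝ Set.univ Lam := by
    refine MonotoneOn.convexOn_of_deriv convex_univ continuous_Lam.continuousOn
      (fun x _ => (hasDerivAt_Lam x).differentiableAt.differentiableWithinAt) ?_
    intro x _ y _ hxy
    rw [(hasDerivAt_Lam x).deriv, (hasDerivAt_Lam y).deriv]
    exact neg_le_neg (antitone_filling hxy)
  rcases lt_trichotomy h 0 with hh | hh | hh
  · have h3 := h2.slope_le_of_hasDerivAt (Set.mem_univ (x + h)) (Set.mem_univ x) (by linarith)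
      (hasDerivAt_Lam x)
    rw [slope_def_field, div_le_iff₀ (by linarith)] at h3
    nlinarith
  · simp [hh]
  · have h3 := h2.le_slope_of_hasDerivAt (Set.mem_univ x) (Set.mem_univ (x + h)) (by linarith)
      (hasDerivAt_Lam x)
    rw [slope_def_field, le_div_iff₀ (by linarith)] at h3
    nlinarith

theorem ell_nonneg {a : ℝ} (hs : 0 < Real.sin (Real.pi * a))
    (hs1 : Real.sin (Real.pi * a) < 1) (x : ℝ) : 0 ≤ ell a x := by
  have h1 := Real.one_le_cosh x
  rw [ell, sub_nonneg]
  exact Real.log_le_log (by linarith) (by linarith)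

theorem hasDerivAt_ell {a : ℝ} (hs : 0 < Real.sin (Real.pi * a))
    (hs1 : Real.sin (Real.pi * a) < 1) (x : ℝ) :
    HasDerivAt (ell a) (Real.sinh x / (Real.cosh x + Real.sin (Real.pi * a)) -
      Real.sinh x / (Real.cosh x - Real.sin (Real.pi * a))) x := by
  have h1 := Real.one_le_cosh x
  exact (((Real.hasDerivAt_cosh x).add_const _).log (by linarith)).sub
    (((Real.hasDerivAt_cosh x).sub_const _).log (by linarith))

end Bounds

section Growth

variable {a m L u : ℝ} {e : ℝ → ℝ}

theorem ker_sub_le (hs : 0 < Real.sin (Real.pi * a)) (θ₀ θ : ℝ) :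
    ∃ C, ∀ t, ker a (θ₀ - t) ≤ C * ker a (θ - t) := by
  have hpi := Real.pi_pos
  refine ⟨1 / (Real.pi * Real.sin (Real.pi * a)) * (2 * Real.cosh (θ - θ₀)) *
    (Real.pi / Real.sin (Real.pi * a)), fun t => ?_⟩
  have h1 := Real.cosh_pos (θ₀ - t)
  have h2 := Real.cosh_pos (θ - t)
  have h4 := Real.cosh_pos (θ - θ₀)
  have h3 := cosh_add_le (θ₀ - t) (θ - θ₀)
  rw [show θ₀ - t + (θ - θ₀) = θ - t by ring] at h3
  calc ker a (θ₀ - t) ≤ 1 / (Real.pi * Real.sin (Real.pi * a)) / Real.cosh (θ₀ - t) := ker_le hs _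
    _ ≤ 1 / (Real.pi * Real.sin (Real.pi * a)) * (2 * Real.cosh (θ - θ₀)) *
        (Real.pi / Real.sin (Real.pi * a)) *
          (Real.sin (Real.pi * a) / Real.pi / Real.cosh (θ - t)) := by
        rw [div_le_iff₀ h1]
        have : 1 ≤ 2 * Real.cosh (θ - θ₀) / Real.cosh (θ - t) * Real.cosh (θ₀ - t) := by
          rw [div_mul_eq_mul_div, one_le_div h2]
          linarith
        calc 1 / (Real.pi * Real.sin (Real.pi * a)) = 1 / (Real.pi * Real.sin (Real.pi * a)) * 1 := by
              ring
          _ ≤ 1 / (Real.pi * Real.sin (Real.pi * a)) *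
            (2 * Real.cosh (θ - θ₀) / Real.cosh (θ - t) * Real.cosh (θ₀ - t)) := by gcongr
          _ = _ := by field_simp
    _ ≤ _ := by gcongr; exact le_ker hs _

/-- If one of the convolution integrals diverged, all would, and the equation, read with the
integral equal to zero, would give a positive pseudoenergy, for which they converge. -/
theorem IsTBASolution.integrable (hs : 0 < Real.sin (Real.pi * a))
    (hs1 : Real.sin (Real.pi * a) < 1) (hmL : 0 < m * L) (he : IsTBASolution a m L u e) (θ : ℝ) :
    Integrable fun t => ker a (θ - t) * Lam (e t) := by
  obtain ⟨hc, heq⟩ := (isTBASolution_iff hs hs1).mp he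
  have hmeas : ∀ θ, AEStronglyMeasurable (fun t => ker a (θ - t) * Lam (e t)) volume := fun θ =>
    (((continuous_ker hs).comp (by fun_prop)).mul (continuous_Lam.comp hc)).aestronglyMeasurable
  by_contra hθ
  have hall : ∀ θ', ¬ Integrable fun t => ker a (θ' - t) * Lam (e t) := by
    intro θ' h
    obtain ⟨C, hC⟩ := ker_sub_le hs θ θ'
    refine hθ ((h.const_mul C).mono' (hmeas θ) (Eventually.of_forall fun t => ?_))
    rw [Real.norm_eq_abs, abs_of_pos (mul_pos (ker_pos hs _) (Lam_pos _)), ← mul_assoc]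
    exact mul_le_mul_of_nonneg_right (hC t) (Lam_pos _).le
  have hpos : ∀ t, 0 ≤ e t := fun t => by
    rw [heq t, integral_undef (hall t), sub_zero]
    have := ell_nonneg hs hs1 (t - u)
    have := Real.cosh_pos t
    positivity
  refine hθ (((integrable_ker_sub hs θ).mul_const (Lam 0)).mono' (hmeas θ)
    (Eventually.of_forall fun t => ?_))
  rw [Real.norm_eq_abs, abs_of_pos (mul_pos (ker_pos hs _) (Lam_pos _))]
  exact mul_le_mul_of_nonneg_left (antitone_Lam (hpos t)) (ker_pos hs _).le

theorem tendsto_cosh_cocompact : Tendsto Real.cosh (cocompact ℝ) atTop := by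
  refine tendsto_atTop_mono (f := fun x => ‖x‖) (fun x => ?_) tendsto_norm_cocompact_atTop
  rw [← Real.cosh_abs, Real.norm_eq_abs]
  exact (Real.self_le_sinh_iff.mpr (abs_nonneg x)).trans (Real.sinh_lt_cosh _).le

/-- The convolution term is of smaller order than `cosh`. -/
theorem IsTBASolution.tendsto_conv_div_cosh (hs : 0 < Real.sin (Real.pi * a))
    (hs1 : Real.sin (Real.pi * a) < 1) (hmL : 0 < m * L) (he : IsTBASolution a m L u e) :
    Tendsto (fun θ => (∫ t, ker a (θ - t) * Lam (e t)) / Real.cosh θ) (cocompact ℝ) (𝓝 0) := by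
  have hc := he.1
  have hpi := Real.pi_pos
  have hcg : (cocompact ℝ).IsCountablyGenerated := by
    rw [cocompact_eq_atBot_atTop]
    infer_instance
  have h1 : Tendsto (fun θ => ∫ t, ker a (θ - t) * Lam (e t) / Real.cosh θ) (cocompact ℝ)
      (𝓝 (∫ _ : ℝ, (0 : ℝ))) := by
    refine tendsto_integral_filter_of_dominated_convergence
      (fun t => 2 / Real.sin (Real.pi * a) ^ 2 * (ker a (0 - t) * Lam (e t))) ?_ ?_ ?_ ?_
    · exact Eventually.of_forall fun θ => ((((continuous_ker hs).comp (by fun_prop)).mul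
        (continuous_Lam.comp hc)).div_const _).aestronglyMeasurable
    · refine Eventually.of_forall fun θ => Eventually.of_forall fun t => ?_
      have c1 := Real.cosh_pos θ
      have c2 := Real.cosh_pos (θ - t)
      have c3 := Real.cosh_pos t
      rw [Real.norm_eq_abs, abs_of_pos (div_pos (mul_pos (ker_pos hs _) (Lam_pos _)) c1),
        mul_div_right_comm, ← mul_assoc]
      refine mul_le_mul_of_nonneg_right ?_ (Lam_pos _).le
      have h2 := cosh_add_le θ (-(θ - t))
      rw [show θ + -(θ - t) = t by ring, Real.cosh_neg] at h2
      have h3 := ker_le hs (θ - t)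
      have h4 := le_ker hs (0 - t)
      rw [zero_sub, Real.cosh_neg] at h4
      rw [zero_sub]
      calc ker a (θ - t) / Real.cosh θ
          ≤ 1 / (Real.pi * Real.sin (Real.pi * a)) / Real.cosh (θ - t) / Real.cosh θ := by gcongr
        _ ≤ 1 / (Real.pi * Real.sin (Real.pi * a)) * (2 / Real.cosh t) := by
            rw [div_div, div_eq_mul_one_div (1 / (Real.pi * Real.sin (Real.pi * a)))]
            gcongr 1 / (Real.pi * Real.sin (Real.pi * a)) * ?_
            rw [div_le_div_iff₀ (by positivity) c3]
            linarith
        _ = 2 / Real.sin (Real.pi * a) ^ 2 * (Real.sin (Real.pi * a) / Real.pi / Real.cosh t) := by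
            field_simp
        _ ≤ _ := by gcongr
    · exact (he.integrable hs hs1 hmL 0).const_mul _
    · refine Eventually.of_forall fun t => ?_
      have h2 : Tendsto (fun θ => (1 / (Real.pi * Real.sin (Real.pi * a)) * Lam (e t)) /
          Real.cosh θ) (cocompact ℝ) (𝓝 0) := tendsto_cosh_cocompact.const_div_atTop _
      refine squeeze_zero (fun θ => ?_) (fun θ => ?_) h2
      · exact (div_pos (mul_pos (ker_pos hs _) (Lam_pos _)) (Real.cosh_pos _)).le
      · have := Real.cosh_pos θ
        have := Lam_pos (e t)
        gcongr
        refine (ker_le hs _).trans (div_le_self (by positivity) (Real.one_le_cosh _))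
  simpa [integral_div] using h1

theorem IsTBASolution.exists_le (hs : 0 < Real.sin (Real.pi * a))
    (hs1 : Real.sin (Real.pi * a) < 1) (hmL : 0 < m * L) (he : IsTBASolution a m L u e) :
    ∃ C, ∀ θ, m * L / 2 * Real.cosh θ - C ≤ e θ := by
  obtain ⟨hc, heq⟩ := (isTBASolution_iff hs hs1).mp he
  have h1 := (he.tendsto_conv_div_cosh hs hs1 hmL).eventually_lt_const
    (by positivity : 0 < m * L / 2)
  obtain ⟨K, hK, hKs⟩ := mem_cocompact.mp h1
  have hcont : Continuous fun θ => m * L / 2 * Real.cosh θ - e θ := by fun_prop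
  obtain ⟨C, hC⟩ := hK.exists_bound_of_continuousOn hcont.continuousOn
  refine ⟨max C 0, fun θ => ?_⟩
  by_cases hθ : θ ∈ K
  · have := (le_abs_self _).trans (hC θ hθ)
    linarith [le_max_left C 0]
  · have h2 : (∫ t, ker a (θ - t) * Lam (e t)) / Real.cosh θ < m * L / 2 := hKs hθ
    rw [div_lt_iff₀ (Real.cosh_pos θ)] at h2
    have := ell_nonneg hs hs1 (θ - u)
    have := heq θ
    linarith [le_max_right C 0]

/-- The decay of a solution of the integral equation, as far as it is used: the filling fraction
is bounded away from one and decays like `1 / cosh`, and so does `log (1 + e^{-ε})`. -/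
theorem IsTBASolution.exists_bounds (hs : 0 < Real.sin (Real.pi * a))
    (hs1 : Real.sin (Real.pi * a) < 1) (hmL : 0 < m * L) (he : IsTBASolution a m L u e) :
    ∃ B > 0, (∀ θ, Real.exp (-e θ) ≤ B) ∧ (∀ θ, Lam (e θ) ≤ B / Real.cosh θ) ∧
      ∀ θ, filling (e θ) ≤ B / Real.cosh θ := by
  obtain ⟨C, hC⟩ := he.exists_le hs hs1 hmL
  have hexp : ∀ θ, Real.exp (-e θ) ≤ Real.exp C * (2 / (m * L)) / Real.cosh θ := by
    intro θ
    have h1 := Real.cosh_pos θ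
    have h2 : Real.exp (-e θ) ≤ Real.exp C * Real.exp (-(m * L / 2 * Real.cosh θ)) := by
      rw [← Real.exp_add]
      exact Real.exp_le_exp.mpr (by linarith [hC θ])
    have h3 : Real.exp (-(m * L / 2 * Real.cosh θ)) ≤ 1 / (m * L / 2 * Real.cosh θ) := by
      rw [Real.exp_neg, ← one_div]
      have := Real.add_one_le_exp (m * L / 2 * Real.cosh θ)
      exact one_div_le_one_div_of_le (by positivity) (by linarith)
    calc _ ≤ _ := h2
      _ ≤ Real.exp C * (1 / (m * L / 2 * Real.cosh θ)) := by gcongr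
      _ = _ := by field_simp
  have hB : 0 < Real.exp C * (2 / (m * L)) := by positivity
  refine ⟨_, hB, fun θ => (hexp θ).trans (div_le_self hB.le (Real.one_le_cosh θ)),
    fun θ => (Lam_le_exp _).trans (hexp θ), fun θ => (filling_le_exp _).trans (hexp θ)⟩

end Growth

end

/-! ### Dependence of the pseudoenergy on the root -/

section

theorem abs_sub_le_of_hasDerivAt {f f' : ℝ → ℝ} {K : ℝ} (hf : ∀ x, HasDerivAt f (f' x) x)
    (hK : ∀ x, |f' x| ≤ K) (x y : ℝ) : |f y - f x| ≤ K * |y - x| :=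
  convex_univ.norm_image_sub_le_of_norm_hasDerivWithin_le
    (fun x _ => (hf x).hasDerivWithinAt) (fun x _ => hK x) (Set.mem_univ x) (Set.mem_univ y)

theorem abs_taylor_le {f f' : ℝ → ℝ} {K : ℝ} (hf : ∀ x, HasDerivAt f (f' x) x)
    (hK : ∀ x y, |f' y - f' x| ≤ K * |y - x|) (x h : ℝ) :
    |f (x + h) - f x - f' x * h| ≤ K * h ^ 2 := by
  have hK0 : 0 ≤ K := by simpa using (abs_nonneg _).trans (hK 0 1)
  have h1 := (convex_uIcc x (x + h)).norm_image_sub_le_of_norm_hasDerivWithin_le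
    (f := fun y => f y - f' x * y) (f' := fun y => f' y - f' x) (C := K * |h|) (x := x)
    (y := x + h)
    (fun y _ => ((hf y).sub (by simpa using (hasDerivAt_id y).const_mul (f' x))).hasDerivWithinAt)
    (fun y hy => ?_) Set.left_mem_uIcc Set.right_mem_uIcc
  · rw [Real.norm_eq_abs, Real.norm_eq_abs, add_sub_cancel_left, mul_assoc, ← sq, sq_abs] at h1
    refine le_trans (le_of_eq ?_) h1
    congr 1
    ring
  · refine (hK x y).trans (mul_le_mul_of_nonneg_left ?_ hK0)
    have := Set.abs_sub_left_of_mem_uIcc hy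
    simpa using this

theorem le_div_of_contraction {f : ℝ → ℝ} {K q : ℝ} (hb : BddAbove (Set.range f)) (hK : 0 ≤ K)
    (hq : 0 ≤ q) (hq1 : q < 1)
    (h : ∀ D, 0 ≤ D → (∀ θ, f θ ≤ D) → ∀ θ, f θ ≤ K + q * D) (θ : ℝ) : f θ ≤ K / (1 - q) := by
  set D := max 0 (⨆ θ, f θ) with hD
  have h0 : 0 ≤ D := le_max_left _ _
  have h1 : ∀ θ, f θ ≤ D := fun θ => (le_ciSup hb θ).trans (le_max_right _ _)
  have h2 : D ≤ K + q * D := max_le (by positivity) (ciSup_le (h D h0 h1))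
  refine (h1 θ).trans ?_
  rw [le_div_iff₀ (by linarith)]
  linarith

theorem abs_filling_sub_le (x y : ℝ) : |filling y - filling x| ≤ 1 * |y - x| := by
  refine abs_sub_le_of_hasDerivAt (f' := fun x => -Real.exp x / (1 + Real.exp x) ^ 2)
    (fun x => ?_) (fun x => ?_) x y
  · have h := ((Real.hasDerivAt_exp x).const_add 1).inv (by positivity)
    rwa [show (fun x => 1 + Real.exp x)⁻¹ = filling by ext; simp [filling]] at h
  · have := Real.exp_pos x
    rw [abs_div, abs_neg, abs_of_pos this, abs_of_pos (by positivity), div_le_one (by positivity)]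
    nlinarith

theorem abs_Lam_taylor_le (x h : ℝ) : |Lam (x + h) - Lam x + filling x * h| ≤ h ^ 2 := by
  have := abs_taylor_le (K := 1) hasDerivAt_Lam (fun x y => by
    rw [neg_sub_neg, abs_sub_comm]
    exact abs_filling_sub_le x y) x h
  rw [one_mul] at this
  simpa [neg_mul, sub_neg_eq_add] using this

theorem filling_le_of_exp_neg_le {x B : ℝ} (h : Real.exp (-x) ≤ B) : filling x ≤ B / (1 + B) := by
  have h1 := Real.exp_pos (-x)
  rw [filling, div_le_div_iff₀ (by positivity) (by linarith)]
  have : Real.exp x * Real.exp (-x) = 1 := by rw [← Real.exp_add]; simp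
  nlinarith [Real.exp_pos x]

/-- The derivative of the source term. -/
def ellDeriv (a x : ℝ) : ℝ :=
  Real.sinh x / (Real.cosh x + Real.sin (Real.pi * a)) -
    Real.sinh x / (Real.cosh x - Real.sin (Real.pi * a))

section Ell

variable {a : ℝ} (hs : 0 < Real.sin (Real.pi * a)) (hs1 : Real.sin (Real.pi * a) < 1)
include hs hs1

omit hs1 in
theorem cosh_sub_ge (x : ℝ) :
    (1 - Real.sin (Real.pi * a)) * Real.cosh x ≤ Real.cosh x - Real.sin (Real.pi * a) := by
  nlinarith [Real.one_le_cosh x]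

theorem abs_ell_le : ∃ K, ∀ x, |ell a x| ≤ K := by
  refine ⟨Real.log ((1 + Real.sin (Real.pi * a)) / (1 - Real.sin (Real.pi * a))), fun x => ?_⟩
  have h1 := Real.one_le_cosh x
  rw [abs_of_nonneg (ell_nonneg hs hs1 x), ell, ← Real.log_div (by linarith) (by linarith)]
  refine Real.log_le_log (div_pos (by linarith) (by linarith)) ?_
  rw [div_le_div_iff₀ (by linarith) (by linarith)]
  nlinarith

theorem abs_ell_sub_le : ∃ K > 0, ∀ x y, |ell a y - ell a x| ≤ K * |y - x| := by
  have h2 : 0 < 1 - Real.sin (Real.pi * a) := by linarith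
  refine ⟨1 + 1 / (1 - Real.sin (Real.pi * a)), by positivity, ?_⟩
  refine abs_sub_le_of_hasDerivAt (hasDerivAt_ell hs hs1) fun x => ?_
  have h1 := Real.one_le_cosh x
  have h3 := cosh_sub_ge hs x
  have h4 : |Real.sinh x| ≤ Real.cosh x := abs_le.mpr
    ⟨by linarith [Real.cosh_pos x, Real.exp_pos x, Real.cosh_add_sinh x],
      (Real.sinh_lt_cosh x).le⟩
  refine (abs_sub _ _).trans (add_le_add ?_ ?_)
  · rw [abs_div, abs_of_pos (a := Real.cosh x + _) (by linarith), div_le_one (by linarith)]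
    linarith
  · rw [abs_div, abs_of_pos (a := Real.cosh x - _) (by linarith), div_le_div_iff₀ (by linarith) h2]
    nlinarith

theorem abs_ellDeriv_sub_le : ∃ K > 0, ∀ x y, |ellDeriv a y - ellDeriv a x| ≤ K * |y - x| := by
  set s := Real.sin (Real.pi * a) with hsdef
  have h2 : 0 < 1 - s := by linarith
  refine ⟨(1 + 1) + (1 / (1 - s) + 1 / (1 - s) ^ 2), by positivity, ?_⟩
  refine abs_sub_le_of_hasDerivAt
    (f' := fun x => (Real.cosh x / (Real.cosh x + s) - Real.sinh x ^ 2 / (Real.cosh x + s) ^ 2) -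
      (Real.cosh x / (Real.cosh x - s) - Real.sinh x ^ 2 / (Real.cosh x - s) ^ 2))
    (fun x => ?_) fun x => ?_
  · have h1 := Real.one_le_cosh x
    have e1 : Real.cosh x + s ≠ 0 := by linarith
    have e2 : Real.cosh x - s ≠ 0 := by linarith
    have d1 := (Real.hasDerivAt_sinh x).fun_div ((Real.hasDerivAt_cosh x).add_const s) e1
    have d2 := (Real.hasDerivAt_sinh x).fun_div ((Real.hasDerivAt_cosh x).sub_const s) e2
    refine (d1.sub d2).congr_deriv ?_
    field_simp
  · have h1 := Real.one_le_cosh x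
    have h3 := cosh_sub_ge hs x
    rw [← hsdef] at h3
    have h4 : Real.sinh x ^ 2 ≤ Real.cosh x ^ 2 := by linarith [Real.cosh_sq x]
    have p1 : 0 < Real.cosh x + s := by linarith
    have p2 : 0 < Real.cosh x - s := by linarith
    refine (abs_sub _ _).trans (add_le_add ((abs_sub _ _).trans (add_le_add ?_ ?_))
      ((abs_sub _ _).trans (add_le_add ?_ ?_)))
    · rw [abs_of_nonneg (by positivity), div_le_one p1]
      linarith
    · rw [abs_of_nonneg (by positivity), div_le_one (by positivity)]
      refine h4.trans (pow_le_pow_left₀ (by linarith) (by linarith) 2)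
    · rw [abs_of_nonneg (by positivity), div_le_div_iff₀ p2 h2]
      linarith
    · rw [abs_of_nonneg (by positivity), div_le_div_iff₀ (by positivity) (by positivity)]
      have := pow_le_pow_left₀ (by positivity) h3 2
      nlinarith

theorem ellDeriv_eq (x : ℝ) : (ellDeriv a x : ℂ) =
    Complex.I * phi a (x - (Real.pi / 2 : ℝ) * Complex.I) := by
  have h1 := Real.one_le_cosh x
  have e1 : Real.cosh x + Real.sin (Real.pi * a) ≠ 0 := by linarith
  have e2 : Real.cosh x - Real.sin (Real.pi * a) ≠ 0 := by linarith
  have hsinh : Complex.sinh ((x : ℂ) - (Real.pi / 2 : ℝ) * Complex.I) =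
      -Complex.I * (Real.cosh x : ℂ) := by
    rw [Complex.sinh_sub, Complex.sinh_mul_I, Complex.cosh_mul_I, ← Complex.ofReal_sin,
      ← Complex.ofReal_cos, Real.sin_pi_div_two, Real.cos_pi_div_two]
    push_cast
    ring
  have hcosh : Complex.cosh ((x : ℂ) - (Real.pi / 2 : ℝ) * Complex.I) =
      -Complex.I * (Real.sinh x : ℂ) := by
    rw [Complex.cosh_sub, Complex.sinh_mul_I, Complex.cosh_mul_I, ← Complex.ofReal_sin,
      ← Complex.ofReal_cos, Real.sin_pi_div_two, Real.cos_pi_div_two]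
    push_cast
    ring
  have h3 : ellDeriv a x = 2 * Real.sin (Real.pi * a) * Real.sinh x /
      (-(Real.cosh x + Real.sin (Real.pi * a)) * (Real.cosh x - Real.sin (Real.pi * a))) := by
    rw [ellDeriv]
    field_simp
    ring
  have h4 : tau a ((x : ℂ) - (Real.pi / 2 : ℝ) * Complex.I) =
      ((-(Real.cosh x + Real.sin (Real.pi * a)) * (Real.cosh x - Real.sin (Real.pi * a)) : ℝ) : ℂ) := by
    rw [tau, hsinh]
    push_cast
    linear_combination (Complex.cosh x) ^ 2 * Complex.I_sq
  rw [phi_eq, h4, hcosh, h3]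
  rw [show ∀ S H T : ℂ, Complex.I * (2 * S * (-Complex.I * H) / T) = -(Complex.I ^ 2) * (2 * S * H) / T
    by intros; ring, Complex.I_sq]
  push_cast
  ring

end Ell

section Lipschitz

variable {a m L u v : ℝ} {e₀ e₁ : ℝ → ℝ}

theorem IsTBASolution.sub_eq (hs : 0 < Real.sin (Real.pi * a))
    (hs1 : Real.sin (Real.pi * a) < 1) (hmL : 0 < m * L) (h₀ : IsTBASolution a m L v e₀)
    (h₁ : IsTBASolution a m L u e₁) (θ : ℝ) :
    e₁ θ - e₀ θ = ell a (θ - u) - ell a (θ - v) +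
      ∫ t, ker a (θ - t) * (Lam (e₀ t) - Lam (e₁ t)) := by
  rw [((isTBASolution_iff hs hs1).mp h₀).2 θ, ((isTBASolution_iff hs hs1).mp h₁).2 θ]
  simp only [mul_sub]
  rw [integral_sub (h₀.integrable hs hs1 hmL θ) (h₁.integrable hs hs1 hmL θ)]
  ring

theorem integral_ker_mul_le (hs : 0 < Real.sin (Real.pi * a)) {f : ℝ → ℝ} {θ D : ℝ}
    (hf : Integrable fun t => ker a (θ - t) * f t) (h : ∀ t, f t ≤ D) :
    ∫ t, ker a (θ - t) * f t ≤ D := by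
  calc _ ≤ ∫ t, ker a (θ - t) * D :=
        integral_mono hf ((integrable_ker_sub hs θ).mul_const D) fun t =>
          mul_le_mul_of_nonneg_left (h t) (ker_pos hs _).le
    _ = D := by rw [integral_mul_const, integral_ker_sub hs, one_mul]

theorem IsTBASolution.integrable_sub (hs : 0 < Real.sin (Real.pi * a))
    (hs1 : Real.sin (Real.pi * a) < 1) (hmL : 0 < m * L) (h₀ : IsTBASolution a m L v e₀)
    (h₁ : IsTBASolution a m L u e₁) (θ : ℝ) :
    Integrable fun t => ker a (θ - t) * (Lam (e₀ t) - Lam (e₁ t)) := by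
  simp only [mul_sub]
  exact (h₀.integrable hs hs1 hmL θ).sub (h₁.integrable hs hs1 hmL θ)

theorem IsTBASolution.bddAbove_sub (hs : 0 < Real.sin (Real.pi * a))
    (hs1 : Real.sin (Real.pi * a) < 1) (hmL : 0 < m * L) (h₀ : IsTBASolution a m L v e₀)
    (h₁ : IsTBASolution a m L u e₁) : BddAbove (Set.range fun θ => e₁ θ - e₀ θ) := by
  obtain ⟨K, hK⟩ := abs_ell_le hs hs1
  obtain ⟨B, hB, -, hL, -⟩ := h₀.exists_bounds hs hs1 hmL
  refine ⟨K + K + B, ?_⟩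
  rintro _ ⟨θ, rfl⟩
  simp only
  rw [h₀.sub_eq hs hs1 hmL h₁]
  have h1 := integral_ker_mul_le hs (h₀.integrable_sub hs hs1 hmL h₁ θ) (D := B) fun t => by
    have := (hL t).trans (div_le_self hB.le (Real.one_le_cosh t))
    linarith [Lam_pos (e₁ t)]
  have h2 := (le_abs_self _).trans (hK (θ - u))
  have h3 := (neg_abs_le _).trans' (neg_le_neg (hK (θ - v)))
  linarith

/-- An upper bound for a perturbed solution: the tangent line of the convex function `log (1 + e⁻ˣ)`
at the unperturbed solution turns the integral equation into a contraction estimate. -/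
theorem IsTBASolution.sub_le (hs : 0 < Real.sin (Real.pi * a))
    (hs1 : Real.sin (Real.pi * a) < 1) (hmL : 0 < m * L) (h₀ : IsTBASolution a m L v e₀)
    (h₁ : IsTBASolution a m L u e₁) {B K : ℝ} (hB : 0 < B) (hB₀ : ∀ θ, Real.exp (-e₀ θ) ≤ B)
    (hK : ∀ x y, |ell a y - ell a x| ≤ K * |y - x|) (hK0 : 0 < K) (θ : ℝ) :
    e₁ θ - e₀ θ ≤ (1 + B) * K * |u - v| := by
  have hell : ∀ θ, ell a (θ - u) - ell a (θ - v) ≤ K * |u - v| := fun θ => by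
    refine (le_abs_self _).trans ((hK _ _).trans (le_of_eq ?_))
    rw [abs_sub_comm u v]
    congr 2
    ring
  have h := le_div_of_contraction (q := B / (1 + B)) (K := K * |u - v|)
    (h₀.bddAbove_sub hs hs1 hmL h₁) (by positivity) (by positivity)
    (by rw [div_lt_one (by positivity)]; linarith) (fun D hD hf θ => ?_) θ
  · refine h.trans (le_of_eq ?_)
    have : 1 + B ≠ 0 := by positivity
    field_simp
    ring
  · rw [h₀.sub_eq hs hs1 hmL h₁]
    refine add_le_add (hell θ) (integral_ker_mul_le hs (h₀.integrable_sub hs hs1 hmL h₁ θ) ?_)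
    intro t
    have h1 := Lam_add_ge (e₀ t) D
    have h2 := antitone_Lam (show e₁ t ≤ e₀ t + D by linarith [hf t])
    have h3 := mul_le_mul_of_nonneg_right (filling_le_of_exp_neg_le (hB₀ t)) hD
    linarith

/-- The lower bound only uses the filling fraction of the unperturbed solution: if `H` is the
largest drop of the pseudoenergy, then
`H ≤ K |u - v| + log ((1 + B e^H) / (1 + B))`, which forces `H = O(|u - v|)`. -/
theorem IsTBASolution.le_sub (hs : 0 < Real.sin (Real.pi * a))
    (hs1 : Real.sin (Real.pi * a) < 1) (hmL : 0 < m * L) (h₀ : IsTBASolution a m L v e₀)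
    (h₁ : IsTBASolution a m L u e₁) {B K : ℝ} (hB : 0 < B) (hB₀ : ∀ θ, Real.exp (-e₀ θ) ≤ B)
    (hK : ∀ x y, |ell a y - ell a x| ≤ K * |y - x|) (hK0 : 0 < K)
    (huv : K * |u - v| ≤ 1 / (4 * (1 + B))) (θ : ℝ) :
    e₀ θ - e₁ θ ≤ 4 * (1 + B) * K * |u - v| := by
  set κ := K * |u - v| with hκ
  have hκ0 : 0 ≤ κ := by positivity
  have hell : ∀ θ, ell a (θ - v) - ell a (θ - u) ≤ κ := fun θ => by
    refine (le_abs_self _).trans ((hK _ _).trans (le_of_eq ?_))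
    rw [hκ]
    congr 2
    ring
  have hbdd := h₁.bddAbove_sub hs hs1 hmL h₀
  set H := max 0 (⨆ θ, (e₀ θ - e₁ θ)) with hH
  have hH0 : 0 ≤ H := le_max_left _ _
  have hle : ∀ θ, e₀ θ - e₁ θ ≤ H := fun θ => (le_ciSup hbdd θ).trans (le_max_right _ _)
  set G := Real.log ((1 + B * Real.exp H) / (1 + B)) with hG
  have h1B : 0 < 1 + B := by positivity
  have hexpH : 1 ≤ Real.exp H := Real.one_le_exp hH0
  have hG0 : 0 ≤ G := Real.log_nonneg (by
    rw [one_le_div h1B]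
    nlinarith)
  have hstep : ∀ θ, e₀ θ - e₁ θ ≤ κ + G := by
    intro θ
    rw [h₁.sub_eq hs hs1 hmL h₀]
    refine add_le_add (hell θ) (integral_ker_mul_le hs (h₁.integrable_sub hs hs1 hmL h₀ θ) ?_)
    intro t
    have h2 := antitone_Lam (show e₀ t - H ≤ e₁ t by linarith [hle t])
    have h3 : Lam (e₀ t - H) - Lam (e₀ t) ≤ G := by
      rw [Lam, Lam, ← Real.log_div (by positivity) (by positivity)]
      refine Real.log_le_log (by positivity) ?_
      rw [div_le_div_iff₀ (by positivity) h1B, show -(e₀ t - H) = -e₀ t + H by ring, Real.exp_add]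
      nlinarith [hB₀ t, mul_nonneg (sub_nonneg.mpr (hB₀ t)) (sub_nonneg.mpr hexpH)]
    linarith
  have h4 : H ≤ κ + G := max_le (by positivity) (ciSup_le hstep)
  have h5 : Real.exp H * (1 + B) ≤ Real.exp κ * (1 + B * Real.exp H) := by
    have := Real.exp_le_exp.mpr h4
    rw [Real.exp_add, hG, Real.exp_log (by positivity)] at this
    rw [← le_div_iff₀ h1B]
    exact this.trans (le_of_eq (by ring))
  have h6 : Real.exp κ - 1 ≤ 2 * κ := by
    have h7 : κ ≤ 1 := huv.trans (by rw [div_le_one (by positivity)]; linarith)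
    have := Real.abs_exp_sub_one_le (x := κ) (by rwa [abs_of_nonneg hκ0])
    rw [abs_of_nonneg hκ0] at this
    exact (le_abs_self _).trans this
  have h8 : κ * (4 * (1 + B)) ≤ 1 := by
    rwa [le_div_iff₀ (by positivity)] at huv
  have h9 : Real.exp H - 1 ≤ 4 * (1 + B) * κ := by
    have h10 : 1 ≤ Real.exp κ := Real.one_le_exp hκ0
    have h11 : B * (Real.exp κ - 1) ≤ 1 / 2 := by nlinarith
    have h12 : (Real.exp H - 1) * (1 + B - B * Real.exp κ) ≤ (1 + B) * (Real.exp κ - 1) := by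
      nlinarith
    nlinarith
  have h13 := Real.add_one_le_exp H
  calc _ ≤ H := hle θ
    _ ≤ 4 * (1 + B) * κ := by linarith
    _ = _ := by rw [hκ]; ring

end Lipschitz

/-- The pseudoenergy is Lipschitz continuous in the root parameter, uniformly in the rapidity. -/
theorem IsTBASolution.eventually_abs_sub_le {a m L v : ℝ} (hs : 0 < Real.sin (Real.pi * a))
    (hs1 : Real.sin (Real.pi * a) < 1) (hmL : 0 < m * L) {ε : ℝ → ℝ → ℝ}
    (hε : ∀ u, IsTBASolution a m L u (ε u)) :
    ∃ C > 0, ∀ᶠ u in 𝓝 v, ∀ θ, |ε u θ - ε v θ| ≤ C * |u - v| := by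
  obtain ⟨B, hB, hB₀, -⟩ := (hε v).exists_bounds hs hs1 hmL
  obtain ⟨K, hK0, hK⟩ := abs_ell_sub_le hs hs1
  refine ⟨4 * (1 + B) * K, by positivity, ?_⟩
  have h1 : ∀ᶠ u in 𝓝 v, K * |u - v| < 1 / (4 * (1 + B)) := by
    have : ContinuousAt (fun u => K * |u - v|) v := by fun_prop
    refine this.eventually_lt_const ?_
    simp only [sub_self, abs_zero, mul_zero]
    positivity
  filter_upwards [h1] with u hu θ
  have h2 := (hε v).sub_le hs hs1 hmL (hε u) hB hB₀ hK hK0 θ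
  have h3 := (hε v).le_sub hs hs1 hmL (hε u) hB hB₀ hK hK0 hu.le θ
  have h4 : 0 ≤ (1 + B) * K * |u - v| := by positivity
  rw [abs_le]
  constructor <;> nlinarith

end

/-! ### Iterated kernels -/

section

/-- Regularity and decay of the kernel `φ` on the strips that contain rapidity differences. -/
structure KernelBound (a δ C : ℝ) : Prop where
  sin_pos : 0 < Real.sin (Real.pi * a)
  sin_lt : Real.sin (Real.pi * a) < 1
  δ_pos : 0 < δ
  δ_lt : δ < 1 / 2
  C_pos : 0 < C
  tau_ne : ∀ z ∈ strips δ, tau a z ≠ 0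
  norm_phi_le : ∀ z ∈ strips δ, ‖phi a z‖ ≤ C / Real.cosh z.re

theorem exists_kernelBound {a : ℝ} (ha₀ : 0 < a) (ha₁ : a < 1) (ha : a ≠ 1 / 2) :
    ∃ δ C, KernelBound a δ C := by
  obtain ⟨δ, h1, h2, C, h3, h4⟩ := exists_strips_bound ha₀ ha₁ ha
  exact ⟨δ, C, sin_pi_mul_pos ha₀ ha₁, sin_pi_mul_lt_one ha₀ ha₁ ha, h1, h2, h3,
    fun z hz => (h4 z hz).1, fun z hz => (h4 z hz).2⟩

/-- The real line together with a strip around `Im z = π/2`: all rapidities that occur. -/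
def rapidities (δ : ℝ) : Set ℂ := {z | z.im = 0 ∨ |z.im - Real.pi / 2| ≤ δ}

theorem ofReal_mem_rapidities (δ x : ℝ) : (x : ℂ) ∈ rapidities δ := Or.inl (Complex.ofReal_im x)

theorem root_im (u : ℝ) : (root u).im = Real.pi / 2 := by simp [root]

theorem root_re (u : ℝ) : (root u).re = u := by simp [root]

theorem sub_mem_strips {δ : ℝ} (hδ : 0 ≤ δ) {x y : ℂ} (hx : x ∈ rapidities (δ / 2))
    (hy : y ∈ rapidities (δ / 2)) : x - y ∈ strips δ := by
  simp only [rapidities, strips, Set.mem_ofPred_eq, Complex.sub_im] at *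
  rcases hx with hx | hx <;> rcases hy with hy | hy
  · left; simp [hx, hy, hδ]
  · right; right
    rw [hx, abs_le] at *
    constructor <;> linarith [hy.1, hy.2]
  · right; left
    rw [hy, abs_le] at *
    constructor <;> linarith [hx.1, hx.2]
  · left
    rw [abs_le] at *
    constructor <;> linarith [hx.1, hx.2, hy.1, hy.2]

section
variable {a δ C : ℝ} (hk : KernelBound a δ C)
include hk

theorem KernelBound.root_mem (u : ℝ) : root u ∈ rapidities (δ / 2) := by
  right
  rw [root_im, sub_self, abs_zero]
  exact (half_pos hk.δ_pos).le

theorem KernelBound.norm_phi_le' {z : ℂ} (hz : z ∈ strips δ) : ‖phi a z‖ ≤ C :=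
  (hk.norm_phi_le z hz).trans (div_le_self hk.C_pos.le (Real.one_le_cosh _))

theorem KernelBound.admissible : Admissible a (rapidities (δ / 2)) where
  im_lt x hx y hy := by
    have hpi := Real.pi_gt_three
    have := hk.δ_lt
    rcases sub_mem_strips hk.δ_pos.le hx hy with h | h | h <;> rw [abs_lt] <;>
      rw [abs_le] at h <;> constructor <;> linarith [h.1, h.2]
  tau_ne x hx y hy := hk.tau_ne _ (sub_mem_strips hk.δ_pos.le hx hy)

theorem KernelBound.norm_deriv_phi_le {z : ℂ} {ρ : ℝ} (hρ : 0 < ρ)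
    (hz : Metric.closedBall z ρ ⊆ strips δ) : ‖deriv (phi a) z‖ ≤ C / ρ := by
  refine Complex.norm_deriv_le_of_forall_mem_sphere_norm_le hρ ?_ fun w hw =>
    hk.norm_phi_le' (hz (Metric.sphere_subset_closedBall hw))
  refine DifferentiableOn.diffContOnCl fun w hw => ?_
  rw [closure_ball z hρ.ne'] at hw
  exact (differentiableAt_phi (hk.tau_ne w (hz hw))).differentiableWithinAt

theorem KernelBound.integrable_phi_mul {x : ℂ} (hx : x ∈ rapidities (δ / 2)) {g : ℝ → ℂ}
    (hg : Integrable g) : Integrable fun t : ℝ => phi a (x - t) * g t :=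
  hg.bdd_mul (c := C)
    ((measurable_phi a).comp (by fun_prop : Measurable fun t : ℝ => x - t)).aestronglyMeasurable
    (Eventually.of_forall fun t =>
      hk.norm_phi_le' (sub_mem_strips hk.δ_pos.le hx (ofReal_mem_rapidities _ t)))

theorem KernelBound.hasDerivAt_integral_phi {x : ℂ} (hx : |x.im - Real.pi / 2| < δ / 2) {g : ℝ → ℂ}
    (hg : Integrable g) : HasDerivAt (fun z => ∫ t : ℝ, phi a (z - t) * g t)
      (∫ t : ℝ, deriv (phi a) (x - t) * g t) x := by
  have hδ := hk.δ_pos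
  set ρ := δ / 4 with hρdef
  have hρ : 0 < ρ := by positivity
  have hball : ∀ z ∈ Metric.ball x ρ, ∀ t : ℝ, Metric.closedBall (z - t) ρ ⊆ strips δ := by
    intro z hz t w hw
    rw [Metric.mem_ball, Complex.dist_eq] at hz
    rw [Metric.mem_closedBall, Complex.dist_eq] at hw
    have h1 := (Complex.abs_im_le_norm _).trans_lt hz
    have h2 := (Complex.abs_im_le_norm _).trans hw
    right; left
    simp only [Complex.sub_im, Complex.ofReal_im, sub_zero] at h1 h2
    rw [abs_lt] at h1 hx
    rw [abs_le] at *
    constructor <;> linarith [h1.1, h1.2, h2.1, h2.2, hx.1, hx.2]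
  refine (hasDerivAt_integral_of_dominated_loc_of_deriv_le
    (F := fun z t => phi a (z - t) * g t) (F' := fun z t => deriv (phi a) (z - t) * g t)
    (bound := fun t => C / ρ * ‖g t‖)
    (Metric.ball_mem_nhds x hρ) ?_ ?_ ?_ ?_ ?_ ?_).2
  · refine Eventually.of_forall fun z => AEStronglyMeasurable.mul ?_ hg.aestronglyMeasurable
    exact ((measurable_phi a).comp
      (by fun_prop : Measurable fun t : ℝ => z - t)).aestronglyMeasurable
  · exact hk.integrable_phi_mul (Or.inr hx.le) hg
  · refine AEStronglyMeasurable.mul ?_ hg.aestronglyMeasurable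
    exact ((measurable_deriv (phi a)).comp
      (by fun_prop : Measurable fun t : ℝ => x - t)).aestronglyMeasurable
  · refine Eventually.of_forall fun t z hz => ?_
    rw [norm_mul]
    exact mul_le_mul_of_nonneg_right (hk.norm_deriv_phi_le hρ (hball z hz t)) (norm_nonneg _)
  · exact hg.norm.const_mul _
  · refine Eventually.of_forall fun t z hz => HasDerivAt.mul_const ?_ _
    have h1 := (differentiableAt_phi (hk.tau_ne (z - t)
      (hball z hz t (Metric.mem_closedBall_self hρ.le)))).hasDerivAt
    simpa using h1.comp_sub_const z (t : ℂ)

end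

/-- The iterated kernels: `u_0(x) = φ(x - c)` and `u_{l+1}(x) = ∫ dt/(2π) w(t) φ(x - t) u_l(t)`. -/
def chain (a : ℝ) (c : ℂ) (w : ℝ → ℂ) : ℕ → ℂ → ℂ
  | 0, x => phi a (x - c)
  | l + 1, x => ∫ t : ℝ, (1 / (2 * Real.pi) * w t) * (phi a (x - t) * chain a c w l t)

/-- A weight function bounded by `q < 1` and decaying like `1 / cosh`. -/
structure WeightBound (w : ℝ → ℂ) (q B : ℝ) : Prop where
  continuous : Continuous w
  q_nonneg : 0 ≤ q
  q_lt : q < 1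
  norm_le : ∀ t, ‖w t‖ ≤ q
  norm_le_cosh : ∀ t, ‖w t‖ ≤ B / Real.cosh t

theorem measurable_chain (a : ℝ) (c : ℂ) {w : ℝ → ℂ} (hw : Measurable w) (l : ℕ) :
    Measurable (chain a c w l) := by
  induction l with
  | zero => exact (measurable_phi a).comp (measurable_id.sub_const c)
  | succ l ih =>
    have h : Measurable fun p : ℂ × ℝ =>
        (1 / (2 * Real.pi) * w p.2) * (phi a (p.1 - p.2) * chain a c w l p.2) := by
      refine ((hw.comp measurable_snd).const_mul _).mul (((measurable_phi a).comp ?_).mul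
        (ih.comp (Complex.measurable_ofReal.comp measurable_snd)))
      exact measurable_fst.sub (Complex.measurable_ofReal.comp measurable_snd)
    exact (h.stronglyMeasurable.integral_prod_right (ν := volume)).measurable

section
variable {a δ C : ℝ} (hk : KernelBound a δ C) {w : ℝ → ℂ} {q B : ℝ} (hw : WeightBound w q B)
  {c : ℂ} (hc : c ∈ rapidities (δ / 2))
include hk hw

theorem WeightBound.integrable : Integrable w := by
  refine ((integrable_one_div_cosh hk.sin_pos).const_mul B).mono'
    hw.continuous.aestronglyMeasurable (Eventually.of_forall fun t => ?_)
  exact (hw.norm_le_cosh t).trans (le_of_eq (by ring))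

theorem WeightBound.integrable_mul {g : ℝ → ℂ} {M : ℝ} (hg : AEStronglyMeasurable g)
    (hM : ∀ t, ‖g t‖ ≤ M) : Integrable fun t => (1 / (2 * Real.pi) * w t) * g t :=
  ((hw.integrable hk).const_mul _).mul_bdd (c := M) hg (Eventually.of_forall hM)

include hc

theorem norm_chain_ofReal_le (l : ℕ) (x : ℝ) : ‖chain a c w l x‖ ≤ C * q ^ l := by
  induction l generalizing x with
  | zero =>
    simpa [chain] using hk.norm_phi_le' (sub_mem_strips hk.δ_pos.le (ofReal_mem_rapidities _ x) hc)
  | succ l ih =>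
    have hpi := Real.pi_pos
    rw [chain]
    refine (norm_integral_le_of_norm_le (g := fun t => ker a (x - t) * (C * q ^ (l + 1)))
      ((integrable_ker_sub hk.sin_pos x).mul_const _) (Eventually.of_forall fun t => ?_)).trans ?_
    · rw [← Complex.ofReal_sub, phi_ofReal, norm_mul, norm_mul, norm_mul, Complex.norm_real,
        Real.norm_eq_abs, abs_of_pos (mul_pos (by positivity) (ker_pos hk.sin_pos _))]
      have h1 : ‖(1 / (2 * Real.pi) : ℂ)‖ = 1 / (2 * Real.pi) := by
        simp [abs_of_pos hpi]
      rw [h1]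
      calc _ = ker a (x - t) * (‖w t‖ * ‖chain a c w l t‖) := by field_simp
        _ ≤ ker a (x - t) * (q * (C * q ^ l)) := by
          have := (ker_pos hk.sin_pos (x - t)).le
          have := hw.q_nonneg
          gcongr
          · exact hw.norm_le t
          · exact ih t
        _ = _ := by ring
    · rw [integral_mul_const, integral_ker_sub hk.sin_pos, one_mul]

theorem integrable_chain_integrand {x : ℂ} (hx : x ∈ rapidities (δ / 2)) (l : ℕ) :
    Integrable fun t : ℝ => (1 / (2 * Real.pi) * w t) * (phi a (x - t) * chain a c w l t) := by
  refine hw.integrable_mul hk (M := C * (C * q ^ l)) ?_ fun t => ?_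
  · exact (((measurable_phi a).comp (by fun_prop : Measurable fun t : ℝ => x - t)).mul
      ((measurable_chain a c hw.continuous.measurable l).comp
        Complex.measurable_ofReal)).aestronglyMeasurable
  · rw [norm_mul]
    exact mul_le_mul (hk.norm_phi_le' (sub_mem_strips hk.δ_pos.le hx (ofReal_mem_rapidities _ t)))
      (norm_chain_ofReal_le hk hw hc l t) (norm_nonneg _) hk.C_pos.le

theorem norm_chain_integrand_le {x : ℂ} (hx : x ∈ rapidities (δ / 2)) (l : ℕ) (t : ℝ) :
    ‖(1 / (2 * Real.pi) * w t) * (phi a (x - t) * chain a c w l t)‖ ≤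
      ‖w t‖ * (C * C * q ^ l) := by
  have hpi := Real.pi_gt_three
  have h1 : ‖(1 / (2 * Real.pi) : ℂ)‖ ≤ 1 := by
    have : ‖(1 / (2 * Real.pi) : ℂ)‖ = 1 / (2 * Real.pi) := by
      simp [abs_of_pos Real.pi_pos]
    rw [this, div_le_one (by positivity)]
    linarith
  rw [norm_mul, norm_mul, norm_mul, mul_assoc C]
  have h2 := hk.norm_phi_le' (sub_mem_strips hk.δ_pos.le hx (ofReal_mem_rapidities _ t))
  have h3 := norm_chain_ofReal_le hk hw hc l t
  have h4 := hk.C_pos.le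
  calc _ ≤ (1 * ‖w t‖) * (C * (C * q ^ l)) := by gcongr
    _ = _ := by ring

theorem summable_integral_norm_chain {x : ℂ} (hx : x ∈ rapidities (δ / 2)) :
    Summable fun l => ∫ t : ℝ, ‖(1 / (2 * Real.pi) * w t) * (phi a (x - t) * chain a c w l t)‖ := by
  refine Summable.of_nonneg_of_le (fun l => integral_nonneg fun t => norm_nonneg _)
    (f := fun l => (∫ t, ‖w t‖) * (C * C) * q ^ l) (fun l => ?_)
    ((summable_geometric_of_lt_one hw.q_nonneg hw.q_lt).mul_left _)
  refine (integral_mono (integrable_chain_integrand hk hw hc hx l).norm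
    ((hw.integrable hk).norm.mul_const _) (norm_chain_integrand_le hk hw hc hx l)).trans ?_
  rw [integral_mul_const]
  exact le_of_eq (by ring)

theorem summable_norm_chain {x : ℂ} (hx : x ∈ rapidities (δ / 2)) :
    Summable fun l => ‖chain a c w l x‖ := by
  rw [← summable_nat_add_iff 1]
  exact Summable.of_nonneg_of_le (fun l => norm_nonneg _)
    (fun l => norm_integral_le_integral_norm _) (summable_integral_norm_chain hk hw hc hx)

/-- The sum of the iterated kernels solves the linearized integral equation. -/
theorem tsum_chain_eq {x : ℂ} (hx : x ∈ rapidities (δ / 2)) :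
    ∑' l, chain a c w l x = phi a (x - c) +
      ∫ t : ℝ, (1 / (2 * Real.pi) * w t) * (phi a (x - t) * ∑' l, chain a c w l t) := by
  have h1 := hasSum_integral_of_summable_integral_norm
    (fun l => integrable_chain_integrand hk hw hc hx l) (summable_integral_norm_chain hk hw hc hx)
  rw [(summable_norm_chain hk hw hc hx).of_norm.tsum_eq_zero_add]
  congr 1
  simp only [chain]
  rw [h1.tsum_eq]
  simp only [tsum_mul_left]

theorem norm_tsum_chain_le (x : ℝ) : ‖∑' l, chain a c w l x‖ ≤ C / (1 - q) := by
  refine (tsum_of_norm_bounded ((hasSum_geometric_of_lt_one hw.q_nonneg hw.q_lt).mul_left C)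
    fun l => norm_chain_ofReal_le hk hw hc l x).trans (le_of_eq ?_)
  ring

omit hc in
theorem differentiableAt_chain (v : ℝ) {x : ℂ} (hx : |x.im - Real.pi / 2| < δ / 2) (l : ℕ) :
    DifferentiableAt ℂ (chain a (root v) w l) x := by
  have hδ := hk.δ_pos
  cases l with
  | zero =>
    have h1 : x - root v ∈ strips δ := sub_mem_strips hδ.le (Or.inr hx.le) (hk.root_mem v)
    exact (differentiableAt_phi (hk.tau_ne _ h1)).comp x (differentiableAt_id.sub_const _)
  | succ l =>
    have hg := hw.integrable_mul hk (g := fun t : ℝ => chain a (root v) w l t)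
      ((measurable_chain a (root v) hw.continuous.measurable l).comp
        Complex.measurable_ofReal).aestronglyMeasurable
      (norm_chain_ofReal_le hk hw (hk.root_mem v) l)
    refine (hk.hasDerivAt_integral_phi hx hg).differentiableAt.congr_of_eventuallyEq
      (Eventually.of_forall fun z => ?_)
    simp only [chain]
    refine integral_congr_ae (Eventually.of_forall fun t => ?_)
    simp only
    ring

end

end

/-! ### The derivative of the quantization function -/

section

theorem hasDerivAt_logS {a : ℝ} {z : ℂ} (h : tau a z ≠ 0) (hz : -(S a z)⁻¹ ∈ Complex.slitPlane) :
    HasDerivAt (logS a) (Complex.I * phi a z) z := by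
  have hS := S_ne_zero h
  have h1 := ((((differentiableAt_S h).hasDerivAt.inv hS).neg).clog hz).const_sub
    (Real.pi * Complex.I)
  refine h1.congr_deriv ?_
  rw [phi, logDeriv_apply, Pi.neg_apply, Pi.inv_apply]
  field_simp
  linear_combination (deriv (S a) z) * Complex.I_sq

theorem eventually_slitPlane {a : ℝ} (hs : 0 < Real.sin (Real.pi * a)) :
    ∀ᶠ z in 𝓝 (0 : ℂ), tau a z ≠ 0 ∧ -(S a z)⁻¹ ∈ Complex.slitPlane := by
  have h0 : tau a 0 ≠ 0 := by
    have : (Real.sin (Real.pi * a) : ℂ) ≠ 0 := by exact_mod_cast hs.ne'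
    rw [tau, Complex.sinh_zero]
    simpa using this
  have h1 : S a 0 = -1 := by
    have : (Real.sin (Real.pi * a) : ℂ) ≠ 0 := by exact_mod_cast hs.ne'
    rw [S, Complex.sinh_zero, zero_sub, zero_add, neg_div,
      div_self (mul_ne_zero Complex.I_ne_zero this)]
  have h2 : ContinuousAt (fun z => -(S a z)⁻¹) 0 :=
    ((differentiableAt_S h0).continuousAt.inv₀ (by rw [h1]; norm_num)).neg
  refine ((continuous_tau a).continuousAt.eventually_ne h0).and
    (h2.eventually_mem (Complex.isOpen_slitPlane.mem_nhds ?_))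
  rw [h1]
  simp

theorem hasDerivAt_mul_sub {f : ℝ → ℂ} {v : ℝ} {y : ℂ} (hf : f v = 0)
    (h : Tendsto (fun u : ℝ => ((u - v : ℝ) : ℂ)⁻¹ * f u) (𝓝[≠] v) (𝓝 y)) : HasDerivAt f y v := by
  rw [hasDerivAt_iff_tendsto_slope]
  refine h.congr fun u => ?_
  rw [slope_def_module, hf, sub_zero, Complex.real_smul, Complex.ofReal_inv]

section

variable {a δ C m L v : ℝ} {ε : ℝ → ℝ → ℝ}

theorem IsTBASolution.weight_ofReal {u : ℝ} {e : ℝ → ℝ} (he : IsTBASolution a m L u e) (t : ℝ) :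
    weight a m L u e t = (filling (e t) : ℂ) := by
  rw [weight, ← he.2 t, filling]
  push_cast
  rfl

theorem KernelBound.exists_weightBound (hk : KernelBound a δ C) (hmL : 0 < m * L) {u : ℝ}
    {e : ℝ → ℝ} (he : IsTBASolution a m L u e) :
    ∃ q B, WeightBound (fun t => (filling (e t) : ℂ)) q B := by
  obtain ⟨B, hB, h1, -, h3⟩ := he.exists_bounds hk.sin_pos hk.sin_lt hmL
  have hn : ∀ t, ‖(filling (e t) : ℂ)‖ = filling (e t) := fun t => by
    rw [Complex.norm_real, Real.norm_eq_abs, abs_of_pos (filling_pos _)]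
  refine ⟨B / (1 + B), B, ?_, by positivity, ?_, fun t => ?_, fun t => ?_⟩
  · exact Complex.continuous_ofReal.comp (continuous_filling.comp he.1)
  · rw [div_lt_one (by positivity)]
    linarith
  · rw [hn]
    exact filling_le_of_exp_neg_le (h1 t)
  · rw [hn]
    exact h3 t

theorem KernelBound.integrable_Lam (hk : KernelBound a δ C) (hmL : 0 < m * L) {u : ℝ}
    {e : ℝ → ℝ} (he : IsTBASolution a m L u e) : Integrable fun t => (Lam (e t) : ℂ) := by
  obtain ⟨B, hB, -, h2, -⟩ := he.exists_bounds hk.sin_pos hk.sin_lt hmL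
  refine ((integrable_one_div_cosh hk.sin_pos).const_mul B).mono'
    (Complex.continuous_ofReal.comp (continuous_Lam.comp he.1)).aestronglyMeasurable
    (Eventually.of_forall fun t => ?_)
  rw [Complex.norm_real, Real.norm_eq_abs, abs_of_pos (Lam_pos _)]
  exact (h2 t).trans (le_of_eq (by ring))

theorem pseudoenergy_eq (a m L u : ℝ) (e : ℝ → ℝ) (z : ℂ) :
    pseudoenergy a m L u e z = m * L * Complex.cosh z + logS a (z - root u) -
      (∫ t : ℝ, phi a (z - t) * (Lam (e t) : ℂ)) / (2 * Real.pi) := by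
  rw [pseudoenergy, ← integral_div]
  rfl

/-- Near `θ̄ + iπ/2` the pseudoenergy is holomorphic. -/
theorem KernelBound.eventually_differentiableAt (hk : KernelBound a δ C) (hmL : 0 < m * L) {u : ℝ}
    {e : ℝ → ℝ} (he : IsTBASolution a m L u e) :
    ∀ᶠ z in 𝓝 (root u), DifferentiableAt ℂ (pseudoenergy a m L u e) z := by
  have h1 : Tendsto (fun z => z - root u) (𝓝 (root u)) (𝓝 0) := by
    have : Continuous fun z => z - root u := by fun_prop
    simpa using this.tendsto (root u)
  have h2 : ∀ᶠ z in 𝓝 (root u), |z.im - Real.pi / 2| < δ / 2 := by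
    have h3 : Continuous fun z : ℂ => |z.im - Real.pi / 2| := by fun_prop
    refine h3.continuousAt.eventually_lt_const ?_
    simp only
    rw [root_im, sub_self, abs_zero]
    exact half_pos hk.δ_pos
  filter_upwards [h1.eventually (eventually_slitPlane hk.sin_pos), h2] with z hz hz2
  rw [show pseudoenergy a m L u e = fun z => _ from funext (pseudoenergy_eq a m L u e)]
  have h4 := (hasDerivAt_logS hz.1 hz.2).differentiableAt.comp z
    (differentiableAt_id.sub_const (root u))
  exact ((Complex.differentiable_cosh z).const_mul _).add h4 |>.sub
    ((hk.hasDerivAt_integral_phi hz2 (hk.integrable_Lam hmL he)).differentiableAt.div_const _)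

/-- The difference quotients of the pseudoenergy with respect to the root converge, uniformly in
the rapidity, to `-i` times the sum of the iterated kernels, which solves the linearized
equation. -/
theorem KernelBound.eventually_norm_slope_add_le (hk : KernelBound a δ C) (hmL : 0 < m * L)
    (hε : ∀ u, IsTBASolution a m L u (ε u)) :
    ∃ K, ∀ᶠ u in 𝓝[≠] v, ∀ θ : ℝ, ‖((ε u θ - ε v θ) / (u - v) : ℝ) +
      Complex.I * ∑' l, chain a (root v) (fun t => (filling (ε v t) : ℂ)) l θ‖ ≤ K * |u - v| := by
  obtain ⟨K₁, hK₁, hell⟩ := abs_ellDeriv_sub_le hk.sin_pos hk.sin_lt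
  obtain ⟨K₂, hK₂, hlip⟩ :=
    IsTBASolution.eventually_abs_sub_le (v := v) hk.sin_pos hk.sin_lt hmL hε
  obtain ⟨q, B, hw⟩ := hk.exists_weightBound hmL (hε v)
  have hpi : (Real.pi : ℂ) ≠ 0 := by exact_mod_cast Real.pi_ne_zero
  have hs := hk.sin_pos
  set w : ℝ → ℂ := fun t => (filling (ε v t) : ℂ) with hwdef
  set U : ℂ → ℂ := fun x => ∑' l, chain a (root v) w l x with hU
  have hroot := hk.root_mem v
  have hUmeas : Measurable fun t : ℝ => U t := by
    refine Measurable.comp (g := U) ?_ Complex.measurable_ofReal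
    exact Measurable.tsum fun l => measurable_chain a (root v) hw.continuous.measurable l
  refine ⟨(K₁ + K₂ ^ 2) / (1 - q), ?_⟩
  filter_upwards [nhdsWithin_le_nhds hlip, self_mem_nhdsWithin] with u hu huv θ
  have huv' : u - v ≠ 0 := sub_ne_zero.mpr huv
  have huvc : ((u - v : ℝ) : ℂ) ≠ 0 := by exact_mod_cast huv'
  have habs : 0 < |u - v| := abs_pos.mpr huv'
  rw [div_mul_eq_mul_div]
  refine le_div_of_contraction (f := fun θ : ℝ => ‖((ε u θ - ε v θ) / (u - v) : ℝ) + Complex.I * U θ‖)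
    ?_ (by positivity) hw.q_nonneg hw.q_lt (fun D hD hf θ => ?_) θ
  · refine ⟨K₂ + C / (1 - q), ?_⟩
    rintro _ ⟨θ, rfl⟩
    refine (norm_add_le _ _).trans (add_le_add ?_ ?_)
    · rw [Complex.norm_real, Real.norm_eq_abs, abs_div, div_le_iff₀ habs]
      exact hu θ
    · rw [norm_mul, Complex.norm_I, one_mul]
      exact norm_tsum_chain_le hk hw hroot θ
  · -- the equation satisfied by the difference quotient minus its limit
    have h1 := (hε v).sub_eq hs hk.sin_lt hmL (hε u) θ
    have h2 := tsum_chain_eq hk hw hroot (ofReal_mem_rapidities _ θ)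
    have hint : Integrable fun t : ℝ => (ker a (θ - t) : ℂ) * ((w t) * U t) := by
      refine Integrable.mul_bdd (c := C / (1 - q)) (integrable_ker_sub hs θ).ofReal
        (hw.continuous.measurable.mul hUmeas).aestronglyMeasurable (Eventually.of_forall fun t => ?_)
      rw [norm_mul]
      calc _ ≤ 1 * (C / (1 - q)) := mul_le_mul ((hw.norm_le t).trans hw.q_lt.le)
            (norm_tsum_chain_le hk hw hroot t) (norm_nonneg _) zero_le_one
        _ = _ := one_mul _
    have h3 : U θ = phi a (θ - root v) + ∫ t : ℝ, (ker a (θ - t) : ℂ) * ((w t) * U t) := by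
      refine h2.trans ?_
      congr 1
      refine integral_congr_ae (Eventually.of_forall fun t => ?_)
      simp only [← Complex.ofReal_sub, phi_ofReal]
      push_cast
      field_simp
      simp only [hU]
    set R : ℝ → ℂ := fun t => ((Lam (ε v t) - Lam (ε u t)) / (u - v) : ℝ) + Complex.I * (w t * U t)
      with hR
    have hintL := (hε v).integrable_sub hs hk.sin_lt hmL (hε u) θ
    have hLc : Integrable fun t =>
        ((ker a (θ - t) * (Lam (ε v t) - Lam (ε u t)) : ℝ) : ℂ) := hintL.ofReal
    have hintR : Integrable fun t : ℝ => (ker a (θ - t) : ℂ) * R t := by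
      refine ((hLc.div_const ((u - v : ℝ) : ℂ)).add (hint.const_mul Complex.I)).congr (Eventually.of_forall fun t => ?_)
      simp only [Pi.add_apply, hR]
      push_cast
      ring
    have h4 : (((ε u θ - ε v θ) / (u - v) : ℝ) : ℂ) + Complex.I * U θ =
        (((ell a (θ - u) - ell a (θ - v)) / (u - v) + ellDeriv a (θ - v) : ℝ) : ℂ) +
          ∫ t : ℝ, (ker a (θ - t) : ℂ) * R t := by
      have h5 : ∫ t : ℝ, (ker a (θ - t) : ℂ) * R t =
          ((∫ t, ker a (θ - t) * (Lam (ε v t) - Lam (ε u t)) : ℝ) : ℂ) / (u - v : ℝ) +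
            Complex.I * ∫ t : ℝ, (ker a (θ - t) : ℂ) * ((w t) * U t) := by
        rw [← integral_complex_ofReal, ← integral_div, ← integral_const_mul,
          ← integral_add (hLc.div_const _) (hint.const_mul Complex.I)]
        refine integral_congr_ae (Eventually.of_forall fun t => ?_)
        simp only [hR]
        push_cast
        ring
      rw [h5, h1, h3, Complex.ofReal_add, ellDeriv_eq hs hk.sin_lt, ← sub_root]
      push_cast
      ring
    have h6 : |(ell a (θ - u) - ell a (θ - v)) / (u - v) + ellDeriv a (θ - v)| ≤ K₁ * |u - v| := by
      have := abs_taylor_le (hasDerivAt_ell hs hk.sin_lt) hell (θ - v) (-(u - v))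
      rw [show θ - v + -(u - v) = θ - u by ring, neg_sq, ← sq_abs (u - v)] at this
      rw [show (ell a (θ - u) - ell a (θ - v)) / (u - v) + ellDeriv a (θ - v) =
        (ell a (θ - u) - ell a (θ - v) - ellDeriv a (θ - v) * -(u - v)) / (u - v) by
          field_simp
          ring, abs_div, div_le_iff₀ habs]
      refine this.trans (le_of_eq (by ring))
    -- the second-order Taylor remainder, plus the current error damped by the filling fraction
    have h7 : ∀ t, ‖R t‖ ≤ K₂ ^ 2 * |u - v| + q * D := by
      intro t
      have h8 := abs_Lam_taylor_le (ε v t) (ε u t - ε v t)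
      rw [add_sub_cancel] at h8
      have h9 : R t = ((-(Lam (ε u t) - Lam (ε v t) + filling (ε v t) * (ε u t - ε v t)) /
          (u - v) : ℝ) : ℂ) + w t * ((((ε u t - ε v t) / (u - v) : ℝ) : ℂ) + Complex.I * U t) := by
        simp only [hR, hwdef]
        push_cast
        ring
      rw [h9]
      refine (norm_add_le _ _).trans (add_le_add ?_ ?_)
      · rw [Complex.norm_real, Real.norm_eq_abs, abs_div, abs_neg, div_le_iff₀ habs]
        refine h8.trans ?_
        have := pow_le_pow_left₀ (abs_nonneg _) (hu t) 2
        rw [sq_abs] at this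
        refine this.trans (le_of_eq (by ring))
      · rw [norm_mul]
        exact mul_le_mul (hw.norm_le t) (hf t) (norm_nonneg _) hw.q_nonneg
    rw [h4]
    have h10 : ‖∫ t : ℝ, (ker a (θ - t) : ℂ) * R t‖ ≤ K₂ ^ 2 * |u - v| + q * D := by
      refine (norm_integral_le_of_norm_le (g := fun t => ker a (θ - t) *
        (K₂ ^ 2 * |u - v| + q * D)) ((integrable_ker_sub hs θ).mul_const _)
        (Eventually.of_forall fun t => ?_)).trans (le_of_eq ?_)
      · rw [norm_mul, Complex.norm_real, Real.norm_eq_abs, abs_of_pos (ker_pos hs _)]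
        exact mul_le_mul_of_nonneg_left (h7 t) (ker_pos hs _).le
      · rw [integral_mul_const, integral_ker_sub hs, one_mul]
    refine (norm_add_le _ _).trans ?_
    rw [Complex.norm_real, Real.norm_eq_abs]
    linarith

theorem KernelBound.tendsto_slope (hk : KernelBound a δ C) (hmL : 0 < m * L)
    (hε : ∀ u, IsTBASolution a m L u (ε u)) (θ : ℝ) :
    Tendsto (fun u => (((ε u θ - ε v θ) / (u - v) : ℝ) : ℂ)) (𝓝[≠] v)
      (𝓝 (-(Complex.I * ∑' l, chain a (root v) (fun t => (filling (ε v t) : ℂ)) l θ))) := by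
  obtain ⟨K, hK⟩ := hk.eventually_norm_slope_add_le (v := v) hmL hε
  rw [tendsto_iff_norm_sub_tendsto_zero]
  refine squeeze_zero' (Eventually.of_forall fun u => norm_nonneg _)
    (hK.mono fun u hu => ?_) (g := fun u => K * |u - v|) ?_
  · rw [sub_neg_eq_add]
    exact hu θ
  · have : Continuous fun u => K * |u - v| := by fun_prop
    simpa using (this.tendsto v).mono_left nhdsWithin_le_nhds

/-- The derivative of the pseudoenergy with respect to the root parameter, after integration
against the kernel, as it enters the derivative of `Q̄`. -/
theorem KernelBound.hasDerivAt_integral_Lam (hk : KernelBound a δ C) (hmL : 0 < m * L)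
    (hε : ∀ u, IsTBASolution a m L u (ε u)) :
    HasDerivAt (fun u : ℝ => (∫ t : ℝ, phi a (root u - t) * ((Lam (ε v t) - Lam (ε u t) : ℝ) : ℂ)) /
        (2 * Real.pi))
      (-Complex.I * (∑' l, chain a (root v) (fun t => (filling (ε v t) : ℂ)) l (root v) - phi a 0))
      v := by
  obtain ⟨K, hK, hlip⟩ :=
    IsTBASolution.eventually_abs_sub_le (v := v) hk.sin_pos hk.sin_lt hmL hε
  obtain ⟨q, B, hw⟩ := hk.exists_weightBound hmL (hε v)
  have hpi : (Real.pi : ℂ) ≠ 0 := by exact_mod_cast Real.pi_ne_zero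
  have hs := hk.sin_pos
  set w : ℝ → ℂ := fun t => (filling (ε v t) : ℂ) with hwdef
  set U : ℂ → ℂ := fun x => ∑' l, chain a (root v) w l x with hU
  have hroot := hk.root_mem v
  have hUv := tsum_chain_eq hk hw hroot hroot
  refine hasDerivAt_mul_sub (by simp) ?_
  have hlim : -Complex.I * (U (root v) - phi a 0) =
      ∫ t : ℝ, phi a (root v - t) * (w t * (-(Complex.I * U t))) / (2 * Real.pi) := by
    rw [show U (root v) = _ from hUv, sub_self, add_sub_cancel_left, ← integral_const_mul]
    refine integral_congr_ae (Eventually.of_forall fun t => ?_)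
    simp only [hU]
    field_simp
  rw [show -Complex.I * (∑' l, chain a (root v) w l (root v) - phi a 0) = _ from hlim]
  have hmain : Tendsto (fun u : ℝ => ∫ t : ℝ, phi a (root u - t) *
      (((Lam (ε v t) - Lam (ε u t)) / (u - v) : ℝ) : ℂ) / (2 * Real.pi)) (𝓝[≠] v)
      (𝓝 (∫ t : ℝ, phi a (root v - t) * (w t * (-(Complex.I * U t))) / (2 * Real.pi))) := by
    refine tendsto_integral_filter_of_dominated_convergence
      (fun t => C * (2 * Real.cosh 1) * K * (1 / Real.cosh (v - t))) ?_ ?_ ?_ ?_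
    · refine Eventually.of_forall fun u => ((Measurable.mul ?_ ?_).div_const _).aestronglyMeasurable
      · exact (measurable_phi a).comp (by fun_prop)
      · have h1 := (continuous_Lam.comp (hε v).1).measurable
        have h2 := (continuous_Lam.comp (hε u).1).measurable
        exact Complex.measurable_ofReal.comp ((h1.sub h2).div_const _)
    · have hnear : ∀ᶠ u in 𝓝[≠] v, |u - v| < 1 := by
        have : ContinuousAt (fun u => |u - v|) v := by fun_prop
        exact nhdsWithin_le_nhds (this.eventually_lt_const (by simp))
      filter_upwards [nhdsWithin_le_nhds hlip, hnear, self_mem_nhdsWithin] with u hu hu1 huv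
      refine Eventually.of_forall fun t => ?_
      have habs : 0 < |u - v| := abs_pos.mpr (sub_ne_zero.mpr huv)
      have hphi : ‖phi a (root u - t)‖ ≤ C * (2 * Real.cosh 1) * (1 / Real.cosh (v - t)) := by
        have h1 := hk.norm_phi_le _ (sub_mem_strips hk.δ_pos.le (hk.root_mem u)
          (ofReal_mem_rapidities _ t))
        rw [Complex.sub_re, root_re, Complex.ofReal_re] at h1
        have h2 := cosh_add_le (u - t) (v - u)
        have h3 : Real.cosh (v - u) ≤ Real.cosh 1 := by
          rw [Real.cosh_le_cosh, abs_one, abs_sub_comm]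
          exact hu1.le
        rw [show u - t + (v - u) = v - t by ring] at h2
        have h4 := Real.cosh_pos (u - t)
        have h5 := Real.cosh_pos (v - t)
        have h6 := hk.C_pos
        refine h1.trans ?_
        rw [div_le_iff₀ h4, mul_one_div, div_mul_eq_mul_div, le_div_iff₀ h5]
        calc C * Real.cosh (v - t) ≤ C * (2 * Real.cosh (u - t) * Real.cosh 1) := by
              gcongr
              exact h2.trans (by gcongr)
          _ = _ := by ring
      have hL : |(Lam (ε v t) - Lam (ε u t)) / (u - v)| ≤ K := by
        rw [abs_div, div_le_iff₀ habs]
        refine le_trans ?_ (hu t)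
        have := abs_sub_le_of_hasDerivAt (K := 1) hasDerivAt_Lam (fun x => by
          rw [abs_neg, abs_of_pos (filling_pos x)]
          exact (filling_lt_one x).le) (ε u t) (ε v t)
        rwa [one_mul, abs_sub_comm (ε v t)] at this
      have h2pi : ‖(2 * Real.pi : ℂ)‖ = 2 * Real.pi := by
        simp [abs_of_pos Real.pi_pos]
      rw [norm_div, norm_mul, Complex.norm_real, Real.norm_eq_abs, h2pi]
      have hC := hk.C_pos
      have hch := Real.cosh_pos (1 : ℝ)
      have hch' := Real.cosh_pos (v - t)
      calc _ ≤ ‖phi a (root u - t)‖ * |(Lam (ε v t) - Lam (ε u t)) / (u - v)| :=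
            div_le_self (by positivity) (by linarith [Real.pi_gt_three])
        _ ≤ C * (2 * Real.cosh 1) * (1 / Real.cosh (v - t)) * K := by gcongr
        _ = _ := by ring
    · exact ((integrable_one_div_cosh hs).comp_sub_left v).const_mul _
    · refine Eventually.of_forall fun t => ?_
      refine (Tendsto.mul ?_ ?_).div_const _
      · have hd := (differentiableAt_phi (hk.tau_ne _ (sub_mem_strips hk.δ_pos.le hroot
          (ofReal_mem_rapidities _ t)))).continuousAt
        have hc : ContinuousAt (fun u : ℝ => root u - t) v := by
          unfold root
          fun_prop
        exact (ContinuousAt.comp (f := fun u : ℝ => root u - t) (x := v) hd hc).tendsto.mono_left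
          nhdsWithin_le_nhds
      · -- chain rule for difference quotients
        have h1 := hk.tendsto_slope (v := v) hmL hε t
        have h2 : Tendsto (fun u => ε u t - ε v t) (𝓝[≠] v) (𝓝 0) := by
          rw [tendsto_zero_iff_abs_tendsto_zero]
          refine squeeze_zero' (Eventually.of_forall fun u => abs_nonneg _)
            ((hlip.filter_mono nhdsWithin_le_nhds).mono fun u hu => hu t) (g := fun u => K * |u - v|) ?_
          have : Continuous fun u => K * |u - v| := by fun_prop
          simpa using (this.tendsto v).mono_left nhdsWithin_le_nhds
        have h3 : Tendsto (fun u => ((-(Lam (ε u t) - Lam (ε v t) +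
            filling (ε v t) * (ε u t - ε v t)) / (u - v) : ℝ) : ℂ)) (𝓝[≠] v) (𝓝 0) := by
          rw [tendsto_zero_iff_norm_tendsto_zero]
          refine squeeze_zero' (Eventually.of_forall fun u => norm_nonneg _)
            (g := fun u => K ^ 2 * |u - v|) ?_ ?_
          · filter_upwards [nhdsWithin_le_nhds hlip, self_mem_nhdsWithin] with u hu huv
            have habs : 0 < |u - v| := abs_pos.mpr (sub_ne_zero.mpr huv)
            have h8 := abs_Lam_taylor_le (ε v t) (ε u t - ε v t)
            rw [add_sub_cancel] at h8
            rw [Complex.norm_real, Real.norm_eq_abs, abs_div, abs_neg, div_le_iff₀ habs]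
            refine h8.trans ?_
            have := pow_le_pow_left₀ (abs_nonneg _) (hu t) 2
            rw [sq_abs] at this
            refine this.trans (le_of_eq (by ring))
          · have : Continuous fun u => K ^ 2 * |u - v| := by fun_prop
            simpa using (this.tendsto v).mono_left nhdsWithin_le_nhds
        have h4 := h3.add (h1.const_mul (w t))
        rw [zero_add] at h4
        refine h4.congr fun u => ?_
        simp only [hwdef]
        push_cast
        ring
  refine hmain.congr fun u => ?_
  rw [← integral_div, ← integral_const_mul]
  refine integral_congr_ae (Eventually.of_forall fun t => ?_)
  simp only
  push_cast
  ring

/-- The derivative of `Q̄` is `n_1` minus the sum of the connected paths. -/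
theorem KernelBound.hasDerivAt_Qbar (hk : KernelBound a δ C) (hmL : 0 < m * L)
    (hε : ∀ u, IsTBASolution a m L u (ε u)) :
    HasDerivAt (Qbar a m L ε) (nOne a m L v (ε v) -
      ∑' l, chain a (root v) (fun t => (filling (ε v t) : ℂ)) l (root v)) v := by
  have hE := (hk.eventually_differentiableAt hmL (hε v)).self_of_nhds.hasDerivAt
  have h1 : HasDerivAt (fun u : ℝ => pseudoenergy a m L v (ε v) (root u))
      (deriv (pseudoenergy a m L v (ε v)) (root v)) v := by
    exact (HasDerivAt.comp_add_const (v : ℂ) ((Real.pi / 2 : ℝ) * Complex.I) hE).comp_ofReal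
  have h2 : HasDerivAt (fun u : ℝ => logS a (root u - root v)) (Complex.I * phi a 0) v := by
    have h0 := (eventually_slitPlane hk.sin_pos).self_of_nhds
    have h3 : HasDerivAt (logS a) (Complex.I * phi a 0) (root v - root v) := by
      rw [sub_self]
      exact hasDerivAt_logS h0.1 h0.2
    exact (HasDerivAt.comp_add_const (v : ℂ) ((Real.pi / 2 : ℝ) * Complex.I)
      (HasDerivAt.comp_sub_const (root v) (root v) h3)).comp_ofReal
  have h3 := hk.hasDerivAt_integral_Lam (v := v) hmL hε
  have h4 := (((h1.sub h2).add_const (logS a 0)).add h3).const_mul (-Complex.I)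
  have h5 := h4.congr_of_eventuallyEq (f₁ := Qbar a m L ε) (Eventually.of_forall fun u => ?_)
  · refine h5.congr_deriv ?_
    rw [nOne]
    linear_combination (∑' l, chain a (root v) (fun t => (filling (ε v t) : ℂ)) l (root v)) *
      Complex.I_sq
  · have i1 := hk.integrable_phi_mul (hk.root_mem u) (hk.integrable_Lam hmL (hε v))
    have i2 := hk.integrable_phi_mul (hk.root_mem u) (hk.integrable_Lam hmL (hε u))
    have h6 : ∫ t : ℝ, phi a (root u - t) * ((Lam (ε v t) - Lam (ε u t) : ℝ) : ℂ) =
        (∫ t : ℝ, phi a (root u - t) * (Lam (ε v t) : ℂ)) -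
          ∫ t : ℝ, phi a (root u - t) * (Lam (ε u t) : ℂ) := by
      rw [← integral_sub i1 i2]
      refine integral_congr_ae (Eventually.of_forall fun t => ?_)
      simp only
      push_cast
      ring
    simp only [Qbar, Pi.add_apply, Pi.sub_apply, pseudoenergy_eq, h6, sub_self]
    ring

end

end

/-! ### Integration over configurations -/

section

section Configurations

variable {X : Type} [MeasurableSpace X] (μ : Measure X) [SigmaFinite μ] {n : ℕ}

theorem measurePreserving_extract (j : Fin (n + 1)) :
    MeasurePreserving (fun B : Fin (n + 1) → X => (B j, B ∘ j.succAbove))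
      (Measure.pi fun _ => μ) (μ.prod (Measure.pi fun _ => μ)) :=
  measurePreserving_piFinSuccAbove (fun _ => μ) j

theorem measurableEmbedding_extract (j : Fin (n + 1)) :
    MeasurableEmbedding (fun B : Fin (n + 1) → X => (B j, B ∘ j.succAbove)) :=
  (MeasurableEquiv.piFinSuccAbove (fun _ => X) j).measurableEmbedding

theorem integral_extract (j : Fin (n + 1)) (h : X × (Fin n → X) → ℂ) :
    ∫ B, h (B j, B ∘ j.succAbove) ∂(Measure.pi fun _ : Fin (n + 1) => μ) =
      ∫ p, h p ∂(μ.prod (Measure.pi fun _ => μ)) :=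
  (measurePreserving_extract μ j).integral_comp (measurableEmbedding_extract j) h

theorem integrable_extract_iff (j : Fin (n + 1)) {h : X × (Fin n → X) → ℂ} :
    Integrable (fun B : Fin (n + 1) → X => h (B j, B ∘ j.succAbove)) (Measure.pi fun _ => μ) ↔
      Integrable h (μ.prod (Measure.pi fun _ => μ)) :=
  (measurePreserving_extract μ j).integrable_comp_emb (measurableEmbedding_extract j)

/-- Summing over the choice of a distinguished rapidity gives a factor `n + 1`. -/
theorem integral_sum_extract {h : X × (Fin n → X) → ℂ}
    (hh : Integrable h (μ.prod (Measure.pi fun _ => μ))) :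
    ∫ B, ∑ j, h (B j, B ∘ j.succAbove) ∂(Measure.pi fun _ : Fin (n + 1) => μ) =
      (n + 1 : ℂ) * ∫ p, h p ∂(μ.prod (Measure.pi fun _ => μ)) := by
  rw [integral_finsetSum _ fun j _ => (integrable_extract_iff μ j).mpr hh]
  simp only [integral_extract]
  simp

omit [SigmaFinite μ] in
theorem integral_zero_config (g : (Fin 0 → X) → ℂ) :
    ∫ B, g B ∂(Measure.pi fun _ : Fin 0 => μ) = g Fin.elim0 := by
  rw [Measure.pi_of_empty _ Fin.elim0, integral_dirac]

theorem integrable_prod_config {ω : X → ℂ} (hω : Integrable ω μ) (n : ℕ) :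
    Integrable (fun t : Fin n → X => ∏ j, ω (t j)) (Measure.pi fun _ => μ) :=
  Integrable.fintype_prod (f := fun _ => ω) fun _ => hω

end Configurations

/-! ### Connected paths -/

/-- The product of kernels along the path from `x` through `θ_1, …, θ_l` to `c`. -/
def pathProd (a : ℝ) (c : ℂ) : (l : ℕ) → ℂ → (Fin l → ℝ) → ℂ
  | 0, x, _ => phi a (x - c)
  | l + 1, x, θ => phi a (x - θ 0) * pathProd a c l (θ 0) (θ ∘ Fin.succ)

theorem pathProd_eq (a : ℝ) (c : ℂ) (l : ℕ) (x : ℂ) (θ : Fin l → ℝ) :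
    ∏ i : Fin (l + 1),
      phi a ((Fin.cons x (Fin.snoc (fun i => (θ i : ℂ)) c : Fin (l + 1) → ℂ) : Fin (l + 2) → ℂ)
          i.castSucc - (Fin.snoc (fun i => (θ i : ℂ)) c : Fin (l + 1) → ℂ) i) =
      pathProd a c l x θ := by
  induction l generalizing x with
  | zero => simp [pathProd, Fin.snoc]
  | succ l ih =>
    rw [Fin.prod_univ_succ, pathProd, ← ih]
    have h0 : (Fin.snoc (fun i => (θ i : ℂ)) c : Fin (l + 2) → ℂ) =
        Fin.cons (θ 0 : ℂ) (Fin.snoc (fun i => ((θ ∘ Fin.succ) i : ℂ)) c : Fin (l + 1) → ℂ) := by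
      rw [Fin.cons_snoc_eq_snoc_cons]
      congr 1
      ext i
      refine Fin.cases ?_ (fun i => ?_) i <;> simp
    rw [h0]
    congr 1

theorem bracket_path (a : ℝ) (c : ℂ) (l : ℕ) (θ : Fin l → ℝ) :
    bracket a c θ (Fin.cons none (Fin.snoc (fun i : Fin l => some i) none :
      Fin (l + 1) → Option (Fin l))) = pathProd a c l c θ := by
  rw [bracket, ← pathProd_eq]
  have h : ∀ j : Fin (l + 1), ((Fin.snoc (fun i : Fin l => some i) none :
      Fin (l + 1) → Option (Fin l)) j).elim c (fun p => (θ p : ℂ)) =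
      (Fin.snoc (fun i => (θ i : ℂ)) c : Fin (l + 1) → ℂ) j := by
    intro j
    refine Fin.lastCases ?_ (fun i => ?_) j <;> simp
  refine Finset.prod_congr rfl fun i _ => ?_
  rw [Fin.cons_succ, h]
  congr 2
  refine Fin.cases ?_ (fun j => ?_) i
  · simp
  · rw [← Fin.succ_castSucc, Fin.cons_succ, Fin.cons_succ, h]

section

variable {a δ C : ℝ} (hk : KernelBound a δ C) {w : ℝ → ℂ} {q B : ℝ} (hw : WeightBound w q B)
  {c : ℂ} (hc : c ∈ rapidities (δ / 2))
include hk hc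

omit hk hc in
theorem measurable_pathProd (l : ℕ) :
    Measurable fun p : ℂ × (Fin l → ℝ) => pathProd a c l p.1 p.2 := by
  induction l with
  | zero => exact (measurable_phi a).comp (measurable_fst.sub_const c)
  | succ l ih =>
    have h0 : Measurable fun p : ℂ × (Fin (l + 1) → ℝ) => ((p.2 0 : ℝ) : ℂ) :=
      Complex.measurable_ofReal.comp ((measurable_pi_apply 0).comp measurable_snd)
    refine ((measurable_phi a).comp (measurable_fst.sub h0)).mul
      (ih.comp (h0.prodMk (measurable_pi_iff.mpr fun j =>
        (measurable_pi_apply j.succ).comp measurable_snd)))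

theorem norm_pathProd_le (l : ℕ) {x : ℂ} (hx : x ∈ rapidities (δ / 2)) (θ : Fin l → ℝ) :
    ‖pathProd a c l x θ‖ ≤ C ^ (l + 1) := by
  induction l generalizing x with
  | zero => simpa [pathProd] using hk.norm_phi_le' (sub_mem_strips hk.δ_pos.le hx hc)
  | succ l ih =>
    rw [pathProd, norm_mul, pow_succ' C]
    exact mul_le_mul (hk.norm_phi_le' (sub_mem_strips hk.δ_pos.le hx (ofReal_mem_rapidities _ _)))
      (ih (ofReal_mem_rapidities _ _) _) (norm_nonneg _) hk.C_pos.le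

include hw

theorem integral_pathProd (l : ℕ) {x : ℂ} (hx : x ∈ rapidities (δ / 2)) :
    ∫ θ : Fin l → ℝ, (∏ i, 1 / (2 * Real.pi) * w (θ i)) * pathProd a c l x θ =
      chain a c w l x := by
  induction l generalizing x with
  | zero =>
    rw [volume_pi, integral_zero_config]
    simp [pathProd, chain]
  | succ l ih =>
    have hω : Integrable (fun t => 1 / (2 * Real.pi) * w t) := (hw.integrable hk).const_mul _
    set h : ℝ × (Fin l → ℝ) → ℂ := fun p => (1 / (2 * Real.pi) * w p.1) * (phi a (x - p.1) *
      ((∏ i, 1 / (2 * Real.pi) * w (p.2 i)) * pathProd a c l p.1 p.2)) with hh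
    have h1 : (fun θ : Fin (l + 1) → ℝ => (∏ i, 1 / (2 * Real.pi) * w (θ i)) *
        pathProd a c (l + 1) x θ) = fun θ => h (θ 0, θ ∘ (0 : Fin (l + 1)).succAbove) := by
      ext θ
      rw [Fin.prod_univ_succ, pathProd]
      simp only [hh, Fin.succAbove_zero, Function.comp_def]
      ring
    have h2 : Integrable (fun θ : Fin (l + 1) → ℝ => (∏ i, 1 / (2 * Real.pi) * w (θ i)) *
        pathProd a c (l + 1) x θ) (Measure.pi fun _ => volume) :=
      (integrable_prod_config volume hω (l + 1)).mul_bdd (c := C ^ (l + 1 + 1))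
        ((measurable_pathProd (l + 1)).comp
          (measurable_const.prodMk measurable_id)).aestronglyMeasurable
        (Eventually.of_forall fun θ => norm_pathProd_le hk hc (l + 1) hx θ)
    rw [h1, integrable_extract_iff] at h2
    rw [volume_pi, h1, integral_extract, integral_prod _ h2, chain]
    refine integral_congr_ae (Eventually.of_forall fun y => ?_)
    simp only [hh]
    rw [integral_const_mul, integral_const_mul, ← volume_pi, ih (ofReal_mem_rapidities _ y)]

end

theorem pathTerm_eq_chain {a δ C m L u : ℝ} (hk : KernelBound a δ C) (hmL : 0 < m * L) {e : ℝ → ℝ}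
    (he : IsTBASolution a m L u e) (l : ℕ) :
    pathTerm a m L u e l = chain a (root u) (fun t => (filling (e t) : ℂ)) l (root u) := by
  obtain ⟨q, B, hw⟩ := hk.exists_weightBound hmL he
  rw [← integral_pathProd hk hw (hk.root_mem u) l (hk.root_mem u), pathTerm]
  simp only [he.weight_ofReal, bracket_path]

end

/-! ### Closed walks and the series for `1 / N_1` -/

section

/-- The sum over the walks with `k` steps that start at `x`, end at `c`, and visit each of the `l`
rapidities `θ_i` exactly once, and otherwise only `c`, of the products of kernels along the steps.
The Boolean tells whether the starting point counts as `c`, which matters for `k = 0` only. -/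
def walkSum (a : ℝ) (c : ℂ) : (k l : ℕ) → Bool → ℂ → (Fin l → ℝ) → ℂ
  | 0, l, b, _, _ => if l = 0 ∧ b then 1 else 0
  | k + 1, 0, _, x, θ => phi a (x - c) * walkSum a c k 0 true c θ
  | k + 1, l + 1, _, x, θ => phi a (x - c) * walkSum a c k (l + 1) true c θ +
      ∑ i, phi a (x - θ i) * walkSum a c k l false (θ i) (θ ∘ i.succAbove)

/-- The steps `s` form a walk ending at `none` in which every label `some i` occurs once; the
Boolean tells whether the walk starts at `none`. -/
def IsWalk {k l : ℕ} (b : Bool) (s : Fin k → Option (Fin l)) : Prop :=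
  (if h : k = 0 then b = true else s ⟨k - 1, by omega⟩ = none) ∧ ∀ i, ∃! p, s p = some i

/-- The product of the kernels along a walk from `x`. -/
def walkProd (a : ℝ) (c : ℂ) {l : ℕ} (θ : Fin l → ℝ) : (k : ℕ) → ℂ → (Fin k → Option (Fin l)) → ℂ
  | 0, _, _ => 1
  | k + 1, x, s => phi a (x - (s 0).elim c (fun p => (θ p : ℂ))) *
      walkProd a c θ k ((s 0).elim c (fun p => (θ p : ℂ))) (s ∘ Fin.succ)

theorem existsUnique_cons {k l : ℕ} (o : Option (Fin l)) (s : Fin k → Option (Fin l))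
    (i : Fin l) : (∃! p, (Fin.cons o s : Fin (k + 1) → Option (Fin l)) p = some i) ↔
      if o = some i then ∀ p, s p ≠ some i else ∃! p, s p = some i := by
  split_ifs with h
  · constructor
    · rintro ⟨p, -, hp⟩ j hj
      have h1 := hp 0 (by simpa using h)
      have h2 := hp j.succ (by simpa using hj)
      exact absurd (h2.trans h1.symm) (Fin.succ_ne_zero j)
    · intro hs
      refine ⟨0, by simpa using h, fun p => ?_⟩
      refine Fin.cases (fun _ => rfl) (fun j hj => ?_) p
      exact absurd (by simpa using hj) (hs j)
  · constructor
    · rintro ⟨p, hp, hu⟩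
      revert hp hu
      refine Fin.cases (fun hp _ => absurd (by simpa using hp) h) (fun j hp hu => ?_) p
      exact ⟨j, by simpa using hp, fun j' hj' => Fin.succ_injective _ (hu j'.succ (by simpa using hj'))⟩
    · rintro ⟨j, hj, hu⟩
      refine ⟨j.succ, by simpa using hj, fun p => ?_⟩
      refine Fin.cases (fun hp => absurd (by simpa using hp) h) (fun j' hj' => ?_) p
      rw [hu j' (by simpa using hj')]

theorem isWalk_cons_none {k l : ℕ} (b : Bool) (s : Fin k → Option (Fin l)) :
    IsWalk b (Fin.cons none s : Fin (k + 1) → Option (Fin l)) ↔ IsWalk true s := by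
  simp only [IsWalk, existsUnique_cons, reduceCtorEq, if_false]
  refine and_congr_left fun _ => ?_
  cases k with
  | zero => simp
  | succ k =>
    simp only [Nat.add_eq_zero_iff, one_ne_zero, and_false, dite_false]
    exact Iff.rfl

theorem isWalk_cons_some {k l : ℕ} (b : Bool) (i : Fin (l + 1)) (s : Fin k → Option (Fin l)) :
    IsWalk b (Fin.cons (some i) (Option.map i.succAbove ∘ s) : Fin (k + 1) → Option (Fin (l + 1))) ↔
      IsWalk false s := by
  have hinj := Option.map_injective (Fin.succAbove_right_injective (p := i))
  simp only [IsWalk, existsUnique_cons]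
  refine and_congr ?_ ?_
  · cases k with
    | zero => simp
    | succ k =>
      simp only [Nat.add_eq_zero_iff, one_ne_zero, and_false, dite_false]
      change Option.map i.succAbove (s ⟨k, _⟩) = none ↔ _
      simp
  · rw [Fin.forall_iff_succAbove i]
    simp only [if_true, Option.some.injEq, Function.comp_apply]
    have h0 : ∀ p, Option.map i.succAbove (s p) ≠ some i := by
      intro p h
      obtain ⟨y, -, hy⟩ := Option.map_eq_some_iff.mp h
      exact Fin.succAbove_ne i y hy
    have h1 : ∀ j, i ≠ i.succAbove j := fun j => (Fin.succAbove_ne i j).symm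
    simp only [ne_eq, h0, not_false_eq_true, implies_true, true_and, h1, if_false]
    refine forall_congr' fun j => ?_
    have h2 : ∀ p, Option.map i.succAbove (s p) = some (i.succAbove j) ↔ s p = some j := fun p => by
      rw [← Option.map_some, hinj.eq_iff]
    simp only [h2]

theorem eq_map_succAbove {k l : ℕ} {b : Bool} {i : Fin (l + 1)} {s : Fin k → Option (Fin (l + 1))}
    (h : IsWalk b (Fin.cons (some i) s : Fin (k + 1) → Option (Fin (l + 1)))) :
    ∃ s' : Fin k → Option (Fin l), Option.map i.succAbove ∘ s' = s := by
  have h1 := (existsUnique_cons _ _ _).mp (h.2 i)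
  rw [if_pos rfl] at h1
  have h2 : ∀ p, ∃ o : Option (Fin l), Option.map i.succAbove o = s p := by
    intro p
    rcases hp : s p with _ | j
    · exact ⟨none, rfl⟩
    · have hj : j ≠ i := fun hji => h1 p (by rw [hp, hji])
      obtain ⟨y, hy⟩ := Fin.exists_succAbove_eq hj
      exact ⟨some y, by simp [hy]⟩
  choose s' hs' using h2
  exact ⟨s', funext hs'⟩

theorem walkProd_map (a : ℝ) (c : ℂ) {l : ℕ} (θ : Fin (l + 1) → ℝ) (i : Fin (l + 1)) (k : ℕ) (x : ℂ)
    (s : Fin k → Option (Fin l)) :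
    walkProd a c θ k x (Option.map i.succAbove ∘ s) = walkProd a c (θ ∘ i.succAbove) k x s := by
  induction k generalizing x with
  | zero => rfl
  | succ k ih =>
    have h : (Option.map i.succAbove (s 0)).elim c (fun p => (θ p : ℂ)) =
        (s 0).elim c (fun p => ((θ ∘ i.succAbove) p : ℂ)) := by
      cases s 0 <;> rfl
    rw [walkProd, walkProd, Function.comp_apply, h, Function.comp_assoc, ih]

theorem consEquiv_apply {α : Type*} {k : ℕ} (x : α) (s : Fin k → α) :
    Fin.consEquiv (fun _ => α) (x, s) = (Fin.cons x s : Fin (k + 1) → α) := rfl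

open Classical in
/-- The first step of a walk leads to `c` or to one of the rapidities, which is then removed. -/
theorem sum_walkProd (a : ℝ) (c : ℂ) (k l : ℕ) (b : Bool) (x : ℂ) (θ : Fin l → ℝ) :
    ∑ s : Fin k → Option (Fin l), (if IsWalk b s then walkProd a c θ k x s else 0) =
      walkSum a c k l b x θ := by
  induction k generalizing l b x with
  | zero =>
    rw [Fintype.sum_subsingleton _ (Fin.elim0 : Fin 0 → Option (Fin l)), walkSum]
    refine if_congr ?_ rfl rfl
    rw [IsWalk, and_comm]
    refine and_congr ?_ (by simp)
    constructor
    · intro h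
      by_contra hl
      obtain ⟨p, -⟩ := h ⟨0, Nat.pos_of_ne_zero hl⟩
      exact p.elim0
    · rintro rfl i
      exact i.elim0
  | succ k ih =>
    rw [← (Fin.consEquiv fun _ => Option (Fin l)).sum_comp, Fintype.sum_prod_type,
      Fintype.sum_option]
    simp only [consEquiv_apply, isWalk_cons_none]
    have h0 : ∑ s : Fin k → Option (Fin l), (if IsWalk true s then
        walkProd a c θ (k + 1) x (Fin.cons none s) else 0) =
        phi a (x - c) * walkSum a c k l true c θ := by
      rw [← ih, Finset.mul_sum]
      refine Finset.sum_congr rfl fun s _ => ?_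
      rw [mul_ite, mul_zero]
      rfl
    rw [h0]
    cases l with
    | zero => simp [walkSum]
    | succ l =>
      rw [walkSum]
      congr 1
      refine Finset.sum_congr rfl fun i _ => ?_
      rw [← ih, Finset.mul_sum]
      have hinj : Function.Injective fun s : Fin k → Option (Fin l) => Option.map i.succAbove ∘ s :=
        (Option.map_injective Fin.succAbove_right_injective).comp_left
      symm
      refine Finset.sum_of_injOn (fun s : Fin k → Option (Fin l) => Option.map i.succAbove ∘ s)
        hinj.injOn (fun _ _ => Finset.mem_coe.mpr (Finset.mem_univ _)) (fun s _ hs => ?_)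
        (fun s _ => ?_)
      · refine if_neg fun hw => hs ?_
        obtain ⟨s', hs'⟩ := eq_map_succAbove hw
        exact ⟨s', Finset.mem_coe.mpr (Finset.mem_univ _), hs'⟩
      · simp only [isWalk_cons_some]
        rw [mul_ite, mul_zero, ← walkProd_map]
        rfl

theorem bracket_cons_eq (a : ℝ) (c : ℂ) {l k : ℕ} (θ : Fin l → ℝ) (o : Option (Fin l))
    (s : Fin k → Option (Fin l)) : bracket a c θ (Fin.cons o s : Fin (k + 1) → Option (Fin l)) =
      walkProd a c θ k (o.elim c fun p => (θ p : ℂ)) s := by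
  induction k generalizing o with
  | zero => simp [bracket, walkProd]
  | succ k ih =>
    rw [walkProd, ← ih, bracket, Fin.prod_univ_succ, bracket]
    congr 1
    refine Finset.prod_congr rfl fun i _ => ?_
    have h : (Fin.cons (s 0) (s ∘ Fin.succ) : Fin (k + 1) → Option (Fin l)) = s :=
      Fin.cons_self_tail s
    rw [← Fin.succ_castSucc, Fin.cons_succ, Fin.cons_succ, h]

theorem sum_sequences (a : ℝ) (c : ℂ) (l k : ℕ) (θ : Fin l → ℝ) :
    ∑ s ∈ sequences l k, bracket a c θ s = walkSum a c k l true c θ := by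
  classical
  rw [← sum_walkProd, sequences, Finset.sum_filter,
    ← (Fin.consEquiv fun _ => Option (Fin l)).sum_comp, Fintype.sum_prod_type, Fintype.sum_option]
  simp only [consEquiv_apply, Fin.cons_zero, true_and, reduceCtorEq, false_and, if_false,
    Finset.sum_const_zero, add_zero, existsUnique_cons, bracket_cons_eq]
  refine Finset.sum_congr rfl fun s _ => if_congr (and_congr_left fun _ => ?_) rfl rfl
  cases k with
  | zero => simp
  | succ k =>
    simp only [Nat.add_eq_zero_iff, one_ne_zero, and_false, dite_false]
    exact Iff.rfl

theorem walkSum_eq_zero (a : ℝ) (c : ℂ) {k l : ℕ} (h : k < l) (b : Bool) (x : ℂ) (θ : Fin l → ℝ) :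
    walkSum a c k l b x θ = 0 := by
  induction k generalizing l b x with
  | zero =>
    rw [walkSum, if_neg]
    omega
  | succ k ih =>
    cases l with
    | zero => omega
    | succ l =>
      rw [walkSum, ih (by omega), mul_zero, zero_add]
      exact Finset.sum_eq_zero fun i _ => by rw [ih (by omega), mul_zero]

theorem measurable_walkSum (a : ℝ) (c : ℂ) (k l : ℕ) (b : Bool) :
    Measurable fun p : ℂ × (Fin l → ℝ) => walkSum a c k l b p.1 p.2 := by
  induction k generalizing l b with
  | zero => exact measurable_const
  | succ k ih =>
    have hc : ∀ l, Measurable fun p : ℂ × (Fin l → ℝ) => phi a (p.1 - c) * walkSum a c k l true c p.2 :=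
      fun l => ((measurable_phi a).comp (measurable_fst.sub_const c)).mul
        ((ih l true).comp (measurable_const.prodMk measurable_snd))
    cases l with
    | zero => exact hc 0
    | succ l =>
      refine (hc (l + 1)).add (Finset.measurable_fun_sum _ fun i _ => ?_)
      have h0 : Measurable fun p : ℂ × (Fin (l + 1) → ℝ) => ((p.2 i : ℝ) : ℂ) :=
        Complex.measurable_ofReal.comp ((measurable_pi_apply i).comp measurable_snd)
      exact ((measurable_phi a).comp (measurable_fst.sub h0)).mul ((ih l false).comp
        (h0.prodMk (measurable_pi_iff.mpr fun j =>
          (measurable_pi_apply (i.succAbove j)).comp measurable_snd)))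

section

variable {a δ C : ℝ} (hk : KernelBound a δ C) {w : ℝ → ℂ} {q B : ℝ} (hw : WeightBound w q B)
  {c : ℂ} (hc : c ∈ rapidities (δ / 2))

/-- The integrated walk sums. -/
def walkInt (a : ℝ) (c : ℂ) (w : ℝ → ℂ) (k l : ℕ) (b : Bool) (x : ℂ) : ℂ :=
  (1 / (l.factorial : ℂ)) *
    ∫ θ : Fin l → ℝ, (∏ i, 1 / (2 * Real.pi) * w (θ i)) * walkSum a c k l b x θ

theorem walkInt_eq_zero (a : ℝ) (c : ℂ) (w : ℝ → ℂ) {k l : ℕ} (h : k < l) (b : Bool) (x : ℂ) :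
    walkInt a c w k l b x = 0 := by
  simp [walkInt, walkSum_eq_zero a c h]

theorem walkInt_zero_zero (a : ℝ) (c : ℂ) (w : ℝ → ℂ) (x : ℂ) :
    walkInt a c w 0 0 true x = 1 := by
  rw [walkInt, volume_pi, integral_zero_config]
  simp [walkSum]

theorem walkInt_succ_zero (a : ℝ) (c : ℂ) (w : ℝ → ℂ) (k : ℕ) (b : Bool) (x : ℂ) :
    walkInt a c w (k + 1) 0 b x = phi a (x - c) * walkInt a c w k 0 true c := by
  rw [walkInt, volume_pi, integral_zero_config, walkInt, volume_pi, integral_zero_config]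
  simp [walkSum]

include hk hc

theorem exists_norm_walkSum_le (k l : ℕ) (b : Bool) : ∃ M, 0 ≤ M ∧ ∀ x ∈ rapidities (δ / 2),
    ∀ θ : Fin l → ℝ, ‖walkSum a c k l b x θ‖ ≤ M := by
  induction k generalizing l b with
  | zero =>
    refine ⟨1, zero_le_one, fun x _ θ => ?_⟩
    rw [walkSum]
    split_ifs <;> simp
  | succ k ih =>
    have hC := hk.C_pos.le
    obtain ⟨M, hM0, hM⟩ := ih l true
    have h1 : ∀ x ∈ rapidities (δ / 2), ∀ θ : Fin l → ℝ,
        ‖phi a (x - c) * walkSum a c k l true c θ‖ ≤ C * M := fun x hx θ => by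
      rw [norm_mul]
      exact mul_le_mul (hk.norm_phi_le' (sub_mem_strips hk.δ_pos.le hx hc)) (hM c hc θ)
        (norm_nonneg _) hC
    cases l with
    | zero => exact ⟨C * M, by positivity, h1⟩
    | succ l =>
      obtain ⟨M', hM0', hM'⟩ := ih l false
      refine ⟨C * M + ∑ _i : Fin (l + 1), C * M', by positivity, fun x hx θ => ?_⟩
      refine (norm_add_le _ _).trans (add_le_add (h1 x hx θ) (norm_sum_le_of_le _ fun i _ => ?_))
      rw [norm_mul]
      exact mul_le_mul (hk.norm_phi_le' (sub_mem_strips hk.δ_pos.le hx (ofReal_mem_rapidities _ _)))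
        (hM' _ (ofReal_mem_rapidities _ _) _) (norm_nonneg _) hC

include hw

/-- The first step of a walk leads back to `c` or to one of the real rapidities, which is integrated
over. -/
theorem walkInt_succ_succ (k l : ℕ) (b : Bool) {x : ℂ} (hx : x ∈ rapidities (δ / 2)) :
    walkInt a c w (k + 1) (l + 1) b x = phi a (x - c) * walkInt a c w k (l + 1) true c +
      ∫ t : ℝ, (1 / (2 * Real.pi) * w t) * (phi a (x - t) * walkInt a c w k l false t) := by
  have hω : Integrable (fun t => 1 / (2 * Real.pi) * w t) := (hw.integrable hk).const_mul _
  have hbdd : ∀ {l : ℕ} {f : (Fin l → ℝ) → ℂ} {M : ℝ}, Measurable f → (∀ θ, ‖f θ‖ ≤ M) →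
      Integrable (fun θ : Fin l → ℝ => (∏ i, 1 / (2 * Real.pi) * w (θ i)) * f θ)
        (Measure.pi fun _ => volume) := fun hf hM =>
    (integrable_prod_config volume hω _).mul_bdd hf.aestronglyMeasurable (Eventually.of_forall hM)
  obtain ⟨M, hM0, hM⟩ := exists_norm_walkSum_le hk hc k l false
  obtain ⟨M', hM0', hM'⟩ := exists_norm_walkSum_le hk hc k (l + 1) true
  set h : ℝ × (Fin l → ℝ) → ℂ := fun p => (1 / (2 * Real.pi) * w p.1) * (phi a (x - p.1) *
    ((∏ i, 1 / (2 * Real.pi) * w (p.2 i)) * walkSum a c k l false p.1 p.2)) with hh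
  have hsplit : ∀ (i : Fin (l + 1)) (θ : Fin (l + 1) → ℝ), h (θ i, θ ∘ i.succAbove) =
      (∏ i, 1 / (2 * Real.pi) * w (θ i)) *
        (phi a (x - θ i) * walkSum a c k l false (θ i) (θ ∘ i.succAbove)) := by
    intro i θ
    rw [Fin.prod_univ_succAbove _ i]
    simp only [hh, Function.comp_apply]
    ring
  have hmeas : ∀ i : Fin (l + 1), Measurable fun θ : Fin (l + 1) → ℝ =>
      phi a (x - θ i) * walkSum a c k l false (θ i) (θ ∘ i.succAbove) := fun i => by
    have h0 : Measurable fun θ : Fin (l + 1) → ℝ => ((θ i : ℝ) : ℂ) :=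
      Complex.measurable_ofReal.comp (measurable_pi_apply i)
    exact ((measurable_phi a).comp (measurable_const.sub h0)).mul
      ((measurable_walkSum a c k l false).comp (h0.prodMk (measurable_pi_iff.mpr fun j =>
        measurable_pi_apply (i.succAbove j))))
  have hint : Integrable h (volume.prod (Measure.pi fun _ => volume)) := by
    rw [← integrable_extract_iff volume 0]
    simp only [hsplit]
    refine hbdd (M := C * M) (hmeas 0) fun θ => ?_
    rw [norm_mul]
    exact mul_le_mul (hk.norm_phi_le' (sub_mem_strips hk.δ_pos.le hx (ofReal_mem_rapidities _ _)))
      (hM _ (ofReal_mem_rapidities _ _) _) (norm_nonneg _) hk.C_pos.le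
  have hone : Integrable (fun θ : Fin (l + 1) → ℝ => (∏ i, 1 / (2 * Real.pi) * w (θ i)) *
      (phi a (x - c) * walkSum a c k (l + 1) true c θ)) (Measure.pi fun _ => volume) := by
    refine hbdd (M := C * M') (((measurable_walkSum a c k (l + 1) true).comp
      (measurable_const.prodMk measurable_id)).const_mul _) fun θ => ?_
    rw [norm_mul]
    exact mul_le_mul (hk.norm_phi_le' (sub_mem_strips hk.δ_pos.le hx hc))
      (hM' _ hc _) (norm_nonneg _) hk.C_pos.le
  have hsum : Integrable (fun θ : Fin (l + 1) → ℝ => ∑ i, h (θ i, θ ∘ i.succAbove))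
      (Measure.pi fun _ => volume) :=
    integrable_finsetSum _ fun i _ => (integrable_extract_iff volume i).mpr hint
  have e1 : ∫ θ : Fin (l + 1) → ℝ, (∏ i, 1 / (2 * Real.pi) * w (θ i)) *
      walkSum a c (k + 1) (l + 1) b x θ = (∫ θ : Fin (l + 1) → ℝ,
        (∏ i, 1 / (2 * Real.pi) * w (θ i)) * (phi a (x - c) * walkSum a c k (l + 1) true c θ)) +
      (l + 1 : ℂ) * ∫ p, h p ∂(volume.prod (Measure.pi fun _ => volume)) := by
    rw [← integral_sum_extract volume hint, volume_pi, ← integral_add hone hsum]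
    refine integral_congr_ae (Eventually.of_forall fun θ => ?_)
    simp only [hsplit, walkSum, ← Finset.mul_sum]
    ring
  have e2 : ∫ p, h p ∂(volume.prod (Measure.pi fun _ => volume)) = (l.factorial : ℂ) *
      ∫ t : ℝ, (1 / (2 * Real.pi) * w t) * (phi a (x - t) * walkInt a c w k l false t) := by
    rw [integral_prod _ hint, ← integral_const_mul]
    refine integral_congr_ae (Eventually.of_forall fun t => ?_)
    have : (l.factorial : ℂ) ≠ 0 := by exact_mod_cast l.factorial_ne_zero
    simp only [hh, walkInt]
    rw [integral_const_mul, integral_const_mul, ← volume_pi]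
    field_simp
  have hl : (l.factorial : ℂ) ≠ 0 := by exact_mod_cast l.factorial_ne_zero
  have hl1 : (l + 1 : ℂ) ≠ 0 := by exact_mod_cast l.succ_ne_zero
  have e3 : ∫ θ : Fin (l + 1) → ℝ, (∏ i, 1 / (2 * Real.pi) * w (θ i)) *
      (phi a (x - c) * walkSum a c k (l + 1) true c θ) = phi a (x - c) *
        ∫ θ : Fin (l + 1) → ℝ, (∏ i, 1 / (2 * Real.pi) * w (θ i)) *
          walkSum a c k (l + 1) true c θ := by
    rw [← integral_const_mul]
    refine integral_congr_ae (Eventually.of_forall fun θ => ?_)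
    simp only
    ring
  rw [walkInt, e1, e2, e3, walkInt, Nat.factorial_succ, Nat.cast_mul, Nat.cast_succ]
  generalize ∫ t : ℝ, (1 / (2 * Real.pi) * w t) * (phi a (x - t) * walkInt a c w k l false t) = J
  field_simp

/-- Decomposition of the walks with respect to the first return to `c`. -/
theorem walkInt_succ (k l : ℕ) (b : Bool) {x : ℂ} (hx : x ∈ rapidities (δ / 2)) :
    walkInt a c w (k + 1) l b x = ∑ m ∈ Finset.range (l + 1), if m ≤ k then
      chain a c w m x * walkInt a c w (k - m) (l - m) true c else 0 := by
  induction k generalizing l b x with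
  | zero =>
    rw [Finset.sum_range_succ', Finset.sum_eq_zero fun i _ => if_neg (by omega), zero_add,
      if_pos le_rfl]
    cases l with
    | zero => rw [walkInt_succ_zero, zero_add]; rfl
    | succ l =>
      have h1 : ∀ t : ℂ, walkInt a c w 0 l false t = 0 := fun t => by
        simp [walkInt, walkSum]
      rw [walkInt_succ_succ hk hw hc 0 l b hx]
      simp [h1, chain]
  | succ k ih =>
    rw [Finset.sum_range_succ', if_pos (Nat.zero_le _)]
    cases l with
    | zero => rw [walkInt_succ_zero, Finset.sum_range_zero, zero_add]; rfl
    | succ l =>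
      rw [walkInt_succ_succ hk hw hc (k + 1) l b hx, add_comm]
      congr 1
      simp only [ih l false (ofReal_mem_rapidities _ _), Nat.add_le_add_iff_right,
        Nat.add_sub_add_right]
      have h1 : ∀ m, (if m ≤ k then chain a c w (m + 1) x * walkInt a c w (k - m) (l - m) true c
          else 0) = ∫ t : ℝ, if m ≤ k then (1 / (2 * Real.pi) * w t) * (phi a (x - t) *
            chain a c w m t) * walkInt a c w (k - m) (l - m) true c else 0 := fun m => by
        split_ifs
        · rw [integral_mul_const, chain]
        · simp
      simp only [h1]
      rw [← integral_finsetSum]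
      · refine integral_congr_ae (Eventually.of_forall fun t => ?_)
        simp only [Finset.mul_sum]
        refine Finset.sum_congr rfl fun m _ => ?_
        split_ifs <;> ring
      · intro m _
        split_ifs
        · exact (integrable_chain_integrand hk hw hc hx m).mul_const _
        · exact integrable_zero _ _ _

theorem walkInt_zero (l : ℕ) : walkInt a c w (0 + l) l true c = if l = 0 then 1 else 0 := by
  cases l with
  | zero => exact walkInt_zero_zero a c w c
  | succ l =>
    rw [if_neg l.succ_ne_zero, zero_add, walkInt_succ hk hw hc l (l + 1) true hc]
    refine Finset.sum_eq_zero fun m _ => ?_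
    split_ifs with hm
    · rw [walkInt_eq_zero a c w (by omega), mul_zero]
    · rfl

theorem walkInt_add_succ (j l : ℕ) : walkInt a c w (j + 1 + l) l true c =
    ∑ m ∈ Finset.range (l + 1), chain a c w m c * walkInt a c w (j + (l - m)) (l - m) true c := by
  rw [show j + 1 + l = j + l + 1 by ring, walkInt_succ hk hw hc (j + l) l true hc]
  refine Finset.sum_congr rfl fun m hm => ?_
  have := Finset.mem_range.mp hm
  rw [if_pos (by omega), show j + l - m = j + (l - m) by omega]

/-- Closed walks with `j` returns are sequences of `j` connected paths. -/
theorem hasSum_walkInt (j : ℕ) :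
    Summable (fun l => ‖walkInt a c w (j + l) l true c‖) ∧
      ∑' l, walkInt a c w (j + l) l true c = (∑' l, chain a c w l c) ^ j := by
  induction j with
  | zero =>
    simp only [walkInt_zero hk hw hc]
    refine ⟨summable_of_ne_finset_zero (s := {0}) fun l hl => ?_, ?_⟩
    · rw [if_neg (by simpa using hl), norm_zero]
    · simp
  | succ j ih =>
    have h := summable_norm_chain hk hw hc hc
    simp only [walkInt_add_succ hk hw hc]
    have h1 := summable_norm_sum_mul_range_of_summable_norm
      (f := fun l => chain a c w l c) (g := fun l => walkInt a c w (j + l) l true c) h ih.1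
    have h2 := tsum_mul_tsum_eq_tsum_sum_range_of_summable_norm
      (f := fun l => chain a c w l c) (g := fun l => walkInt a c w (j + l) l true c) h ih.1
    exact ⟨h1, by rw [← h2, ih.2, pow_succ']⟩

end

/-- The double series for `1 / N_1` is a geometric series in the sum of the connected paths. -/
theorem eq_of_hasSum_invNTerm {a δ C m L u : ℝ} (hk : KernelBound a δ C) (hmL : 0 < m * L)
    {e : ℝ → ℝ} (he : IsTBASolution a m L u e) (hn : nOne a m L u e ≠ 0) {N : ℂ}
    (hN : HasSum (invNTerm a m L u e) N⁻¹) :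
    nOne a m L u e - ∑' l, chain a (root u) (fun t => (filling (e t) : ℂ)) l (root u) = N := by
  obtain ⟨q, B, hw⟩ := hk.exists_weightBound hmL he
  have hc := hk.root_mem u
  set w : ℝ → ℂ := fun t => (filling (e t) : ℂ) with hwdef
  set P := ∑' l, chain a (root u) w l (root u) with hP
  set n₁ := nOne a m L u e with hn₁
  have hterm : ∀ j l, invNTerm a m L u e (j, l) =
      n₁⁻¹ ^ (j + 1) * walkInt a (root u) w (j + l) l true (root u) := by
    intro j l
    simp only [invNTerm, walkInt, he.weight_ofReal, sum_sequences, mul_assoc]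
    rfl
  have h1 : HasSum (fun j => n₁⁻¹ * (n₁⁻¹ * P) ^ j) N⁻¹ := by
    refine hN.prod_fiberwise fun j => ?_
    simp only [hterm]
    obtain ⟨h2, h3⟩ := hasSum_walkInt hk hw hc j
    have h4 := h2.of_norm.hasSum.mul_left (n₁⁻¹ ^ (j + 1))
    rw [h3, ← hP] at h4
    have h5 : n₁⁻¹ ^ (j + 1) * P ^ j = n₁⁻¹ * (n₁⁻¹ * P) ^ j := by ring
    rwa [h5] at h4
  have hn' : n₁⁻¹ ≠ 0 := inv_ne_zero hn
  have h2 : ‖n₁⁻¹ * P‖ < 1 :=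
    summable_geometric_iff_norm_lt_one.mp ((summable_mul_left_iff hn').mp h1.summable)
  have h3 := (hasSum_geometric_of_norm_lt_one h2).mul_left n₁⁻¹
  have h4 := h1.unique h3
  rw [← mul_inv, mul_sub, mul_one, mul_inv_cancel_left₀ hn] at h4
  exact (inv_injective h4).symm

end

/-! ### The contour -/

theorem measurableEmbedding_inl : MeasurableEmbedding (Sum.inl : ℝ → ℝ ⊕ ℝ) :=
  ⟨Sum.inl_injective, measurable_inl, fun _ hs => hs.inl_image⟩

theorem measurableEmbedding_inr : MeasurableEmbedding (Sum.inr : ℝ → ℝ ⊕ ℝ) :=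
  ⟨Sum.inr_injective, measurable_inr, fun _ hs => hs.inr_image⟩

instance sigmaFinite_contourMeasure : SigmaFinite contourMeasure := by
  have h1 := measurableEmbedding_inl.sigmaFinite_map (μ := (volume : Measure ℝ))
  have h2 := measurableEmbedding_inr.sigmaFinite_map
    (μ := (volume : Measure ℝ).restrict (Set.Ioc 0 (2 * Real.pi)))
  unfold contourMeasure
  infer_instance

/-- The parameters of the circle. -/
def circlePart : Set (ℝ ⊕ ℝ) := Set.range Sum.inr

theorem measurableSet_circlePart : MeasurableSet circlePart := measurableSet_range_inr

theorem restrict_circlePart : contourMeasure.restrict circlePart =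
    ((volume : Measure ℝ).restrict (Set.Ioc 0 (2 * Real.pi))).map Sum.inr := by
  rw [contourMeasure, Measure.restrict_add, measurableEmbedding_inl.restrict_map,
    measurableEmbedding_inr.restrict_map]
  have h1 : (Sum.inl : ℝ → ℝ ⊕ ℝ) ⁻¹' circlePart = ∅ := by ext; simp [circlePart]
  have h2 : (Sum.inr : ℝ → ℝ ⊕ ℝ) ⁻¹' circlePart = Set.univ := by ext; simp [circlePart]
  rw [h1, h2]
  simp

theorem restrict_circlePart_compl : contourMeasure.restrict circlePartᶜ =
    (volume : Measure ℝ).map Sum.inl := by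
  rw [contourMeasure, Measure.restrict_add, measurableEmbedding_inl.restrict_map,
    measurableEmbedding_inr.restrict_map]
  have h1 : (Sum.inl : ℝ → ℝ ⊕ ℝ) ⁻¹' circlePartᶜ = Set.univ := by ext; simp [circlePart]
  have h2 : (Sum.inr : ℝ → ℝ ⊕ ℝ) ⁻¹' circlePartᶜ = ∅ := by ext; simp [circlePart]
  rw [h1, h2]
  simp

theorem setIntegral_circlePart (f : ℝ ⊕ ℝ → ℂ) : ∫ x in circlePart, f x ∂contourMeasure =
    ∫ s in Set.Ioc 0 (2 * Real.pi), f (Sum.inr s) := by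
  rw [restrict_circlePart, measurableEmbedding_inr.integral_map]

theorem setIntegral_circlePart_compl (f : ℝ ⊕ ℝ → ℂ) : ∫ x in circlePartᶜ, f x ∂contourMeasure =
    ∫ t : ℝ, f (Sum.inl t) := by
  rw [restrict_circlePart_compl, measurableEmbedding_inl.integral_map]

theorem measurable_contourPoint (u r : ℝ) : Measurable (contourPoint u r) := by
  refine measurable_fun_sum Complex.measurable_ofReal ?_
  have : Continuous fun s : ℝ => root u + r * Complex.exp (-(s * Complex.I)) := by fun_prop
  exact this.measurable

theorem dist_contourPoint_inr (u : ℝ) {r : ℝ} (hr : 0 < r) (s : ℝ) :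
    ‖contourPoint u r (Sum.inr s) - root u‖ = r := by
  have : contourPoint u r (Sum.inr s) - root u = r * Complex.exp (((-s : ℝ) : ℂ) * Complex.I) := by
    simp [contourPoint]
  rw [this, norm_mul, Complex.norm_exp_ofReal_mul_I, mul_one, Complex.norm_real,
    Real.norm_eq_abs, abs_of_pos hr]

theorem closedBall_root_subset {u r δ : ℝ} (hr : r < δ / 2) {z : ℂ}
    (hz : z ∈ Metric.closedBall (root u) r) : |z.im - Real.pi / 2| < δ / 2 := by
  rw [Metric.mem_closedBall, Complex.dist_eq] at hz
  have := (Complex.abs_im_le_norm _).trans hz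
  rw [Complex.sub_im, root_im] at this
  linarith

theorem contourPoint_mem {u r δ : ℝ} (hr0 : 0 < r) (hr : r < δ / 2) (x : ℝ ⊕ ℝ) :
    contourPoint u r x ∈ rapidities (δ / 2) := by
  rcases x with t | s
  · exact ofReal_mem_rapidities _ t
  · refine Or.inr (closedBall_root_subset (u := u) hr ?_).le
    rw [Metric.mem_closedBall, Complex.dist_eq, dist_contourPoint_inr u hr0]

theorem ae_contourPoint_ne (u : ℝ) {r : ℝ} (hr : 0 < r) (z : ℂ) :
    ∀ᵐ x ∂contourMeasure, contourPoint u r x ≠ z := by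
  rw [contourMeasure, ae_add_measure_iff, measurableEmbedding_inl.ae_map_iff,
    measurableEmbedding_inr.ae_map_iff]
  constructor
  · have h : ({z.re} : Set ℝ)ᶜ ∈ ae (volume : Measure ℝ) := by
      rw [mem_ae_iff, compl_compl]
      exact measure_singleton _
    filter_upwards [h] with t ht h0
    exact ht (by rw [← h0]; simp [contourPoint])
  · refine ae_restrict_of_ae ?_
    by_cases h0 : ∃ s₀ : ℝ, contourPoint u r (Sum.inr s₀) = z
    · obtain ⟨s₀, hs₀⟩ := h0
      have hc : (Set.range fun n : ℤ => s₀ + n * (2 * Real.pi)).Countable := Set.countable_range _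
      have h := hc.measure_zero (volume : Measure ℝ)
      rw [← compl_compl (Set.range _), ← mem_ae_iff] at h
      filter_upwards [h] with s hs hsz
      apply hs
      rw [← hs₀] at hsz
      have hr' : (r : ℂ) ≠ 0 := by exact_mod_cast hr.ne'
      have h1 := mul_left_cancel₀ hr' (add_left_cancel hsz)
      obtain ⟨n, hn⟩ := Complex.exp_eq_exp_iff_exists_int.mp h1
      refine ⟨-n, ?_⟩
      have h2 : ((s₀ + ((-n : ℤ) : ℝ) * (2 * Real.pi) : ℝ) : ℂ) = (s : ℂ) := by
        push_cast
        have h3 := congrArg (fun x => x * Complex.I) hn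
        linear_combination -h3 + ((s₀ : ℂ) - n * (2 * Real.pi) - s) * Complex.I_sq
      exact_mod_cast h2
    · push Not at h0
      exact Eventually.of_forall h0

/-- A weight on the contour which restricts to `w / 2π` on the real line and represents the
evaluation at the center, up to the factor `n₁`, on the circle. The test functions need not be
differentiable on a countable set, since connected form factors are only known to be continuous
where rapidities coincide. -/
structure IsContour (δ u r : ℝ) (n₁ : ℂ) (w : ℝ → ℂ) (ω : ℝ ⊕ ℝ → ℂ) : Prop where
  r_pos : 0 < r
  r_lt : r < δ / 2
  inl : ∀ t, ω (Sum.inl t) = 1 / (2 * Real.pi) * w t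
  integrable : Integrable ω contourMeasure
  residue : ∀ (g : ℂ → ℂ) (E : Set ℂ), E.Countable →
    ContinuousOn g (Metric.closedBall (root u) r) →
    (∀ z ∈ Metric.ball (root u) r \ E, DifferentiableAt ℂ g z) →
    ∫ x in circlePart, ω x * g (contourPoint u r x) ∂contourMeasure = g (root u) / n₁

/-- The contour weight of the LeClair–Mussardo series. -/
def contourWeight (a m L u : ℝ) (e : ℝ → ℝ) (r : ℝ) (x : ℝ ⊕ ℝ) : ℂ :=
  contourSpeed r x / (2 * Real.pi) * weight a m L u e (contourPoint u r x)

theorem circleIntegral_eq_setIntegral (f : ℂ → ℂ) (u r : ℝ) :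
    ∫ s in Set.Ioc 0 (2 * Real.pi), contourSpeed r (Sum.inr s) * f (contourPoint u r (Sum.inr s)) =
      -∮ z in C(root u, r), f z := by
  have hpi := Real.two_pi_pos
  set G : ℝ → ℂ := fun s => (Complex.I * r * Complex.exp (s * Complex.I)) *
    f (root u + r * Complex.exp (s * Complex.I)) with hG
  have h1 : ∫ s in (0 : ℝ)..2 * Real.pi, G (2 * Real.pi - s) = ∫ s in (0 : ℝ)..2 * Real.pi, G s := by
    rw [intervalIntegral.integral_comp_sub_left]
    simp
  rw [← intervalIntegral.integral_of_le hpi.le]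
  have h2 : ∮ z in C(root u, r), f z = ∫ s in (0 : ℝ)..2 * Real.pi, G s := by
    rw [circleIntegral]
    refine intervalIntegral.integral_congr fun s _ => ?_
    simp only [hG, deriv_circleMap, circleMap, smul_eq_mul]
    ring_nf
  rw [h2, ← h1, ← intervalIntegral.integral_neg]
  refine intervalIntegral.integral_congr fun s _ => ?_
  have h3 : Complex.exp (((2 * Real.pi - s : ℝ) : ℂ) * Complex.I) =
      Complex.exp (-(s * Complex.I)) := by
    rw [show ((2 * Real.pi - s : ℝ) : ℂ) * Complex.I = -(s * Complex.I) + 2 * Real.pi * Complex.I by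
      push_cast; ring, Complex.exp_periodic]
  simp only [hG, h3, contourSpeed, contourPoint, Sum.elim_inr]
  ring

/-- A simple zero of `1 + e^ε` makes small circles around it contours in the above sense. -/
theorem KernelBound.eventually_isContour {a δ C m L u : ℝ} (hk : KernelBound a δ C)
    (hmL : 0 < m * L) {e : ℝ → ℝ} (he : IsTBASolution a m L u e)
    (hexp : Complex.exp (pseudoenergy a m L u e (root u)) = -1)
    (hsimple : deriv (pseudoenergy a m L u e) (root u) ≠ 0) :
    ∀ᶠ r in 𝓝[>] (0 : ℝ), IsContour δ u r (nOne a m L u e) (fun t => (filling (e t) : ℂ))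
      (contourWeight a m L u e r) := by
  have hpi : (Real.pi : ℂ) ≠ 0 := by exact_mod_cast Real.pi_ne_zero
  set c := root u with hc
  set E := pseudoenergy a m L u e with hE
  set D : ℂ → ℂ := fun z => 1 + Complex.exp (E z) with hD
  -- near the root `1 + e^ε = (z - c) h z` with `h c = -ε' c`
  set h := dslope D c with hh
  have hdiff := hk.eventually_differentiableAt hmL he
  obtain ⟨ρ, hρ, hball⟩ := Metric.eventually_nhds_iff_ball.mp hdiff
  have hDd : ∀ z ∈ Metric.ball c ρ, DifferentiableAt ℂ D z := fun z hz =>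
    ((hball z hz).cexp).const_add 1
  have hhd : DifferentiableOn ℂ h (Metric.ball c ρ) :=
    (Complex.differentiableOn_dslope (Metric.ball_mem_nhds c hρ)).mpr
      fun z hz => (hDd z hz).differentiableWithinAt
  have hhd' : ∀ z ∈ Metric.ball c ρ, DifferentiableAt ℂ h z := fun z hz =>
    hhd.differentiableAt (Metric.isOpen_ball.mem_nhds hz)
  have hhc : h c = -deriv E c := by
    rw [hh, dslope_same]
    have := ((hball c (Metric.mem_ball_self hρ)).hasDerivAt.cexp).const_add 1
    rw [this.deriv, hexp]
    ring
  have hne : ∀ᶠ z in 𝓝 c, h z ≠ 0 :=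
    (hhd' c (Metric.mem_ball_self hρ)).continuousAt.eventually_ne
      (by rw [hhc]; exact neg_ne_zero.mpr hsimple)
  obtain ⟨ρ', hρ', hball'⟩ := Metric.eventually_nhds_iff_ball.mp hne
  have hDz : ∀ z, z ≠ c → weight a m L u e z = (z - c)⁻¹ * (h z)⁻¹ := fun z hz => by
    have h1 : (z - c) * h z = D z := by
      have := sub_smul_dslope D c z
      rw [smul_eq_mul] at this
      rw [hh, this]
      simp only [hD, hexp]
      ring
    rw [← mul_inv, h1, weight, one_div]
  have hδ := hk.δ_pos
  filter_upwards [Ioo_mem_nhdsGT (show 0 < min (min ρ ρ') (δ / 2) by positivity)] with r hr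
  have hr0 : 0 < r := hr.1
  have hrρ : r < ρ := hr.2.trans_le ((min_le_left _ _).trans (min_le_left _ _))
  have hrρ' : r < ρ' := hr.2.trans_le ((min_le_left _ _).trans (min_le_right _ _))
  have hsub : Metric.closedBall c r ⊆ Metric.ball c ρ := Metric.closedBall_subset_ball hrρ
  have hsub' : Metric.closedBall c r ⊆ Metric.ball c ρ' := Metric.closedBall_subset_ball hrρ'
  have hmem : ∀ s, contourPoint u r (Sum.inr s) ∈ Metric.closedBall c r := fun s => by
    rw [Metric.mem_closedBall, Complex.dist_eq, dist_contourPoint_inr u hr0]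
  have hnec : ∀ s, contourPoint u r (Sum.inr s) ≠ c := fun s h0 => by
    have := dist_contourPoint_inr u hr0 s
    rw [h0, hc, sub_self, norm_zero] at this
    exact hr0.ne this
  have hpt : Continuous fun s => contourPoint u r (Sum.inr s) := by
    simp only [contourPoint, Sum.elim_inr]
    fun_prop
  refine ⟨hr0, hr.2.trans_le (min_le_right _ _), fun t => ?_, ?_, ?_⟩
  · simp [contourWeight, contourSpeed, contourPoint, he.weight_ofReal]
  · rw [contourMeasure, integrable_add_measure, measurableEmbedding_inl.integrable_map_iff,
      measurableEmbedding_inr.integrable_map_iff]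
    constructor
    · obtain ⟨q, B, hw⟩ := hk.exists_weightBound hmL he
      refine ((hw.integrable hk).const_mul (1 / (2 * Real.pi))).congr
        (Eventually.of_forall fun t => ?_)
      simp [contourWeight, contourSpeed, contourPoint, he.weight_ofReal]
    · have hcont : Continuous (contourWeight a m L u e r ∘ Sum.inr) := by
        have h1 : (contourWeight a m L u e r ∘ Sum.inr) = fun s => contourSpeed r (Sum.inr s) /
            (2 * Real.pi) * ((contourPoint u r (Sum.inr s) - c)⁻¹ *
              (h (contourPoint u r (Sum.inr s)))⁻¹) := by
          ext s
          rw [← hDz _ (hnec s)]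
          rfl
        rw [h1]
        have h2 : Continuous fun s => contourSpeed r (Sum.inr s) := by
          simp only [contourSpeed, Sum.elim_inr]
          fun_prop
        have h3 : Continuous fun s => h (contourPoint u r (Sum.inr s)) :=
          continuous_iff_continuousAt.mpr fun s =>
            ContinuousAt.comp (f := fun s => contourPoint u r (Sum.inr s))
              (hhd' _ (hsub (hmem s))).continuousAt hpt.continuousAt
        exact (h2.div_const _).mul (((hpt.sub continuous_const).inv₀
          fun s => sub_ne_zero.mpr (hnec s)).mul (h3.inv₀ fun s => hball' _ (hsub' (hmem s))))
      exact (hcont.integrableOn_Icc).mono_set Set.Ioc_subset_Icc_self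
  · intro g A hA hg hgd
    rw [setIntegral_circlePart]
    have h1 := Complex.circleIntegral_sub_inv_smul_of_differentiable_on_off_countable
      (f := fun z => (h z)⁻¹ * g z) hA (Metric.mem_ball_self hr0)
      (ContinuousOn.mul (ContinuousOn.inv₀ (fun z hz =>
        (hhd' z (hsub hz)).continuousAt.continuousWithinAt) fun z hz => hball' z (hsub' hz)) hg)
      (fun z hz => ((hhd' z (hsub (Metric.ball_subset_closedBall hz.1))).fun_inv
        (hball' z (hsub' (Metric.ball_subset_closedBall hz.1)))).fun_mul (hgd z hz))
    have h2 := circleIntegral_eq_setIntegral (fun z => (z - c)⁻¹ • ((h z)⁻¹ * g z)) u r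
    rw [h1] at h2
    have h3 : ∀ s, contourWeight a m L u e r (Sum.inr s) * g (contourPoint u r (Sum.inr s)) =
        1 / (2 * Real.pi) * (contourSpeed r (Sum.inr s) *
          ((contourPoint u r (Sum.inr s) - c)⁻¹ • ((h (contourPoint u r (Sum.inr s)))⁻¹ *
            g (contourPoint u r (Sum.inr s))))) := fun s => by
      rw [contourWeight, hDz _ (hnec s), smul_eq_mul]
      ring
    simp only [h3]
    rw [integral_const_mul, h2, hhc, nOne, ← hE, ← hc, smul_eq_mul]
    field_simp
    linear_combination (g c) * Complex.I_sq

/-! ### Residues of the connected form factors at the excited-state root -/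

section

variable {a δ C : ℝ} {F : ∀ n : ℕ, (Fin n → ℂ) → ℂ}

/-- The permutation that moves the entry `j` to the front. -/
def toFront {n : ℕ} (j : Fin (n + 1)) : Equiv.Perm (Fin (n + 1)) :=
  (finSuccEquiv' 0).trans (finSuccEquiv' j).symm

theorem comp_toFront {n : ℕ} {α : Type*} (j : Fin (n + 1)) (θ : Fin (n + 1) → α) :
    θ ∘ toFront j = Fin.cons (θ j) (θ ∘ j.succAbove) := by
  ext i
  refine Fin.cases ?_ (fun i => ?_) i
  · simp [toFront]
  · have : (finSuccEquiv' (0 : Fin (n + 1))) i.succ = some i := by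
      rw [← Fin.succAbove_zero_apply, finSuccEquiv'_succAbove]
    simp [toFront, this]

theorem connectedFF_toFront (hF : IsFormFactorFamily a F) {V : Set ℂ} (hV : Admissible a V) {n : ℕ}
    {θ : Fin (n + 1) → ℂ} (hθ : Distinct V θ) (j : Fin (n + 1)) :
    connectedFF a F (n + 1) θ = connectedFF a F (n + 1) (Fin.cons (θ j) (θ ∘ j.succAbove)) := by
  rw [← comp_toFront, connectedFF_comp_perm hF hV hθ]

theorem distinct_cons {V : Set ℂ} {n : ℕ} {z : ℂ} {θ : Fin n → ℂ} :
    Distinct V (Fin.cons z θ : Fin (n + 1) → ℂ) ↔ z ∈ V ∧ (∀ j, z ≠ θ j) ∧ Distinct V θ := by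
  simp only [Distinct, Fin.forall_fin_succ, Fin.cons_zero, Fin.cons_succ, Fin.cons_injective_iff,
    Set.mem_range, not_exists]
  constructor
  · rintro ⟨⟨h1, h2⟩, h3, h4⟩
    exact ⟨h1, fun j h => h3 j h.symm, h2, h4⟩
  · rintro ⟨h1, h2, h3, h4⟩
    exact ⟨⟨h1, h3⟩, fun j h => h2 j h.symm, h4⟩

theorem isOpen_strip (δ : ℝ) : IsOpen {z : ℂ | |z.im - Real.pi / 2| < δ} :=
  isOpen_lt (by fun_prop) continuous_const

/-- As a function of its first argument, the connected form factor is differentiable off the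
other rapidities. -/
theorem differentiableAt_connectedFF_cons (hF : IsFormFactorFamily a F) {V : Set ℂ}
    (hV : Admissible a V) {n : ℕ} {z : ℂ} {θ : Fin n → ℂ}
    (h : Distinct V (Fin.cons z θ : Fin (n + 1) → ℂ)) :
    DifferentiableAt ℂ (fun z => connectedFF a F (n + 1) (Fin.cons z θ)) z := by
  refine DifferentiableAt.comp (g := connectedFF a F (n + 1))
    (f := fun z : ℂ => (Fin.cons z θ : Fin (n + 1) → ℂ)) z
    (analyticAt_connectedFF hF hV h).differentiableAt ?_
  rw [differentiableAt_pi]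
  refine Fin.cases ?_ fun j => ?_
  · simp
  · simp

/-- As a function of its first argument, the connected form factor extends continuously to the
other rapidities. -/
theorem tendsto_connectedFF_cons (hF : IsFormFactorFamily a F) {V : Set ℂ}
    (hV : Admissible a V) {n : ℕ} {θ : Fin (n + 1) → ℂ} (h : Distinct V θ) (j : Fin (n + 1))
    (hj : V ∈ 𝓝 (θ j)) :
    Tendsto (fun z => connectedFF a F (n + 2) (Fin.cons z θ)) (𝓝[≠] (θ j))
      (𝓝 (2 * mergeWt a F (θ j) n (θ j) (θ ∘ j.succAbove))) := by
  have hd : Distinct V (Fin.cons (θ j) (θ ∘ j.succAbove) : Fin (n + 1) → ℂ) := by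
    rw [← comp_toFront]
    exact h.comp (toFront j).injective
  have hVe : ∀ᶠ z in 𝓝[≠] (θ j), z ∈ V := nhdsWithin_le_nhds hj
  refine (tendsto_connectedFF_merge hF hV hd le_rfl hVe).congr' ?_
  have hne : ∀ᶠ z in 𝓝[≠] (θ j), ∀ i, z ≠ θ i := by
    refine eventually_all.mpr fun i => ?_
    by_cases hi : i = j
    · subst hi
      exact self_mem_nhdsWithin
    · exact nhdsWithin_le_nhds (isOpen_ne.mem_nhds (h.2.ne (Ne.symm hi)))
  filter_upwards [hVe, hne] with z hz hz'
  rw [connectedFF_toFront hF hV (distinct_cons.mpr ⟨hz, hz', h⟩) j.succ, Fin.cons_succ,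
    cons_comp_succAbove]

/-- Integration over the circle of a function that is differentiable off a finite set, with
limits there. -/
theorem IsContour.integral_eq {u r : ℝ} {n₁ : ℂ} {w : ℝ → ℂ} {ω : ℝ ⊕ ℝ → ℂ}
    (hI : IsContour δ u r n₁ w ω) (K : Set ℂ) (hK : K.Finite) {f ℓ : ℂ → ℂ}
    (hf : ∀ z ∈ Metric.closedBall (root u) r, z ∉ K → DifferentiableAt ℂ f z)
    (hl : ∀ z ∈ Metric.closedBall (root u) r, z ∈ K → Tendsto f (𝓝[≠] z) (𝓝 (ℓ z)))
    {y : ℂ} (hy : (root u ∉ K → y = f (root u)) ∧ (root u ∈ K → y = ℓ (root u))) :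
    ∫ x in circlePart, ω x * f (contourPoint u r x) ∂contourMeasure = y / n₁ := by
  classical
  set g : ℂ → ℂ := fun z => if z ∈ K then ℓ z else f z with hg
  have hgf : ∀ z, ∀ᶠ z' in 𝓝[≠] z, g z' = f z' := by
    intro z
    have h1 : (K \ {z})ᶜ ∈ 𝓝 z := (hK.subset Set.sdiff_subset).isClosed.isOpen_compl.mem_nhds
      (by simp)
    filter_upwards [nhdsWithin_le_nhds h1, self_mem_nhdsWithin] with z' h2 h3
    exact if_neg fun h4 => h2 ⟨h4, h3⟩
  have hgy : g (root u) = y := by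
    simp only [hg]
    split_ifs with h
    · exact (hy.2 h).symm
    · exact (hy.1 h).symm
  have hgd : ∀ z ∈ Metric.closedBall (root u) r, z ∉ K → DifferentiableAt ℂ g z := by
    intro z hz hzK
    refine (hf z hz hzK).congr_of_eventuallyEq ?_
    filter_upwards [hK.isClosed.isOpen_compl.mem_nhds hzK] with z' h'
    exact if_neg h'
  have h := hI.residue g K hK.countable (fun z hz => ContinuousAt.continuousWithinAt ?_)
    fun z hz => hgd z (Metric.ball_subset_closedBall hz.1) hz.2
  · rw [hgy] at h
    rw [← h]
    refine integral_congr_ae (ae_restrict_of_ae ?_)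
    have h1 : ∀ᵐ x ∂contourMeasure, ∀ z ∈ K, contourPoint u r x ≠ z :=
      (ae_ball_iff hK.countable).mpr fun z _ => ae_contourPoint_ne u hI.r_pos z
    filter_upwards [h1] with x hx
    simp only [hg]
    rw [if_neg fun hxK => hx _ hxK rfl]
  · by_cases hzK : z ∈ K
    · rw [continuousAt_iff_punctured_nhds, show g z = ℓ z from if_pos hzK]
      exact (hl z hz hzK).congr' ((hgf z).mono fun _ h => h.symm)
    · exact (hgd z hz hzK).continuousAt

section

variable {u r : ℝ} {n₁ : ℂ} {w : ℝ → ℂ} {ω : ℝ ⊕ ℝ → ℂ} (hF : IsFormFactorFamily a F)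
  (hk : KernelBound a δ C) (hI : IsContour δ u r n₁ w ω)
include hF hk hI

/-- Integrating one argument of the connected form factor over the circle yields its value at the
center, or the limit if the center is among the other arguments. -/
theorem IsContour.integral_connectedFF {n : ℕ} {θ : Fin n → ℂ} (hθ : Distinct (rapidities (δ / 2)) θ)
    {y : ℂ} (hy : (∀ j, root u ≠ θ j) → y = connectedFF a F (n + 1) (Fin.cons (root u) θ))
    (hy' : root u ∈ Set.range θ →
      Tendsto (fun z => connectedFF a F (n + 1) (Fin.cons z θ)) (𝓝[≠] (root u)) (𝓝 y)) :
    ∫ x in circlePart, ω x * connectedFF a F (n + 1) (Fin.cons (contourPoint u r x) θ)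
      ∂contourMeasure = y / n₁ := by
  have hstrip : ∀ z ∈ Metric.closedBall (root u) r, |z.im - Real.pi / 2| < δ / 2 := fun z hz =>
    closedBall_root_subset hI.r_lt hz
  have hlim : ∀ z ∈ Metric.closedBall (root u) r, z ∈ Set.range θ → Tendsto
      (fun z => connectedFF a F (n + 1) (Fin.cons z θ)) (𝓝[≠] z)
      (𝓝 (limUnder (𝓝[≠] z) fun z => connectedFF a F (n + 1) (Fin.cons z θ))) := by
    rintro z hz ⟨j, rfl⟩
    cases n with
    | zero => exact j.elim0
    | succ n =>
      refine tendsto_nhds_limUnder ⟨_, tendsto_connectedFF_cons hF hk.admissible hθ j ?_⟩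
      exact Filter.mem_of_superset ((isOpen_strip (δ / 2)).mem_nhds (hstrip _ hz))
        fun z hz => Or.inr (le_of_lt hz)
  refine hI.integral_eq (Set.range θ) (Set.finite_range θ) (fun z hz hzK => ?_) hlim ⟨?_, ?_⟩
  · refine differentiableAt_connectedFF_cons hF hk.admissible (distinct_cons.mpr
      ⟨Or.inr (hstrip z hz).le, fun j h => hzK ⟨j, h.symm⟩, hθ⟩)
  · exact fun h => hy fun j hj => h ⟨j, hj.symm⟩
  · exact fun h => tendsto_nhds_unique (hy' h)
      (hlim _ (Metric.mem_closedBall_self hI.r_pos.le) h)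

theorem IsContour.integral_connectedFF_one {n : ℕ} {θ : Fin n → ℂ}
    (hθ : Distinct (rapidities (δ / 2)) (Fin.cons (root u) θ : Fin (n + 1) → ℂ)) :
    ∫ x in circlePart, ω x * connectedFF a F (n + 1) (Fin.cons (contourPoint u r x) θ)
      ∂contourMeasure = connectedFF a F (n + 1) (Fin.cons (root u) θ) / n₁ := by
  obtain ⟨-, h1, h2⟩ := distinct_cons.mp hθ
  exact hI.integral_connectedFF hF hk h2 (fun _ => rfl) fun ⟨j, hj⟩ => absurd hj.symm (h1 j)

theorem IsContour.integral_connectedFF_two {n : ℕ} {θ : Fin n → ℂ}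
    (hθ : Distinct (rapidities (δ / 2)) (Fin.cons (root u) θ : Fin (n + 1) → ℂ)) :
    ∫ x in circlePart, ω x * connectedFF a F (n + 2)
        (Fin.cons (root u) (Fin.cons (contourPoint u r x) θ : Fin (n + 1) → ℂ))
      ∂contourMeasure = 2 * mergeWt a F (root u) n (root u) θ / n₁ := by
  obtain ⟨h0, h1, h2⟩ := distinct_cons.mp hθ
  have h := hI.integral_connectedFF hF hk hθ (y := 2 * mergeWt a F (root u) n (root u) θ)
    (fun h => absurd rfl (h 0)) fun _ => ?_
  · rw [← h]
    refine integral_congr_ae (ae_restrict_of_ae ?_)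
    have h3 : ∀ᵐ x ∂contourMeasure, ∀ j,
        contourPoint u r x ≠ (Fin.cons (root u) θ : Fin (n + 1) → ℂ) j :=
      ae_all_iff.mpr fun j => ae_contourPoint_ne u hI.r_pos _
    filter_upwards [h3] with x hx
    rw [connectedFF_toFront hF hk.admissible (distinct_cons.mpr
      ⟨contourPoint_mem hI.r_pos hI.r_lt x, hx, hθ⟩) (Fin.succ 0), cons_comp_succAbove]
    rfl
  · exact tendsto_connectedFF_cons hF hk.admissible hθ 0
      (Filter.mem_of_superset ((isOpen_strip (δ / 2)).mem_nhds
        (closedBall_root_subset hI.r_lt (Metric.mem_closedBall_self hI.r_pos.le)))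
        fun z hz => Or.inr (le_of_lt hz))

end

end

/-! ### Counting the rapidities on the circle -/

/-- The product measure on contour configurations. -/
abbrev contourPi (n : ℕ) : Measure (Fin n → ℝ ⊕ ℝ) := Measure.pi fun _ => contourMeasure

/-- The number of rapidities on the circle. -/
def circleCount {n : ℕ} (t : Fin n → ℝ ⊕ ℝ) : ℕ := ∑ j, if (t j).isRight then 1 else 0

/-- The indicator function of the configurations with `k` rapidities on the circle. -/
def countInd (k : ℕ) {n : ℕ} (t : Fin n → ℝ ⊕ ℝ) : ℂ := if circleCount t = k then 1 else 0

/-- The indicator function of the circle. -/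
def circleInd (x : ℝ ⊕ ℝ) : ℂ := if x.isRight then 1 else 0

theorem circleCount_eq {n : ℕ} (t : Fin (n + 1) → ℝ ⊕ ℝ) (j : Fin (n + 1)) :
    circleCount t = (if (t j).isRight then 1 else 0) + circleCount (t ∘ j.succAbove) := by
  rw [circleCount, Fin.sum_univ_succAbove _ j]
  rfl

theorem circleCount_le {n : ℕ} (t : Fin n → ℝ ⊕ ℝ) : circleCount t ≤ n := by
  refine (Finset.sum_le_card_nsmul _ _ 1 fun j _ => ?_).trans (by simp)
  split_ifs <;> simp

theorem mem_circlePart_iff {x : ℝ ⊕ ℝ} : x ∈ circlePart ↔ x.isRight = true := by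
  cases x <;> simp [circlePart]

theorem circleInd_eq_indicator : circleInd = circlePart.indicator 1 := by
  classical
  ext x
  simp [circleInd, Set.indicator_apply, mem_circlePart_iff]

theorem measurable_circleCount {n : ℕ} :
    Measurable (circleCount : (Fin n → ℝ ⊕ ℝ) → ℕ) := by
  refine Finset.measurable_fun_sum _ fun j _ => Measurable.ite ?_ measurable_const measurable_const
  have h : Measurable fun t : Fin n → ℝ ⊕ ℝ => t j := measurable_pi_apply j
  convert h measurableSet_circlePart using 1
  ext t
  exact mem_circlePart_iff.symm

theorem measurable_countInd (k n : ℕ) : Measurable (countInd k : (Fin n → ℝ ⊕ ℝ) → ℂ) :=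
  Measurable.ite (measurable_circleCount (measurableSet_singleton k)) measurable_const
    measurable_const

theorem measurable_circleInd : Measurable circleInd := by
  rw [circleInd_eq_indicator]
  exact measurable_one.indicator measurableSet_circlePart

theorem norm_countInd_le (k : ℕ) {n : ℕ} (t : Fin n → ℝ ⊕ ℝ) : ‖countInd k t‖ ≤ 1 := by
  rw [countInd]
  split_ifs <;> simp

theorem norm_circleInd_le (x : ℝ ⊕ ℝ) : ‖circleInd x‖ ≤ 1 := by
  rw [circleInd]
  split_ifs <;> simp

theorem integrable_countInd_mul {n : ℕ} {f : (Fin n → ℝ ⊕ ℝ) → ℂ}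
    (hf : Integrable f (contourPi n)) (k : ℕ) :
    Integrable (fun t => countInd k t * f t) (contourPi n) :=
  hf.bdd_mul (measurable_countInd k n).aestronglyMeasurable
    (Eventually.of_forall (norm_countInd_le k))

/-- Each of the `k + 1` rapidities on the circle may be singled out. -/
theorem sum_circleInd_mul_countInd (k : ℕ) {n : ℕ} (t : Fin (n + 1) → ℝ ⊕ ℝ) :
    ∑ j, circleInd (t j) * countInd k (t ∘ j.succAbove) = (k + 1) * countInd (k + 1) t := by
  have h : ∀ j, circleInd (t j) * countInd k (t ∘ j.succAbove) =
      (if (t j).isRight then 1 else 0) * countInd (k + 1) t := by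
    intro j
    rw [circleInd, countInd, countInd, circleCount_eq t j]
    by_cases hj : (t j).isRight
    · simp only [hj, if_true, one_mul]
      exact if_congr (by omega) rfl rfl
    · simp [hj]
  simp only [h, ← Finset.sum_mul]
  rw [countInd]
  split_ifs with hk
  · have : ((circleCount t : ℕ) : ℂ) = ∑ j, if (t j).isRight then 1 else 0 := by
      rw [circleCount]
      push_cast
      rfl
    rw [← this, hk]
    push_cast
    rfl
  · simp

theorem sum_countInd {n : ℕ} (t : Fin n → ℝ ⊕ ℝ) :
    ∑ k ∈ Finset.range (n + 1), countInd k t = 1 := by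
  simp only [countInd]
  rw [Finset.sum_ite_eq, if_pos (Finset.mem_range.mpr (Nat.lt_succ_of_le (circleCount_le t)))]

theorem countInd_eq_zero {k n : ℕ} (h : n < k) (t : Fin n → ℝ ⊕ ℝ) : countInd k t = 0 :=
  if_neg fun h0 => by
    have := circleCount_le t
    omega

theorem integral_circleInd_mul (f : ℝ ⊕ ℝ → ℂ) :
    ∫ x, circleInd x * f x ∂contourMeasure = ∫ x in circlePart, f x ∂contourMeasure := by
  rw [← integral_indicator measurableSet_circlePart, circleInd_eq_indicator]
  refine integral_congr_ae (Eventually.of_forall fun x => ?_)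
  by_cases hx : x ∈ circlePart <;> simp [hx]

/-- Configurations on the real line, inside the configurations on the contour. -/
theorem map_inl_pi (n : ℕ) : (contourPi n).restrict {t | circleCount t = 0} =
    (volume : Measure (Fin n → ℝ)).map fun θ j => Sum.inl (θ j) := by
  have h1 : {t : Fin n → ℝ ⊕ ℝ | circleCount t = 0} = Set.univ.pi fun _ => circlePartᶜ := by
    ext t
    simp [circleCount, mem_circlePart_iff]
  have h2 := measurableEmbedding_inl.sigmaFinite_map (μ := (volume : Measure ℝ))
  rw [h1, contourPi, Measure.restrict_pi_pi, restrict_circlePart_compl, volume_pi,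
    ← Measure.pi_map_pi fun _ => measurable_inl.aemeasurable]

theorem measurableEmbedding_inl_pi (n : ℕ) :
    MeasurableEmbedding fun (θ : Fin n → ℝ) (j : Fin n) => (Sum.inl (θ j) : ℝ ⊕ ℝ) := by
  refine MeasurableEmbedding.of_measurable_inverse
    (g := fun (t : Fin n → ℝ ⊕ ℝ) j => (t j).elim id fun _ => 0) ?_ ?_ ?_ ?_
  · exact measurable_pi_iff.mpr fun j => measurable_inl.comp (measurable_pi_apply j)
  · have : Set.range (fun (θ : Fin n → ℝ) (j : Fin n) => (Sum.inl (θ j) : ℝ ⊕ ℝ)) =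
        Set.univ.pi fun _ => circlePartᶜ := by
      ext t
      constructor
      · rintro ⟨θ, rfl⟩ j -
        simp [circlePart]
      · intro ht
        have h : ∀ j, ∃ x, Sum.inl x = t j := fun j => by
          rcases hj : t j with x | s
          · exact ⟨x, rfl⟩
          · exact absurd ⟨s, hj.symm⟩ (ht j trivial)
        choose θ hθ using h
        exact ⟨θ, funext hθ⟩
    rw [this]
    exact MeasurableSet.univ_pi fun _ => measurableSet_circlePart.compl
  · refine measurable_pi_iff.mpr fun j => Measurable.comp (g := Sum.elim id fun _ => 0) ?_
      (measurable_pi_apply j)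
    exact measurable_fun_sum measurable_id measurable_const
  · exact fun θ => rfl

theorem integral_countInd_zero {n : ℕ} (f : (Fin n → ℝ ⊕ ℝ) → ℂ) :
    ∫ t, countInd 0 t * f t ∂contourPi n = ∫ θ : Fin n → ℝ, f fun j => Sum.inl (θ j) := by
  have hm : MeasurableSet {t : Fin n → ℝ ⊕ ℝ | circleCount t = 0} :=
    measurable_circleCount (measurableSet_singleton 0)
  rw [← (measurableEmbedding_inl_pi n).integral_map, ← map_inl_pi, ← integral_indicator hm]
  refine integral_congr_ae (Eventually.of_forall fun t => ?_)
  by_cases h : circleCount t = 0 <;> simp [countInd, h]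

theorem integrable_comp_inl {n : ℕ} {f : (Fin n → ℝ ⊕ ℝ) → ℂ}
    (hf : Integrable f (contourPi n)) :
    Integrable fun θ : Fin n → ℝ => f fun j => Sum.inl (θ j) := by
  have h := hf.integrableOn (s := {t | circleCount t = 0})
  rw [IntegrableOn, map_inl_pi, (measurableEmbedding_inl_pi n).integrable_map_iff] at h
  exact h

/-- Almost all configurations on the contour consist of distinct rapidities, all different from
the center of the circle. -/
theorem ae_distinct {δ u r : ℝ} (hr0 : 0 < r) (hr : r < δ / 2) (n : ℕ) :
    ∀ᵐ t ∂contourPi n, Distinct (rapidities (δ / 2))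
      (Fin.cons (root u) fun j => contourPoint u r (t j) : Fin (n + 1) → ℂ) := by
  have hroot : root u ∈ rapidities (δ / 2) := by
    right
    rw [root_im, sub_self, abs_zero]
    linarith
  have hne : ∀ (z : ℂ) {n : ℕ} (j : Fin n), ∀ᵐ t ∂contourPi n, contourPoint u r (t j) ≠ z :=
    fun z n j => (Measure.tendsto_eval_ae_ae (μ := fun _ : Fin n => contourMeasure) (i := j)).eventually
      (ae_contourPoint_ne u hr0 z)
  have hpair : ∀ i j : Fin n, i ≠ j → ∀ᵐ t ∂contourPi n,
      contourPoint u r (t i) ≠ contourPoint u r (t j) := by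
    intro i j hij
    cases n with
    | zero => exact i.elim0
    | succ n =>
      obtain ⟨j', rfl⟩ := Fin.exists_succAbove_eq hij.symm
      refine (measurePreserving_extract contourMeasure i).quasiMeasurePreserving.ae
        (p := fun p => contourPoint u r p.1 ≠ contourPoint u r (p.2 j')) ?_
      rw [Measure.ae_prod_iff_ae_ae]
      · exact Eventually.of_forall fun x => (hne _ j').mono fun _ h => h.symm
      · exact (measurableSet_eq_fun ((measurable_contourPoint u r).comp measurable_fst)
          ((measurable_contourPoint u r).comp
            ((measurable_pi_apply j').comp measurable_snd))).compl
  have h1 : ∀ᵐ t ∂contourPi n, ∀ i j, i ≠ j → contourPoint u r (t i) ≠ contourPoint u r (t j) :=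
    ae_all_iff.mpr fun i => ae_all_iff.mpr fun j => by
      by_cases h : i = j
      · exact Eventually.of_forall fun _ h' => absurd h h'
      · exact (hpair i j h).mono fun _ h' _ => h'
  filter_upwards [h1, ae_all_iff.mpr fun j => hne (root u) j] with t h1 h2
  exact distinct_cons.mpr ⟨hroot, fun j h => h2 j h.symm, fun j => contourPoint_mem hr0 hr _,
    fun i j hij => by_contra fun h => h1 i j h hij⟩

/-- Singling out a rapidity on the circle in the integral of a symmetric function. -/
theorem integral_countInd_succ {n : ℕ} {f : (Fin (n + 1) → ℝ ⊕ ℝ) → ℂ}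
    (hf : Integrable f (contourPi (n + 1)))
    (hsymm : ∀ᵐ t ∂contourPi (n + 1), ∀ j, f t = f (Fin.cons (t j) (t ∘ j.succAbove))) (k : ℕ) :
    Integrable (fun p : (ℝ ⊕ ℝ) × (Fin n → ℝ ⊕ ℝ) => f (Fin.cons p.1 p.2))
      (contourMeasure.prod (contourPi n)) ∧
    (k + 1 : ℂ) * ∫ t, countInd (k + 1) t * f t ∂contourPi (n + 1) =
      (n + 1 : ℂ) * ∫ t, countInd k t * ∫ x in circlePart, f (Fin.cons x t)
        ∂contourMeasure ∂contourPi n := by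
  have h0 : Integrable (fun p : (ℝ ⊕ ℝ) × (Fin n → ℝ ⊕ ℝ) => f (Fin.cons p.1 p.2))
      (contourMeasure.prod (contourPi n)) := by
    rw [← integrable_extract_iff contourMeasure 0]
    refine hf.congr (hsymm.mono fun t ht => ht 0)
  set h : (ℝ ⊕ ℝ) × (Fin n → ℝ ⊕ ℝ) → ℂ :=
    fun p => (circleInd p.1 * countInd k p.2) * f (Fin.cons p.1 p.2) with hh
  have hint : Integrable h (contourMeasure.prod (contourPi n)) := by
    refine h0.bdd_mul (c := 1) ((measurable_circleInd.comp measurable_fst).mul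
      ((measurable_countInd k n).comp measurable_snd)).aestronglyMeasurable
      (Eventually.of_forall fun p => ?_)
    rw [norm_mul]
    exact mul_le_one₀ (norm_circleInd_le _) (norm_nonneg _) (norm_countInd_le _ _)
  refine ⟨h0, ?_⟩
  have h1 := integral_sum_extract contourMeasure hint
  have h2 : ∫ t, ∑ j, h (t j, t ∘ j.succAbove) ∂contourPi (n + 1) =
      (k + 1 : ℂ) * ∫ t, countInd (k + 1) t * f t ∂contourPi (n + 1) := by
    rw [← integral_const_mul]
    refine integral_congr_ae (hsymm.mono fun t ht => ?_)
    simp only [hh, ← ht, ← Finset.sum_mul, sum_circleInd_mul_countInd]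
    ring
  rw [← h2, contourPi, h1, integral_prod_symm _ hint]
  congr 1
  refine integral_congr_ae (Eventually.of_forall fun t => ?_)
  simp only [hh]
  rw [← integral_circleInd_mul, ← integral_const_mul]
  refine integral_congr_ae (Eventually.of_forall fun x => ?_)
  simp only
  ring

/-! ### Contour integrals sorted by the number of rapidities on the circle -/

section

section Sectors

variable (a : ℝ) (F : ∀ n : ℕ, (Fin n → ℂ) → ℂ) (u r : ℝ) (ω : ℝ ⊕ ℝ → ℂ)

/-- The weighted connected form factor on contour configurations. -/
def seriesWt (n : ℕ) (t : Fin n → ℝ ⊕ ℝ) : ℂ :=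
  (∏ j, ω (t j)) * connectedFF a F n fun j => contourPoint u r (t j)

/-- The weighted connected form factor with an additional rapidity at the center of the circle. -/
def dressedWt (n : ℕ) (t : Fin n → ℝ ⊕ ℝ) : ℂ :=
  (∏ j, ω (t j)) *
    connectedFF a F (n + 1) (Fin.cons (root u) fun j => contourPoint u r (t j))

/-- The weighted sum over chains of kernels from `x` to the center of the circle. -/
def mergedWt (n : ℕ) (x : ℂ) (t : Fin n → ℝ ⊕ ℝ) : ℂ :=
  (∏ j, ω (t j)) * mergeWt a F (root u) n x fun j => contourPoint u r (t j)

variable {a F u r ω}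

theorem contourPoint_cons {n : ℕ} (y : ℝ ⊕ ℝ) (t : Fin n → ℝ ⊕ ℝ) :
    (fun j => contourPoint u r ((Fin.cons y t : Fin (n + 1) → ℝ ⊕ ℝ) j)) =
      Fin.cons (contourPoint u r y) fun j => contourPoint u r (t j) :=
  Fin.comp_cons (contourPoint u r) y t

theorem prod_extract {n : ℕ} (t : Fin (n + 1) → ℝ ⊕ ℝ) (j : Fin (n + 1)) :
    ∏ i, ω (t i) = ω (t j) * ∏ i, ω ((t ∘ j.succAbove) i) :=
  Fin.prod_univ_succAbove _ j

theorem prod_cons {n : ℕ} (y : ℝ ⊕ ℝ) (t : Fin n → ℝ ⊕ ℝ) :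
    ∏ i, ω ((Fin.cons y t : Fin (n + 1) → ℝ ⊕ ℝ) i) = ω y * ∏ i, ω (t i) := by
  simp [Fin.prod_univ_succ]

variable {δ C : ℝ} {n₁ : ℂ} {w : ℝ → ℂ} (hF : IsFormFactorFamily a F)
  (hk : KernelBound a δ C) (hI : IsContour δ u r n₁ w ω)
include hF hk hI

theorem seriesWt_symm (n : ℕ) : ∀ᵐ t ∂contourPi (n + 1), ∀ j : Fin (n + 1),
    seriesWt a F u r ω (n + 1) t =
      seriesWt a F u r ω (n + 1) (Fin.cons (t j) (t ∘ j.succAbove)) := by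
  filter_upwards [ae_distinct (u := u) hI.r_pos hI.r_lt (n + 1)] with t ht j
  rw [seriesWt, seriesWt, prod_cons, ← prod_extract, contourPoint_cons,
    connectedFF_toFront hF hk.admissible (distinct_cons.mp ht).2.2 j]
  rfl

theorem dressedWt_symm (n : ℕ) : ∀ᵐ t ∂contourPi (n + 1), ∀ j : Fin (n + 1),
    dressedWt a F u r ω (n + 1) t =
      dressedWt a F u r ω (n + 1) (Fin.cons (t j) (t ∘ j.succAbove)) := by
  filter_upwards [ae_distinct (u := u) hI.r_pos hI.r_lt (n + 1)] with t ht j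
  have h1 := connectedFF_toFront hF hk.admissible ht j.succ
  have h2 : Distinct (rapidities (δ / 2)) (Fin.cons (root u) (Fin.cons (contourPoint u r (t j))
      fun i => contourPoint u r ((t ∘ j.succAbove) i) : Fin (n + 1) → ℂ) : Fin (n + 2) → ℂ) := by
    obtain ⟨h3, h4, h5⟩ := distinct_cons.mp ht
    have h6 := h5.comp (toFront j).injective
    rw [comp_toFront] at h6
    exact distinct_cons.mpr ⟨h3, Fin.cases (h4 j) fun i => h4 _, h6⟩
  have h3 := connectedFF_toFront hF hk.admissible h2 (1 : Fin (n + 2))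
  rw [dressedWt, dressedWt, prod_cons, ← prod_extract, contourPoint_cons, h1, h3,
    show (1 : Fin (n + 2)) = Fin.succ 0 from rfl, cons_comp_succAbove, cons_comp_succAbove]
  rfl

theorem setIntegral_seriesWt (n : ℕ) : ∀ᵐ t ∂contourPi n,
    ∫ x in circlePart, seriesWt a F u r ω (n + 1) (Fin.cons x t) ∂contourMeasure =
      dressedWt a F u r ω n t / n₁ := by
  filter_upwards [ae_distinct (u := u) hI.r_pos hI.r_lt n] with t ht
  simp only [seriesWt, prod_cons, contourPoint_cons]
  rw [dressedWt, mul_div_assoc, ← hI.integral_connectedFF_one hF hk ht, ← integral_const_mul]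
  refine integral_congr_ae (Eventually.of_forall fun x => ?_)
  simp only
  ring

/-- A further rapidity on the circle meets the root where one has already been inserted, so that its
integral picks out the merging limit. -/
theorem setIntegral_dressedWt (n : ℕ) : ∀ᵐ t ∂contourPi n,
    ∫ x in circlePart, dressedWt a F u r ω (n + 1) (Fin.cons x t) ∂contourMeasure =
      2 * mergedWt a F u r ω n (root u) t / n₁ := by
  filter_upwards [ae_distinct (u := u) hI.r_pos hI.r_lt n] with t ht
  simp only [dressedWt, prod_cons, contourPoint_cons]
  have h : 2 * mergedWt a F u r ω n (root u) t / n₁ = (∏ i, ω (t i)) *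
      (2 * mergeWt a F (root u) n (root u) (fun j => contourPoint u r (t j)) / n₁) := by
    rw [mergedWt]
    ring
  rw [h, ← hI.integral_connectedFF_two hF hk ht, ← integral_const_mul]
  refine integral_congr_ae (Eventually.of_forall fun x => ?_)
  simp only
  ring

variable (hn : n₁ ≠ 0) (hint : ∀ n, Integrable (seriesWt a F u r ω n) (contourPi n))
include hn hint

theorem integrable_dressedWt (n : ℕ) : Integrable (dressedWt a F u r ω n) (contourPi n) := by
  have h0 := (integral_countInd_succ (hint (n + 1)) (seriesWt_symm hF hk hI n) 0).1
  have h1 := (h0.bdd_mul (c := 1) (measurable_circleInd.comp measurable_fst).aestronglyMeasurable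
    (Eventually.of_forall fun p => norm_circleInd_le p.1)).integral_prod_right
  refine (h1.const_mul n₁).congr ?_
  filter_upwards [setIntegral_seriesWt hF hk hI n] with t ht
  simp only [Function.comp_apply]
  rw [integral_circleInd_mul, ht, mul_div_cancel₀ _ hn]

omit hn in
/-- A rapidity on the circle is replaced by one at its center. -/
theorem integral_countInd_seriesWt (n k : ℕ) :
    (k + 1 : ℂ) * ∫ t, countInd (k + 1) t * seriesWt a F u r ω (n + 1) t ∂contourPi (n + 1) =
      (n + 1 : ℂ) * ((∫ t, countInd k t * dressedWt a F u r ω n t ∂contourPi n) / n₁) := by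
  rw [(integral_countInd_succ (hint (n + 1)) (seriesWt_symm hF hk hI n) k).2, ← integral_div]
  congr 1
  refine integral_congr_ae ?_
  filter_upwards [setIntegral_seriesWt hF hk hI n] with t ht
  rw [ht, mul_div_assoc]

/-- Absolute convergence of the dressed series is inherited from the configurations with exactly one
rapidity on the circle. -/
theorem integral_norm_dressedWt_le (n : ℕ) :
    (n + 1) * ∫ t : Fin n → ℝ, ‖dressedWt a F u r ω n fun j => Sum.inl (t j)‖ ≤
      ‖n₁‖ * ∫ t, ‖seriesWt a F u r ω (n + 1) t‖ ∂contourPi (n + 1) := by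
  have hd := integrable_dressedWt hF hk hI hn hint n
  set f : (Fin (n + 1) → ℝ ⊕ ℝ) → ℂ := fun t => (‖seriesWt a F u r ω (n + 1) t‖ : ℂ) with hf
  have hfi : Integrable f (contourPi (n + 1)) := (hint (n + 1)).norm.ofReal
  have hfs : ∀ᵐ t ∂contourPi (n + 1), ∀ j, f t = f (Fin.cons (t j) (t ∘ j.succAbove)) :=
    (seriesWt_symm hF hk hI n).mono fun t ht j => congrArg (fun z : ℂ => (‖z‖ : ℂ)) (ht j)
  obtain ⟨h1, h2⟩ := integral_countInd_succ hfi hfs 0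
  have h3 : ‖∫ t, countInd 1 t * f t ∂contourPi (n + 1)‖ ≤
      ∫ t, ‖seriesWt a F u r ω (n + 1) t‖ ∂contourPi (n + 1) := by
    refine norm_integral_le_of_norm_le (hint (n + 1)).norm (Eventually.of_forall fun t => ?_)
    rw [norm_mul, hf, Complex.norm_real, norm_norm]
    exact mul_le_of_le_one_left (norm_nonneg _) (norm_countInd_le _ _)
  have h4 : ∫ t, countInd 0 t * ∫ x in circlePart, f (Fin.cons x t) ∂contourMeasure ∂contourPi n =
      ((∫ t : Fin n → ℝ, ∫ x in circlePart, ‖seriesWt a F u r ω (n + 1)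
        (Fin.cons x fun j => Sum.inl (t j))‖ ∂contourMeasure : ℝ) : ℂ) := by
    rw [integral_countInd_zero, ← integral_complex_ofReal]
    simp only [hf, integral_complex_ofReal]
  have h5 : Integrable fun t : Fin n → ℝ => ∫ x in circlePart, ‖seriesWt a F u r ω (n + 1)
      (Fin.cons x fun j => Sum.inl (t j))‖ ∂contourMeasure := by
    have h6 : Integrable (fun t : Fin n → ℝ ⊕ ℝ => ∫ x in circlePart, f (Fin.cons x t)
        ∂contourMeasure) (contourPi n) := by
      refine ((h1.bdd_mul (c := 1) (measurable_circleInd.comp measurable_fst).aestronglyMeasurable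
        (Eventually.of_forall fun p => norm_circleInd_le p.1)).integral_prod_right).congr ?_
      refine Eventually.of_forall fun t => ?_
      simp only [Function.comp_apply]
      rw [integral_circleInd_mul]
    refine (integrable_comp_inl h6).norm.congr (Eventually.of_forall fun t => ?_)
    simp only [hf, integral_complex_ofReal, Complex.norm_real]
    exact Real.norm_of_nonneg (integral_nonneg fun _ => norm_nonneg _)
  have h7 : ∫ t : Fin n → ℝ, ‖dressedWt a F u r ω n fun j => Sum.inl (t j)‖ ≤
      ‖n₁‖ * ∫ t : Fin n → ℝ, ∫ x in circlePart, ‖seriesWt a F u r ω (n + 1)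
        (Fin.cons x fun j => Sum.inl (t j))‖ ∂contourMeasure := by
    rw [← integral_const_mul]
    refine integral_mono_ae (integrable_comp_inl hd).norm (h5.const_mul _) ?_
    have h8 := ae_restrict_of_ae (s := {t : Fin n → ℝ ⊕ ℝ | circleCount t = 0})
      (setIntegral_seriesWt hF hk hI n)
    rw [map_inl_pi] at h8
    filter_upwards [ae_of_ae_map (measurableEmbedding_inl_pi n).measurable.aemeasurable h8] with t ht
    have h9 : dressedWt a F u r ω n (fun j => Sum.inl (t j)) = n₁ * ∫ x in circlePart,
        seriesWt a F u r ω (n + 1) (Fin.cons x fun j => Sum.inl (t j)) ∂contourMeasure := by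
      rw [ht, mul_div_cancel₀ _ hn]
    rw [h9, norm_mul]
    exact mul_le_mul_of_nonneg_left (norm_integral_le_integral_norm _) (norm_nonneg _)
  have h10 : (n + 1 : ℝ) * ∫ t : Fin n → ℝ, ∫ x in circlePart, ‖seriesWt a F u r ω (n + 1)
      (Fin.cons x fun j => Sum.inl (t j))‖ ∂contourMeasure =
      ‖∫ t, countInd 1 t * f t ∂contourPi (n + 1)‖ := by
    rw [h4] at h2
    simp only [Nat.cast_zero, zero_add, one_mul] at h2
    have h11 : 0 ≤ ∫ t : Fin n → ℝ, ∫ x in circlePart, ‖seriesWt a F u r ω (n + 1)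
      (Fin.cons x fun j => Sum.inl (t j))‖ ∂contourMeasure :=
      integral_nonneg fun _ => integral_nonneg fun _ => norm_nonneg _
    rw [h2, norm_mul, Complex.norm_real, Real.norm_of_nonneg h11]
    congr 1
    norm_cast
  calc _ ≤ (n + 1 : ℝ) * (‖n₁‖ * ∫ t : Fin n → ℝ, ∫ x in circlePart, ‖seriesWt a F u r ω (n + 1)
        (Fin.cons x fun j => Sum.inl (t j))‖ ∂contourMeasure) := by gcongr
    _ = ‖n₁‖ * ‖∫ t, countInd 1 t * f t ∂contourPi (n + 1)‖ := by rw [← h10]; ring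
    _ ≤ _ := by gcongr

end Sectors

end

/-! ### Recursion for the dressed terms -/

section

section Recursion

variable (a : ℝ) (F : ∀ n : ℕ, (Fin n → ℂ) → ℂ) (u r : ℝ) (ω : ℝ ⊕ ℝ → ℂ)

/-- The contribution to the `n`-th dressed term of the configurations with `k` rapidities on the
circle. -/
def dressedTerm (n k : ℕ) : ℂ :=
  (1 / (n.factorial : ℂ)) * ∫ t, countInd k t * dressedWt a F u r ω n t ∂contourPi n

/-- The analogue of `dressedTerm` for `mergedWt`. -/
def mergedTerm (n k : ℕ) (x : ℂ) : ℂ :=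
  (1 / (n.factorial : ℂ)) * ∫ t, countInd k t * mergedWt a F u r ω n x t ∂contourPi n

variable {a F u r ω}

theorem mergedWt_zero (x : ℂ) (t : Fin 0 → ℝ ⊕ ℝ) :
    mergedWt a F u r ω 0 x t = phi a (x - root u) * dressedWt a F u r ω 0 t := by
  rw [mergedWt, dressedWt, mergeWt]
  ring

theorem mergedWt_succ (n : ℕ) (x : ℂ) (t : Fin (n + 1) → ℝ ⊕ ℝ) :
    mergedWt a F u r ω (n + 1) x t = phi a (x - root u) * dressedWt a F u r ω (n + 1) t +
      ∑ j, phi a (x - contourPoint u r (t j)) *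
        (ω (t j) * mergedWt a F u r ω n (contourPoint u r (t j)) (t ∘ j.succAbove)) := by
  rw [mergedWt, dressedWt, mergeWt, mul_add, Finset.mul_sum]
  congr 1
  · ring
  · refine Finset.sum_congr rfl fun j _ => ?_
    rw [prod_extract t j, mergedWt]
    simp only [Function.comp_def]
    ring

variable {δ C : ℝ} {n₁ : ℂ} {w : ℝ → ℂ} (hF : IsFormFactorFamily a F)
  (hk : KernelBound a δ C) (hI : IsContour δ u r n₁ w ω)

include hk in
theorem Integrable.phi_mul {X : Type*} [MeasurableSpace X] {μ : Measure X} {f : X → ℂ}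
    (hf : Integrable f μ) {p q : X → ℂ} (hp : Measurable p) (hq : Measurable q)
    (hpm : ∀ x, p x ∈ rapidities (δ / 2)) (hqm : ∀ x, q x ∈ rapidities (δ / 2)) :
    Integrable (fun x => phi a (p x - q x) * f x) μ :=
  hf.bdd_mul (c := C) ((measurable_phi a).comp (hp.sub hq)).aestronglyMeasurable
    (Eventually.of_forall fun x => hk.norm_phi_le' (sub_mem_strips hk.δ_pos.le (hpm x) (hqm x)))

include hF hk hI

variable (hn : n₁ ≠ 0) (hint : ∀ n, Integrable (seriesWt a F u r ω n) (contourPi n))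
include hn hint

theorem integrable_mergedWt_prod (n : ℕ) :
    Integrable (fun p : (ℝ ⊕ ℝ) × (Fin n → ℝ ⊕ ℝ) =>
      ω p.1 * mergedWt a F u r ω n (contourPoint u r p.1) p.2)
      (contourMeasure.prod (contourPi n)) := by
  have hpt := measurable_contourPoint u r
  have hmem := contourPoint_mem (u := u) hI.r_pos hI.r_lt
  have hd := fun n => Integrable.phi_mul hk
    (hI.integrable.mul_prod (integrable_dressedWt hF hk hI hn hint n))
    (hpt.comp measurable_fst) measurable_const (fun p => hmem p.1) fun _ => hk.root_mem u
  induction n with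
  | zero =>
    refine (hd 0).congr (Eventually.of_forall fun p => ?_)
    simp only [mergedWt_zero, Function.comp_apply]
    ring
  | succ n ih =>
    have h : ∀ j : Fin (n + 1), Integrable (fun p : (ℝ ⊕ ℝ) × (Fin (n + 1) → ℝ ⊕ ℝ) =>
        phi a (contourPoint u r p.1 - contourPoint u r (p.2 j)) * (ω p.1 * (ω (p.2 j) *
          mergedWt a F u r ω n (contourPoint u r (p.2 j)) (p.2 ∘ j.succAbove))))
        (contourMeasure.prod (contourPi (n + 1))) := fun j =>
      Integrable.phi_mul hk
        (hI.integrable.mul_prod ((integrable_extract_iff contourMeasure j).mpr ih))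
        (hpt.comp measurable_fst) (hpt.comp ((measurable_pi_apply j).comp measurable_snd))
        (fun p => hmem p.1) fun p => hmem (p.2 j)
    refine ((hd (n + 1)).add (integrable_finsetSum Finset.univ fun j _ => h j)).congr
      (Eventually.of_forall fun p => ?_)
    simp only [mergedWt_succ, Function.comp_apply, Pi.add_apply, mul_add, Finset.mul_sum]
    congr 1
    · ring
    · exact Finset.sum_congr rfl fun j _ => by ring

omit hF hk hI hn hint in
theorem dressedTerm_zero_succ (k : ℕ) : dressedTerm a F u r ω 0 (k + 1) = 0 := by
  simp [dressedTerm, countInd_eq_zero k.succ_pos]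

theorem dressedTerm_succ_succ (n k : ℕ) : (k + 1 : ℂ) * dressedTerm a F u r ω (n + 1) (k + 1) =
    2 * mergedTerm a F u r ω n k (root u) / n₁ := by
  have h := (integral_countInd_succ (integrable_dressedWt hF hk hI hn hint (n + 1))
    (dressedWt_symm hF hk hI n) k).2
  have h1 : ∫ t, countInd k t * ∫ x in circlePart, dressedWt a F u r ω (n + 1) (Fin.cons x t)
      ∂contourMeasure ∂contourPi n =
      2 * (∫ t, countInd k t * mergedWt a F u r ω n (root u) t ∂contourPi n) / n₁ := by
    rw [← integral_const_mul, ← integral_div]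
    refine integral_congr_ae ?_
    filter_upwards [setIntegral_dressedWt hF hk hI n] with t ht
    rw [ht]
    ring
  rw [h1] at h
  have hn' : (n + 1 : ℂ) ≠ 0 := by exact_mod_cast n.succ_ne_zero
  rw [dressedTerm, mergedTerm, mul_left_comm, h, Nat.factorial_succ]
  push_cast
  field_simp

omit hF hk hI hn hint in
theorem mergedTerm_zero (k : ℕ) (x : ℂ) :
    mergedTerm a F u r ω 0 k x = phi a (x - root u) * dressedTerm a F u r ω 0 k := by
  simp only [mergedTerm, dressedTerm, mergedWt_zero, mul_left_comm _ (phi a _), integral_const_mul]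

/-- The chain of kernels passes from `x` either directly to the center of the circle or to another
rapidity `y`. -/
theorem mergedTerm_succ (n k : ℕ) {x : ℂ} (hx : x ∈ rapidities (δ / 2)) :
    Integrable (fun y => ω y * phi a (x - contourPoint u r y) * ((1 / (n.factorial : ℂ)) *
      ∫ t, countInd k (Fin.cons y t : Fin (n + 1) → ℝ ⊕ ℝ) *
        mergedWt a F u r ω n (contourPoint u r y) t ∂contourPi n)) contourMeasure ∧
    mergedTerm a F u r ω (n + 1) k x = phi a (x - root u) * dressedTerm a F u r ω (n + 1) k +
      ∫ y, ω y * phi a (x - contourPoint u r y) * ((1 / (n.factorial : ℂ)) *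
        ∫ t, countInd k (Fin.cons y t : Fin (n + 1) → ℝ ⊕ ℝ) *
          mergedWt a F u r ω n (contourPoint u r y) t ∂contourPi n) ∂contourMeasure := by
  have hpt := measurable_contourPoint u r
  have hmem := contourPoint_mem (u := u) hI.r_pos hI.r_lt
  set g : (ℝ ⊕ ℝ) × (Fin n → ℝ ⊕ ℝ) → ℂ := fun p => phi a (x - contourPoint u r p.1) *
    (ω p.1 * mergedWt a F u r ω n (contourPoint u r p.1) p.2) with hg
  have hgi : Integrable g (contourMeasure.prod (contourPi n)) :=
    Integrable.phi_mul hk (integrable_mergedWt_prod hF hk hI hn hint n) measurable_const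
      (hpt.comp measurable_fst) (fun _ => hx) fun p => hmem p.1
  set h : (ℝ ⊕ ℝ) × (Fin n → ℝ ⊕ ℝ) → ℂ := fun p =>
    countInd k (Fin.cons p.1 p.2 : Fin (n + 1) → ℝ ⊕ ℝ) * g p with hh
  have hcons : Measurable fun p : (ℝ ⊕ ℝ) × (Fin n → ℝ ⊕ ℝ) =>
      (Fin.cons p.1 p.2 : Fin (n + 1) → ℝ ⊕ ℝ) := by
    refine measurable_pi_iff.mpr (Fin.cases measurable_fst fun j => ?_)
    exact (measurable_pi_apply j).comp measurable_snd
  have hhi : Integrable h (contourMeasure.prod (contourPi n)) :=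
    hgi.bdd_mul (c := 1) ((measurable_countInd k (n + 1)).comp hcons).aestronglyMeasurable
      (Eventually.of_forall fun p => norm_countInd_le k _)
  have hinner : ∀ y, ω y * phi a (x - contourPoint u r y) * ((1 / (n.factorial : ℂ)) *
      ∫ t, countInd k (Fin.cons y t : Fin (n + 1) → ℝ ⊕ ℝ) *
        mergedWt a F u r ω n (contourPoint u r y) t ∂contourPi n) =
      (1 / (n.factorial : ℂ)) * ∫ t, h (y, t) ∂contourPi n := by
    intro y
    rw [mul_left_comm, ← integral_const_mul]
    congr 1
    refine integral_congr_ae (Eventually.of_forall fun t => ?_)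
    simp only [hh, hg]
    ring
  simp only [hinner]
  refine ⟨hhi.integral_prod_left.const_mul _, ?_⟩
  have hcount : ∀ (t : Fin (n + 1) → ℝ ⊕ ℝ) (j : Fin (n + 1)),
      countInd k (Fin.cons (t j) (t ∘ j.succAbove) : Fin (n + 1) → ℝ ⊕ ℝ) = countInd k t := by
    intro t j
    rw [countInd, countInd, circleCount_eq t j, circleCount_eq _ 0]
    rfl
  have h1 : ∀ t, countInd k t * mergedWt a F u r ω (n + 1) x t =
      phi a (x - root u) * (countInd k t * dressedWt a F u r ω (n + 1) t) +
        ∑ j, h (t j, t ∘ j.succAbove) := by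
    intro t
    simp only [hh, hg, hcount, mergedWt_succ, mul_add, Finset.mul_sum]
    ring
  have hn' : (n + 1 : ℂ) ≠ 0 := by exact_mod_cast n.succ_ne_zero
  rw [mergedTerm, dressedTerm]
  simp only [h1]
  rw [integral_add, integral_const_mul, contourPi, integral_sum_extract contourMeasure hhi,
    integral_const_mul, ← integral_prod _ hhi, Nat.factorial_succ]
  · push_cast
    field_simp
  · exact (integrable_countInd_mul (integrable_dressedWt hF hk hI hn hint (n + 1)) k).const_mul _
  · exact integrable_finsetSum _ fun j _ => (integrable_extract_iff contourMeasure j).mpr hhi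

variable {q B : ℝ} (hw : WeightBound w q B)
include hw

/-- A chain of kernels from `x` to the center of the circle passes through `m` rapidities on the
real line. A chain through a rapidity on the circle, which is closed by the residue, accounts for
the factor `1 + k / 2`. -/
theorem mergedTerm_eq (n k : ℕ) {x : ℂ} (hx : x ∈ rapidities (δ / 2)) :
    mergedTerm a F u r ω n k x = ∑ m ∈ Finset.range (n + 1),
      chain a (root u) w m x * ((1 + k / 2) * dressedTerm a F u r ω (n - m) k) := by
  induction n generalizing k x with
  | zero =>
    rw [mergedTerm_zero]
    cases k with
    | zero => simp [chain]
    | succ k => simp [dressedTerm_zero_succ]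
  | succ n ih =>
    obtain ⟨hi, hs⟩ := mergedTerm_succ hF hk hI hn hint n k hx
    rw [hs, ← integral_add_compl measurableSet_circlePart hi, setIntegral_circlePart_compl]
    have hreal : ∫ s : ℝ, ω (Sum.inl s) * phi a (x - contourPoint u r (Sum.inl s)) *
        ((1 / (n.factorial : ℂ)) * ∫ t, countInd k (Fin.cons (Sum.inl s) t : Fin (n + 1) → ℝ ⊕ ℝ) *
          mergedWt a F u r ω n (contourPoint u r (Sum.inl s)) t ∂contourPi n) =
        ∑ m ∈ Finset.range (n + 1),
          chain a (root u) w (m + 1) x * ((1 + k / 2) * dressedTerm a F u r ω (n - m) k) := by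
      simp only [chain, ← integral_mul_const]
      rw [← integral_finsetSum _ fun m _ =>
        (integrable_chain_integrand hk hw (hk.root_mem u) hx m).mul_const _]
      refine integral_congr_ae (Eventually.of_forall fun s => ?_)
      have h1 : ∀ t : Fin n → ℝ ⊕ ℝ,
          countInd k (Fin.cons (Sum.inl s) t : Fin (n + 1) → ℝ ⊕ ℝ) = countInd k t := by
        intro t
        rw [countInd, countInd, circleCount_eq _ 0]
        simp [Function.comp_def]
      simp only [h1]
      change ω (Sum.inl s) * phi a (x - s) * mergedTerm a F u r ω n k s = _
      rw [ih k (ofReal_mem_rapidities _ s), hI.inl, Finset.mul_sum]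
      exact Finset.sum_congr rfl fun m _ => by ring
    have hcirc : ∫ y in circlePart, ω y * phi a (x - contourPoint u r y) *
        ((1 / (n.factorial : ℂ)) * ∫ t, countInd k (Fin.cons y t : Fin (n + 1) → ℝ ⊕ ℝ) *
          mergedWt a F u r ω n (contourPoint u r y) t ∂contourPi n) ∂contourMeasure =
        phi a (x - root u) * (k / 2 * dressedTerm a F u r ω (n + 1) k) := by
      have hcount : ∀ y ∈ circlePart, ∀ t : Fin n → ℝ ⊕ ℝ,
          circleCount (Fin.cons y t : Fin (n + 1) → ℝ ⊕ ℝ) = 1 + circleCount t := by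
        intro y hy t
        rw [circleCount_eq _ 0]
        simp [mem_circlePart_iff.mp hy, Function.comp_def]
      cases k with
      | zero =>
        rw [setIntegral_congr_fun measurableSet_circlePart (g := fun _ => 0)]
        · simp
        · intro y hy
          simp [countInd, hcount y hy]
      | succ k =>
        set g : ℂ → ℂ := fun z => phi a (x - z) * ∑ m ∈ Finset.range (n + 1),
          chain a (root u) w m z * ((1 + k / 2) * dressedTerm a F u r ω (n - m) k) with hg
        have hdiff : ∀ z ∈ Metric.closedBall (root u) r, DifferentiableAt ℂ g z := by
          intro z hz
          have hz' := closedBall_root_subset hI.r_lt hz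
          refine DifferentiableAt.fun_mul ?_ (DifferentiableAt.fun_sum fun m _ =>
            (differentiableAt_chain hk hw u hz' m).mul_const _)
          exact (differentiableAt_phi (hk.tau_ne _
            (sub_mem_strips hk.δ_pos.le hx (Or.inr hz'.le)))).comp z
              (differentiableAt_id.const_sub x)
        have h1 := hI.residue g ∅ Set.countable_empty
          (fun z hz => (hdiff z hz).continuousAt.continuousWithinAt)
          fun z hz => hdiff z (Metric.ball_subset_closedBall hz.1)
        rw [setIntegral_congr_fun measurableSet_circlePart
          (g := fun y => ω y * g (contourPoint u r y)), h1, hg]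
        · have h2 := dressedTerm_succ_succ hF hk hI hn hint n k
          simp only
          rw [← ih k (hk.root_mem u)]
          push_cast
          linear_combination (-phi a (x - root u) / 2) * h2
        · intro y hy
          have h3 : ∀ t : Fin n → ℝ ⊕ ℝ,
              countInd (k + 1) (Fin.cons y t : Fin (n + 1) → ℝ ⊕ ℝ) = countInd k t := by
            intro t
            rw [countInd, countInd, hcount y hy]
            exact if_congr (by omega) rfl rfl
          simp only [h3]
          change ω y * phi a (x - contourPoint u r y) *
            mergedTerm a F u r ω n k (contourPoint u r y) = _
          rw [ih k (contourPoint_mem hI.r_pos hI.r_lt y), mul_assoc]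
    rw [hcirc, hreal, Finset.sum_range_succ' _ (n + 1)]
    simp only [Nat.sub_zero, Nat.add_sub_add_right, chain]
    ring

theorem dressedTerm_recursion (n k : ℕ) :
    (k + 1 : ℂ) * dressedTerm a F u r ω (n + 1) (k + 1) = (k + 2) / n₁ *
      ∑ m ∈ Finset.range (n + 1),
        chain a (root u) w m (root u) * dressedTerm a F u r ω (n - m) k := by
  rw [dressedTerm_succ_succ hF hk hI hn hint, mergedTerm_eq hF hk hI hn hint hw n k (hk.root_mem u)]
  simp only [mul_left_comm _ (1 + (k : ℂ) / 2), ← Finset.mul_sum]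
  ring

end Recursion

end

/-! ### Summation over the number of rapidities on the circle -/

section

/-- The resummation. The `k`-th column of `D` sums to `(k + 1) (P / n₁) ^ k` times the sum of the
first one, where `P = ∑ p m`, so that the columns of `Z` but the first form a geometric series. -/
theorem tsum_sectors {Z D : ℕ → ℕ → ℂ} {p : ℕ → ℂ} {n₁ : ℂ} (hn : n₁ ≠ 0)
    (hZ : Summable fun q : ℕ × ℕ => Z q.1 q.2) (hp : Summable fun m => ‖p m‖)
    (hZ₀ : ∀ k, Z 0 (k + 1) = 0) (hD₀ : ∀ k, D 0 (k + 1) = 0)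
    (hZD : ∀ n k : ℕ, (k + 1 : ℂ) * Z (n + 1) (k + 1) = D n k / n₁)
    (hD : ∀ n k : ℕ, (k + 1 : ℂ) * D (n + 1) (k + 1) =
      (k + 2) / n₁ * ∑ m ∈ Finset.range (n + 1), p m * D (n - m) k) :
    (∑' m, p m = n₁ → ∑' n, D n 0 = 0) ∧
      ∑' q : ℕ × ℕ, Z q.1 q.2 = ∑' n, Z n 0 + (n₁ - ∑' m, p m)⁻¹ * ∑' n, D n 0 := by
  have hk : ∀ k : ℕ, (k + 1 : ℂ) ≠ 0 := fun k => by exact_mod_cast k.succ_ne_zero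
  have hZ' : Summable fun q : ℕ × ℕ => Z q.2 q.1 := hZ.prod_symm
  have hZk : ∀ k, Summable fun n => Z n k := fun k => hZ'.prod_factor k
  have hDZ : ∀ n k : ℕ, D n k = n₁ * (k + 1) * Z (n + 1) (k + 1) := fun n k => by
    rw [mul_assoc, hZD, mul_div_cancel₀ _ hn]
  have hDk : ∀ k, Summable fun n => D n k := fun k => by
    simp only [hDZ]
    exact ((summable_nat_add_iff 1).mpr (hZk (k + 1))).mul_left _
  set P := ∑' m, p m with hP
  set E : ℕ → ℂ := fun k => ∑' n, D n k with hE
  have hE1 : ∀ k : ℕ, (k + 1 : ℂ) * E (k + 1) = (k + 2) / n₁ * (P * E k) := by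
    intro k
    simp only [hE, hP]
    rw [(hDk (k + 1)).tsum_eq_zero_add, hD₀, zero_add, ← tsum_mul_left,
      tsum_mul_tsum_eq_tsum_sum_range_of_summable_norm hp (hDk k).norm, ← tsum_mul_left]
    simp only [hD]
  have hE2 : ∀ k : ℕ, E k = (k + 1) * ((P / n₁) ^ k * E 0) := by
    intro k
    induction k with
    | zero => simp
    | succ k ih =>
      refine mul_left_cancel₀ (hk k) ?_
      rw [hE1, ih]
      push_cast
      ring
  have hZ2 : ∀ k, ∑' n, Z n (k + 1) = (P / n₁) ^ k * (E 0 / n₁) := by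
    intro k
    have h1 : ∀ n, Z (n + 1) (k + 1) = (n₁ * (k + 1))⁻¹ * D n k := fun n => by
      have := hk k
      rw [hDZ, inv_mul_cancel_left₀ (mul_ne_zero hn (hk k))]
    rw [(hZk (k + 1)).tsum_eq_zero_add, hZ₀, zero_add]
    simp only [h1]
    rw [tsum_mul_left]
    change _ * E k = _
    rw [hE2 k]
    have := hk k
    field_simp
  have hcol : Summable fun k => ∑' n, Z n k := hZ'.prod
  have hgeom : Summable fun k => (P / n₁) ^ k * (E 0 / n₁) := by
    simp only [← hZ2]
    exact (summable_nat_add_iff 1).mpr hcol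
  have hsum : ∑' q : ℕ × ℕ, Z q.1 q.2 = ∑' n, Z n 0 + ∑' k, (P / n₁) ^ k * (E 0 / n₁) := by
    rw [← (Equiv.prodComm ℕ ℕ).tsum_eq]
    simp only [Equiv.prodComm_apply, Prod.fst_swap, Prod.snd_swap]
    rw [hZ'.tsum_prod, hcol.tsum_eq_zero_add]
    simp only [hZ2]
  by_cases hE0 : E 0 = 0
  · refine ⟨fun _ => hE0, ?_⟩
    rw [hsum, show ∑' n, D n 0 = 0 from hE0, hE0]
    simp
  -- the sums of the columns converge, and a divergent geometric series is excluded
  · have h1 : ‖P / n₁‖ < 1 := by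
      rw [← summable_geometric_iff_norm_lt_one]
      exact (summable_mul_right_iff (div_ne_zero hE0 hn)).mp hgeom
    have h2 : n₁ - P ≠ 0 := fun h => by
      rw [← sub_eq_zero.mp h, div_self hn, norm_one] at h1
      exact lt_irrefl _ h1
    refine ⟨fun h => absurd (sub_eq_zero.mpr h.symm) h2, ?_⟩
    rw [hsum, tsum_mul_right, tsum_geometric_of_norm_lt_one h1]
    change _ = _ + _ * E 0
    have h3 : (1 - P / n₁)⁻¹ = n₁ * (n₁ - P)⁻¹ := by
      rw [one_sub_div hn, inv_div, div_eq_mul_inv]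
    rw [h3]
    field_simp

theorem integral_norm_comp_inl_le {n : ℕ} {f : (Fin n → ℝ ⊕ ℝ) → ℂ}
    (hf : Integrable f (contourPi n)) :
    ∫ θ : Fin n → ℝ, ‖f fun j => Sum.inl (θ j)‖ ≤ ∫ t, ‖f t‖ ∂contourPi n := by
  rw [← (measurableEmbedding_inl_pi n).integral_map (fun t => ‖f t‖), ← map_inl_pi]
  exact setIntegral_le_integral hf.norm (Eventually.of_forall fun t => norm_nonneg _)

section Sum

variable {a : ℝ} {F : ∀ n : ℕ, (Fin n → ℂ) → ℂ} {u r : ℝ} {ω : ℝ ⊕ ℝ → ℂ}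

theorem sum_norm_integral_countInd_le {n : ℕ} {f : (Fin n → ℝ ⊕ ℝ) → ℂ}
    (hf : Integrable f (contourPi n)) :
    ∑ k ∈ Finset.range (n + 1), ‖∫ t, countInd k t * f t ∂contourPi n‖ ≤
      ∫ t, ‖f t‖ ∂contourPi n := by
  have h : ∀ t : Fin n → ℝ ⊕ ℝ, ∑ k ∈ Finset.range (n + 1), ‖countInd k t * f t‖ = ‖f t‖ := by
    intro t
    have h1 : ∀ k, ‖countInd k t‖ = if circleCount t = k then 1 else 0 := fun k => by
      rw [countInd]
      split_ifs <;> simp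
    simp only [norm_mul, ← Finset.sum_mul, h1]
    rw [Finset.sum_ite_eq,
      if_pos (Finset.mem_range.mpr (Nat.lt_succ_of_le (circleCount_le t))), one_mul]
  simp only [← h]
  rw [integral_finsetSum _ fun k _ => (integrable_countInd_mul hf k).norm]
  exact Finset.sum_le_sum fun k _ => norm_integral_le_integral_norm _

theorem sum_integral_countInd {n : ℕ} {f : (Fin n → ℝ ⊕ ℝ) → ℂ}
    (hf : Integrable f (contourPi n)) :
    ∑ k ∈ Finset.range (n + 1), ∫ t, countInd k t * f t ∂contourPi n = ∫ t, f t ∂contourPi n := by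
  rw [← integral_finsetSum _ fun k _ => integrable_countInd_mul hf k]
  simp only [← Finset.sum_mul, sum_countInd, one_mul]

variable {δ C : ℝ} {n₁ : ℂ} {w : ℝ → ℂ} (hF : IsFormFactorFamily a F)
  (hk : KernelBound a δ C) (hI : IsContour δ u r n₁ w ω) (hn : n₁ ≠ 0)
  (hconv : SeriesConverges contourMeasure (seriesWt a F u r ω))

include hconv in
theorem seriesConverges_seriesWt_inl :
    SeriesConverges volume fun n (θ : Fin n → ℝ) => seriesWt a F u r ω n fun j => Sum.inl (θ j) := by
  refine ⟨fun n => integrable_comp_inl (hconv.1 n), ?_⟩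
  refine Summable.of_nonneg_of_le (fun n => ?_) (fun n => ?_) hconv.2
  · exact mul_nonneg (by positivity) (integral_nonneg fun _ => norm_nonneg _)
  · exact mul_le_mul_of_nonneg_left (integral_norm_comp_inl_le (hconv.1 n)) (by positivity)

include hF hk hI hn hconv

theorem seriesConverges_dressedWt_inl :
    SeriesConverges volume fun n (θ : Fin n → ℝ) =>
      dressedWt a F u r ω n fun j => Sum.inl (θ j) := by
  refine ⟨fun n => integrable_comp_inl (integrable_dressedWt hF hk hI hn hconv.1 n), ?_⟩
  refine Summable.of_nonneg_of_le (fun n => ?_) (fun n => ?_)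
    (((summable_nat_add_iff 1).mpr hconv.2).mul_left ‖n₁‖)
  · exact mul_nonneg (by positivity) (integral_nonneg fun _ => norm_nonneg _)
  · have h := integral_norm_dressedWt_le hF hk hI hn hconv.1 n
    have hf : (((n + 1).factorial : ℕ) : ℝ) = (n + 1) * n.factorial := by
      rw [Nat.factorial_succ]
      push_cast
      ring
    have hpos : (0 : ℝ) < 1 / ((n + 1).factorial : ℝ) := by positivity
    have h' := mul_le_mul_of_nonneg_left h hpos.le
    calc _ = 1 / ((n + 1).factorial : ℝ) * ((n + 1) * ∫ t : Fin n → ℝ,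
          ‖dressedWt a F u r ω n fun j => Sum.inl (t j)‖) := by
          rw [hf, volume_pi]
          field_simp
      _ ≤ _ := h'
      _ = _ := by ring

variable {q B : ℝ} (hw : WeightBound w q B)
include hw

/-- The contour series is the series on the real line plus the dressed series, divided by the
difference of `n₁` and the sum over the chains of kernels from the center of the circle to
itself. -/
theorem seriesSum_seriesWt :
    (∑' l, chain a (root u) w l (root u) = n₁ → seriesSum volume (fun n (θ : Fin n → ℝ) =>
      dressedWt a F u r ω n fun j => Sum.inl (θ j)) = 0) ∧
    seriesSum contourMeasure (seriesWt a F u r ω) =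
      seriesSum volume (fun n (θ : Fin n → ℝ) => seriesWt a F u r ω n fun j => Sum.inl (θ j)) +
      (n₁ - ∑' l, chain a (root u) w l (root u))⁻¹ * seriesSum volume (fun n (θ : Fin n → ℝ) =>
        dressedWt a F u r ω n fun j => Sum.inl (θ j)) := by
  have hint := hconv.1
  set Z : ℕ → ℕ → ℂ := fun n k => (1 / (n.factorial : ℂ)) *
    ∫ t, countInd k t * seriesWt a F u r ω n t ∂contourPi n with hZdef
  have hZvanish : ∀ n k, n < k → Z n k = 0 := fun n k h => by
    simp [hZdef, countInd_eq_zero h]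
  have hZrow : ∀ n, ∀ k ∉ Finset.range (n + 1), Z n k = 0 := fun n k h =>
    hZvanish n k (not_lt.mp fun h' => h (Finset.mem_range.mpr h'))
  have hZ : Summable fun p : ℕ × ℕ => Z p.1 p.2 := by
    refine Summable.of_norm ((summable_prod_of_nonneg fun p => norm_nonneg _).mpr ⟨fun n => ?_, ?_⟩)
    · exact summable_of_ne_finset_zero (s := Finset.range (n + 1)) fun k h => by
        simp [hZrow n k h]
    · refine Summable.of_nonneg_of_le (fun n => tsum_nonneg fun k => norm_nonneg _)
        (fun n => ?_) hconv.2
      rw [tsum_eq_sum (s := Finset.range (n + 1)) fun k h => by simp [hZrow n k h]]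
      simp only [hZdef, norm_mul, ← Finset.mul_sum]
      have h1 : ‖(1 / (n.factorial : ℂ))‖ = 1 / (n.factorial : ℝ) := by simp
      rw [h1]
      exact mul_le_mul_of_nonneg_left (sum_norm_integral_countInd_le (hint n)) (by positivity)
  have hZD : ∀ n k : ℕ, (k + 1 : ℂ) * Z (n + 1) (k + 1) = dressedTerm a F u r ω n k / n₁ := by
    intro n k
    have hn' : (n + 1 : ℂ) ≠ 0 := by exact_mod_cast n.succ_ne_zero
    simp only [hZdef]
    rw [mul_left_comm, integral_countInd_seriesWt hF hk hI hint, dressedTerm, Nat.factorial_succ]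
    push_cast
    field_simp
  obtain ⟨h1, h2⟩ := tsum_sectors (D := dressedTerm a F u r ω) hn hZ
    (summable_norm_chain hk hw (hk.root_mem u) (hk.root_mem u)) (fun k => hZvanish 0 _ k.succ_pos)
    dressedTerm_zero_succ hZD (dressedTerm_recursion hF hk hI hn hint hw)
  have h3 : ∑' p : ℕ × ℕ, Z p.1 p.2 = seriesSum contourMeasure (seriesWt a F u r ω) := by
    rw [hZ.tsum_prod, seriesSum]
    refine tsum_congr fun n => ?_
    rw [tsum_eq_sum (hZrow n), ← sum_integral_countInd (hint n), Finset.mul_sum]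
  have h4 : ∑' n, Z n 0 = seriesSum volume
      (fun n (θ : Fin n → ℝ) => seriesWt a F u r ω n fun j => Sum.inl (θ j)) := by
    simp only [hZdef, integral_countInd_zero]
    rfl
  have h5 : ∑' n, dressedTerm a F u r ω n 0 = seriesSum volume
      (fun n (θ : Fin n → ℝ) => dressedWt a F u r ω n fun j => Sum.inl (θ j)) := by
    simp only [dressedTerm, integral_countInd_zero]
    rfl
  rw [← h3, ← h4, ← h5]
  exact ⟨h1, h2⟩

end Sum

end

end SinhGordon

end

theorem mainTheorem1 (a : ℝ) (ha₀ : 0 < a) (ha₁ : a < 1) (ha : a ≠ 1 / 2)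
    (m L : ℝ) (hm : 0 < m) (hL : 0 < L)
    (F : ∀ n : ℕ, (Fin n → ℂ) → ℂ) (hF : SinhGordon.IsFormFactorFamily a F)
    (ε : ℝ → ℝ → ℝ) (hε : ∀ u : ℝ, SinhGordon.IsTBASolution a m L u (ε u))
    (θbar : ℝ) (I : ℤ)
    (hquant : SinhGordon.pseudoenergy a m L θbar (ε θbar) (SinhGordon.root θbar) =
      Complex.I * (2 * I + 1) * Real.pi)
    (hsimple : deriv (SinhGordon.pseudoenergy a m L θbar (ε θbar)) (SinhGordon.root θbar) ≠ 0)
    (meanValue : ℂ)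
    (hLM : ∀ᶠ r : ℝ in 𝓝[>] 0,
      SinhGordon.SeriesConverges SinhGordon.contourMeasure
        (SinhGordon.contourIntegrand a m L θbar (ε θbar) F r) ∧
      meanValue = SinhGordon.seriesSum SinhGordon.contourMeasure
        (SinhGordon.contourIntegrand a m L θbar (ε θbar) F r)) :
    SinhGordon.SeriesConverges volume (SinhGordon.realIntegrand a m L θbar (ε θbar) F) ∧
    SinhGordon.SeriesConverges volume (SinhGordon.dressedIntegrand a m L θbar (ε θbar) F) ∧
    DifferentiableAt ℝ (SinhGordon.Qbar a m L ε) θbar ∧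
    meanValue =
      SinhGordon.seriesSum volume (SinhGordon.realIntegrand a m L θbar (ε θbar) F) +
      (deriv (SinhGordon.Qbar a m L ε) θbar)⁻¹ *
        SinhGordon.seriesSum volume (SinhGordon.dressedIntegrand a m L θbar (ε θbar) F) ∧
    (deriv (SinhGordon.Qbar a m L ε) θbar = 0 →
      SinhGordon.seriesSum volume (SinhGordon.dressedIntegrand a m L θbar (ε θbar) F) = 0) ∧
    HasSum (SinhGordon.pathTerm a m L θbar (ε θbar))
      (SinhGordon.nOne a m L θbar (ε θbar) - deriv (SinhGordon.Qbar a m L ε) θbar) ∧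
    (∀ N₁ : ℂ, HasSum (SinhGordon.invNTerm a m L θbar (ε θbar)) N₁⁻¹ →
      deriv (SinhGordon.Qbar a m L ε) θbar = N₁) := by
  have hmL := mul_pos hm hL
  obtain ⟨δ, C, hk⟩ := SinhGordon.exists_kernelBound ha₀ ha₁ ha
  have he := hε θbar
  have hexp : Complex.exp (SinhGordon.pseudoenergy a m L θbar (ε θbar) (SinhGordon.root θbar)) =
      -1 := by
    rw [hquant, show Complex.I * (2 * I + 1) * Real.pi =
      I * (2 * Real.pi * Complex.I) + Real.pi * Complex.I by ring, Complex.exp_add,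
      Complex.exp_int_mul_two_pi_mul_I, Complex.exp_pi_mul_I, one_mul]
  have hn : SinhGordon.nOne a m L θbar (ε θbar) ≠ 0 :=
    mul_ne_zero (neg_ne_zero.mpr Complex.I_ne_zero) hsimple
  obtain ⟨q, B, hw⟩ := hk.exists_weightBound hmL he
  obtain ⟨r, ⟨hconv, hmean⟩, hI⟩ :=
    (hLM.and (hk.eventually_isContour hmL he hexp hsimple)).exists
  have hreal : SinhGordon.realIntegrand a m L θbar (ε θbar) F = fun n θ =>
      SinhGordon.seriesWt a F θbar r (SinhGordon.contourWeight a m L θbar (ε θbar) r) n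
        fun j => Sum.inl (θ j) := rfl
  have hdressed : SinhGordon.dressedIntegrand a m L θbar (ε θbar) F = fun n θ =>
      SinhGordon.dressedWt a F θbar r (SinhGordon.contourWeight a m L θbar (ε θbar) r) n
        fun j => Sum.inl (θ j) := rfl
  obtain ⟨hzero, hsum⟩ := SinhGordon.seriesSum_seriesWt hF hk hI hn hconv hw
  have hQ := hk.hasDerivAt_Qbar (v := θbar) hmL hε
  refine ⟨?_, ?_, hQ.differentiableAt, ?_, fun h => ?_, ?_, fun N₁ hN => ?_⟩
  · rw [hreal]
    exact SinhGordon.seriesConverges_seriesWt_inl hconv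
  · rw [hdressed]
    exact SinhGordon.seriesConverges_dressedWt_inl hF hk hI hn hconv
  · rw [hQ.deriv, hreal, hdressed]
    exact hmean.trans hsum
  · rw [hdressed]
    rw [hQ.deriv, sub_eq_zero] at h
    exact hzero h.symm
  · rw [hQ.deriv, sub_sub_cancel]
    rw [show SinhGordon.pathTerm a m L θbar (ε θbar) = _ from
      funext (SinhGordon.pathTerm_eq_chain hk hmL he)]
    exact (SinhGordon.summable_norm_chain hk hw (hk.root_mem θbar)
      (hk.root_mem θbar)).of_norm.hasSum
  · rw [hQ.deriv]
    exact SinhGordon.eq_of_hasSum_invNTerm hk hmL he hn hN
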